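/- **Setting.** Put $d=14$, $q=252$, $\theta=757$, $m=758$, let $r\ge 2018$ be an integer, $0<\tau<1/50$, and fix constants $D\ge1$, $C_0\ge 1$, $c>0$, $\kappa>0$. For $R_0>1$ let $R_{n+1}=R_n^{1+2\tau}$ and $\rho_n=R_n^{-(3-5\tau)}$. *Normal form.* Let $k\in(\mathbb Z^2\setminus\{0\})\times\mathbb Z$ and $f\in\mathbb Z^2$ have entries bounded by $R_n$ in absolute value, such that the matrix $\widetilde A$ with rows $k,(f,0),e_3$ is non-singular. Slow-fast variables are $(\psi^s,\psi^f,t)^T=\widetilde A(\varphi_1,\varphi_2,t)^T$ and $(J^s,J^f,E')^T=\widetilde A^{-T}(I_1,I_2,E)^T$, where $E$ is conjugate to $t$. Let $H(\varphi,I,t)=H_0(I)+Z(k\cdot(\varphi,t),I)+R(\varphi,I,t)$ be of class $C^r$ and $1$-periodic in $\varphi_1,\varphi_2,t$ ($Z$ is $1$-periodic in its first argument). Let $\widehat H=\widehat H_0(J)+\widehat Z(\psi^s,J)+\widehat R(\psi^s,\psi^f,J,t)$ be $H$ in slow-fast variables; here $\widehat H_0$ contains the term $k_3J^s$ that comes from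 $E=E'+k_3J^s$. Assume that the resonance $\partial_{J^s}\widehat H_0=0$ contains a continuous graph $J^s=J^s_{\rm res}(J^f)$ over $J^f\in[b^-,b^+]$, $b^-<b^+$. Let the single-resonance zone be the tube of radius $c\rho_n^{m+\theta/3+1}$ about this arc in the original actions $I$, and assume that in this zone $$D^{-1}\mathrm{Id}\le\partial_I^2H_0\le D\,\mathrm{Id},\qquad \|H_0\|_{C^3},\ \|Z\|_{C^3}\le C_0,\qquad \|Z\|_{C^2}\le C_0\rho_n^{\frac43r-2m},\qquad \|R\|_{C^2}\le C_0\rho_n^{q(r+1)-2m}.$$ *Bifurcation values.* For fixed $J^f$ let $\mathcal H^{\rm trunc}(\psi^s,J^s)=\widehat H_0(J)+\widehat Z(\psi^s,J)$. A critical point of it is called minimal if its value is the infimum of the energies $E$ such that $\{\mathcal H^{\rm trunc}<E\}$ contains the graph of a smooth closed one-form on $\mathbb T$ (with values in the zone). Let $b^-=J^f_0<J_1^f<\dots<J_N^f<J^f_{N+1}=b^+$. Assume that for $J^f\in[b^-,b^+]\setminus\{J^f_1,\dots,J^f_N\}$ there is exactly one minimal critical point in $\mathbb T\times\mathbb R$,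 that for each bifurcation value $J^f=J_i^f$, $1\le i\le N$, there are exactly two, and that all of them are saddles, with eigenvalues $\pm\lambda$, $\lambda\ge\kappa\rho_n^{(dr+1)/2}$. **Theorem.** There are $C>0$ and $R_*>1$, depending only on $r,\tau,D,C_0,c,\kappa$ (so $C$ does not depend on $\rho_n$), such that for all $R_0\ge R_*$, all $n\ge 0$, all data as above and every $i=0,\dots,N$ there is $\delta>0$ with the following properties. Write $Y_s=[J^f_i-s,J^f_{i+1}+s]$, where the enlargement by $s$ is omitted at an end equal to $b^\pm$. The curve of minimal critical points over $[J^f_i,J^f_{i+1}]$ extends to a $C^1$ curve $(\psi^s_*(J^f),J^s_*(J^f))$ of saddles of $\mathcal H^{\rm trunc}$ over $Y_\delta$. For every such curve (every choice of the lift of $\psi^s_*$ to $\mathbb R$) there is a $C^1$ map $(\Psi^s,\mathcal J^s)(\psi^f,J^f,t)$ on $\mathbb R\times Y_{\delta/2}\times\mathbb R$ that is invariant under $(\psi^f,t)\mapsto(\psi^f+f\cdot(l_1,l_2),\,t+l_3)$ for all $l\in\mathbb Z^3$ with $k\cdot l=0$ (hence it is a map on $\mathbb T\times Y_{\delta/2}\times\mathbb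 T$ when the rows of $\widetilde A$ form a basis of $\mathbb Z^3$), and such that the following holds for its graph $$\mathcal C=\{(\psi^s,J^s)=(\Psi^s,\mathcal J^s)(\psi^f,J^f,t),\ J^f\in Y_{\delta/2}\}.$$ 1. The vector field of $\widehat H$ is tangent to $\mathcal C$ ($\mathcal C$ is weakly invariant), and $\mathcal C$ is normally hyperbolic with one-dimensional stable and unstable directions. 2. The set $V=\{J^f\in Y_{\delta/2},\ |\psi^s-\psi^s_*(J^f)|\le C\rho_n^{m-1+2dr},\ |J^s-J^s_*(J^f)|\le C\rho_n^{2m-1+2dr}\}$ lies in the zone, and $\mathcal C\subset V$. Every full orbit of $\widehat H$ contained in $V$ is contained in $\mathcal C$. 3. $|\Psi^s-\psi^s_*(J^f)|\le C\rho_n^{m-1+5dr}$ and $|\mathcal J^s-J^s_*(J^f)|\le C\rho_n^{2m-1+5dr}$. 4. $\displaystyle\Big|\frac{\partial(\Psi^s-\psi^s_*)}{\partial J^f}\Big|\le C\rho_n^{\frac32dr-\frac{3m+1}{2}}$ and $\displaystyle\Big|\frac{\partial\Psi^s}{\partial\psi^f}\Big|\le C\rho_n^{\frac32dr-\frac{m+1}{2}}$.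 -/

import Mathlib

noncomputable section

namespace SingleResonance

/-! ## Exponents and scales -/

/-- The exponent `d`, measuring the hyperbolicity of the saddles. -/
def dExp : ℝ := 14

/-- The exponent `q = 18 d`, measuring the smallness of the remainder. -/
def qExp : ℝ := 252

/-- The exponent `θ = 3 q + 1`, the order of the strong double resonances. -/
def thetaExp : ℝ := 757

/-- The exponent `m = θ + 1`, the size of the cores of the double resonances. -/
def mExp : ℝ := 758

/-- The radii `R_{n+1} = R_n ^ (1 + 2 τ)`. -/
def radius (τ R₀ : ℝ) : ℕ → ℝ
  | 0 => R₀
  | n + 1 => radius τ R₀ n ^ (1 + 2 * τ)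

/-- The scales `ρ_n = R_n ^ (-(3 - 5 τ))`. -/
def rho (τ R₀ : ℝ) (n : ℕ) : ℝ := radius τ R₀ n ^ (-(3 - 5 * τ))

/-- `‖g‖_{C^j(s)} ≤ B`: all derivatives of order at most `j` are bounded by `B` on `s`. -/
def CkBound {E : Type*} [NormedAddCommGroup E] [NormedSpace ℝ E]
    (j : ℕ) (g : E → ℝ) (s : Set E) (B : ℝ) : Prop :=
  ∀ i ≤ j, ∀ x ∈ s, ‖iteratedFDeriv ℝ i g x‖ ≤ B

/-! ## Hamiltonian systems

Angles are lifted to the universal cover; periodicity is always stated explicitly. -/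

/-- Points `(angles, actions, time)` of the (lifted) extended phase space. In slow-fast variables
such a point is `((ψˢ, ψᶠ), (Jˢ, Jᶠ), t)`. -/
abbrev Phase := (ℝ × ℝ) × (ℝ × ℝ) × ℝ

/-- The vector field `ψ' = ∂_J H`, `J' = -∂_ψ H`, `t' = 1` of a time dependent Hamiltonian. -/
def hamField (H : Phase → ℝ) (p : Phase) : Phase :=
  ((fderiv ℝ H p ((0, 0), (1, 0), 0), fderiv ℝ H p ((0, 0), (0, 1), 0)),
    (-fderiv ℝ H p ((1, 0), (0, 0), 0), -fderiv ℝ H p ((0, 1), (0, 0), 0)), 1)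

/-- The vector field `ψ' = ∂_J h`, `J' = -∂_ψ h` of a Hamiltonian with one degree of freedom. -/
def planarField (h : ℝ × ℝ → ℝ) (x : ℝ × ℝ) : ℝ × ℝ :=
  (fderiv ℝ h x (0, 1), -fderiv ℝ h x (1, 0))

/-- `x` is a critical point of `h`, of saddle type, at which the linearised Hamiltonian flow has
real eigenvalues `μ` and `-μ` with `μ ≥ lam` and `μ > 0`. -/
def IsSaddle (h : ℝ × ℝ → ℝ) (lam : ℝ) (x : ℝ × ℝ) : Prop :=
  fderiv ℝ h x = 0 ∧ ∃ μ : ℝ, 0 < μ ∧ lam ≤ μ ∧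
    Module.End.HasEigenvalue (fderiv ℝ (planarField h) x : (ℝ × ℝ) →ₗ[ℝ] (ℝ × ℝ)) μ ∧
    Module.End.HasEigenvalue (fderiv ℝ (planarField h) x : (ℝ × ℝ) →ₗ[ℝ] (ℝ × ℝ)) (-μ)

/-- The critical level of `h`, a Hamiltonian on (an open part `ψ ∈ 𝕋`, `J ∈ S` of) `T^*𝕋`: the
infimum of the energies `E` such that `{h < E}` contains the graph of a smooth closed one-form
`ω(ψ) dψ` on the circle. -/
def criticalLevel (h : ℝ × ℝ → ℝ) (S : Set ℝ) : ℝ :=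
  sInf {E : ℝ | ∃ ω : ℝ → ℝ, ContDiff ℝ (⊤ : ℕ∞) ω ∧ (∀ s, ω (s + 1) = ω s) ∧
    (∀ s, ω s ∈ S) ∧ ∀ s, h (s, ω s) < E}

/-- `x` is a minimal critical point of `h`: a critical point on the critical level. -/
def IsMinimalCritical (h : ℝ × ℝ → ℝ) (S : Set ℝ) (x : ℝ × ℝ) : Prop :=
  x.2 ∈ S ∧ fderiv ℝ h x = 0 ∧ h x = criticalLevel h S

/-- Two points of `ℝ × ℝ` that project to the same point of `𝕋 × ℝ`. -/
def SamePoint (x y : ℝ × ℝ) : Prop := ∃ j : ℤ, y = (x.1 + j, x.2)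

/-! ## Slow-fast variables -/

/-- The linear change of angles `(ψˢ, ψᶠ, t) = Ã (φ₁, φ₂, t)` where `Ã` has the rows `k`,
`(f, 0)` and `e₃`. It is invertible (over `ℝ`) when `det ≠ 0`. -/
structure SlowFast where
  k : Fin 3 → ℤ
  f : Fin 2 → ℤ

namespace SlowFast

variable (A : SlowFast)

/-- The determinant of `Ã`. -/
def det : ℝ := A.k 0 * A.f 1 - A.k 1 * A.f 0

/-- The original angles `(φ₁, φ₂)` in terms of `(ψˢ, ψᶠ)` and `t`. -/
def angle (ψ : ℝ × ℝ) (t : ℝ) : ℝ × ℝ :=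
  ((A.f 1 * (ψ.1 - A.k 2 * t) - A.k 1 * ψ.2) / A.det,
    (A.k 0 * ψ.2 - A.f 0 * (ψ.1 - A.k 2 * t)) / A.det)

/-- The original actions in terms of `(Jˢ, Jᶠ)`: the first two entries of
`(J₁, J₂, E) = Ãᵀ (Jˢ, Jᶠ, E')`. The third one is `E = k₃ Jˢ + E'`. -/
def action (J : ℝ × ℝ) : ℝ × ℝ :=
  (A.k 0 * J.1 + A.f 0 * J.2, A.k 1 * J.1 + A.f 1 * J.2)

/-- The Hamiltonian in slow-fast variables: `H + E`, written in the new variables, is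
`A.pull H + E'`. -/
def pull (H : Phase → ℝ) (p : Phase) : ℝ :=
  H (A.angle p.1 p.2.2, A.action p.2.1, p.2.2) + A.k 2 * p.2.1.1

theorem slow_angle (h : A.det ≠ 0) (ψ : ℝ × ℝ) (t : ℝ) :
    A.k 0 * (A.angle ψ t).1 + A.k 1 * (A.angle ψ t).2 + A.k 2 * t = ψ.1 := by
  unfold angle
  field_simp
  unfold det
  ring

theorem fast_angle (h : A.det ≠ 0) (ψ : ℝ × ℝ) (t : ℝ) :
    A.f 0 * (A.angle ψ t).1 + A.f 1 * (A.angle ψ t).2 = ψ.2 := by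
  unfold angle
  field_simp
  unfold det
  ring

end SlowFast

/-! ## Normal forms along a single resonance -/

/-- The data of a normal form along the resonance `k`: the integrable part `H₀(I)`, the resonant
part `Z(k · (φ, t), I)`, the remainder `R(φ, I, t)`, and the resonant arc, which in the slow-fast
actions is the graph `Jˢ = res(Jᶠ)`, `Jᶠ ∈ [bm, bp]`. -/
structure NormalForm where
  A : SlowFast
  H₀ : ℝ × ℝ → ℝ
  Z : ℝ × (ℝ × ℝ) → ℝ
  R : Phase → ℝ
  bm : ℝ
  bp : ℝ
  res : ℝ → ℝ

namespace NormalForm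

variable (S : NormalForm)

/-- The normal form Hamiltonian `H₀(I) + Z(k · (φ, t), I) + R(φ, I, t)`. -/
def ham (p : Phase) : ℝ :=
  S.H₀ p.2.1 + S.Z (S.A.k 0 * p.1.1 + S.A.k 1 * p.1.2 + S.A.k 2 * p.2.2, p.2.1) + S.R p

/-- The normal form Hamiltonian in slow-fast variables. -/
def sfHam : Phase → ℝ := S.A.pull S.ham

/-- The integrable part in slow-fast variables. -/
def sfH₀ (J : ℝ × ℝ) : ℝ := S.H₀ (S.A.action J) + S.A.k 2 * J.1

/-- The truncated Hamiltonian at `Jᶠ = y`, a function of `(ψˢ, Jˢ)`. -/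
def trunc (y : ℝ) (x : ℝ × ℝ) : ℝ :=
  S.sfH₀ (x.2, y) + S.Z (x.1, S.A.action (x.2, y))

theorem sfHam_eq (h : S.A.det ≠ 0) (p : Phase) :
    S.sfHam p = S.trunc p.2.1.2 (p.1.1, p.2.1.1)
      + S.R (S.A.angle p.1 p.2.2, S.A.action p.2.1, p.2.2) := by
  simp only [sfHam, SlowFast.pull, ham, trunc, sfH₀, S.A.slow_angle h]
  ring

/-- The resonant arc in the original actions. -/
def arc : Set (ℝ × ℝ) := (fun y => S.A.action (S.res y, y)) '' Set.Icc S.bm S.bp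

/-- The actions of the single resonance zone: the tube of radius `c ρ ^ (m + θ / 3 + 1)` about the
resonant arc. -/
def zone (c ρ : ℝ) : Set (ℝ × ℝ) :=
  Metric.thickening (c * ρ ^ (mExp + thetaExp / 3 + 1)) S.arc

/-- The values of `Jˢ` with `(Jˢ, y)` in the single resonance zone. -/
def fiber (c ρ y : ℝ) : Set ℝ := {j | S.A.action (j, y) ∈ S.zone c ρ}

/-- The properties of a normal form at scale `ρ = ρ_n` in a single resonance zone of width
parameter `c`. Here `K = R_n` bounds the entries of the vectors `k` and `f`, and
`C₀, D` do not depend on the scale. -/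
structure Estimates (r : ℕ) (D C₀ c K ρ : ℝ) : Prop where
  det_ne : S.A.det ≠ 0
  k_le : ∀ j, |(S.A.k j : ℝ)| ≤ K
  f_le : ∀ j, |(S.A.f j : ℝ)| ≤ K
  bm_lt_bp : S.bm < S.bp
  res_cont : ContinuousOn S.res (Set.Icc S.bm S.bp)
  /-- the arc is resonant: `∂_{Jˢ} H₀ = 0`, that is, `k · (∂_I H₀, 1) = 0` -/
  res_eq : ∀ y ∈ Set.Icc S.bm S.bp, fderiv ℝ S.sfH₀ (S.res y, y) (1, 0) = 0
  smooth_H₀ : ContDiffOn ℝ r S.H₀ (S.zone c ρ)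
  smooth_Z : ContDiffOn ℝ r S.Z (Set.univ ×ˢ S.zone c ρ)
  smooth_R : ContDiffOn ℝ r S.R (Set.univ ×ˢ S.zone c ρ ×ˢ Set.univ)
  periodic_Z : ∀ s I, S.Z (s + 1, I) = S.Z (s, I)
  periodic_R : ∀ (φ I : ℝ × ℝ) (t : ℝ) (l : Fin 3 → ℤ),
    S.R ((φ.1 + l 0, φ.2 + l 1), I, t + l 2) = S.R (φ, I, t)
  convex_H₀ : ∀ I ∈ S.zone c ρ, ∀ v : ℝ × ℝ,
    D⁻¹ * (v.1 ^ 2 + v.2 ^ 2) ≤ iteratedFDeriv ℝ 2 S.H₀ I ![v, v] ∧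
      iteratedFDeriv ℝ 2 S.H₀ I ![v, v] ≤ D * (v.1 ^ 2 + v.2 ^ 2)
  bound_H₀ : CkBound 3 S.H₀ (S.zone c ρ) C₀
  bound_Z : CkBound 2 S.Z (Set.univ ×ˢ S.zone c ρ) (C₀ * ρ ^ (4 / 3 * (r : ℝ) - 2 * mExp))
  bound_Z₃ : CkBound 3 S.Z (Set.univ ×ˢ S.zone c ρ) C₀
  bound_R : CkBound 2 S.R (Set.univ ×ˢ S.zone c ρ ×ˢ Set.univ)
    (C₀ * ρ ^ (qExp * ((r : ℝ) + 1) - 2 * mExp))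

/-- `a 0 = bm < a 1 < ⋯ < a N < a (N + 1) = bp`, where `a 1, …, a N` are the bifurcation values:
there the truncated Hamiltonian has exactly two minimal critical points, and at all other values
of `Jᶠ ∈ [bm, bp]` exactly one. All of them are saddles with eigenvalues `±μ`,
`μ ≥ κ ρ ^ ((d r + 1) / 2)`. -/
structure IsBifurcationSequence (r : ℕ) (κ c ρ : ℝ) (N : ℕ) (a : Fin (N + 2) → ℝ) : Prop where
  strictMono : StrictMono a
  first : a 0 = S.bm
  last : a (Fin.last (N + 1)) = S.bp
  saddle : ∀ y ∈ Set.Icc S.bm S.bp, ∀ x,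
    IsMinimalCritical (S.trunc y) (S.fiber c ρ y) x →
      IsSaddle (S.trunc y) (κ * ρ ^ ((dExp * r + 1) / 2)) x
  regular : ∀ y ∈ Set.Icc S.bm S.bp,
    (∀ j : Fin (N + 2), j ≠ 0 → j ≠ Fin.last (N + 1) → y ≠ a j) →
      ∃ x, IsMinimalCritical (S.trunc y) (S.fiber c ρ y) x ∧
        ∀ x', IsMinimalCritical (S.trunc y) (S.fiber c ρ y) x' → SamePoint x x'
  bifurcation : ∀ j : Fin (N + 2), j ≠ 0 → j ≠ Fin.last (N + 1) →
    ∃ x x₁, IsMinimalCritical (S.trunc (a j)) (S.fiber c ρ (a j)) x ∧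
      IsMinimalCritical (S.trunc (a j)) (S.fiber c ρ (a j)) x₁ ∧ ¬ SamePoint x x₁ ∧
      ∀ x', IsMinimalCritical (S.trunc (a j)) (S.fiber c ρ (a j)) x' →
        SamePoint x x' ∨ SamePoint x₁ x'

/-- The curve `y ↦ (ψs y, Js y)` on the interval `Y` is a `C¹` curve of saddles of the truncated
Hamiltonian, and it consists of minimal critical points for `y ∈ Y₀`. -/
def IsSaddleCurve (c ρ : ℝ) (Y₀ Y : Set ℝ) (ψs Js : ℝ → ℝ) : Prop :=
  ContDiffOn ℝ 1 ψs Y ∧ ContDiffOn ℝ 1 Js Y ∧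
    (∀ y ∈ Y, Js y ∈ S.fiber c ρ y ∧ IsSaddle (S.trunc y) 0 (ψs y, Js y)) ∧
    ∀ y ∈ Y₀, IsMinimalCritical (S.trunc y) (S.fiber c ρ y) (ψs y, Js y)

end NormalForm

/-! ## Cylinders -/

/-- The `i`-th interval `[a_i, a_{i+1}]` between consecutive values of `a`, enlarged by `s` at each
end that is not one of the two ends of the whole sequence. -/
def enlarged {N : ℕ} (a : Fin (N + 2) → ℝ) (i : Fin (N + 1)) (s : ℝ) : Set ℝ :=
  Set.Icc (if i = 0 then a i.castSucc else a i.castSucc - s)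
    (if i = Fin.last N then a i.succ else a i.succ + s)

/-- The parameters `(ψᶠ, Jᶠ, t)` with `Jᶠ ∈ Y`. -/
def params (Y : Set ℝ) : Set (ℝ × ℝ × ℝ) := {u | u.2.1 ∈ Y}

/-- The parametrisation `(ψᶠ, Jᶠ, t) ↦ ((Ψ, ψᶠ), (𝒥, Jᶠ), t)` of a graph. -/
def graphMap (Ψ 𝒥 : ℝ × ℝ × ℝ → ℝ) (u : ℝ × ℝ × ℝ) : Phase :=
  ((Ψ u, u.1), (𝒥 u, u.2.1), u.2.2)

/-- The cylinder `{(ψˢ, Jˢ) = (Ψ, 𝒥)(ψᶠ, Jᶠ, t), Jᶠ ∈ Y}`. -/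
def cylinder (Y : Set ℝ) (Ψ 𝒥 : ℝ × ℝ × ℝ → ℝ) : Set Phase := graphMap Ψ 𝒥 '' params Y

/-- The tangent space of the cylinder at its point `p`. -/
def cylTangent (Y : Set ℝ) (Ψ 𝒥 : ℝ × ℝ × ℝ → ℝ) (p : Phase) : Submodule ℝ Phase :=
  LinearMap.range
    (fderivWithin ℝ (graphMap Ψ 𝒥) (params Y) (p.1.2, p.2.1.2, p.2.2) :
      (ℝ × ℝ × ℝ) →ₗ[ℝ] Phase)

/-- Normal hyperbolicity, with one-dimensional stable and unstable directions, of a weakly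
invariant manifold `M` with tangent spaces `T` for the vector field `F`: along orbit segments in
`M`, the linearised flow preserves a uniformly transverse splitting `Eˢ ⊕ Eᵘ ⊕ T`, contracts `Eˢ`
and expands `Eᵘ` at an exponential rate `ν`, and is dominated by the rate `μ < ν` on `T`. -/
def NormallyHyperbolic (F : Phase → Phase) (M : Set Phase) (T : Phase → Submodule ℝ Phase) :
    Prop :=
  ∃ (Es Eu : Phase → Submodule ℝ Phase) (B μ ν : ℝ), 0 ≤ μ ∧ μ < ν ∧
    (∀ p ∈ M, Module.finrank ℝ (Es p) = 1 ∧ Module.finrank ℝ (Eu p) = 1 ∧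
      (∀ v : Phase, ∃ e ∈ Es p, ∃ u ∈ Eu p, ∃ w ∈ T p, v = e + u + w) ∧
      ∀ e ∈ Es p, ∀ u ∈ Eu p, ∀ w ∈ T p,
        ‖e‖ ≤ B * ‖e + u + w‖ ∧ ‖u‖ ≤ B * ‖e + u + w‖ ∧ ‖w‖ ≤ B * ‖e + u + w‖) ∧
    ∀ L : ℝ, 0 ≤ L → ∀ γ v : ℝ → Phase,
      (∀ s ∈ Set.Icc 0 L, γ s ∈ M ∧ HasDerivWithinAt γ (F (γ s)) (Set.Icc 0 L) s ∧
        HasDerivWithinAt v (fderiv ℝ F (γ s) (v s)) (Set.Icc 0 L) s) →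
      (v 0 ∈ Es (γ 0) → v L ∈ Es (γ L) ∧ ‖v L‖ ≤ B * Real.exp (-ν * L) * ‖v 0‖) ∧
      (v 0 ∈ Eu (γ 0) → v L ∈ Eu (γ L) ∧ ‖v 0‖ ≤ B * Real.exp (-ν * L) * ‖v L‖) ∧
      (v 0 ∈ T (γ 0) → v L ∈ T (γ L) ∧ ‖v L‖ ≤ B * Real.exp (μ * L) * ‖v 0‖ ∧
        ‖v 0‖ ≤ B * Real.exp (μ * L) * ‖v L‖)

/-- The neighbourhood `V` of the curve of saddles `(ψs, Js)`: all `(ψ, J, t)` with `Jᶠ ∈ Y`,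
`|ψˢ - ψs(Jᶠ)| ≤ ε₁` and `|Jˢ - Js(Jᶠ)| ≤ ε₂`. -/
def tube (Y : Set ℝ) (ψs Js : ℝ → ℝ) (ε₁ ε₂ : ℝ) : Set Phase :=
  {p | p.2.1.2 ∈ Y ∧ |p.1.1 - ψs p.2.1.2| ≤ ε₁ ∧ |p.2.1.1 - Js p.2.1.2| ≤ ε₂}

end SingleResonance

end

/-!
# Normally hyperbolic cylinders along a single resonance

In slow-fast variables the Hamiltonian is `g(ψˢ, Jˢ, Jᶠ) + R`, where `g` is the truncated Hamiltonian
and `R` is much smaller (`sfHam_eq_slow`). For `R = 0` a curve of saddles of `g(·, ·, Jᶠ)` is a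
normally hyperbolic invariant cylinder. It persists, as the bound `ρ ^ (252 (r + 1) - 1516)` on `R` is
far smaller than the powers of the strength `ρ ^ ((14 r + 1) / 2)` of the saddles that are lost on the
way.
All estimates are made in powers of the unit `η = ρ ^ (0.14 r)`; the constants, the entries of the
matrix of the change of variables and the radius of the zone cost only powers of `ρ` whose exponents do
not grow with `r`, and these are absorbed for `r ≥ 2018`. The constant `C` can therefore be taken to be
`1`.

*The abstract cylinder.* In suitable coordinates on `ℝ × ℝ × U` the field expands the first
coordinate at a rate `Λ`, contracts the second one at the rate `-Λ`, up to errors dominated by `Λ` with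
a margin `lam`, and moves the base `U` at a rate that is small compared to `lam ^ 2 / Λ` (`SaddleField`).
The orbits that stay in the box `|x|, |y| ≤ 1` solve a Lyapunov-Perron equation: the unstable
coordinate is determined by its future and the stable one by its past. A contraction argument with
exponential weights (`Rates.Fits.exists_solution`, `Rates.Fits.norm_le`) gives exactly one such orbit
over each point of the base, and these orbits form an invariant graph. Linearised equations are solved
in the same way; with weights of slow growth they give the derivative of the graph
(`hasStrictFDerivAt_graph`), with decaying weights the stable and the unstable directions, hence normal
hyperbolicity (`normallyHyperbolic_of_chart`).

*The chart.* Along the curve of saddles a shear almost diagonalises the Hessian of `g`, and a rescaling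
makes the two axes of the saddle comparable and the curve nearly constant. As `g` has bounds on three
derivatives only, the slope of the shear has to be smoothed by averaging (`SaddleFamily.exists_shear`).
In this chart the Hamiltonian vector field is a saddle field (`Chart.saddleField`), after clamping `Jᶠ`
to the range of the curve. A chart of size `η ^ 140` shows that full orbits in the set `V` are much
closer to the curve than `V` requires; a chart of size `η ^ 560` then contains the cylinder, and gives
the bounds on its position and its slopes (`SaddleFamily.exists_cylinder`).

*The curve of saddles.* The truncated Hamiltonian is convex in `Jˢ`, with its minimum over each fiber of
the zone very close to the resonant arc (`convexFamily`). Hence the critical level is the maximum over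
`ψˢ` of the minimum over `Jˢ` (`criticalLevel_eq`), and the set of minimal critical points is upper
semicontinuous. Over the open interval between two bifurcation values the minimal critical point is
unique up to integer translations, so that the local branches given by the implicit function theorem can
be glued; at an end point uniqueness nearby selects one of the two branches, which extends beyond it
(`exists_minimal_branch`). Any other curve of saddles that is minimal over the interval is a translate
of this branch (`Branch.eq_add_int`).
-/

set_option linter.unusedSectionVars false

open Set Filter Topology

namespace LyapunovPerron

/-! ### Scalar rates, exponential weights and boundary conditions -/

/-- The exponential weight with growth exponent `κp` in the future and `κm` in the past. -/
noncomputable def weight (κm κp s : ℝ) : ℝ := max (Real.exp (κm * s)) (Real.exp (κp * s))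

/-- The place where the data of a component of a linear equation are prescribed: at `+∞` for a
component that the weight forces to be determined by its future, at `-∞` for one determined by its
past, at time `0` otherwise. -/
inductive Data
  | future
  | past
  | initial

/-- The rate `Λ` and the weight with exponents `κm, κp` fit to the type of the data, with a spectral
gap of at least `g`. -/
def Data.Fits (b : Data) (Λ κm κp g : ℝ) : Prop :=
  match b with
  | .future => κp + g ≤ Λ
  | .past => Λ + g ≤ κm
  | .initial => κm + g ≤ Λ ∧ Λ + g ≤ κp

theorem weight_pos (κm κp s : ℝ) : 0 < weight κm κp s :=
  lt_max_of_lt_left (Real.exp_pos _)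

theorem weight_zero (κm κp : ℝ) : weight κm κp 0 = 1 := by simp [weight]

theorem weight_neg (κm κp s : ℝ) : weight κm κp (-s) = weight (-κp) (-κm) s := by
  simp only [weight, max_comm (Real.exp (κm * -s))]
  congr 2 <;> ring

theorem continuous_weight (κm κp : ℝ) : Continuous (weight κm κp) := by
  unfold weight; fun_prop

theorem weight_of_nonneg {κm κp s : ℝ} (h : κm ≤ κp) (hs : 0 ≤ s) :
    weight κm κp s = Real.exp (κp * s) :=
  max_eq_right (Real.exp_le_exp.2 (mul_le_mul_of_nonneg_right h hs))

theorem weight_of_nonpos {κm κp s : ℝ} (h : κm ≤ κp) (hs : s ≤ 0) :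
    weight κm κp s = Real.exp (κm * s) :=
  max_eq_left (Real.exp_le_exp.2 (mul_le_mul_of_nonpos_right h hs))

theorem weight_le {κm κp s t : ℝ} (h : κm ≤ κp) (hst : s ≤ t) :
    weight κm κp t ≤ weight κm κp s * Real.exp (κp * (t - s)) := by
  have h0 : 0 ≤ t - s := by linarith
  unfold weight
  rw [max_mul_of_nonneg _ _ (Real.exp_pos _).le, ← Real.exp_add, ← Real.exp_add]
  refine max_le_max (Real.exp_le_exp.2 ?_) (Real.exp_le_exp.2 ?_)
  · nlinarith
  · nlinarith

theorem one_le_weight {κm κp : ℝ} (hm : κm ≤ 0) (hp : 0 ≤ κp) (s : ℝ) : 1 ≤ weight κm κp s := by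
  rcases le_total 0 s with hs | hs
  · exact le_max_of_le_right (Real.one_le_exp (mul_nonneg hp hs))
  · exact le_max_of_le_left (Real.one_le_exp (mul_nonneg_of_nonpos_of_nonpos hm hs))

section Slot

variable {F : Type*} [NormedAddCommGroup F] [NormedSpace ℝ F] {x x' : ℝ → F}
  {κm κp κm' κp' Λ g B M d : ℝ}

theorem hasDerivAt_exp_smul (hx : ∀ s, HasDerivAt x (x' s) s) (Λ s : ℝ) :
    HasDerivAt (fun s => Real.exp (-Λ * s) • x s)
      (Real.exp (-Λ * s) • (x' s - Λ • x s)) s := by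
  have h1 : HasDerivAt (fun s => Real.exp (-Λ * s)) (Real.exp (-Λ * s) * (-Λ)) s := by
    simpa using ((hasDerivAt_id s).const_mul (-Λ)).exp
  refine (h1.smul (hx s)).congr_deriv ?_
  rw [smul_sub, smul_smul]
  simp only [mul_neg, neg_smul]
  abel

theorem hasDerivAt_comp_neg (hx : ∀ s, HasDerivAt x (x' s) s) (s : ℝ) :
    HasDerivAt (fun s => x (-s)) (-x' (-s)) s := by
  have := (hx (-s)).scomp s (hasDerivAt_neg s)
  simpa [Function.comp_def] using this

/-- A component with data at `+∞` is controlled by its source: `e ^ (-Λ s) x(s)` tends to `0`, so it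
is minus the integral of its derivative over the future. -/
theorem norm_le_of_future (hκ : κm ≤ κp) (hκ' : κm' ≤ κp') (hx : ∀ s, HasDerivAt x (x' s) s)
    (hM : ∀ s, ‖x s‖ ≤ M * weight κm' κp' s) (hΛ' : κp' < Λ)
    (hB : ∀ s, ‖x' s - Λ • x s‖ ≤ B * weight κm κp s) (hg : 0 < g) (hΛ : κp + g ≤ Λ) (s : ℝ) :
    ‖x s‖ ≤ B / g * weight κm κp s := by
  have hB0 : 0 ≤ B := by
    have := (norm_nonneg _).trans (hB 0)
    rwa [weight_zero, mul_one] at this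
  set G := Λ - κp with hG
  have hGpos : 0 < G := by linarith
  set C := B * weight κm κp s * Real.exp (-κp * s) with hC
  have hC0 : 0 ≤ C := by have := weight_pos κm κp s; positivity
  set z : ℝ → F := fun s => Real.exp (-Λ * s) • x s with hz
  have hzd := hasDerivAt_exp_smul hx Λ
  have key : ∀ S, s ≤ S → ‖z s‖ ≤ ‖z S‖ + C / G * Real.exp (-G * s) := by
    intro S hS
    have h1 := image_norm_le_of_norm_deriv_right_le_deriv_boundary
      (f := fun t => z t - z s) (a := s) (b := S)
      (f' := fun t => Real.exp (-Λ * t) • (x' t - Λ • x t))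
      (B := fun t => C / G * (Real.exp (-G * s) - Real.exp (-G * t)))
      (B' := fun t => C * Real.exp (-G * t)) ?_ ?_ ?_ ?_ ?_ (right_mem_Icc.2 hS)
    · have h2 : ‖z s‖ ≤ ‖z S‖ + ‖z S - z s‖ := by
        calc ‖z s‖ = ‖z S - (z S - z s)‖ := by rw [sub_sub_cancel]
          _ ≤ _ := norm_sub_le _ _
      have h3 : 0 ≤ C / G * Real.exp (-G * S) := by positivity
      have h4 : ‖z S - z s‖ ≤ C / G * (Real.exp (-G * s) - Real.exp (-G * S)) := h1
      rw [mul_sub] at h4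
      linarith
    · intro t _
      exact ((hzd t).continuousAt.sub continuousAt_const).continuousWithinAt
    · intro t _
      exact ((hzd t).sub_const _).hasDerivWithinAt
    · simp
    · intro t
      have h1 : HasDerivAt (fun s => Real.exp (-G * s)) (Real.exp (-G * t) * (-G)) t := by
        simpa using ((hasDerivAt_id t).const_mul (-G)).exp
      refine ((h1.const_sub _).const_mul (C / G)).congr_deriv ?_
      field_simp
    · intro t ht
      rw [norm_smul, Real.norm_eq_abs, abs_of_pos (Real.exp_pos _)]
      calc Real.exp (-Λ * t) * ‖x' t - Λ • x t‖
          ≤ Real.exp (-Λ * t) * (B * (weight κm κp s * Real.exp (κp * (t - s)))) := by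
            gcongr
            exact (hB t).trans (mul_le_mul_of_nonneg_left (weight_le hκ ht.1) hB0)
        _ = B * weight κm κp s * (Real.exp (-Λ * t) * Real.exp (κp * (t - s))) := by ring
        _ = B * weight κm κp s * (Real.exp (-κp * s) * Real.exp (-G * t)) := by
            rw [← Real.exp_add, ← Real.exp_add, hG]; ring_nf
        _ = _ := by rw [hC]; ring
  have hlim : Tendsto (fun S => ‖z S‖ + C / G * Real.exp (-G * s)) atTop
      (𝓝 (0 + C / G * Real.exp (-G * s))) := by
    refine Tendsto.add_const _ ?_
    have h1 : Tendsto (fun S : ℝ => M * Real.exp (-(Λ - κp') * S)) atTop (𝓝 0) := by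
      have : Tendsto (fun S : ℝ => Real.exp (-(Λ - κp') * S)) atTop (𝓝 0) :=
        Real.tendsto_exp_atBot.comp
          (tendsto_id.const_mul_atTop_of_neg (by linarith))
      simpa using this.const_mul M
    refine squeeze_zero' (Eventually.of_forall fun _ => norm_nonneg _) ?_ h1
    filter_upwards [eventually_ge_atTop 0] with S hS
    rw [hz, norm_smul, Real.norm_eq_abs, abs_of_pos (Real.exp_pos _)]
    calc Real.exp (-Λ * S) * ‖x S‖ ≤ Real.exp (-Λ * S) * (M * weight κm' κp' S) := by
          gcongr; exact hM S
      _ = M * (Real.exp (-Λ * S) * Real.exp (κp' * S)) := by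
          rw [weight_of_nonneg hκ' hS]; ring
      _ = _ := by rw [← Real.exp_add]; ring_nf
  have hfin : ‖z s‖ ≤ C / G * Real.exp (-G * s) := by
    have := ge_of_tendsto hlim (by
      filter_upwards [eventually_ge_atTop s] with S hS using key S hS)
    simpa using this
  have hzs : ‖x s‖ = Real.exp (Λ * s) * ‖z s‖ := by
    rw [hz, norm_smul, Real.norm_eq_abs, abs_of_pos (Real.exp_pos _), ← mul_assoc, ← Real.exp_add]
    simp
  rw [hzs]
  calc Real.exp (Λ * s) * ‖z s‖ ≤ Real.exp (Λ * s) * (C / G * Real.exp (-G * s)) := by gcongr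
    _ = B / G * weight κm κp s * (Real.exp (Λ * s) * Real.exp (-κp * s) * Real.exp (-G * s)) := by
        rw [hC]; ring
    _ = B / G * weight κm κp s := by
        rw [← Real.exp_add, ← Real.exp_add, hG]; ring_nf; simp
    _ ≤ _ := by
        have := weight_pos κm κp s
        gcongr
        linarith

/-- The time reversal of `norm_le_of_future`. -/
theorem norm_le_of_past (hκ : κm ≤ κp) (hκ' : κm' ≤ κp') (hx : ∀ s, HasDerivAt x (x' s) s)
    (hM : ∀ s, ‖x s‖ ≤ M * weight κm' κp' s) (hΛ' : Λ < κm')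
    (hB : ∀ s, ‖x' s - Λ • x s‖ ≤ B * weight κm κp s) (hg : 0 < g) (hΛ : Λ + g ≤ κm) (s : ℝ) :
    ‖x s‖ ≤ B / g * weight κm κp s := by
  have h := norm_le_of_future (x := fun s => x (-s)) (x' := fun s => -x' (-s)) (κm := -κp)
    (κp := -κm) (κm' := -κp') (κp' := -κm') (Λ := -Λ) (g := g) (B := B) (M := M)
    (by linarith) (by linarith) (hasDerivAt_comp_neg hx)
    (fun s => by rw [← weight_neg]; exact hM _) (by linarith)
    (fun s => by
      rw [← weight_neg]
      refine le_trans (le_of_eq ?_) (hB (-s))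
      rw [← norm_neg]; congr 1; simp [neg_smul]; abel) hg (by linarith) (-s)
  rw [← weight_neg] at h
  simpa using h

theorem norm_le_of_initial_nonneg (hκ : κm ≤ κp) (hx : ∀ s, HasDerivAt x (x' s) s)
    (hd : ‖x 0‖ ≤ d)
    (hB : ∀ s, ‖x' s - Λ • x s‖ ≤ B * weight κm κp s) (hg : 0 < g) (hΛ : Λ + g ≤ κp) {s : ℝ}
    (hs : 0 ≤ s) : ‖x s‖ ≤ max d (B / g) * weight κm κp s := by
  have hB0 : 0 ≤ B := by
    have := (norm_nonneg _).trans (hB 0)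
    rwa [weight_zero, mul_one] at this
  set G := κp - Λ with hG
  have hGpos : 0 < G := by linarith
  set D := max d (B / g) with hD
  have hDB : B ≤ D * G := by
    have h1 : B / g ≤ D := le_max_right _ _
    have h2 : B ≤ D * g := by rwa [div_le_iff₀ hg] at h1
    have h3 : 0 ≤ D := le_trans (by positivity) h1
    nlinarith
  have h1 := image_norm_le_of_norm_deriv_right_le_deriv_boundary
    (f := fun t => Real.exp (-Λ * t) • x t) (a := 0) (b := s)
    (f' := fun t => Real.exp (-Λ * t) • (x' t - Λ • x t))
    (B := fun t => D * Real.exp (G * t))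
    (B' := fun t => D * G * Real.exp (G * t)) ?_ ?_ ?_ ?_ ?_ (right_mem_Icc.2 hs)
  · simp only [norm_smul, Real.norm_eq_abs, abs_of_pos (Real.exp_pos _)] at h1
    have hzs : ‖x s‖ = Real.exp (Λ * s) * (Real.exp (-Λ * s) * ‖x s‖) := by
      rw [← mul_assoc, ← Real.exp_add]; simp
    rw [hzs, weight_of_nonneg hκ hs]
    calc _ ≤ Real.exp (Λ * s) * (D * Real.exp (G * s)) := by gcongr
      _ = D * (Real.exp (Λ * s) * Real.exp (G * s)) := by ring
      _ = _ := by rw [← Real.exp_add, hG]; ring_nf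
  · intro t _
    exact (hasDerivAt_exp_smul hx Λ t).continuousAt.continuousWithinAt
  · intro t _
    exact (hasDerivAt_exp_smul hx Λ t).hasDerivWithinAt
  · have hdD : d ≤ D := le_max_left _ _
    simpa using hd.trans hdD
  · intro t
    have h1 : HasDerivAt (fun s => Real.exp (G * s)) (Real.exp (G * t) * G) t := by
      simpa using ((hasDerivAt_id t).const_mul G).exp
    refine (h1.const_mul D).congr_deriv (by ring)
  · intro t ht
    rw [norm_smul, Real.norm_eq_abs, abs_of_pos (Real.exp_pos _)]
    calc Real.exp (-Λ * t) * ‖x' t - Λ • x t‖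
        ≤ Real.exp (-Λ * t) * (B * Real.exp (κp * t)) := by
          gcongr
          have := hB t
          rwa [weight_of_nonneg hκ ht.1] at this
      _ = B * Real.exp (G * t) := by
          rw [mul_left_comm, ← Real.exp_add, hG]; ring_nf
      _ ≤ _ := by gcongr

/-- A component with data at time `0`: the equation is integrated from `0` in both directions of time,
in which the weight grows faster than the free solution. -/
theorem norm_le_of_initial (hκ : κm ≤ κp) (hx : ∀ s, HasDerivAt x (x' s) s)
    (hd : ‖x 0‖ ≤ d)
    (hB : ∀ s, ‖x' s - Λ • x s‖ ≤ B * weight κm κp s) (hg : 0 < g) (hΛm : κm + g ≤ Λ)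
    (hΛ : Λ + g ≤ κp) (s : ℝ) : ‖x s‖ ≤ max d (B / g) * weight κm κp s := by
  rcases le_total 0 s with hs | hs
  · exact norm_le_of_initial_nonneg hκ hx hd hB hg hΛ hs
  · have h := norm_le_of_initial_nonneg (x := fun s => x (-s)) (x' := fun s => -x' (-s))
      (κm := -κp) (κp := -κm) (Λ := -Λ) (g := g) (B := B) (d := d)
      (by linarith) (hasDerivAt_comp_neg hx) (by simpa using hd)
      (fun s => by
        rw [← weight_neg]
        refine le_trans (le_of_eq ?_) (hB (-s))
        rw [← norm_neg]; congr 1; simp [neg_smul]; abel) hg (by linarith) (s := -s) (by linarith)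
    rw [← weight_neg] at h
    simpa using h

/-- A priori estimate for one component: `x` is bounded by its data and by its source
`x' - Λ x`. The a priori growth (`κm', κp'`) may be worse than that of the source. -/
theorem Data.norm_le {b : Data} (hκ : κm ≤ κp) (hκ' : κm' ≤ κp') (hx : ∀ s, HasDerivAt x (x' s) s)
    (hM : ∀ s, ‖x s‖ ≤ M * weight κm' κp' s) {g' : ℝ} (hg' : 0 < g') (hΛ' : b.Fits Λ κm' κp' g')
    (hB : ∀ s, ‖x' s - Λ • x s‖ ≤ B * weight κm κp s) (hg : 0 < g) (hΛ : b.Fits Λ κm κp g)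
    (hd : b = .initial → ‖x 0‖ ≤ d) (s : ℝ) :
    ‖x s‖ ≤ max d (B / g) * weight κm κp s := by
  have hw := weight_pos κm κp s
  cases b with
  | future =>
    simp only [Data.Fits] at hΛ hΛ'
    refine (norm_le_of_future hκ hκ' hx hM (by linarith) hB hg hΛ s).trans ?_
    gcongr
    exact le_max_right _ _
  | past =>
    simp only [Data.Fits] at hΛ hΛ'
    refine (norm_le_of_past hκ hκ' hx hM (by linarith) hB hg hΛ s).trans ?_
    gcongr
    exact le_max_right _ _
  | initial => exact norm_le_of_initial hκ hx (hd rfl) hB hg hΛ.1 hΛ.2 s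

variable [CompleteSpace F]

theorem exists_solution_initial {f : ℝ → F} (hf : Continuous f) (Λ : ℝ) (x₀ : F) :
    ∃ x : ℝ → F, (∀ s, HasDerivAt x (Λ • x s + f s) s) ∧ x 0 = x₀ := by
  set h : ℝ → F := fun σ => Real.exp (-Λ * σ) • f σ with hh
  have hc : Continuous h := by fun_prop
  refine ⟨fun s => Real.exp (Λ * s) • (x₀ + ∫ σ in (0 : ℝ)..s, h σ), fun s => ?_, by simp⟩
  have h1 : HasDerivAt (fun s => Real.exp (Λ * s)) (Real.exp (Λ * s) * Λ) s := by
    simpa using ((hasDerivAt_id s).const_mul Λ).exp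
  have h2 : HasDerivAt (fun s => x₀ + ∫ σ in (0 : ℝ)..s, h σ) (h s) s :=
    (intervalIntegral.integral_hasDerivAt_right (hc.intervalIntegrable _ _)
      (hc.stronglyMeasurableAtFilter _ _) hc.continuousAt).const_add _
  refine (h1.smul h2).congr_deriv ?_
  simp only [hh, smul_smul, ← Real.exp_add]
  rw [add_comm]
  simp [mul_comm]

theorem exists_solution_future {f : ℝ → F} (hf : Continuous f) (hκ : κm ≤ κp)
    (hB : ∀ s, ‖f s‖ ≤ B * weight κm κp s) (hΛ : κp < Λ) :
    ∃ x : ℝ → F, (∀ s, HasDerivAt x (Λ • x s + f s) s) ∧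
      ∀ s, ‖x s‖ ≤ B / (Λ - κp) * weight κm κp s := by
  set h : ℝ → F := fun σ => Real.exp (-Λ * σ) • f σ with hh
  have hc : Continuous h := by fun_prop
  have hB0 : 0 ≤ B := by
    have := (norm_nonneg _).trans (hB 0)
    rwa [weight_zero, mul_one] at this
  set G := Λ - κp with hG
  have hGpos : 0 < G := by linarith
  have hbound : ∀ s t, s ≤ t →
      ‖h t‖ ≤ B * weight κm κp s * Real.exp (-κp * s) * Real.exp (-G * t) := by
    intro s t hst
    rw [hh, norm_smul, Real.norm_eq_abs, abs_of_pos (Real.exp_pos _)]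
    calc Real.exp (-Λ * t) * ‖f t‖
        ≤ Real.exp (-Λ * t) * (B * (weight κm κp s * Real.exp (κp * (t - s)))) := by
          gcongr
          exact (hB t).trans (mul_le_mul_of_nonneg_left (weight_le hκ hst) hB0)
      _ = B * weight κm κp s * (Real.exp (-Λ * t) * Real.exp (κp * (t - s))) := by ring
      _ = B * weight κm κp s * (Real.exp (-κp * s) * Real.exp (-G * t)) := by
          rw [← Real.exp_add, ← Real.exp_add, hG]; ring_nf
      _ = _ := by ring
  have hexp : ∀ s, MeasureTheory.IntegrableOn
      (fun t => B * weight κm κp s * Real.exp (-κp * s) * Real.exp (-G * t)) (Ioi s) := fun s =>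
    (integrableOn_exp_mul_Ioi (by linarith) s).const_mul _
  have hint : ∀ s, MeasureTheory.IntegrableOn h (Ioi s) := fun s =>
    (hexp s).mono' hc.aestronglyMeasurable.restrict
      ((MeasureTheory.ae_restrict_mem measurableSet_Ioi).mono fun t ht => hbound s t (le_of_lt ht))
  set I := ∫ σ in Ioi (0 : ℝ), h σ with hI
  have hsplit : ∀ s, I - ∫ σ in (0 : ℝ)..s, h σ = ∫ σ in Ioi s, h σ := by
    intro s
    rw [sub_eq_iff_eq_add', intervalIntegral.integral_interval_add_Ioi' (hc.intervalIntegrable _ _)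
      (hint s)]
  refine ⟨fun s => -(Real.exp (Λ * s) • (I - ∫ σ in (0 : ℝ)..s, h σ)), fun s => ?_, fun s => ?_⟩
  · have h1 : HasDerivAt (fun s => Real.exp (Λ * s)) (Real.exp (Λ * s) * Λ) s := by
      simpa using ((hasDerivAt_id s).const_mul Λ).exp
    have h2 : HasDerivAt (fun s => I - ∫ σ in (0 : ℝ)..s, h σ) (-h s) s :=
      (intervalIntegral.integral_hasDerivAt_right (hc.intervalIntegrable _ _)
        (hc.stronglyMeasurableAtFilter _ _) hc.continuousAt).const_sub _
    refine (h1.smul h2).neg.congr_deriv ?_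
    have h3 : Real.exp (Λ * s) • h s = f s := by
      simp [hh, smul_smul, ← Real.exp_add]
    rw [smul_neg, h3, neg_add, neg_neg, mul_comm, mul_smul, smul_neg, add_comm]
  · beta_reduce
    rw [hsplit, norm_neg, norm_smul, Real.norm_eq_abs, abs_of_pos (Real.exp_pos _)]
    have h1 : ‖∫ σ in Ioi s, h σ‖ ≤
        ∫ σ in Ioi s, B * weight κm κp s * Real.exp (-κp * s) * Real.exp (-G * σ) :=
      MeasureTheory.norm_integral_le_of_norm_le (hexp s)
        ((MeasureTheory.ae_restrict_mem measurableSet_Ioi).mono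
          fun t ht => hbound s t (le_of_lt ht))
    rw [MeasureTheory.integral_const_mul, integral_exp_mul_Ioi (by linarith)] at h1
    calc _ ≤ Real.exp (Λ * s) * (B * weight κm κp s * Real.exp (-κp * s)
          * (-Real.exp (-G * s) / -G)) := by gcongr
      _ = B / G * weight κm κp s * (Real.exp (Λ * s) * Real.exp (-κp * s) * Real.exp (-G * s)) := by
          field_simp
      _ = _ := by
          rw [← Real.exp_add, ← Real.exp_add, hG]; ring_nf; simp

/-- Solvability of one component: existence for a source of the growth of the weight. -/
theorem Data.exists_solution {b : Data} {f : ℝ → F} (hf : Continuous f) (hκ : κm ≤ κp)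
    (hB : ∀ s, ‖f s‖ ≤ B * weight κm κp s) (hg : 0 < g) (hΛ : b.Fits Λ κm κp g) (x₀ : F) :
    ∃ x : ℝ → F, (∀ s, HasDerivAt x (Λ • x s + f s) s) ∧ (b = .initial → x 0 = x₀) ∧
      ∃ M, ∀ s, ‖x s‖ ≤ M * weight κm κp s := by
  cases b with
  | future =>
    simp only [Data.Fits] at hΛ
    obtain ⟨x, h1, h2⟩ := exists_solution_future hf hκ hB (show κp < Λ by linarith)
    exact ⟨x, h1, by simp, _, h2⟩
  | past =>
    simp only [Data.Fits] at hΛ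
    obtain ⟨x, h1, h2⟩ := exists_solution_future (f := fun s => -f (-s)) (κm := -κp) (κp := -κm)
      (B := B) (Λ := -Λ) (by fun_prop) (by linarith)
      (fun s => by rw [← weight_neg, norm_neg]; exact hB _) (by linarith)
    refine ⟨fun s => x (-s), fun s => ?_, by simp, B / (-Λ - -κm), fun s => ?_⟩
    · refine (hasDerivAt_comp_neg h1 s).congr_deriv ?_
      simp [add_comm]
    · have := h2 (-s)
      rwa [weight_neg, neg_neg, neg_neg] at this
  | initial =>
    obtain ⟨x, h1, h2⟩ := exists_solution_initial hf Λ x₀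
    refine ⟨x, h1, fun _ => h2, max ‖x₀‖ (B / g), fun s => ?_⟩
    exact norm_le_of_initial hκ h1 (by rw [h2]) (fun s => by simpa using hB s) hg hΛ.1 hΛ.2 s

end Slot

end LyapunovPerron

namespace LyapunovPerron

/-! ### The Lyapunov-Perron equation for three components -/

theorem norm_prod_le {E₁ E₂ E₃ : Type*} [NormedAddCommGroup E₁] [NormedAddCommGroup E₂]
    [NormedAddCommGroup E₃] {p : E₁ × E₂ × E₃} {c : ℝ} (h₁ : ‖p.1‖ ≤ c) (h₂ : ‖p.2.1‖ ≤ c)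
    (h₃ : ‖p.2.2‖ ≤ c) : ‖p‖ ≤ c := by
  simp only [Prod.norm_def]
  exact max_le h₁ (max_le h₂ h₃)

theorem norm_sub_le_zero {F : Type*} [NormedAddCommGroup F] {a c e : F} (h1 : ‖a - e‖ ≤ 0)
    (h2 : ‖c - e‖ ≤ 0) : ‖a - c‖ ≤ 0 := by
  have := norm_sub_le (a - e) (c - e)
  rw [sub_sub_sub_cancel_right] at this
  linarith

section Product

variable {E₁ E₂ E₃ : Type*} [NormedAddCommGroup E₁] [NormedSpace ℝ E₁]
  [NormedAddCommGroup E₂] [NormedSpace ℝ E₂] [NormedAddCommGroup E₃] [NormedSpace ℝ E₃]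

/-- Rates, types of data, and gaps of the three components of a system on `E₁ × E₂ × E₃`. The
component `i` of the vector field is `Λᵢ` times the component `i` of the point, up to an error of
Lipschitz constant `ℓᵢ`. -/
structure Rates where
  (Λ₁ Λ₂ Λ₃ : ℝ)
  (ℓ₁ ℓ₂ ℓ₃ : ℝ)

/-- The types of the data of the three components. -/
structure Datas where
  (b₁ b₂ b₃ : Data)

/-- The weight with exponents `κm ≤ κp` fits to the rates and the data, with a gap of at least `g`
even after adding the Lipschitz constants of the errors. -/
structure Rates.Fits (r : Rates) (b : Datas) (κm κp g : ℝ) : Prop where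
  le : κm ≤ κp
  pos : 0 < g
  nonneg₁ : 0 ≤ r.ℓ₁
  nonneg₂ : 0 ≤ r.ℓ₂
  nonneg₃ : 0 ≤ r.ℓ₃
  fits₁ : b.b₁.Fits r.Λ₁ κm κp (r.ℓ₁ + g)
  fits₂ : b.b₂.Fits r.Λ₂ κm κp (r.ℓ₂ + g)
  fits₃ : b.b₃.Fits r.Λ₃ κm κp (r.ℓ₃ + g)

/-- `x'` agrees with the linear field with the rates `r` at `x` up to errors `ℓᵢ‖x‖ + w`. -/
structure Rates.Near (r : Rates) (x x' : E₁ × E₂ × E₃) (w : ℝ) : Prop where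
  near₁ : ‖x'.1 - r.Λ₁ • x.1‖ ≤ r.ℓ₁ * ‖x‖ + w
  near₂ : ‖x'.2.1 - r.Λ₂ • x.2.1‖ ≤ r.ℓ₂ * ‖x‖ + w
  near₃ : ‖x'.2.2 - r.Λ₃ • x.2.2‖ ≤ r.ℓ₃ * ‖x‖ + w

/-- The norms of the data that are prescribed at time `0` are at most `d`. -/
structure Datas.Le (b : Datas) (x : E₁ × E₂ × E₃) (d : ℝ) : Prop where
  le₁ : b.b₁ = .initial → ‖x.1‖ ≤ d
  le₂ : b.b₂ = .initial → ‖x.2.1‖ ≤ d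
  le₃ : b.b₃ = .initial → ‖x.2.2‖ ≤ d

variable {r : Rates} {b : Datas} {κm κp κm' κp' g g' B M d : ℝ} {x x' : ℝ → E₁ × E₂ × E₃}

theorem HasDerivAt.fst' {s : ℝ} {p : E₁ × E₂ × E₃} (h : HasDerivAt x p s) :
    HasDerivAt (fun s => (x s).1) p.1 s :=
  (ContinuousLinearMap.fst ℝ E₁ (E₂ × E₃)).hasFDerivAt.comp_hasDerivAt s h

theorem HasDerivAt.snd₁' {s : ℝ} {p : E₁ × E₂ × E₃} (h : HasDerivAt x p s) :
    HasDerivAt (fun s => (x s).2.1) p.2.1 s :=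
  ((ContinuousLinearMap.fst ℝ E₂ E₃).comp
    (ContinuousLinearMap.snd ℝ E₁ (E₂ × E₃))).hasFDerivAt.comp_hasDerivAt s h

theorem HasDerivAt.snd₂' {s : ℝ} {p : E₁ × E₂ × E₃} (h : HasDerivAt x p s) :
    HasDerivAt (fun s => (x s).2.2) p.2.2 s :=
  ((ContinuousLinearMap.snd ℝ E₂ E₃).comp
    (ContinuousLinearMap.snd ℝ E₁ (E₂ × E₃))).hasFDerivAt.comp_hasDerivAt s h

/-- The self-consistent bound `D ≤ max d ((ℓ D + B) / (ℓ + g))` is solved for `D`. -/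
theorem max_div_le_of_le {a c ℓ D : ℝ} (hg : 0 < g) (hℓ : 0 ≤ ℓ) (h : D ≤ max d ((ℓ * D + B) / (ℓ + g)))
    (ha : d ≤ a) (hc : B / g ≤ c) : D ≤ max a c := by
  rcases le_max_iff.1 h with h | h
  · exact (h.trans ha).trans (le_max_left _ _)
  · rw [le_div_iff₀ (by linarith)] at h
    refine le_trans ?_ (hc.trans (le_max_right _ _))
    rw [le_div_iff₀ hg]
    linarith

/-- A priori estimate: a curve of at most the growth of the weight, which solves the equation up to
an error `B` times the weight, is bounded by its data and by `B`. -/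
theorem Rates.Fits.norm_le (h : r.Fits b κm κp g) (hx : ∀ s, HasDerivAt x (x' s) s)
    (hM : ∀ s, ‖x s‖ ≤ M * weight κm κp s)
    (hn : ∀ s, r.Near (x s) (x' s) (B * weight κm κp s)) (hd : b.Le (x 0) d) (s : ℝ) :
    ‖x s‖ ≤ max d (B / g) * weight κm κp s := by
  set D := ⨆ s, ‖x s‖ / weight κm κp s with hD
  have hw := weight_pos κm κp
  have hbdd : BddAbove (range fun s => ‖x s‖ / weight κm κp s) := by
    refine ⟨M, ?_⟩
    rintro _ ⟨s, rfl⟩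
    exact (div_le_iff₀ (hw s)).2 (hM s)
  have hxD : ∀ s, ‖x s‖ ≤ D * weight κm κp s := fun s =>
    (div_le_iff₀ (hw s)).1 (le_ciSup hbdd s)
  have hsrc : ∀ {ℓ : ℝ}, 0 ≤ ℓ → ∀ s, ℓ * ‖x s‖ + B * weight κm κp s
      ≤ (ℓ * D + B) * weight κm κp s := by
    intro ℓ hℓ s
    have := mul_le_mul_of_nonneg_left (hxD s) hℓ
    linarith
  have p₁ := h.pos
  have n₁ := h.nonneg₁
  have n₂ := h.nonneg₂
  have n₃ := h.nonneg₃
  have e₁ := fun s => Data.norm_le h.le h.le (fun s => HasDerivAt.fst' (hx s))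
    (fun s => (norm_fst_le (x s)).trans (hM s)) (by linarith) h.fits₁
    (fun s => ((hn s).near₁).trans (hsrc h.nonneg₁ s)) (by linarith) h.fits₁ hd.le₁ s
  have e₂ := fun s => Data.norm_le h.le h.le (fun s => HasDerivAt.snd₁' (hx s))
    (fun s => ((norm_fst_le _).trans (norm_snd_le (x s))).trans (hM s)) (by linarith) h.fits₂
    (fun s => ((hn s).near₂).trans (hsrc h.nonneg₂ s)) (by linarith) h.fits₂ hd.le₂ s
  have e₃ := fun s => Data.norm_le h.le h.le (fun s => HasDerivAt.snd₂' (hx s))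
    (fun s => ((norm_snd_le _).trans (norm_snd_le (x s))).trans (hM s)) (by linarith) h.fits₃
    (fun s => ((hn s).near₃).trans (hsrc h.nonneg₃ s)) (by linarith) h.fits₃ hd.le₃ s
  have hmax : D ≤ max (max d ((r.ℓ₁ * D + B) / (r.ℓ₁ + g)))
      (max (max d ((r.ℓ₂ * D + B) / (r.ℓ₂ + g))) (max d ((r.ℓ₃ * D + B) / (r.ℓ₃ + g)))) := by
    refine ciSup_le fun s => (div_le_iff₀ (hw s)).2 ?_
    refine norm_prod_le ((e₁ s).trans ?_) ((e₂ s).trans ?_) ((e₃ s).trans ?_)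
    · exact mul_le_mul_of_nonneg_right (le_max_left _ _) (hw s).le
    · exact mul_le_mul_of_nonneg_right
        ((le_max_left _ _).trans (le_max_right _ _)) (hw s).le
    · exact mul_le_mul_of_nonneg_right
        ((le_max_right _ _).trans (le_max_right _ _)) (hw s).le
  have hfin : D ≤ max d (B / g) := by
    rcases le_max_iff.1 hmax with h1 | h1
    · exact max_div_le_of_le h.pos n₁ h1 le_rfl le_rfl
    rcases le_max_iff.1 h1 with h1 | h1
    · exact max_div_le_of_le h.pos n₂ h1 le_rfl le_rfl
    · exact max_div_le_of_le h.pos n₃ h1 le_rfl le_rfl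
  exact (hxD s).trans (mul_le_mul_of_nonneg_right hfin (hw s).le)

/-- The linear field with the rates `r`. -/
def Rates.lin (r : Rates) (p : E₁ × E₂ × E₃) : E₁ × E₂ × E₃ :=
  (r.Λ₁ • p.1, r.Λ₂ • p.2.1, r.Λ₃ • p.2.2)

/-- `N` is Lipschitz, with the constants `ℓᵢ` for its three components. -/
structure Rates.Lip (r : Rates) (n : E₁ × E₂ × E₃) (e : ℝ) : Prop where
  lip₁ : ‖n.1‖ ≤ r.ℓ₁ * e
  lip₂ : ‖n.2.1‖ ≤ r.ℓ₂ * e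
  lip₃ : ‖n.2.2‖ ≤ r.ℓ₃ * e

variable [CompleteSpace E₁] [CompleteSpace E₂] [CompleteSpace E₃]

/-- Solvability of the decoupled linear equation with a source. -/
theorem exists_solution_decoupled (h : r.Fits b κm κp g) {f : ℝ → E₁ × E₂ × E₃}
    (hf : Continuous f) (hB : ∀ s, ‖f s‖ ≤ B * weight κm κp s) (p : E₁ × E₂ × E₃) :
    ∃ x : ℝ → E₁ × E₂ × E₃, (∀ s, HasDerivAt x (r.lin (x s) + f s) s) ∧ b.Le (x 0 - p) 0 ∧
      ∃ M, ∀ s, ‖x s‖ ≤ M * weight κm κp s := by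
  have hw := weight_pos κm κp
  have p₁ := h.pos
  have n₁ := h.nonneg₁
  have n₂ := h.nonneg₂
  have n₃ := h.nonneg₃
  obtain ⟨y₁, d₁, i₁, M₁, m₁⟩ := Data.exists_solution (b := b.b₁) (f := fun s => (f s).1)
    (by fun_prop) h.le (fun s => (norm_fst_le (f s)).trans (hB s)) (by linarith) h.fits₁ p.1
  obtain ⟨y₂, d₂, i₂, M₂, m₂⟩ := Data.exists_solution (b := b.b₂) (f := fun s => (f s).2.1)
    (by fun_prop) h.le (fun s => ((norm_fst_le _).trans (norm_snd_le (f s))).trans (hB s))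
    (by linarith) h.fits₂ p.2.1
  obtain ⟨y₃, d₃, i₃, M₃, m₃⟩ := Data.exists_solution (b := b.b₃) (f := fun s => (f s).2.2)
    (by fun_prop) h.le (fun s => ((norm_snd_le _).trans (norm_snd_le (f s))).trans (hB s))
    (by linarith) h.fits₃ p.2.2
  refine ⟨fun s => (y₁ s, y₂ s, y₃ s), fun s => (d₁ s).prodMk ((d₂ s).prodMk (d₃ s)),
    ⟨fun e => ?_, fun e => ?_, fun e => ?_⟩, max M₁ (max M₂ M₃), fun s => ?_⟩
  · simp [i₁ e]
  · simp [i₂ e]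
  · simp [i₃ e]
  · refine norm_prod_le ((m₁ s).trans ?_) ((m₂ s).trans ?_) ((m₃ s).trans ?_) <;>
    refine mul_le_mul_of_nonneg_right ?_ (hw s).le <;> simp

/-- Existence for the Lyapunov-Perron equation: the fixed point of the map which sends a curve to
the solution of the decoupled linear equation whose source is the error along the curve. -/
theorem Rates.Fits.exists_solution (h : r.Fits b κm κp g)
    {N : ℝ → E₁ × E₂ × E₃ → E₁ × E₂ × E₃} (hN : Continuous fun q : ℝ × (E₁ × E₂ × E₃) => N q.1 q.2)
    (hL : ∀ s p q, r.Lip (N s p - N s q) ‖p - q‖)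
    (hB : ∀ s, ‖N s 0‖ ≤ B * weight κm κp s) (p : E₁ × E₂ × E₃) :
    ∃ x : ℝ → E₁ × E₂ × E₃, (∀ s, HasDerivAt x (r.lin (x s) + N s (x s)) s) ∧
      b.Le (x 0 - p) 0 ∧ ∃ M, ∀ s, ‖x s‖ ≤ M * weight κm κp s := by
  have hw := weight_pos κm κp
  have hwc := continuous_weight κm κp
  set ℓ := max r.ℓ₁ (max r.ℓ₂ r.ℓ₃) with hℓ
  have hℓ0 : 0 ≤ ℓ := h.nonneg₁.trans (le_max_left _ _)
  have hNl : ∀ s p q, ‖N s p - N s q‖ ≤ ℓ * ‖p - q‖ := fun s p q => norm_prod_le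
    ((hL s p q).lip₁.trans (mul_le_mul_of_nonneg_right (le_max_left _ _) (norm_nonneg _)))
    ((hL s p q).lip₂.trans (mul_le_mul_of_nonneg_right
      ((le_max_left _ _).trans (le_max_right _ _)) (norm_nonneg _)))
    ((hL s p q).lip₃.trans (mul_le_mul_of_nonneg_right
      ((le_max_right _ _).trans (le_max_right _ _)) (norm_nonneg _)))
  let X := BoundedContinuousFunction ℝ (E₁ × E₂ × E₃)
  -- a bounded function `ζ` stands for the curve `weight • ζ`
  let src : X → ℝ → E₁ × E₂ × E₃ := fun ζ s => N s (weight κm κp s • ζ s)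
  have hsrcc : ∀ ζ : X, Continuous (src ζ) := fun ζ =>
    hN.comp (continuous_id.prodMk (hwc.smul ζ.continuous))
  have hsrcb : ∀ ζ : X, ∀ s, ‖src ζ s‖ ≤ (ℓ * ‖ζ‖ + B) * weight κm κp s := by
    intro ζ s
    have h1 : ‖src ζ s‖ ≤ ‖src ζ s - N s 0‖ + ‖N s 0‖ := by
      simpa using norm_add_le (src ζ s - N s 0) (N s 0)
    have h2 := hNl s (weight κm κp s • ζ s) 0
    rw [sub_zero, norm_smul, Real.norm_eq_abs, abs_of_pos (hw s)] at h2
    have h3 : ℓ * (weight κm κp s * ‖ζ s‖) ≤ ℓ * (weight κm κp s * ‖ζ‖) := by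
      have := ζ.norm_coe_le_norm s
      have := hw s
      gcongr
    calc _ ≤ _ := h1
      _ ≤ ℓ * (weight κm κp s * ‖ζ‖) + B * weight κm κp s := add_le_add (h2.trans h3) (hB s)
      _ = _ := by ring
  choose sol hsol hsol0 bd hbd using fun ζ : X =>
    exists_solution_decoupled h (hsrcc ζ) (hsrcb ζ) p
  let T : X → X := fun ζ => BoundedContinuousFunction.ofNormedAddCommGroup
    (fun s => (weight κm κp s)⁻¹ • sol ζ s)
    ((hwc.inv₀ fun s => (hw s).ne').smul
      (continuous_iff_continuousAt.2 fun s => (hsol ζ s).continuousAt)) (bd ζ) (fun s => by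
        rw [norm_smul, norm_inv, Real.norm_eq_abs, abs_of_pos (hw s), inv_mul_le_iff₀ (hw s),
          mul_comm]
        exact hbd ζ s)
  set K := ℓ / (ℓ + g) with hK
  have hg := h.pos
  have hK0 : 0 ≤ K := by positivity
  have hK1 : K < 1 := by rw [hK, div_lt_one (by linarith)]; linarith
  -- the data fit to the rates also when the errors are regarded as sources
  have key : ∀ ζ ξ : X, ∀ s, ‖sol ζ s - sol ξ s‖ ≤ K * dist ζ ξ * weight κm κp s := by
    intro ζ ξ
    have hd0 : 0 ≤ dist ζ ξ := dist_nonneg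
    have hsr : ∀ s, r.Lip (src ζ s - src ξ s) (weight κm κp s * dist ζ ξ) := by
      intro s
      have h1 : ‖weight κm κp s • ζ s - weight κm κp s • ξ s‖ ≤ weight κm κp s * dist ζ ξ := by
        rw [← smul_sub, norm_smul, Real.norm_eq_abs, abs_of_pos (hw s), ← dist_eq_norm]
        exact mul_le_mul_of_nonneg_left (ζ.dist_coe_le_dist s) (hw s).le
      have h2 := hL s (weight κm κp s • ζ s) (weight κm κp s • ξ s)
      exact ⟨h2.lip₁.trans (mul_le_mul_of_nonneg_left h1 h.nonneg₁),
        h2.lip₂.trans (mul_le_mul_of_nonneg_left h1 h.nonneg₂),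
        h2.lip₃.trans (mul_le_mul_of_nonneg_left h1 h.nonneg₃)⟩
    have hder : ∀ s, HasDerivAt (fun s => sol ζ s - sol ξ s)
        (r.lin (sol ζ s) + src ζ s - (r.lin (sol ξ s) + src ξ s)) s := fun s =>
      (hsol ζ s).sub (hsol ξ s)
    have hgr : ∀ s, ‖sol ζ s - sol ξ s‖ ≤ (bd ζ + bd ξ) * weight κm κp s := fun s =>
      (norm_sub_le _ _).trans (by linarith [hbd ζ s, hbd ξ s])
    have hslot : ∀ {ℓ' : ℝ}, 0 ≤ ℓ' → ℓ' ≤ ℓ →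
        max 0 (ℓ' * dist ζ ξ / (ℓ' + g)) ≤ K * dist ζ ξ := by
      intro ℓ' h0 h1
      refine max_le (by positivity) ?_
      rw [mul_div_right_comm]
      refine mul_le_mul_of_nonneg_right ?_ hd0
      rw [hK, div_le_div_iff₀ (by linarith) (by linarith)]
      nlinarith
    intro s
    have e₁ := Data.norm_le (d := 0) h.le h.le (fun s => HasDerivAt.fst' (hder s))
      (fun s => (norm_fst_le _).trans (hgr s)) (by linarith [h.nonneg₁]) h.fits₁
      (B := r.ℓ₁ * dist ζ ξ) (fun s => by
        refine le_trans (le_of_eq ?_) ((hsr s).lip₁.trans (le_of_eq (by ring)))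
        simp only [Rates.lin, Prod.fst_sub, Prod.fst_add, smul_sub]
        congr 1; abel) (by linarith [h.nonneg₁]) h.fits₁
      (fun e => norm_sub_le_zero ((hsol0 ζ).le₁ e) ((hsol0 ξ).le₁ e)) s
    have e₂ := Data.norm_le (d := 0) h.le h.le (fun s => HasDerivAt.snd₁' (hder s))
      (fun s => ((norm_fst_le _).trans (norm_snd_le _)).trans (hgr s))
      (by linarith [h.nonneg₂]) h.fits₂
      (B := r.ℓ₂ * dist ζ ξ) (fun s => by
        refine le_trans (le_of_eq ?_) ((hsr s).lip₂.trans (le_of_eq (by ring)))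
        simp only [Rates.lin, Prod.fst_sub, Prod.fst_add, Prod.snd_sub, Prod.snd_add, smul_sub]
        congr 1; abel) (by linarith [h.nonneg₂]) h.fits₂
      (fun e => norm_sub_le_zero ((hsol0 ζ).le₂ e) ((hsol0 ξ).le₂ e)) s
    have e₃ := Data.norm_le (d := 0) h.le h.le (fun s => HasDerivAt.snd₂' (hder s))
      (fun s => ((norm_snd_le _).trans (norm_snd_le _)).trans (hgr s))
      (by linarith [h.nonneg₃]) h.fits₃
      (B := r.ℓ₃ * dist ζ ξ) (fun s => by
        refine le_trans (le_of_eq ?_) ((hsr s).lip₃.trans (le_of_eq (by ring)))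
        simp only [Rates.lin, Prod.snd_sub, Prod.snd_add, smul_sub]
        congr 1; abel) (by linarith [h.nonneg₃]) h.fits₃
      (fun e => norm_sub_le_zero ((hsol0 ζ).le₃ e) ((hsol0 ξ).le₃ e)) s
    exact norm_prod_le
      (e₁.trans (mul_le_mul_of_nonneg_right (hslot h.nonneg₁ (le_max_left _ _)) (hw s).le))
      (e₂.trans (mul_le_mul_of_nonneg_right (hslot h.nonneg₂
        ((le_max_left _ _).trans (le_max_right _ _))) (hw s).le))
      (e₃.trans (mul_le_mul_of_nonneg_right (hslot h.nonneg₃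
        ((le_max_right _ _).trans (le_max_right _ _))) (hw s).le))
  have hT : ContractingWith ⟨K, hK0⟩ T := by
    refine ⟨by exact_mod_cast hK1, LipschitzWith.of_dist_le_mul fun ζ ξ => ?_⟩
    refine (BoundedContinuousFunction.dist_le (by positivity)).2 fun s => ?_
    change dist ((weight κm κp s)⁻¹ • sol ζ s) ((weight κm κp s)⁻¹ • sol ξ s) ≤ K * dist ζ ξ
    rw [dist_eq_norm, ← smul_sub, norm_smul, norm_inv, Real.norm_eq_abs, abs_of_pos (hw s),
      inv_mul_le_iff₀ (hw s), mul_comm]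
    exact key ζ ξ s
  set ζ := ContractingWith.fixedPoint T hT with hζ
  have hfix : T ζ = ζ := hT.fixedPoint_isFixedPt
  have hcurve : ∀ s, weight κm κp s • ζ s = sol ζ s := by
    intro s
    have h1 : (weight κm κp s)⁻¹ • sol ζ s = ζ s := DFunLike.congr_fun hfix s
    rw [← h1, smul_smul, mul_inv_cancel₀ (hw s).ne', one_smul]
  refine ⟨sol ζ, fun s => ?_, hsol0 ζ, bd ζ, hbd ζ⟩
  have h1 := hsol ζ s
  simp only [src, hcurve] at h1
  exact h1

end Product

end LyapunovPerron

namespace LyapunovPerron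

/-! ### Invariant graphs of saddle type: existence and uniqueness of bounded orbits -/

/-- Max principle: bounded functions `a` and `b` with rates `Λ` and `-Λ`, up to errors of relative
size `Λ - lam` and of absolute size `ε`, are bounded by `ε / lam`. -/
theorem abs_le_of_hyperbolic {a b a' b' : ℝ → ℝ} {Λ lam ε M : ℝ} (hlam : 0 < lam) (hΛ : lam ≤ Λ)
    (hε : 0 ≤ ε) (ha : ∀ s, HasDerivAt a (a' s) s) (hb : ∀ s, HasDerivAt b (b' s) s)
    (hM : ∀ s, |a s| ≤ M ∧ |b s| ≤ M)
    (hra : ∀ s, |a' s - Λ * a s| ≤ (Λ - lam) * max |a s| |b s| + ε)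
    (hrb : ∀ s, |b' s + Λ * b s| ≤ (Λ - lam) * max |a s| |b s| + ε) (s : ℝ) :
    |a s| ≤ ε / lam ∧ |b s| ≤ ε / lam := by
  -- the third component is a dummy
  let r : Rates := ⟨Λ, -Λ, Λ, Λ - lam, Λ - lam, Λ - lam⟩
  have hfit : r.Fits ⟨.future, .past, .future⟩ 0 0 lam :=
    ⟨le_rfl, hlam, by simp [r, hΛ], by simp [r, hΛ], by simp [r, hΛ], by simp [r, Data.Fits],
      by simp [r, Data.Fits], by simp [r, Data.Fits]⟩
  have hw : ∀ s, weight 0 0 s = 1 := fun s => by simp [weight]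
  have hnorm : ∀ s, ‖((a s, b s, 0) : ℝ × ℝ × ℝ)‖ = max |a s| |b s| := fun s => by
    simp [Prod.norm_def]
  have h := hfit.norm_le (x := fun s => ((a s, b s, 0) : ℝ × ℝ × ℝ))
    (x' := fun s => (a' s, b' s, 0)) (B := ε) (M := M) (d := 0)
    (fun s => (ha s).prodMk ((hb s).prodMk (hasDerivAt_const s (0 : ℝ))))
    (fun s => by rw [hw, mul_one, hnorm]; exact max_le (hM s).1 (hM s).2)
    (fun s => by
      have h0 : 0 ≤ (Λ - lam) * max |a s| |b s| + ε := (abs_nonneg _).trans (hra s)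
      refine ⟨?_, ?_, ?_⟩ <;> rw [hw, hnorm, mul_one]
      · simpa [r] using hra s
      · simpa [r] using hrb s
      · simpa [r] using h0)
    ⟨by simp, by simp, by simp⟩ s
  have h0 : 0 ≤ ε / lam := div_nonneg hε hlam.le
  rw [hw, mul_one, hnorm, max_eq_right h0] at h
  exact ⟨(le_max_left _ _).trans h, (le_max_right _ _).trans h⟩

variable {U : Type*} [NormedAddCommGroup U] [NormedSpace ℝ U]

/-- The points of `ℝ × ℝ × U` whose first two coordinates have absolute value at most `1`. -/
def box (U : Type*) : Set (ℝ × ℝ × U) := {p | |p.1| ≤ 1 ∧ |p.2.1| ≤ 1}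

/-- A vector field on `ℝ × ℝ × U` with an unstable coordinate, a stable coordinate and a base `U`.
The dominance of the rates `±Λ` over the remaining entries of the derivative, by a margin `lam`,
expresses hyperbolicity in the directions of the first two coordinates; `μ` bounds the rates of
the base, and `ε` the distance of the zero section from being invariant. -/
structure SaddleField (f : ℝ × ℝ × U → ℝ × ℝ × U)
    (f' : ℝ × ℝ × U → ℝ × ℝ × U →L[ℝ] ℝ × ℝ × U) (Λ lam μ ε : ℝ) : Prop where
  deriv : ∀ p ∈ box U, HasFDerivAt f (f' p) p
  cont : ContinuousOn f' (box U)
  row₁ : ∀ p ∈ box U, ∀ v, |(f' p v).1 - Λ * v.1| ≤ (Λ - lam) * ‖v‖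
  row₂ : ∀ p ∈ box U, ∀ v, |(f' p v).2.1 + Λ * v.2.1| ≤ (Λ - lam) * ‖v‖
  row₃ : ∀ p ∈ box U, ∀ v, ‖(f' p v).2.2‖ ≤ μ * ‖v‖
  small₁ : ∀ u, |(f (0, 0, u)).1| ≤ ε
  small₂ : ∀ u, |(f (0, 0, u)).2.1| ≤ ε
  base : ∃ M, ∀ u, ‖(f (0, 0, u)).2.2‖ ≤ M
  lam_pos : 0 < lam
  lam_le : lam ≤ Λ
  μ_nonneg : 0 ≤ μ
  gap : 16 * μ * Λ ≤ lam ^ 2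
  ε_nonneg : 0 ≤ ε
  ε_le : ε ≤ lam

namespace SaddleField

variable {f : ℝ × ℝ × U → ℝ × ℝ × U} {f' : ℝ × ℝ × U → ℝ × ℝ × U →L[ℝ] ℝ × ℝ × U}
  {Λ lam μ ε : ℝ}

theorem convex_box : Convex ℝ (box U) := by
  have h : box U = (Icc (-1) 1) ×ˢ ((Icc (-1 : ℝ) 1) ×ˢ (univ : Set U)) := by
    ext p; simp [box, abs_le]
  rw [h]
  exact (convex_Icc _ _).prod ((convex_Icc _ _).prod convex_univ)

/-- The rates and errors of a saddle field. -/
def rates (Λ lam μ : ℝ) : Rates := ⟨Λ, -Λ, 0, Λ - lam, Λ - lam, μ⟩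

theorem μ_le (h : SaddleField f f' Λ lam μ ε) : 16 * μ ≤ lam := by
  have h1 := h.lam_pos
  have h2 := h.lam_le
  have h3 := h.gap
  have h4 := h.μ_nonneg
  have : 16 * μ * lam ≤ lam * lam := by nlinarith
  exact le_of_mul_le_mul_right this h1

/-- Weights of slow growth in both directions of time: the unstable component is determined by its
future, the stable one by its past, and the base by its initial value. -/
theorem fits_center (h : SaddleField f f' Λ lam μ ε) :
    (rates Λ lam μ).Fits ⟨.future, .past, .initial⟩ (-(lam / 4)) (lam / 4) (lam / 8) := by
  have h1 := h.lam_pos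
  have h2 := h.lam_le
  have h3 := h.μ_le
  have h4 := h.μ_nonneg
  refine ⟨by linarith, by linarith, ?_, ?_, ?_, ?_, ?_, ?_⟩ <;>
    simp only [rates, Data.Fits] <;> first | linarith | (constructor <;> linarith)

/-- As `fits_center`, with a faster growth, against which the growth of orbits is negligible. -/
theorem fits_center' (h : SaddleField f f' Λ lam μ ε) :
    (rates Λ lam μ).Fits ⟨.future, .past, .initial⟩ (-(lam / 2)) (lam / 2) (lam / 8) := by
  have h1 := h.lam_pos
  have h2 := h.lam_le
  have h3 := h.μ_le
  have h4 := h.μ_nonneg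
  refine ⟨by linarith, by linarith, ?_, ?_, ?_, ?_, ?_, ?_⟩ <;>
    simp only [rates, Data.Fits] <;> first | linarith | (constructor <;> linarith)

/-- Weights that decay in the future leave only the stable component free. -/
theorem fits_stable (h : SaddleField f f' Λ lam μ ε) :
    (rates Λ lam μ).Fits ⟨.future, .initial, .future⟩ (-(2 * Λ)) (-(lam / 2)) (lam / 4) := by
  have h1 := h.lam_pos
  have h2 := h.lam_le
  have h3 := h.μ_le
  have h4 := h.μ_nonneg
  refine ⟨by linarith, by linarith, ?_, ?_, ?_, ?_, ?_, ?_⟩ <;>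
    simp only [rates, Data.Fits] <;> first | linarith | (constructor <;> linarith)

/-- Weights that decay in the past leave only the unstable component free. -/
theorem fits_unstable (h : SaddleField f f' Λ lam μ ε) :
    (rates Λ lam μ).Fits ⟨.initial, .past, .past⟩ (lam / 2) (2 * Λ) (lam / 4) := by
  have h1 := h.lam_pos
  have h2 := h.lam_le
  have h3 := h.μ_le
  have h4 := h.μ_nonneg
  refine ⟨by linarith, by linarith, ?_, ?_, ?_, ?_, ?_, ?_⟩ <;>
    simp only [rates, Data.Fits] <;> first | linarith | (constructor <;> linarith)

theorem sub_bounds (h : SaddleField f f' Λ lam μ ε) {p q : ℝ × ℝ × U} (hp : p ∈ box U)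
    (hq : q ∈ box U) :
    |(f p).1 - (f q).1 - Λ * (p.1 - q.1)| ≤ (Λ - lam) * ‖p - q‖ ∧
    |(f p).2.1 - (f q).2.1 + Λ * (p.2.1 - q.2.1)| ≤ (Λ - lam) * ‖p - q‖ ∧
    ‖(f p).2.2 - (f q).2.2‖ ≤ μ * ‖p - q‖ := by
  have h0 : 0 ≤ Λ - lam := by linarith [h.lam_le]
  refine ⟨?_, ?_, ?_⟩
  · have := convex_box.norm_image_sub_le_of_norm_hasFDerivWithin_le
      (f := fun p => (f p).1 - Λ * p.1)
      (f' := fun p => (ContinuousLinearMap.fst ℝ ℝ (ℝ × U)).comp (f' p)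
        - Λ • ContinuousLinearMap.fst ℝ ℝ (ℝ × U)) (C := Λ - lam)
      (fun x hx => (((h.deriv x hx).fst).sub (hasFDerivAt_fst.const_mul Λ)).hasFDerivWithinAt)
      (fun x hx => ContinuousLinearMap.opNorm_le_bound _ h0 fun v => by
        simpa using h.row₁ x hx v) hq hp
    rw [Real.norm_eq_abs] at this
    refine le_trans (le_of_eq ?_) this
    congr 1; ring
  · have := convex_box.norm_image_sub_le_of_norm_hasFDerivWithin_le
      (f := fun p => (f p).2.1 + Λ * p.2.1)
      (f' := fun p => (ContinuousLinearMap.fst ℝ ℝ U).comp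
          ((ContinuousLinearMap.snd ℝ ℝ (ℝ × U)).comp (f' p))
        + Λ • (ContinuousLinearMap.fst ℝ ℝ U).comp (ContinuousLinearMap.snd ℝ ℝ (ℝ × U)))
      (C := Λ - lam)
      (fun x hx => (((h.deriv x hx).snd.fst).add
        ((hasFDerivAt_snd.fst).const_mul Λ)).hasFDerivWithinAt)
      (fun x hx => ContinuousLinearMap.opNorm_le_bound _ h0 fun v => by
        simpa using h.row₂ x hx v) hq hp
    rw [Real.norm_eq_abs] at this
    refine le_trans (le_of_eq ?_) this
    congr 1; ring
  · exact convex_box.norm_image_sub_le_of_norm_hasFDerivWithin_le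
      (f := fun p => (f p).2.2)
      (f' := fun p => (ContinuousLinearMap.snd ℝ ℝ U).comp
          ((ContinuousLinearMap.snd ℝ ℝ (ℝ × U)).comp (f' p))) (C := μ)
      (fun x hx => ((h.deriv x hx).snd.snd).hasFDerivWithinAt)
      (fun x hx => ContinuousLinearMap.opNorm_le_bound _ h.μ_nonneg fun v => by
        simpa using h.row₃ x hx v) hq hp

theorem near_sub (h : SaddleField f f' Λ lam μ ε) {p q : ℝ × ℝ × U} (hp : p ∈ box U)
    (hq : q ∈ box U) : (rates Λ lam μ).Near (p - q) (f p - f q) 0 := by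
  obtain ⟨h1, h2, h3⟩ := h.sub_bounds hp hq
  refine ⟨?_, ?_, ?_⟩
  · simpa [rates] using h1
  · simpa [rates] using h2
  · simpa [rates] using h3

/-- The curves that solve the equation on the whole line inside the box. -/
def Orbit (f : ℝ × ℝ × U → ℝ × ℝ × U) (x : ℝ → ℝ × ℝ × U) : Prop :=
  ∀ s, HasDerivAt x (f (x s)) s ∧ x s ∈ box U

theorem Orbit.shift {x : ℝ → ℝ × ℝ × U} (hx : Orbit f x) (c : ℝ) :
    Orbit f fun s => x (c + s) := fun s =>
  ⟨(hx (c + s)).1.comp_const_add c s, (hx _).2⟩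

theorem mem_box_zero (u : U) : ((0, 0, u) : ℝ × ℝ × U) ∈ box U := by simp [box]

theorem norm_sub_zero_section {p : ℝ × ℝ × U} : ‖p - (0, 0, p.2.2)‖ = max |p.1| |p.2.1| := by
  simp [Prod.norm_def]

/-- Orbits in the box are close to the zero section. -/
theorem Orbit.le (h : SaddleField f f' Λ lam μ ε) {x : ℝ → ℝ × ℝ × U} (hx : Orbit f x) (s : ℝ) :
    |(x s).1| ≤ ε / lam ∧ |(x s).2.1| ≤ ε / lam := by
  refine abs_le_of_hyperbolic (M := 1) h.lam_pos h.lam_le h.ε_nonneg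
    (fun s => HasDerivAt.fst' (hx s).1) (fun s => HasDerivAt.snd₁' (hx s).1)
    (fun s => (hx s).2) (fun s => ?_) (fun s => ?_) s
  · have h1 := (h.sub_bounds (hx s).2 (mem_box_zero (x s).2.2)).1
    rw [norm_sub_zero_section] at h1
    have h2 := h.small₁ (x s).2.2
    have : (f (x s)).1 - Λ * (x s).1 = ((f (x s)).1 - (f (0, 0, (x s).2.2)).1
      - Λ * ((x s).1 - 0)) + (f (0, 0, (x s).2.2)).1 := by ring
    rw [this]
    exact (abs_add_le _ _).trans (add_le_add h1 h2)
  · have h1 := (h.sub_bounds (hx s).2 (mem_box_zero (x s).2.2)).2.1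
    rw [norm_sub_zero_section] at h1
    have h2 := h.small₂ (x s).2.2
    have : (f (x s)).2.1 + Λ * (x s).2.1 = ((f (x s)).2.1 - (f (0, 0, (x s).2.2)).2.1
      + Λ * ((x s).2.1 - 0)) + (f (0, 0, (x s).2.2)).2.1 := by ring
    rw [this]
    exact (abs_add_le _ _).trans (add_le_add h1 h2)

theorem abs_le_exp_mul {c : ℝ} (hc : 0 < c) (s : ℝ) :
    |s| ≤ c⁻¹ * weight (-c) c s := by
  have h1 : c * |s| ≤ weight (-c) c s := by
    rcases le_total 0 s with hs | hs
    · rw [weight_of_nonneg (by linarith) hs, abs_of_nonneg hs]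
      linarith [Real.add_one_le_exp (c * s)]
    · rw [weight_of_nonpos (by linarith) hs, abs_of_nonpos hs]
      linarith [Real.add_one_le_exp (-c * s)]
  rw [le_inv_mul_iff₀ hc]
  exact h1

/-- Orbits in the box grow at most linearly, since the base moves with bounded speed; the
exponential weight serves to compare them. -/
theorem Orbit.growth (h : SaddleField f f' Λ lam μ ε) {x : ℝ → ℝ × ℝ × U} (hx : Orbit f x) :
    ∃ M, ∀ s, ‖x s‖ ≤ M * weight (-(lam / 4)) (lam / 4) s := by
  obtain ⟨M, hM⟩ := h.base
  have hl := h.lam_pos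
  have hM0 : 0 ≤ M := (norm_nonneg _).trans (hM 0)
  have hder : ∀ s, ‖(f (x s)).2.2‖ ≤ M + μ := by
    intro s
    have h1 := (h.sub_bounds (hx s).2 (mem_box_zero (x s).2.2)).2.2
    have h2 : ‖x s - (0, 0, (x s).2.2)‖ ≤ 1 := by
      rw [norm_sub_zero_section]; exact max_le (hx s).2.1 (hx s).2.2
    have h3 := norm_add_le ((f (x s)).2.2 - (f (0, 0, (x s).2.2)).2.2) (f (0, 0, (x s).2.2)).2.2
    rw [sub_add_cancel] at h3
    have h4 := mul_le_mul_of_nonneg_left h2 h.μ_nonneg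
    linarith [hM (x s).2.2]
  have hu : ∀ s, ‖(x s).2.2‖ ≤ ‖(x 0).2.2‖ + (M + μ) * |s| := by
    intro s
    have := (convex_univ (𝕜 := ℝ)).norm_image_sub_le_of_norm_hasDerivWithin_le
      (f := fun s => (x s).2.2) (f' := fun s => (f (x s)).2.2) (C := M + μ)
      (fun s _ => (HasDerivAt.snd₂' (hx s).1).hasDerivWithinAt) (fun s _ => hder s)
      (mem_univ (0 : ℝ)) (mem_univ s)
    simp only [sub_zero, Real.norm_eq_abs] at this
    have h3 := norm_add_le ((x s).2.2 - (x 0).2.2) (x 0).2.2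
    rw [sub_add_cancel] at h3
    linarith
  refine ⟨1 + ‖(x 0).2.2‖ + (M + μ) * (lam / 4)⁻¹, fun s => ?_⟩
  have hw1 := one_le_weight (κm := -(lam / 4)) (κp := lam / 4) (by linarith) (by linarith) s
  have habs := abs_le_exp_mul (show 0 < lam / 4 by linarith) s
  have hn := norm_nonneg (x 0).2.2
  have hμ := h.μ_nonneg
  have hpos : 0 ≤ (M + μ) * (lam / 4)⁻¹ := by positivity
  have h5 : (M + μ) * |s| ≤ (M + μ) * ((lam / 4)⁻¹ * weight (-(lam / 4)) (lam / 4) s) :=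
    mul_le_mul_of_nonneg_left habs (by positivity)
  refine norm_prod_le ?_ ?_ ?_
  · refine (hx s).2.1.trans ?_
    nlinarith
  · refine (hx s).2.2.trans ?_
    nlinarith
  · refine (hu s).trans ?_
    nlinarith

/-- Orbits in the box diverge at most at the slow rate from the distance of their base points. -/
theorem Orbit.dist_le (h : SaddleField f f' Λ lam μ ε) {x y : ℝ → ℝ × ℝ × U} (hx : Orbit f x)
    (hy : Orbit f y) (s : ℝ) :
    ‖x s - y s‖ ≤ ‖(x 0).2.2 - (y 0).2.2‖ * weight (-(lam / 4)) (lam / 4) s := by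
  obtain ⟨M, hM⟩ := hx.growth h
  obtain ⟨M', hM'⟩ := hy.growth h
  have := h.fits_center.norm_le (x := fun s => x s - y s) (x' := fun s => f (x s) - f (y s))
    (B := 0) (M := M + M') (d := ‖(x 0).2.2 - (y 0).2.2‖) (fun s => (hx s).1.sub (hy s).1)
    (fun s => (norm_sub_le _ _).trans (by linarith [hM s, hM' s]))
    (fun s => by rw [zero_mul]; exact h.near_sub (hx s).2 (hy s).2)
    ⟨by simp, by simp, fun _ => le_rfl⟩ s
  rwa [zero_div, max_eq_left (norm_nonneg _)] at this

theorem Orbit.eq (h : SaddleField f f' Λ lam μ ε) {x y : ℝ → ℝ × ℝ × U} (hx : Orbit f x)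
    (hy : Orbit f y) (hxy : (x 0).2.2 = (y 0).2.2) : x = y := by
  funext s
  have := hx.dist_le h hy s
  rw [hxy, sub_self, norm_zero, zero_mul] at this
  exact sub_eq_zero.1 (norm_le_zero_iff.1 this)

/-- The nearest-point projection onto the box. -/
noncomputable def clampBox (p : ℝ × ℝ × U) : ℝ × ℝ × U :=
  (projIcc (-1 : ℝ) 1 (by norm_num) p.1, projIcc (-1 : ℝ) 1 (by norm_num) p.2.1, p.2.2)

theorem clampBox_mem (p : ℝ × ℝ × U) : clampBox p ∈ box U :=
  ⟨abs_le.2 (projIcc (-1 : ℝ) 1 (by norm_num) p.1).2,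
    abs_le.2 (projIcc (-1 : ℝ) 1 (by norm_num) p.2.1).2⟩

theorem clampBox_eq {p : ℝ × ℝ × U} (hp : p ∈ box U) : clampBox p = p := by
  simp [clampBox, projIcc_of_mem _ (abs_le.1 hp.1), projIcc_of_mem _ (abs_le.1 hp.2)]

theorem abs_projIcc_sub_le (a b : ℝ) :
    |((projIcc (-1 : ℝ) 1 (by norm_num) a : ℝ)) - projIcc (-1 : ℝ) 1 (by norm_num) b| ≤ |a - b| := by
  have := (LipschitzWith.projIcc (a := (-1 : ℝ)) (b := 1) (by norm_num)).dist_le_mul a b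
  simpa [Subtype.dist_eq, Real.dist_eq] using this

theorem norm_clampBox_sub_le (p q : ℝ × ℝ × U) : ‖clampBox p - clampBox q‖ ≤ ‖p - q‖ :=
  norm_prod_le ((abs_projIcc_sub_le _ _).trans (norm_fst_le (p - q)))
    ((abs_projIcc_sub_le _ _).trans ((norm_fst_le _).trans (norm_snd_le (p - q))))
    (show ‖(p - q).2.2‖ ≤ _ from (norm_snd_le _).trans (norm_snd_le (p - q)))

theorem continuous_clampBox : Continuous (clampBox (U := U)) := by
  unfold clampBox
  fun_prop

variable [CompleteSpace U]

/-- Through every point of the base passes an orbit in the box. -/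
theorem exists_orbit (h : SaddleField f f' Λ lam μ ε) (u : U) :
    ∃ x, Orbit f x ∧ (x 0).2.2 = u := by
  have hl := h.lam_pos
  have hΛ := h.lam_le
  set r := rates Λ lam μ with hr
  set N : ℝ × ℝ × U → ℝ × ℝ × U := fun p => f (clampBox p) - r.lin (clampBox p) with hN
  have hfc : ContinuousOn f (box U) := fun p hp => (h.deriv p hp).continuousAt.continuousWithinAt
  have hlin : Continuous (r.lin (E₁ := ℝ) (E₂ := ℝ) (E₃ := U)) := by
    unfold Rates.lin; fun_prop
  have hNc : Continuous N :=
    (hfc.comp_continuous continuous_clampBox clampBox_mem).sub (hlin.comp continuous_clampBox)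
  have hNL : ∀ p q, r.Lip (N p - N q) ‖p - q‖ := by
    intro p q
    obtain ⟨h1, h2, h3⟩ := h.sub_bounds (clampBox_mem p) (clampBox_mem q)
    have hc := norm_clampBox_sub_le p q
    have h0 : 0 ≤ Λ - lam := by linarith
    refine ⟨?_, ?_, ?_⟩
    · refine (le_trans (le_of_eq ?_) h1).trans (mul_le_mul_of_nonneg_left hc h0)
      simp only [hN, hr, rates, Rates.lin, Prod.fst_sub, smul_eq_mul, Real.norm_eq_abs]
      congr 1; ring
    · refine (le_trans (le_of_eq ?_) h2).trans (mul_le_mul_of_nonneg_left hc h0)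
      simp only [hN, hr, rates, Rates.lin, Prod.fst_sub, Prod.snd_sub, smul_eq_mul,
        Real.norm_eq_abs]
      congr 1; ring
    · refine (le_trans (le_of_eq ?_) h3).trans (mul_le_mul_of_nonneg_left hc h.μ_nonneg)
      simp [hN, hr, rates, Rates.lin]
  obtain ⟨x, hx, hx0, M, hM⟩ := h.fits_center.exists_solution (N := fun _ => N)
    (hNc.comp continuous_snd) (fun _ => hNL) (B := ‖N 0‖) (fun s => by
      have := one_le_weight (κm := -(lam / 4)) (κp := lam / 4) (by linarith) (by linarith) s
      nlinarith [norm_nonneg (N 0)]) (0, 0, u)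
  -- `x` solves the equation for the field composed with the projection onto the box; its first two
  -- components have sources of size `Λ`, equal to their rates, so that `x` stays in the box
  have hsrc : ∀ s, |(N (x s)).1| ≤ Λ ∧ |(N (x s)).2.1| ≤ Λ := by
    intro s
    set q := clampBox (x s) with hq
    obtain ⟨h1, h2, -⟩ := h.sub_bounds (clampBox_mem (x s)) (mem_box_zero q.2.2)
    have hc : ‖q - (0, 0, q.2.2)‖ ≤ 1 := by
      rw [norm_sub_zero_section]
      exact max_le (clampBox_mem (x s)).1 (clampBox_mem (x s)).2
    have h3 := h.small₁ q.2.2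
    have h4 := h.small₂ q.2.2
    have h5 : (Λ - lam) * ‖q - (0, 0, q.2.2)‖ ≤ Λ - lam := by nlinarith
    have h6 := h.ε_le
    constructor
    · have e : (N (x s)).1 = ((f q).1 - (f (0, 0, q.2.2)).1 - Λ * (q.1 - 0))
          + (f (0, 0, q.2.2)).1 := by
        simp only [hN, hr, rates, Rates.lin, Prod.fst_sub, smul_eq_mul]; ring
      rw [e]
      refine (abs_add_le _ _).trans ?_
      linarith
    · have e : (N (x s)).2.1 = ((f q).2.1 - (f (0, 0, q.2.2)).2.1 + Λ * (q.2.1 - 0))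
          + (f (0, 0, q.2.2)).2.1 := by
        simp only [hN, hr, rates, Rates.lin, Prod.fst_sub, Prod.snd_sub, smul_eq_mul]; ring
      rw [e]
      refine (abs_add_le _ _).trans ?_
      linarith
  have hw : ∀ s, weight 0 0 s = 1 := fun s => by simp [weight]
  have hΛ0 : 0 < Λ := by linarith
  have hbox : ∀ s, x s ∈ box U := by
    intro s
    constructor
    · have := Data.norm_le (b := .future) (κm := 0) (κp := 0) (g := Λ) (B := Λ) (d := 0) le_rfl
        h.fits_center.le
        (fun s => HasDerivAt.fst' (hx s)) (fun s => (norm_fst_le _).trans (hM s))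
        (g' := lam / 2) (Λ := Λ) (by linarith) (by simp only [Data.Fits]; linarith)
        (fun s => by
          rw [hw, mul_one]
          simpa [Rates.lin, hr, rates] using (hsrc s).1) hΛ0 (by simp [Data.Fits]) (by simp) s
      simpa [hw, div_self hΛ0.ne'] using this
    · have := Data.norm_le (b := .past) (κm := 0) (κp := 0) (g := Λ) (B := Λ) (d := 0) le_rfl
        h.fits_center.le
        (fun s => HasDerivAt.snd₁' (hx s))
        (fun s => ((norm_fst_le _).trans (norm_snd_le _)).trans (hM s))
        (g' := lam / 2) (Λ := -Λ) (by linarith) (by simp only [Data.Fits]; linarith)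
        (fun s => by
          rw [hw, mul_one]
          simpa [Rates.lin, hr, rates] using (hsrc s).2) hΛ0 (by simp [Data.Fits]) (by simp) s
      simpa [hw, div_self hΛ0.ne'] using this
  refine ⟨x, fun s => ⟨?_, hbox s⟩, ?_⟩
  · refine (hx s).congr_deriv ?_
    simp [hN, hr, clampBox_eq (hbox s)]
  · have := hx0.le₃ rfl
    simpa [sub_eq_zero] using this

/-- The orbit in the box through the point of the invariant graph above `u`. -/
noncomputable def orbit (h : SaddleField f f' Λ lam μ ε) (u : U) : ℝ → ℝ × ℝ × U :=
  (h.exists_orbit u).choose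

theorem orbit_spec (h : SaddleField f f' Λ lam μ ε) (u : U) : Orbit f (h.orbit u) :=
  (h.exists_orbit u).choose_spec.1

theorem orbit_base (h : SaddleField f f' Λ lam μ ε) (u : U) : (h.orbit u 0).2.2 = u :=
  (h.exists_orbit u).choose_spec.2

/-- The parametrisation of the invariant graph by its base. -/
noncomputable def graph (h : SaddleField f f' Λ lam μ ε) (u : U) : ℝ × ℝ × U := h.orbit u 0

theorem graph_base (h : SaddleField f f' Λ lam μ ε) (u : U) : (h.graph u).2.2 = u := h.orbit_base u

theorem graph_le (h : SaddleField f f' Λ lam μ ε) (u : U) :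
    |(h.graph u).1| ≤ ε / lam ∧ |(h.graph u).2.1| ≤ ε / lam :=
  (h.orbit_spec u).le h 0

/-- Full orbits in the box lie on the graph. -/
theorem Orbit.eq_graph (h : SaddleField f f' Λ lam μ ε) {x : ℝ → ℝ × ℝ × U} (hx : Orbit f x)
    (s : ℝ) : x s = h.graph (x s).2.2 := by
  have := (hx.shift s).eq h (h.orbit_spec (x s).2.2) (by simp [h.orbit_base])
  simpa [graph] using congrFun this 0

theorem orbit_eq_graph (h : SaddleField f f' Λ lam μ ε) (u : U) (s : ℝ) :
    h.orbit u s = h.graph (h.orbit u s).2.2 :=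
  (h.orbit_spec u).eq_graph h s

theorem norm_graph_sub_le (h : SaddleField f f' Λ lam μ ε) (u w : U) :
    ‖h.graph u - h.graph w‖ ≤ ‖u - w‖ := by
  have := (h.orbit_spec u).dist_le h (h.orbit_spec w) 0
  rw [weight_zero, mul_one, h.orbit_base, h.orbit_base] at this
  exact this

/-- Symmetries of the field are symmetries of the graph. -/
theorem graph_add (h : SaddleField f f' Λ lam μ ε) {w : U}
    (hw : ∀ p, f (p + (0, 0, w)) = f p) (u : U) : h.graph (u + w) = h.graph u + (0, 0, w) := by
  have hx : Orbit f fun s => h.orbit u s + (0, 0, w) := fun s => by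
    refine ⟨?_, ?_⟩
    · rw [hw]
      exact (h.orbit_spec u s).1.add_const _
    · have := (h.orbit_spec u s).2
      simpa [box] using this
  have := hx.eq_graph h 0
  simp only [Prod.snd_add, h.orbit_base] at this
  exact this.symm

end SaddleField

end LyapunovPerron

namespace LyapunovPerron

variable {U : Type*} [NormedAddCommGroup U] [NormedSpace ℝ U]

/-! ### Linearised equation along orbits and differentiability of the graph -/

theorem weight_mono {a b : ℝ} (ha : 0 ≤ a) (hab : a ≤ b) (s : ℝ) :
    weight (-a) a s ≤ weight (-b) b s := by
  rcases le_total 0 s with hs | hs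
  · rw [weight_of_nonneg (by linarith) hs, weight_of_nonneg (by linarith) hs]
    gcongr
  · rw [weight_of_nonpos (by linarith) hs, weight_of_nonpos (by linarith) hs]
    refine Real.exp_le_exp.2 ?_
    nlinarith

theorem weight_add_le (κm κp s t : ℝ) :
    weight κm κp (s + t) ≤ weight κm κp s * weight κm κp t := by
  have h1 := Real.exp_pos (κm * s)
  have h2 := Real.exp_pos (κp * s)
  refine max_le ?_ ?_
  · rw [mul_add, Real.exp_add]
    exact mul_le_mul (le_max_left _ _) (le_max_left _ _) (Real.exp_pos _).le
      (h1.le.trans (le_max_left _ _))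
  · rw [mul_add, Real.exp_add]
    exact mul_le_mul (le_max_right _ _) (le_max_right _ _) (Real.exp_pos _).le
      (h1.le.trans (le_max_left _ _))

/-- `v` solves the linearised equation along `x` and grows at most like the weight. -/
structure Variation (f' : ℝ × ℝ × U → ℝ × ℝ × U →L[ℝ] ℝ × ℝ × U) (x : ℝ → ℝ × ℝ × U)
    (κm κp : ℝ) (v : ℝ → ℝ × ℝ × U) : Prop where
  deriv : ∀ s, HasDerivAt v (f' (x s) (v s)) s
  growth : ∃ M, ∀ s, ‖v s‖ ≤ M * weight κm κp s

namespace Variation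

variable {f' : ℝ × ℝ × U → ℝ × ℝ × U →L[ℝ] ℝ × ℝ × U} {x v w : ℝ → ℝ × ℝ × U} {κm κp : ℝ}

theorem add (hv : Variation f' x κm κp v) (hw : Variation f' x κm κp w) :
    Variation f' x κm κp fun s => v s + w s := by
  obtain ⟨M, hM⟩ := hv.growth
  obtain ⟨M', hM'⟩ := hw.growth
  refine ⟨fun s => ?_, M + M', fun s => (norm_add_le _ _).trans (by linarith [hM s, hM' s])⟩
  rw [map_add]
  exact (hv.deriv s).add (hw.deriv s)

theorem smul (hv : Variation f' x κm κp v) (c : ℝ) :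
    Variation f' x κm κp fun s => c • v s := by
  obtain ⟨M, hM⟩ := hv.growth
  refine ⟨fun s => ?_, |c| * M, fun s => ?_⟩
  · rw [map_smul]
    exact (hv.deriv s).const_smul c
  · rw [norm_smul, Real.norm_eq_abs, mul_assoc]
    exact mul_le_mul_of_nonneg_left (hM s) (abs_nonneg c)

theorem shift (hv : Variation f' x κm κp v) (c : ℝ) :
    Variation f' (fun s => x (c + s)) κm κp fun s => v (c + s) := by
  obtain ⟨M, hM⟩ := hv.growth
  have hM0 : 0 ≤ M := by
    have := (norm_nonneg _).trans (hM 0)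
    rwa [weight_zero, mul_one] at this
  refine ⟨fun s => (hv.deriv (c + s)).comp_const_add c s, M * weight κm κp c, fun s => ?_⟩
  rw [mul_assoc]
  exact (hM _).trans (mul_le_mul_of_nonneg_left (weight_add_le _ _ _ _) hM0)

end Variation

namespace SaddleField

variable {f : ℝ × ℝ × U → ℝ × ℝ × U} {f' : ℝ × ℝ × U → ℝ × ℝ × U →L[ℝ] ℝ × ℝ × U}
  {Λ lam μ ε : ℝ} {b : Datas} {κm κp g d : ℝ} {x v w : ℝ → ℝ × ℝ × U}

theorem near_deriv (h : SaddleField f f' Λ lam μ ε) {p : ℝ × ℝ × U} (hp : p ∈ box U)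
    (v : ℝ × ℝ × U) : (rates Λ lam μ).Near v (f' p v) 0 := by
  refine ⟨?_, ?_, ?_⟩
  · simpa [rates] using h.row₁ p hp v
  · simpa [rates] using h.row₂ p hp v
  · simpa [rates] using h.row₃ p hp v

theorem variation_le (h : SaddleField f f' Λ lam μ ε) (hfit : (rates Λ lam μ).Fits b κm κp g)
    (hx : Orbit f x) (hv : Variation f' x κm κp v) (hd0 : 0 ≤ d) (hd : b.Le (v 0) d) (s : ℝ) :
    ‖v s‖ ≤ d * weight κm κp s := by
  obtain ⟨M, hM⟩ := hv.growth
  have := hfit.norm_le (B := 0) hv.deriv hM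
    (fun s => by rw [zero_mul]; exact h.near_deriv (hx s).2 _) hd s
  rwa [zero_div, max_eq_left hd0] at this

theorem variation_eq (h : SaddleField f f' Λ lam μ ε) (hfit : (rates Λ lam μ).Fits b κm κp g)
    (hx : Orbit f x) (hv : Variation f' x κm κp v) (hw : Variation f' x κm κp w)
    (hd : b.Le (v 0 - w 0) 0) : v = w := by
  funext s
  have hvw : Variation f' x κm κp fun s => v s + (-1 : ℝ) • w s := hv.add (hw.smul (-1))
  have := h.variation_le hfit hx hvw le_rfl (by simpa [← sub_eq_add_neg] using hd) s
  simp only [neg_smul, one_smul, ← sub_eq_add_neg, zero_mul] at this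
  exact sub_eq_zero.1 (norm_le_zero_iff.1 this)

theorem continuous_deriv_orbit (h : SaddleField f f' Λ lam μ ε) (hx : Orbit f x) :
    Continuous fun s => f' (x s) :=
  h.cont.comp_continuous (continuous_iff_continuousAt.2 fun s => (hx s).1.continuousAt)
    fun s => (hx s).2

variable [CompleteSpace U]

/-- The linearised equation along an orbit is solvable for every admissible type of data. -/
theorem exists_variation (h : SaddleField f f' Λ lam μ ε)
    (hfit : (rates Λ lam μ).Fits b κm κp g) (hx : Orbit f x) (p : ℝ × ℝ × U) :
    ∃ v, Variation f' x κm κp v ∧ b.Le (v 0 - p) 0 := by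
  set r := rates Λ lam μ with hr
  have hlin : Continuous (r.lin (E₁ := ℝ) (E₂ := ℝ) (E₃ := U)) := by
    unfold Rates.lin; fun_prop
  have hc := h.continuous_deriv_orbit hx
  obtain ⟨v, hv, hv0, M, hM⟩ := hfit.exists_solution (N := fun s p => f' (x s) p - r.lin p)
    (((hc.comp continuous_fst).clm_apply continuous_snd).sub (hlin.comp continuous_snd))
    (fun s p q => by
      have hn := h.near_deriv (hx s).2 (p - q)
      have e : f' (x s) p - r.lin p - (f' (x s) q - r.lin q)
          = f' (x s) (p - q) - r.lin (p - q) := by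
        simp only [map_sub, Rates.lin, Prod.fst_sub, Prod.snd_sub, smul_sub]
        ext <;> simp <;> abel
      rw [e]
      refine ⟨?_, ?_, ?_⟩
      · simpa [Rates.lin] using hn.near₁
      · simpa [Rates.lin] using hn.near₂
      · simpa [Rates.lin] using hn.near₃)
    (B := 0) (fun s => by simp [Rates.lin]) p
  refine ⟨v, ⟨fun s => (hv s).congr_deriv (by simp [hr]), M, hM⟩, hv0⟩

/-- The solutions of the linearised equation that are tangent to the graph are those of slow growth
in both directions of time, one for each vector of the base. -/
theorem exists_tangent (h : SaddleField f f' Λ lam μ ε) (u w : U) :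
    ∃ v, Variation f' (h.orbit u) (-(lam / 4)) (lam / 4) v ∧ (v 0).2.2 = w := by
  obtain ⟨v, hv, hd⟩ := h.exists_variation h.fits_center (h.orbit_spec u) (0, 0, w)
  exact ⟨v, hv, by simpa [sub_eq_zero] using hd.le₃ rfl⟩

theorem tangent_eq (h : SaddleField f f' Λ lam μ ε) {u : U}
    (hv : Variation f' (h.orbit u) (-(lam / 4)) (lam / 4) v)
    (hw : Variation f' (h.orbit u) (-(lam / 4)) (lam / 4) w) (hvw : (v 0).2.2 = (w 0).2.2) :
    v = w :=
  h.variation_eq h.fits_center (h.orbit_spec u) hv hw ⟨by simp, by simp, fun _ => by simp [hvw]⟩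

theorem tangent_le (h : SaddleField f f' Λ lam μ ε) {u : U}
    (hv : Variation f' (h.orbit u) (-(lam / 4)) (lam / 4) v) (s : ℝ) :
    ‖v s‖ ≤ ‖(v 0).2.2‖ * weight (-(lam / 4)) (lam / 4) s :=
  h.variation_le h.fits_center (h.orbit_spec u) hv (norm_nonneg _) ⟨by simp, by simp, fun _ => le_rfl⟩ s

/-- The derivative of the graph: the value at time `0` of the slowly growing solution of the
linearised equation with the given base component. -/
noncomputable def graphDeriv (h : SaddleField f f' Λ lam μ ε) (u : U) : U →L[ℝ] ℝ × ℝ × U :=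
  LinearMap.mkContinuous
    { toFun := fun w => (h.exists_tangent u w).choose 0
      map_add' := fun w₁ w₂ => by
        have h₁ := (h.exists_tangent u w₁).choose_spec
        have h₂ := (h.exists_tangent u w₂).choose_spec
        have h₃ := (h.exists_tangent u (w₁ + w₂)).choose_spec
        exact congrFun (h.tangent_eq h₃.1 (h₁.1.add h₂.1) (by simp [h₁.2, h₂.2, h₃.2])) 0
      map_smul' := fun c w => by
        have h₁ := (h.exists_tangent u w).choose_spec
        have h₃ := (h.exists_tangent u (c • w)).choose_spec
        exact congrFun (h.tangent_eq h₃.1 (h₁.1.smul c) (by simp [h₁.2, h₃.2])) 0 } 1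
    (fun w => by
      have h₁ := (h.exists_tangent u w).choose_spec
      have := h.tangent_le h₁.1 0
      rw [weight_zero, mul_one, h₁.2] at this
      simpa using this)

theorem graphDeriv_spec (h : SaddleField f f' Λ lam μ ε) (u w : U) :
    ∃ v, Variation f' (h.orbit u) (-(lam / 4)) (lam / 4) v ∧ v 0 = h.graphDeriv u w ∧
      (v 0).2.2 = w :=
  ⟨_, (h.exists_tangent u w).choose_spec.1, rfl, (h.exists_tangent u w).choose_spec.2⟩

theorem graphDeriv_base (h : SaddleField f f' Λ lam μ ε) (u w : U) :
    (h.graphDeriv u w).2.2 = w := by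
  obtain ⟨v, -, h2, h3⟩ := h.graphDeriv_spec u w
  rw [← h2, h3]

theorem tangent_zero (h : SaddleField f f' Λ lam μ ε) {u : U}
    (hv : Variation f' (h.orbit u) (-(lam / 4)) (lam / 4) v) :
    v 0 = h.graphDeriv u (v 0).2.2 := by
  obtain ⟨w, h1, h2, h3⟩ := h.graphDeriv_spec u (v 0).2.2
  rw [← h2, h.tangent_eq hv h1 h3.symm]

theorem norm_graphDeriv_le (h : SaddleField f f' Λ lam μ ε) (u w : U) :
    ‖h.graphDeriv u w‖ ≤ ‖w‖ := by
  obtain ⟨v, h1, h2, h3⟩ := h.graphDeriv_spec u w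
  have := h.tangent_le h1 0
  rwa [weight_zero, mul_one, h2, ← h2, h3, h2] at this

theorem norm_sub_deriv_le (h : SaddleField f f' Λ lam μ ε) {p q y : ℝ × ℝ × U} (hp : p ∈ box U)
    (hq : q ∈ box U) (hy : y ∈ box U) :
    ‖f p - f q - f' y (p - q)‖ ≤ 2 * Λ * ‖p - q‖ := by
  have h1 := h.near_sub hp hq
  have h2 := h.near_deriv hy (p - q)
  have hl := h.lam_pos
  have hΛ := h.lam_le
  have hμ := h.μ_le
  have hn := norm_nonneg (p - q)
  have key : ∀ {F : Type _} [NormedAddCommGroup F] {a b c : F} {ℓ : ℝ}, ℓ ≤ Λ →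
      ‖a - c‖ ≤ ℓ * ‖p - q‖ + 0 → ‖b - c‖ ≤ ℓ * ‖p - q‖ + 0 →
      ‖a - b‖ ≤ 2 * Λ * ‖p - q‖ := by
    intro F _ a b c ℓ hℓ ha hb
    have := norm_sub_le (a - c) (b - c)
    rw [sub_sub_sub_cancel_right] at this
    nlinarith
  have hu : ‖(f p - f q - f' y (p - q)).2.2‖ ≤ 2 * Λ * ‖p - q‖ := by
    have h3 := h1.near₃
    have h4 := h2.near₃
    simp only [rates, zero_smul, sub_zero, add_zero] at h3 h4
    have := norm_sub_le (f p - f q).2.2 (f' y (p - q)).2.2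
    have h5 : μ * ‖p - q‖ ≤ Λ * ‖p - q‖ := mul_le_mul_of_nonneg_right (by linarith) hn
    rw [Prod.snd_sub, Prod.snd_sub]
    linarith
  exact norm_prod_le (key (by simp only [rates]; linarith) h1.near₁ h2.near₁)
    (key (by simp only [rates]; linarith) h1.near₂ h2.near₂) hu

/-- Strict differentiability of the graph. The difference of two orbits, minus the corresponding
solution of the linearised equation, solves the linearised equation up to an error that is small
relative to a faster growing weight: on a compact interval of time because `f'` is continuous,
outside because the slower weight is negligible there. -/
theorem hasStrictFDerivAt_graph (h : SaddleField f f' Λ lam μ ε) (u : U) :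
    HasStrictFDerivAt h.graph (h.graphDeriv u) u := by
  have hl := h.lam_pos
  have hΛ := h.lam_le
  set x := h.orbit u with hx
  have hxo : Orbit f x := h.orbit_spec u
  refine HasStrictFDerivAt.of_isLittleO (Asymptotics.isLittleO_iff.2 fun c hc => ?_)
  set c' := c * (lam / 8) with hc'
  have hc'0 : 0 < c' := by positivity
  obtain ⟨T, hT0, hT⟩ : ∃ T : ℝ, 0 ≤ T ∧ 2 * Λ * Real.exp (-(lam / 4) * T) ≤ c' := by
    have h1 : Tendsto (fun T : ℝ => 2 * Λ * Real.exp (-(lam / 4) * T)) atTop (𝓝 (2 * Λ * 0)) :=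
      (Real.tendsto_exp_atBot.comp
        (tendsto_id.const_mul_atTop_of_neg (by linarith))).const_mul _
    rw [mul_zero] at h1
    obtain ⟨T, h2, h3⟩ := ((h1.eventually (gt_mem_nhds hc'0)).and (eventually_ge_atTop 0)).exists
    exact ⟨T, h3, h2.le⟩
  have hxc : Continuous x := continuous_iff_continuousAt.2 fun s => (hxo s).1.continuousAt
  have hK : IsCompact (x '' Icc (-T) T) := isCompact_Icc.image hxc
  have hfc : Continuous fun p => f' (clampBox p) :=
    h.cont.comp_continuous continuous_clampBox clampBox_mem
  obtain ⟨η, hη, hηK⟩ := Metric.mem_uniformity_dist.1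
    (hK.uniformContinuousAt_of_continuousAt _ (fun a _ => hfc.continuousAt)
      (Metric.dist_mem_uniformity hc'0))
  have hclose : ∀ s ∈ Icc (-T) T, ∀ y ∈ box U, dist (x s) y < η → ‖f' y - f' (x s)‖ ≤ c' := by
    intro s hs y hy hd
    have h1 := hηK hd ⟨s, hs, rfl⟩
    simp only [mem_ofPred_eq, clampBox_eq hy, clampBox_eq (hxo s).2] at h1
    rw [← dist_eq_norm, dist_comm]
    exact h1.le
  have hwT := weight_pos (-(lam / 4)) (lam / 4) T
  have hev : ∀ᶠ p in 𝓝 u, ‖p - u‖ * weight (-(lam / 4)) (lam / 4) T < η := by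
    have h1 : Tendsto (fun p => ‖p - u‖ * weight (-(lam / 4)) (lam / 4) T) (𝓝 u)
        (𝓝 (‖u - u‖ * weight (-(lam / 4)) (lam / 4) T)) :=
      ((continuous_id.sub continuous_const).norm.mul continuous_const).tendsto u
    rw [sub_self, norm_zero, zero_mul] at h1
    exact h1.eventually (gt_mem_nhds hη)
  have hev2 : ∀ᶠ pq : U × U in 𝓝 (u, u),
      ‖pq.1 - u‖ * weight (-(lam / 4)) (lam / 4) T < η ∧
      ‖pq.2 - u‖ * weight (-(lam / 4)) (lam / 4) T < η := by
    rw [nhds_prod_eq]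
    exact hev.prod_mk hev
  filter_upwards [hev2] with ⟨p, q⟩ ⟨hp, hq⟩
  simp only at hp hq ⊢
  have hpo := h.orbit_spec p
  have hqo := h.orbit_spec q
  have hpq : ∀ s, ‖h.orbit p s - h.orbit q s‖ ≤ ‖p - q‖ * weight (-(lam / 4)) (lam / 4) s := by
    intro s
    have := hpo.dist_le h hqo s
    rwa [h.orbit_base, h.orbit_base] at this
  have hwle : ∀ s ∈ Icc (-T) T, weight (-(lam / 4)) (lam / 4) s ≤ weight (-(lam / 4)) (lam / 4) T := by
    intro s hs
    rw [weight_of_nonneg (by linarith) hT0]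
    exact max_le (Real.exp_le_exp.2 (by nlinarith [hs.1])) (Real.exp_le_exp.2 (by nlinarith [hs.2]))
  have hnear : ∀ y, ‖y - u‖ * weight (-(lam / 4)) (lam / 4) T < η → ∀ s ∈ Icc (-T) T,
      dist (x s) (h.orbit y s) < η := by
    intro y hy s hs
    have := (h.orbit_spec y).dist_le h hxo s
    rw [h.orbit_base, hx, h.orbit_base] at this
    rw [dist_comm, dist_eq_norm]
    exact (this.trans (mul_le_mul_of_nonneg_left (hwle s hs) (norm_nonneg _))).trans_lt hy
  have herr : ∀ s, ‖f (h.orbit p s) - f (h.orbit q s) - f' (x s) (h.orbit p s - h.orbit q s)‖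
      ≤ c' * ‖p - q‖ * weight (-(lam / 2)) (lam / 2) s := by
    intro s
    have hn := norm_nonneg (p - q)
    have hw2 := weight_pos (-(lam / 2)) (lam / 2) s
    by_cases hs : s ∈ Icc (-T) T
    · have hconv : Convex ℝ (box U ∩ Metric.ball (x s) η) := convex_box.inter (convex_ball _ _)
      have h1 := hconv.norm_image_sub_le_of_norm_hasFDerivWithin_le' (f := f) (f' := f')
        (φ := f' (x s)) (C := c') (fun y hy => (h.deriv y hy.1).hasFDerivWithinAt)
        (fun y hy => hclose s hs y hy.1 (by rw [dist_comm]; exact hy.2))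
        (x := h.orbit q s) (y := h.orbit p s)
        ⟨(hqo s).2, by rw [Metric.mem_ball, dist_comm]; exact hnear q hq s hs⟩
        ⟨(hpo s).2, by rw [Metric.mem_ball, dist_comm]; exact hnear p hp s hs⟩
      refine h1.trans ?_
      rw [mul_assoc c' ‖p - q‖]
      refine mul_le_mul_of_nonneg_left ((hpq s).trans ?_) hc'0.le
      exact mul_le_mul_of_nonneg_left (weight_mono (by linarith) (by linarith) s) hn
    · have h1 := h.norm_sub_deriv_le (hpo s).2 (hqo s).2 (hxo s).2
      have h2 : T ≤ |s| := by
        by_contra hlt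
        rw [not_le, abs_lt] at hlt
        exact hs ⟨hlt.1.le, hlt.2.le⟩
      have h3 : weight (-(lam / 4)) (lam / 4) s
          ≤ Real.exp (-(lam / 4) * T) * weight (-(lam / 2)) (lam / 2) s := by
        rcases le_total 0 s with hs0 | hs0
        · rw [weight_of_nonneg (by linarith) hs0, weight_of_nonneg (by linarith) hs0,
            ← Real.exp_add]
          rw [abs_of_nonneg hs0] at h2
          exact Real.exp_le_exp.2 (by nlinarith)
        · rw [weight_of_nonpos (by linarith) hs0, weight_of_nonpos (by linarith) hs0,
            ← Real.exp_add]
          rw [abs_of_nonpos hs0] at h2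
          exact Real.exp_le_exp.2 (by nlinarith)
      calc _ ≤ _ := h1
        _ ≤ 2 * Λ * (‖p - q‖ * (Real.exp (-(lam / 4) * T) * weight (-(lam / 2)) (lam / 2) s)) :=
            mul_le_mul_of_nonneg_left ((hpq s).trans (mul_le_mul_of_nonneg_left h3 hn))
              (by linarith)
        _ = (2 * Λ * Real.exp (-(lam / 4) * T)) * (‖p - q‖ * weight (-(lam / 2)) (lam / 2) s) := by
            ring
        _ ≤ c' * (‖p - q‖ * weight (-(lam / 2)) (lam / 2) s) :=
            mul_le_mul_of_nonneg_right hT (by positivity)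
        _ = _ := by ring
  obtain ⟨v, hv, hv0, hvb⟩ := h.graphDeriv_spec u (p - q)
  obtain ⟨M, hM⟩ := hv.growth
  have hM0 : 0 ≤ M := by
    have := (norm_nonneg _).trans (hM 0)
    rwa [weight_zero, mul_one] at this
  have hfin := h.fits_center'.norm_le (x := fun s => h.orbit p s - h.orbit q s - v s)
    (x' := fun s => f (h.orbit p s) - f (h.orbit q s) - f' (x s) (v s))
    (B := c' * ‖p - q‖) (M := ‖p - q‖ + M) (d := 0)
    (fun s => ((hpo s).1.sub (hqo s).1).sub (hv.deriv s))
    (fun s => by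
      refine (norm_sub_le _ _).trans ?_
      have h1 := weight_mono (a := lam / 4) (b := lam / 2) (by linarith) (by linarith) s
      have h2 := mul_le_mul_of_nonneg_left h1 (norm_nonneg (p - q))
      have h3 := mul_le_mul_of_nonneg_left h1 hM0
      linarith [hpq s, hM s])
    (fun s => by
      have hn := h.near_deriv (hxo s).2 (h.orbit p s - h.orbit q s - v s)
      have he := herr s
      set e := f (h.orbit p s) - f (h.orbit q s) - f' (x s) (h.orbit p s - h.orbit q s) with hedef
      have e1 : f (h.orbit p s) - f (h.orbit q s) - f' (x s) (v s)
          = f' (x s) (h.orbit p s - h.orbit q s - v s) + e := by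
        rw [hedef, map_sub _ (h.orbit p s - h.orbit q s)]; abel
      rw [e1]
      have e2 : ∀ {F : Type _} [NormedAddCommGroup F] {a z k : F} {A B : ℝ}, ‖a - z‖ ≤ A + 0 →
          ‖k‖ ≤ B → ‖a + k - z‖ ≤ A + B := by
        intro F _ a z k A B ha hk
        have : a + k - z = (a - z) + k := by abel
        rw [this]
        exact (norm_add_le _ _).trans (by linarith)
      have e2' : ∀ {a z k : U} {A B : ℝ}, ‖a - z‖ ≤ A + 0 →
          ‖k‖ ≤ B → ‖a + k - z‖ ≤ A + B := by
        intro a z k A B ha hk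
        have : a + k - z = (a - z) + k := by abel
        rw [this]
        exact (norm_add_le _ _).trans (by linarith)
      exact ⟨e2 hn.near₁ ((norm_fst_le e).trans he),
        e2 hn.near₂ (((norm_fst_le _).trans (norm_snd_le e)).trans he),
        e2' hn.near₃ (((norm_snd_le _).trans (norm_snd_le e)).trans he)⟩)
    ⟨by simp, by simp, fun _ => by simp [h.orbit_base, hvb]⟩ 0
  rw [weight_zero, mul_one, max_eq_right (by positivity)] at hfin
  have e3 : c' * ‖p - q‖ / (lam / 8) = c * ‖p - q‖ := by rw [hc']; field_simp
  rw [e3] at hfin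
  rw [← hv0]
  exact hfin

theorem contDiff_graph (h : SaddleField f f' Λ lam μ ε) : ContDiff ℝ 1 h.graph := by
  refine contDiff_one_iff_fderiv.2
    ⟨fun u => (h.hasStrictFDerivAt_graph u).hasFDerivAt.differentiableAt, ?_⟩
  have e : fderiv ℝ h.graph = h.graphDeriv :=
    funext fun u => (h.hasStrictFDerivAt_graph u).hasFDerivAt.fderiv
  rw [e, continuous_iff_continuousAt]
  intro u
  refine Metric.continuousAt_iff'.2 fun c hc => ?_
  have h1 := (h.hasStrictFDerivAt_graph u).isLittleO
  have h2 := (Asymptotics.isLittleO_iff.1 h1) (half_pos hc)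
  rw [nhds_prod_eq] at h2
  obtain ⟨s, hs, hs2⟩ := eventually_prod_self_iff'.1 h2
  obtain ⟨s', hs's, hs'o, hus'⟩ := mem_nhds_iff.1 hs
  filter_upwards [hs'o.mem_nhds hus'] with p hp
  have h3 : HasFDerivAt (fun q => h.graph q - h.graphDeriv u q)
      (h.graphDeriv p - h.graphDeriv u) p :=
    (h.hasStrictFDerivAt_graph p).hasFDerivAt.sub (h.graphDeriv u).hasFDerivAt
  have h4 : LipschitzOnWith ⟨c / 2, (half_pos hc).le⟩
      (fun q => h.graph q - h.graphDeriv u q) s' := by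
    refine LipschitzOnWith.of_dist_le_mul fun a ha b hb => ?_
    have := hs2 a (hs's ha) b (hs's hb)
    rw [dist_eq_norm, dist_eq_norm]
    refine le_trans (le_of_eq ?_) this
    congr 1
    simp only [map_sub]
    abel
  have h5 := h3.le_of_lipschitzOn (hs'o.mem_nhds hp) h4
  rw [dist_eq_norm]
  exact lt_of_le_of_lt h5 (half_lt_self hc)

/-- Tangency of the field to its invariant graph. -/
theorem field_graph (h : SaddleField f f' Λ lam μ ε) (u : U) :
    f (h.graph u) = h.graphDeriv u (f (h.graph u)).2.2 := by
  have hx := h.orbit_spec u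
  have h1 : HasDerivAt (fun s => h.graph (h.orbit u s).2.2)
      (h.graphDeriv u (f (h.orbit u 0)).2.2) 0 := by
    have h2 := HasDerivAt.snd₂' (hx 0).1
    have h3 := (h.hasStrictFDerivAt_graph u).hasFDerivAt
    rw [← h.orbit_base u] at h3
    have := h3.comp_hasDerivAt (0 : ℝ) h2
    rw [h.orbit_base u] at this
    exact this
  have e : (fun s => h.graph (h.orbit u s).2.2) = h.orbit u :=
    funext fun s => (h.orbit_eq_graph u s).symm
  rw [e] at h1
  exact (hx 0).1.unique h1

end SaddleField

end LyapunovPerron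

namespace LyapunovPerron

variable {U : Type*} [NormedAddCommGroup U] [NormedSpace ℝ U]

namespace SaddleField

/-! ### Stable and unstable directions along the graph -/

variable {f : ℝ × ℝ × U → ℝ × ℝ × U} {f' : ℝ × ℝ × U → ℝ × ℝ × U →L[ℝ] ℝ × ℝ × U}
  {Λ lam μ ε : ℝ} {L : ℝ} {γ v w : ℝ → ℝ × ℝ × U} {u : U}

/-- A segment of an orbit in the box, together with a solution of the linearised equation. -/
structure Segment (f : ℝ × ℝ × U → ℝ × ℝ × U) (f' : ℝ × ℝ × U → ℝ × ℝ × U →L[ℝ] ℝ × ℝ × U)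
    (L : ℝ) (γ v : ℝ → ℝ × ℝ × U) : Prop where
  mem : ∀ s ∈ Icc 0 L, γ s ∈ box U
  curve : ∀ s ∈ Icc 0 L, HasDerivWithinAt γ (f (γ s)) (Icc 0 L) s
  vector : ∀ s ∈ Icc 0 L, HasDerivWithinAt v (f' (γ s) (v s)) (Icc 0 L) s

theorem norm_field_sub_le (h : SaddleField f f' Λ lam μ ε) {p q : ℝ × ℝ × U} (hp : p ∈ box U)
    (hq : q ∈ box U) : ‖f p - f q‖ ≤ 2 * Λ * ‖p - q‖ := by
  obtain ⟨h1, h2, h3⟩ := h.sub_bounds hp hq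
  have hl := h.lam_pos
  have hΛ := h.lam_le
  have hμ := h.μ_le
  have hn := norm_nonneg (p - q)
  have n1 : |p.1 - q.1| ≤ ‖p - q‖ := norm_fst_le (p - q)
  have n2 : |p.2.1 - q.2.1| ≤ ‖p - q‖ := (norm_fst_le _).trans (norm_snd_le (p - q))
  have key : ∀ a c : ℝ, |c| ≤ ‖p - q‖ → |a - Λ * c| ≤ (Λ - lam) * ‖p - q‖ →
      |a| ≤ 2 * Λ * ‖p - q‖ := by
    intro a c hc ha
    have e : a = (a - Λ * c) + Λ * c := by ring
    rw [e]
    refine (abs_add_le _ _).trans ?_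
    rw [abs_mul, abs_of_nonneg (show 0 ≤ Λ by linarith)]
    nlinarith
  refine norm_prod_le (key _ _ n1 h1) (key _ (-(p.2.1 - q.2.1)) (by rwa [abs_neg]) ?_) ?_
  · rwa [mul_neg, sub_neg_eq_add]
  · refine h3.trans ?_
    have : μ ≤ 2 * Λ := by linarith
    gcongr

theorem norm_deriv_le (h : SaddleField f f' Λ lam μ ε) {p : ℝ × ℝ × U} (hp : p ∈ box U)
    (z : ℝ × ℝ × U) : ‖f' p z‖ ≤ 2 * Λ * ‖z‖ := by
  have hl := h.lam_pos
  have hΛ := h.lam_le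
  have hμ := h.μ_le
  have hn := norm_nonneg z
  have n1 : |z.1| ≤ ‖z‖ := norm_fst_le z
  have n2 : |z.2.1| ≤ ‖z‖ := (norm_fst_le _).trans (norm_snd_le z)
  have key : ∀ a c : ℝ, |c| ≤ ‖z‖ → |a - Λ * c| ≤ (Λ - lam) * ‖z‖ →
      |a| ≤ 2 * Λ * ‖z‖ := by
    intro a c hc ha
    have e : a = (a - Λ * c) + Λ * c := by ring
    rw [e]
    refine (abs_add_le _ _).trans ?_
    rw [abs_mul, abs_of_nonneg (show 0 ≤ Λ by linarith)]
    nlinarith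
  refine norm_prod_le (key _ _ n1 (h.row₁ p hp z)) (key _ (-z.2.1) (by rwa [abs_neg]) ?_) ?_
  · simpa using h.row₂ p hp z
  · refine (h.row₃ p hp z).trans ?_
    have : μ ≤ 2 * Λ := by linarith
    gcongr

theorem hasDerivWithinAt_Ici_of_Icc {E : Type*} [NormedAddCommGroup E] [NormedSpace ℝ E]
    {y : ℝ → E} {y' : E} {s : ℝ} (hs : s ∈ Ico 0 L) (hy : HasDerivWithinAt y y' (Icc 0 L) s) :
    HasDerivWithinAt y y' (Ici s) s :=
  hy.mono_of_mem_nhdsWithin (Icc_mem_nhdsGE_of_mem hs)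

variable [CompleteSpace U]

/-- A segment that starts on the graph is part of the full orbit. -/
theorem Segment.eq_orbit (h : SaddleField f f' Λ lam μ ε) (hs : Segment f f' L γ v)
    (h0 : γ 0 = h.graph u) : ∀ s ∈ Icc 0 L, γ s = h.orbit u s := by
  have hΛ : 0 ≤ 2 * Λ := by linarith [h.lam_pos, h.lam_le]
  refine ODE_solution_unique_of_mem_Icc_right (v := fun _ => f) (s := fun _ => box U)
    (K := ⟨2 * Λ, hΛ⟩) (fun t _ => LipschitzOnWith.of_dist_le_mul fun p hp q hq => ?_)
    (fun t ht => (hs.curve t ht).continuousWithinAt)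
    (fun t ht => hasDerivWithinAt_Ici_of_Icc ht (hs.curve t (Ico_subset_Icc_self ht)))
    (fun t ht => hs.mem t (Ico_subset_Icc_self ht))
    (fun t _ => (h.orbit_spec u t).1.continuousAt.continuousWithinAt)
    (fun t _ => (h.orbit_spec u t).1.hasDerivWithinAt) (fun t _ => (h.orbit_spec u t).2) h0
  rw [dist_eq_norm, dist_eq_norm]
  exact h.norm_field_sub_le hp hq

theorem Segment.eq_variation (h : SaddleField f f' Λ lam μ ε) (hs : Segment f f' L γ v)
    (h0 : γ 0 = h.graph u) (hw : ∀ s, HasDerivAt w (f' (h.orbit u s) (w s)) s) (hv : v 0 = w 0) :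
    ∀ s ∈ Icc 0 L, v s = w s := by
  have hΛ : 0 ≤ 2 * Λ := by linarith [h.lam_pos, h.lam_le]
  have hγ := hs.eq_orbit h h0
  refine ODE_solution_unique_of_mem_Icc_right (v := fun t z => f' (h.orbit u t) z)
    (s := fun _ => univ)
    (K := ⟨2 * Λ, hΛ⟩) (fun t _ => LipschitzOnWith.of_dist_le_mul fun p _ q _ => ?_)
    (fun t ht => (hs.vector t ht).continuousWithinAt)
    (fun t ht => ?_)
    (fun t ht => mem_univ _)
    (fun t _ => (hw t).continuousAt.continuousWithinAt)
    (fun t _ => (hw t).hasDerivWithinAt) (fun t _ => mem_univ _) hv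
  · rw [dist_eq_norm, dist_eq_norm, ← map_sub]
    exact h.norm_deriv_le (h.orbit_spec u t).2 _
  · rw [← hγ t (Ico_subset_Icc_self ht)]
    exact hasDerivWithinAt_Ici_of_Icc ht (hs.vector t (Ico_subset_Icc_self ht))

theorem orbit_shift (h : SaddleField f f' Λ lam μ ε) (u : U) (c : ℝ) :
    (fun s => h.orbit u (c + s)) = h.orbit (h.orbit u c).2.2 :=
  ((h.orbit_spec u).shift c).eq h (h.orbit_spec _) (by simp [h.orbit_base])

theorem Variation.shift_orbit (h : SaddleField f f' Λ lam μ ε) {κm κp : ℝ}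
    (hw : Variation f' (h.orbit u) κm κp w) (c : ℝ) :
    Variation f' (h.orbit (h.orbit u c).2.2) κm κp fun s => w (c + s) := by
  rw [← h.orbit_shift u c]
  exact hw.shift c

theorem exists_stable (h : SaddleField f f' Λ lam μ ε) (u : U) :
    ∃ v, Variation f' (h.orbit u) (-(2 * Λ)) (-(lam / 2)) v ∧ (v 0).2.1 = 1 := by
  obtain ⟨v, hv, hd⟩ := h.exists_variation h.fits_stable (h.orbit_spec u) (0, 1, 0)
  exact ⟨v, hv, by simpa [sub_eq_zero] using hd.le₂ rfl⟩

theorem exists_unstable (h : SaddleField f f' Λ lam μ ε) (u : U) :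
    ∃ v, Variation f' (h.orbit u) (lam / 2) (2 * Λ) v ∧ (v 0).1 = 1 := by
  obtain ⟨v, hv, hd⟩ := h.exists_variation h.fits_unstable (h.orbit_spec u) (1, 0, 0)
  exact ⟨v, hv, by simpa [sub_eq_zero] using hd.le₁ rfl⟩

/-- The stable direction at the point of the graph above `u`: the initial value of a solution of the
linearised equation which decays in the future. -/
noncomputable def stableVec (h : SaddleField f f' Λ lam μ ε) (u : U) : ℝ × ℝ × U :=
  (h.exists_stable u).choose 0

/-- The unstable direction at the point of the graph above `u`: the initial value of a solution of
the linearised equation which decays in the past. -/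
noncomputable def unstableVec (h : SaddleField f f' Λ lam μ ε) (u : U) : ℝ × ℝ × U :=
  (h.exists_unstable u).choose 0

theorem stable_le (h : SaddleField f f' Λ lam μ ε)
    (hv : Variation f' (h.orbit u) (-(2 * Λ)) (-(lam / 2)) v) (s : ℝ) :
    ‖v s‖ ≤ |(v 0).2.1| * weight (-(2 * Λ)) (-(lam / 2)) s :=
  h.variation_le h.fits_stable (h.orbit_spec u) hv (abs_nonneg _) ⟨by simp, fun _ => le_rfl, by simp⟩ s

theorem unstable_le (h : SaddleField f f' Λ lam μ ε)
    (hv : Variation f' (h.orbit u) (lam / 2) (2 * Λ) v) (s : ℝ) :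
    ‖v s‖ ≤ |(v 0).1| * weight (lam / 2) (2 * Λ) s :=
  h.variation_le h.fits_unstable (h.orbit_spec u) hv (abs_nonneg _)
    ⟨fun _ => le_rfl, by simp, by simp⟩ s

theorem stable_zero (h : SaddleField f f' Λ lam μ ε)
    (hv : Variation f' (h.orbit u) (-(2 * Λ)) (-(lam / 2)) v) :
    v 0 = (v 0).2.1 • h.stableVec u := by
  have hs := (h.exists_stable u).choose_spec
  exact congrFun (h.variation_eq h.fits_stable (h.orbit_spec u) hv (hs.1.smul (v 0).2.1)
    ⟨by simp, fun _ => by simp [hs.2], by simp⟩) 0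

theorem unstable_zero (h : SaddleField f f' Λ lam μ ε)
    (hv : Variation f' (h.orbit u) (lam / 2) (2 * Λ) v) :
    v 0 = (v 0).1 • h.unstableVec u := by
  have hs := (h.exists_unstable u).choose_spec
  exact congrFun (h.variation_eq h.fits_unstable (h.orbit_spec u) hv (hs.1.smul (v 0).1)
    ⟨fun _ => by simp [hs.2], by simp, by simp⟩) 0

theorem stableVec_spec (h : SaddleField f f' Λ lam μ ε) (u : U) :
    (h.stableVec u).2.1 = 1 ∧ ‖h.stableVec u‖ ≤ 1 ∧
    |(h.stableVec u).1| ≤ (Λ - lam) / (Λ + lam / 2) ∧ ‖(h.stableVec u).2.2‖ ≤ 2 * μ / lam := by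
  have hl := h.lam_pos
  have hΛ := h.lam_le
  have hμ := h.μ_nonneg
  obtain ⟨hv, h1⟩ := (h.exists_stable u).choose_spec
  set v := (h.exists_stable u).choose with hvdef
  have hle := h.stable_le hv
  rw [h1, abs_one] at hle
  simp only [one_mul] at hle
  have hκ : -(2 * Λ) ≤ -(lam / 2) := by linarith
  have hnear := fun s => h.near_deriv (h.orbit_spec u s).2 (v s)
  refine ⟨h1, by have := hle 0; rw [weight_zero] at this; exact this, ?_, ?_⟩
  · have := Data.norm_le (b := .future) (g := Λ + lam / 2) (g' := Λ + lam / 2) (M := 1) (d := 0)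
      (B := Λ - lam) hκ hκ
      (fun s => HasDerivAt.fst' (hv.deriv s))
      (fun s => by rw [one_mul]; exact (norm_fst_le _).trans (hle s)) (by linarith)
      (by simp only [Data.Fits, rates]; linarith)
      (fun s => (hnear s).near₁.trans (by
        rw [add_zero]
        exact mul_le_mul_of_nonneg_left (hle s) (by simp only [rates]; linarith))) (by linarith)
      (by simp only [Data.Fits, rates]; linarith) (by simp) 0
    rw [weight_zero, mul_one, max_eq_right (div_nonneg (by linarith) (by linarith))] at this
    exact this
  · have := Data.norm_le (b := .future) (g := lam / 2) (g' := lam / 2) (M := 1) (d := 0)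
      (B := μ) hκ hκ
      (fun s => HasDerivAt.snd₂' (hv.deriv s))
      (fun s => by rw [one_mul]; exact ((norm_snd_le _).trans (norm_snd_le _)).trans (hle s))
      (by linarith)
      (by simp only [Data.Fits, rates]; linarith)
      (fun s => (hnear s).near₃.trans (by
        rw [add_zero]
        exact mul_le_mul_of_nonneg_left (hle s) hμ)) (by linarith)
      (by simp only [Data.Fits, rates]; linarith) (by simp) 0
    rw [weight_zero, mul_one, max_eq_right (div_nonneg hμ (by linarith))] at this
    refine this.trans (le_of_eq ?_)
    field_simp

theorem unstableVec_spec (h : SaddleField f f' Λ lam μ ε) (u : U) :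
    (h.unstableVec u).1 = 1 ∧ ‖h.unstableVec u‖ ≤ 1 ∧
    |(h.unstableVec u).2.1| ≤ (Λ - lam) / (Λ + lam / 2) ∧
    ‖(h.unstableVec u).2.2‖ ≤ 2 * μ / lam := by
  have hl := h.lam_pos
  have hΛ := h.lam_le
  have hμ := h.μ_nonneg
  obtain ⟨hv, h1⟩ := (h.exists_unstable u).choose_spec
  set v := (h.exists_unstable u).choose with hvdef
  have hle := h.unstable_le hv
  rw [h1, abs_one] at hle
  simp only [one_mul] at hle
  have hκ : lam / 2 ≤ 2 * Λ := by linarith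
  have hnear := fun s => h.near_deriv (h.orbit_spec u s).2 (v s)
  refine ⟨h1, by have := hle 0; rw [weight_zero] at this; exact this, ?_, ?_⟩
  · have := Data.norm_le (b := .past) (g := Λ + lam / 2) (g' := Λ + lam / 2) (M := 1) (d := 0)
      (B := Λ - lam) hκ hκ
      (fun s => HasDerivAt.snd₁' (hv.deriv s))
      (fun s => by rw [one_mul]; exact ((norm_fst_le _).trans (norm_snd_le _)).trans (hle s))
      (by linarith)
      (by simp only [Data.Fits, rates]; linarith)
      (fun s => (hnear s).near₂.trans (by
        rw [add_zero]
        exact mul_le_mul_of_nonneg_left (hle s) (by simp only [rates]; linarith))) (by linarith)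
      (by simp only [Data.Fits, rates]; linarith) (by simp) 0
    rw [weight_zero, mul_one, max_eq_right (div_nonneg (by linarith) (by linarith))] at this
    exact this
  · have := Data.norm_le (b := .past) (g := lam / 2) (g' := lam / 2) (M := 1) (d := 0)
      (B := μ) hκ hκ
      (fun s => HasDerivAt.snd₂' (hv.deriv s))
      (fun s => by rw [one_mul]; exact ((norm_snd_le _).trans (norm_snd_le _)).trans (hle s))
      (by linarith)
      (by simp only [Data.Fits, rates]; linarith)
      (fun s => (hnear s).near₃.trans (by
        rw [add_zero]
        exact mul_le_mul_of_nonneg_left (hle s) hμ)) (by linarith)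
      (by simp only [Data.Fits, rates]; linarith) (by simp) 0
    rw [weight_zero, mul_one, max_eq_right (div_nonneg hμ (by linarith))] at this
    refine this.trans (le_of_eq ?_)
    field_simp

/-- Uniform transversality of the stable direction, the unstable direction and the graph. -/
theorem exists_splitting_bound (h : SaddleField f f' Λ lam μ ε) :
    ∃ B : ℝ, 0 ≤ B ∧ ∀ (u : U) (α β : ℝ) (w : U),
      |α| ≤ B * ‖α • h.stableVec u + β • h.unstableVec u + h.graphDeriv u w‖ ∧
      |β| ≤ B * ‖α • h.stableVec u + β • h.unstableVec u + h.graphDeriv u w‖ ∧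
      ‖w‖ ≤ B * ‖α • h.stableVec u + β • h.unstableVec u + h.graphDeriv u w‖ := by
  have hl := h.lam_pos
  have hΛ := h.lam_le
  have hμ := h.μ_nonneg
  have hΛ0 : 0 < Λ := by linarith
  set θ := (Λ - lam) / (Λ + lam / 2) with hθ
  set δ := 2 * μ / lam with hδ
  have hθ0 : 0 ≤ θ := div_nonneg (by linarith) (by linarith)
  have hδ0 : 0 ≤ δ := div_nonneg (by linarith) (by linarith)
  set k := lam / (2 * Λ) with hk
  have hk0 : 0 < k := by positivity
  have hk1 : k ≤ 1 / 2 := by rw [hk, div_le_div_iff₀ (by linarith) (by norm_num)]; linarith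
  have hgap : θ + 2 * δ ≤ 1 - k := by
    have h1 : θ ≤ 1 - lam / Λ := by
      rw [hθ, div_le_iff₀ (by linarith)]
      have : (1 - lam / Λ) * (Λ + lam / 2) = Λ - lam + lam / 2 * (1 - lam / Λ) := by
        field_simp
      rw [this]
      have : lam / Λ ≤ 1 := (div_le_one hΛ0).2 hΛ
      nlinarith
    have h2 : 2 * δ ≤ lam / (2 * Λ) := by
      rw [hδ, mul_div_assoc', div_le_div_iff₀ hl (by linarith)]
      nlinarith [h.gap]
    have h3 : lam / Λ = 2 * k := by rw [hk]; field_simp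
    rw [h3] at h1
    linarith
  refine ⟨2 / k + 1, by positivity, fun u α β w => ?_⟩
  obtain ⟨s1, s2, s3, s4⟩ := h.stableVec_spec u
  obtain ⟨u1, u2, u3, u4⟩ := h.unstableVec_spec u
  set S := α • h.stableVec u + β • h.unstableVec u + h.graphDeriv u w with hS
  set m := max |α| |β| with hm
  have hm0 : 0 ≤ m := (abs_nonneg _).trans (le_max_left _ _)
  have hα : |α| ≤ m := le_max_left _ _
  have hβ : |β| ≤ m := le_max_right _ _
  have hD := h.norm_graphDeriv_le u w
  have hw : ‖w‖ ≤ ‖S‖ + 2 * δ * m := by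
    have e : w = S.2.2 - α • (h.stableVec u).2.2 - β • (h.unstableVec u).2.2 := by
      have := h.graphDeriv_base u w
      simp only [hS, Prod.snd_add, Prod.smul_snd, this]
      abel
    have n1 : ‖S.2.2‖ ≤ ‖S‖ := (norm_snd_le _).trans (norm_snd_le S)
    have n2 : ‖α • (h.stableVec u).2.2‖ ≤ m * δ := by
      rw [norm_smul]; exact mul_le_mul hα s4 (norm_nonneg _) hm0
    have n3 : ‖β • (h.unstableVec u).2.2‖ ≤ m * δ := by
      rw [norm_smul]; exact mul_le_mul hβ u4 (norm_nonneg _) hm0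
    calc ‖w‖ = ‖S.2.2 - α • (h.stableVec u).2.2 - β • (h.unstableVec u).2.2‖ := by rw [← e]
      _ ≤ ‖S.2.2‖ + ‖α • (h.stableVec u).2.2‖ + ‖β • (h.unstableVec u).2.2‖ :=
        (norm_sub_le _ _).trans (add_le_add (norm_sub_le _ _) le_rfl)
      _ ≤ _ := by linarith
  have hβ' : |β| ≤ ‖S‖ + m * θ + ‖w‖ := by
    have e : β = S.1 - α * (h.stableVec u).1 - (h.graphDeriv u w).1 := by
      simp only [hS, Prod.fst_add, Prod.smul_fst, smul_eq_mul, u1]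
      ring
    have n1 : |S.1| ≤ ‖S‖ := norm_fst_le S
    have n2 : |α * (h.stableVec u).1| ≤ m * θ := by
      rw [abs_mul]; exact mul_le_mul hα s3 (abs_nonneg _) hm0
    have n3 : |(h.graphDeriv u w).1| ≤ ‖w‖ := (norm_fst_le (h.graphDeriv u w)).trans hD
    calc |β| = |S.1 - α * (h.stableVec u).1 - (h.graphDeriv u w).1| := by rw [← e]
      _ ≤ |S.1| + |α * (h.stableVec u).1| + |(h.graphDeriv u w).1| :=
        (abs_sub _ _).trans (add_le_add (abs_sub _ _) le_rfl)
      _ ≤ _ := by linarith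
  have hα' : |α| ≤ ‖S‖ + m * θ + ‖w‖ := by
    have e : α = S.2.1 - β * (h.unstableVec u).2.1 - (h.graphDeriv u w).2.1 := by
      simp only [hS, Prod.fst_add, Prod.snd_add, Prod.smul_fst, Prod.smul_snd, smul_eq_mul, s1]
      ring
    have n1 : |S.2.1| ≤ ‖S‖ := (norm_fst_le _).trans (norm_snd_le S)
    have n2 : |β * (h.unstableVec u).2.1| ≤ m * θ := by
      rw [abs_mul]; exact mul_le_mul hβ u3 (abs_nonneg _) hm0
    have n3 : |(h.graphDeriv u w).2.1| ≤ ‖w‖ :=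
      ((norm_fst_le _).trans (norm_snd_le (h.graphDeriv u w))).trans hD
    calc |α| = |S.2.1 - β * (h.unstableVec u).2.1 - (h.graphDeriv u w).2.1| := by rw [← e]
      _ ≤ |S.2.1| + |β * (h.unstableVec u).2.1| + |(h.graphDeriv u w).2.1| :=
        (abs_sub _ _).trans (add_le_add (abs_sub _ _) le_rfl)
      _ ≤ _ := by linarith
  have hm' : m ≤ ‖S‖ + m * θ + ‖w‖ := max_le hα' hβ'
  have hmS : m ≤ 2 / k * ‖S‖ := by
    have h1 : m * k ≤ 2 * ‖S‖ := by nlinarith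
    rw [div_mul_eq_mul_div, le_div_iff₀ hk0]
    exact h1
  have hn := norm_nonneg S
  refine ⟨by nlinarith, by nlinarith, ?_⟩
  nlinarith

theorem exists_splitting [FiniteDimensional ℝ U] (h : SaddleField f f' Λ lam μ ε) (u : U)
    (z : ℝ × ℝ × U) : ∃ (α β : ℝ) (w : U),
      z = α • h.stableVec u + β • h.unstableVec u + h.graphDeriv u w := by
  obtain ⟨B, hB0, hB⟩ := h.exists_splitting_bound
  let T : (ℝ × ℝ × U) →ₗ[ℝ] ℝ × ℝ × U :=
    { toFun := fun q => q.1 • h.stableVec u + q.2.1 • h.unstableVec u + h.graphDeriv u q.2.2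
      map_add' := fun p q => by
        simp only [Prod.fst_add, Prod.snd_add, add_smul, map_add]
        abel
      map_smul' := fun c q => by
        simp only [Prod.smul_fst, Prod.smul_snd, smul_eq_mul, mul_smul, map_smul, smul_add,
          RingHom.id_apply] }
  have hinj : Function.Injective T := by
    refine (injective_iff_map_eq_zero T).2 fun q hq => ?_
    obtain ⟨h1, h2, h3⟩ := hB u q.1 q.2.1 q.2.2
    change q.1 • h.stableVec u + q.2.1 • h.unstableVec u + h.graphDeriv u q.2.2 = 0 at hq
    rw [hq, norm_zero, mul_zero] at h1 h2 h3
    have e1 : q.1 = 0 := abs_nonpos_iff.1 h1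
    have e2 : q.2.1 = 0 := abs_nonpos_iff.1 h2
    have e3 : q.2.2 = 0 := norm_le_zero_iff.1 h3
    ext <;> simp [e1, e2, e3]
  obtain ⟨q, hq⟩ := LinearMap.injective_iff_surjective.1 hinj z
  exact ⟨q.1, q.2.1, q.2.2, hq.symm⟩

theorem Segment.stable (h : SaddleField f f' Λ lam μ ε) (hs : Segment f f' L γ v) (hL : 0 ≤ L)
    (h0 : γ 0 = h.graph u) {c : ℝ} (hv : v 0 = c • h.stableVec u) :
    (∃ c' : ℝ, v L = c' • h.stableVec (γ L).2.2) ∧ ‖v L‖ ≤ Real.exp (-(lam / 2) * L) * ‖v 0‖ := by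
  obtain ⟨hV, hV1⟩ := (h.exists_stable u).choose_spec
  set V := (h.exists_stable u).choose with hVdef
  have hcV := hV.smul c
  have hvV := hs.eq_variation h h0 hcV.deriv hv L (right_mem_Icc.2 hL)
  have hγ := hs.eq_orbit h h0 L (right_mem_Icc.2 hL)
  have hsh := Variation.shift_orbit h hcV L
  constructor
  · have := h.stable_zero hsh
    rw [← hγ] at this
    simp only [add_zero] at this
    exact ⟨_, hvV.trans this⟩
  · have h1 := h.stable_le hcV L
    have hv' : v 0 = c • V 0 := hv
    change ‖c • V L‖ ≤ |(c • V 0).2.1| * _ at h1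
    have hvV' : v L = c • V L := hvV
    rw [← hv'] at h1
    have hκ : -(2 * Λ) ≤ -(lam / 2) := by linarith [h.lam_pos, h.lam_le]
    rw [← hvV', weight_of_nonneg hκ hL] at h1
    have h2 : |(v 0).2.1| ≤ ‖v 0‖ := (norm_fst_le _).trans (norm_snd_le (v 0))
    rw [mul_comm]
    exact h1.trans (mul_le_mul_of_nonneg_right h2 (Real.exp_pos _).le)

theorem Segment.unstable (h : SaddleField f f' Λ lam μ ε) (hs : Segment f f' L γ v) (hL : 0 ≤ L)
    (h0 : γ 0 = h.graph u) {c : ℝ} (hv : v 0 = c • h.unstableVec u) :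
    (∃ c' : ℝ, v L = c' • h.unstableVec (γ L).2.2) ∧
      ‖v 0‖ ≤ Real.exp (-(lam / 2) * L) * ‖v L‖ := by
  obtain ⟨hV, hV1⟩ := (h.exists_unstable u).choose_spec
  set V := (h.exists_unstable u).choose with hVdef
  have hcV := hV.smul c
  have hvV := hs.eq_variation h h0 hcV.deriv hv L (right_mem_Icc.2 hL)
  have hγ := hs.eq_orbit h h0 L (right_mem_Icc.2 hL)
  have hsh := Variation.shift_orbit h hcV L
  constructor
  · have := h.unstable_zero hsh
    rw [← hγ] at this
    simp only [add_zero] at this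
    exact ⟨_, hvV.trans this⟩
  · have h1 := h.unstable_le hsh (-L)
    simp only [add_zero, add_neg_cancel] at h1
    have hv' : v 0 = c • V 0 := hv
    have hvV' : v L = c • V L := hvV
    change ‖c • V 0‖ ≤ |(c • V L).1| * _ at h1
    have hκ : lam / 2 ≤ 2 * Λ := by linarith [h.lam_pos, h.lam_le]
    rw [← hv', ← hvV', weight_of_nonpos hκ (by linarith)] at h1
    have h2 : |(v L).1| ≤ ‖v L‖ := norm_fst_le (v L)
    rw [mul_comm, neg_mul, ← mul_neg]
    exact h1.trans (mul_le_mul_of_nonneg_right h2 (Real.exp_pos _).le)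

theorem Segment.tangent (h : SaddleField f f' Λ lam μ ε) (hs : Segment f f' L γ v) (hL : 0 ≤ L)
    (h0 : γ 0 = h.graph u) {w : U} (hv : v 0 = h.graphDeriv u w) :
    (∃ w' : U, v L = h.graphDeriv (γ L).2.2 w') ∧ ‖v L‖ ≤ Real.exp (lam / 4 * L) * ‖v 0‖ ∧
      ‖v 0‖ ≤ Real.exp (lam / 4 * L) * ‖v L‖ := by
  have hl := h.lam_pos
  obtain ⟨V, hV, hV0, hVb⟩ := h.graphDeriv_spec u w
  have hvV := hs.eq_variation h h0 hV.deriv (hv.trans hV0.symm)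
  have hvL := hvV L (right_mem_Icc.2 hL)
  have hv0 := hvV 0 (left_mem_Icc.2 hL)
  have hγ := hs.eq_orbit h h0 L (right_mem_Icc.2 hL)
  have hsh := Variation.shift_orbit h hV L
  have n : ∀ z : ℝ × ℝ × U, ‖z.2.2‖ ≤ ‖z‖ := fun z => (norm_snd_le _).trans (norm_snd_le z)
  refine ⟨?_, ?_, ?_⟩
  · have := h.tangent_zero hsh
    rw [← hγ] at this
    simp only [add_zero] at this
    exact ⟨_, hvL.trans this⟩
  · have h1 := h.tangent_le hV L
    rw [weight_of_nonneg (by linarith) hL, ← hvL, ← hv0] at h1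
    rw [mul_comm]
    exact h1.trans (mul_le_mul_of_nonneg_right (n _) (Real.exp_pos _).le)
  · have h1 := h.tangent_le hsh (-L)
    simp only [add_zero, add_neg_cancel] at h1
    rw [weight_of_nonpos (by linarith) (by linarith), ← hvL, ← hv0, mul_neg, neg_mul, neg_neg] at h1
    rw [mul_comm]
    exact h1.trans (mul_le_mul_of_nonneg_right (n _) (Real.exp_pos _).le)

end SaddleField

end LyapunovPerron

namespace LyapunovPerron

namespace SaddleField

/-! ### Normal hyperbolicity in a chart -/

section Chart

variable {P E : Type*} [NormedAddCommGroup P] [NormedSpace ℝ P] [NormedAddCommGroup E]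
  [NormedSpace ℝ E] {F : P → P} {f : E → E} {Θ : P → E} {O : Set P}

/-- If the chart `Θ` conjugates the vector field `F` to `f`, then its derivative conjugates the
linearised equations, up to the second derivative of the chart. -/
theorem fderiv_conj {f' : E →L[ℝ] E} {p : P} (hO : IsOpen O) (hΘ : ContDiffOn ℝ 2 Θ O)
    (hF : DifferentiableAt ℝ F p) (hp : p ∈ O) (hf : HasFDerivAt f f' (Θ p))
    (hconj : ∀ p ∈ O, f (Θ p) = fderiv ℝ Θ p (F p)) (v : P) :
    f' (fderiv ℝ Θ p v) =
      fderiv ℝ (fderiv ℝ Θ) p v (F p) + fderiv ℝ Θ p (fderiv ℝ F p v) := by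
  have hΘp : ContDiffAt ℝ 2 Θ p := hΘ.contDiffAt (hO.mem_nhds hp)
  have h1 : HasFDerivAt Θ (fderiv ℝ Θ p) p := (hΘp.differentiableAt (by norm_num)).hasFDerivAt
  have h2 : HasFDerivAt (fderiv ℝ Θ) (fderiv ℝ (fderiv ℝ Θ) p) p :=
    ((hΘp.fderiv_right (m := 1) (by norm_num)).differentiableAt (by norm_num)).hasFDerivAt
  have h3 := (hf.comp p h1).congr_of_eventuallyEq
    (f₁ := fun p => fderiv ℝ Θ p (F p)) (by
      filter_upwards [hO.mem_nhds hp] with q hq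
      exact (hconj q hq).symm)
  have h4 := h2.clm_apply hF.hasFDerivAt
  have := congrArg (fun A => A v) (h3.unique h4)
  simp only [ContinuousLinearMap.comp_apply, add_apply,
    ContinuousLinearMap.flip_apply] at this
  rw [this, add_comm]

end Chart

variable {U : Type*} [NormedAddCommGroup U] [NormedSpace ℝ U]
  {P : Type*} [NormedAddCommGroup P] [NormedSpace ℝ P]
  {f : ℝ × ℝ × U → ℝ × ℝ × U} {f' : ℝ × ℝ × U → ℝ × ℝ × U →L[ℝ] ℝ × ℝ × U}
  {Λ lam μ ε : ℝ} {F : P → P} {Θ : P → ℝ × ℝ × U} {O : Set P}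

theorem segment_of_chart (h : SaddleField f f' Λ lam μ ε) (hO : IsOpen O)
    (hΘ : ContDiffOn ℝ 2 Θ O) (hF : ∀ p ∈ O, DifferentiableAt ℝ F p) (hbox : ∀ p ∈ O, Θ p ∈ box U)
    (hconj : ∀ p ∈ O, f (Θ p) = fderiv ℝ Θ p (F p)) {L : ℝ} {γ v : ℝ → P}
    (hγ : ∀ s ∈ Icc 0 L, γ s ∈ O ∧ HasDerivWithinAt γ (F (γ s)) (Icc 0 L) s ∧
      HasDerivWithinAt v (fderiv ℝ F (γ s) (v s)) (Icc 0 L) s) :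
    Segment f f' L (fun s => Θ (γ s)) fun s => fderiv ℝ Θ (γ s) (v s) where
  mem s hs := hbox _ (hγ s hs).1
  curve s hs := by
    obtain ⟨h1, h2, -⟩ := hγ s hs
    rw [hconj _ h1]
    exact (((hΘ.contDiffAt (hO.mem_nhds h1)).differentiableAt
      (by norm_num)).hasFDerivAt).comp_hasDerivWithinAt s h2
  vector s hs := by
    obtain ⟨h1, h2, h3⟩ := hγ s hs
    have hΘp : ContDiffAt ℝ 2 Θ (γ s) := hΘ.contDiffAt (hO.mem_nhds h1)
    have h4 : HasFDerivAt (fderiv ℝ Θ) (fderiv ℝ (fderiv ℝ Θ) (γ s)) (γ s) :=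
      ((hΘp.fderiv_right (m := 1) (by norm_num)).differentiableAt (by norm_num)).hasFDerivAt
    have h5 := (h4.comp_hasDerivWithinAt s h2).clm_apply h3
    rw [fderiv_conj hO hΘ (hF _ h1) h1 (h.deriv _ (hbox _ h1)) hconj,
      (hΘp.isSymmSndFDerivAt (by simp)) (v s) (F (γ s))]
    exact h5

open SingleResonance

variable [CompleteSpace U] [FiniteDimensional ℝ U]

/-- The graph is normally hyperbolic, also in the original coordinates. -/
theorem normallyHyperbolic_of_chart {F : Phase → Phase} {Θ : Phase → ℝ × ℝ × U} {O M : Set Phase}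
    {T : Phase → Submodule ℝ Phase} (h : SaddleField f f' Λ lam μ ε) (hO : IsOpen O)
    (hΘ : ContDiffOn ℝ 2 Θ O) (hF : ∀ p ∈ O, DifferentiableAt ℝ F p) (hbox : ∀ p ∈ O, Θ p ∈ box U)
    (hconj : ∀ p ∈ O, f (Θ p) = fderiv ℝ Θ p (F p)) {Φ' : Phase → ℝ × ℝ × U →L[ℝ] Phase}
    (hl : ∀ p ∈ M, ∀ v, Φ' p (fderiv ℝ Θ p v) = v) (hr : ∀ p ∈ M, ∀ z, fderiv ℝ Θ p (Φ' p z) = z)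
    {B : ℝ} (hB : ∀ p ∈ M, ∀ z, ‖Φ' p z‖ ≤ B * ‖z‖) (hB' : ∀ p ∈ M, ∀ v, ‖fderiv ℝ Θ p v‖ ≤ B * ‖v‖)
    (hM : M ⊆ O) (hgraph : ∀ p ∈ M, Θ p = h.graph (Θ p).2.2)
    (hT : ∀ p ∈ M, ∀ w, w ∈ T p ↔ ∃ z, Φ' p (h.graphDeriv (Θ p).2.2 z) = w) :
    NormallyHyperbolic F M T := by
  have hlam := h.lam_pos
  obtain ⟨b, hb0, hb⟩ := h.exists_splitting_bound
  rcases M.eq_empty_or_nonempty with rfl | ⟨p₀, hp₀⟩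
  · refine ⟨fun _ => ⊥, fun _ => ⊥, 0, lam / 4, lam / 2, by linarith, by linarith, by simp, ?_⟩
    intro L hL γ v hγ
    exact absurd (hγ 0 (left_mem_Icc.2 hL)).1 (by simp)
  have hB0 : 0 ≤ B := by
    by_contra hneg
    have h1 := hB p₀ hp₀ (1, 0, 0)
    have h2 : (0 : ℝ) < ‖((1, 0, 0) : ℝ × ℝ × U)‖ := norm_pos_iff.2 (by simp)
    nlinarith [norm_nonneg (Φ' p₀ (1, 0, 0))]
  have hBB : B * B ≤ B * B * (b + 1) := le_mul_of_one_le_right (mul_nonneg hB0 hB0) (by linarith)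
  have back : ∀ {c : ℝ} {p q : Phase}, p ∈ M → q ∈ M → 0 ≤ c → ∀ v w : Phase,
      ‖fderiv ℝ Θ p v‖ ≤ c * ‖fderiv ℝ Θ q w‖ → ‖v‖ ≤ B * B * (b + 1) * c * ‖w‖ := by
    intro c p q hp hq hc v w hvw
    calc ‖v‖ = ‖Φ' p (fderiv ℝ Θ p v)‖ := by rw [hl p hp]
      _ ≤ B * ‖fderiv ℝ Θ p v‖ := hB p hp _
      _ ≤ B * (c * (B * ‖w‖)) := by
        refine mul_le_mul_of_nonneg_left (hvw.trans ?_) hB0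
        exact mul_le_mul_of_nonneg_left (hB' q hq w) hc
      _ = B * B * c * ‖w‖ := by ring
      _ ≤ _ := by gcongr
  refine ⟨fun p => Submodule.span ℝ {Φ' p (h.stableVec (Θ p).2.2)},
    fun p => Submodule.span ℝ {Φ' p (h.unstableVec (Θ p).2.2)}, B * B * (b + 1), lam / 4, lam / 2,
    by linarith, by linarith, ?_, ?_⟩
  · intro p hp
    obtain ⟨s1, s2, -⟩ := h.stableVec_spec (Θ p).2.2
    obtain ⟨u1, u2, -⟩ := h.unstableVec_spec (Θ p).2.2
    refine ⟨finrank_span_singleton fun h0 => ?_, finrank_span_singleton fun h0 => ?_, ?_, ?_⟩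
    · have := hr p hp (h.stableVec (Θ p).2.2)
      rw [h0, map_zero] at this
      rw [← this] at s1
      simp at s1
    · have := hr p hp (h.unstableVec (Θ p).2.2)
      rw [h0, map_zero] at this
      rw [← this] at u1
      simp at u1
    · intro v
      obtain ⟨α, β, w, hw⟩ := h.exists_splitting (Θ p).2.2 (fderiv ℝ Θ p v)
      refine ⟨α • Φ' p (h.stableVec (Θ p).2.2),
        Submodule.smul_mem _ _ (Submodule.mem_span_singleton_self _),
        β • Φ' p (h.unstableVec (Θ p).2.2),
        Submodule.smul_mem _ _ (Submodule.mem_span_singleton_self _),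
        Φ' p (h.graphDeriv (Θ p).2.2 w), (hT p hp _).2 ⟨w, rfl⟩, ?_⟩
      rw [← map_smul, ← map_smul, ← map_add, ← map_add, ← hw, hl p hp]
    · intro e he u hu w hw
      obtain ⟨α, rfl⟩ := Submodule.mem_span_singleton.1 he
      obtain ⟨β, rfl⟩ := Submodule.mem_span_singleton.1 hu
      obtain ⟨z, rfl⟩ := (hT p hp _).1 hw
      obtain ⟨h1, h2, h3⟩ := hb (Θ p).2.2 α β z
      rw [← map_smul, ← map_smul, ← map_add, ← map_add]
      set S := α • h.stableVec (Θ p).2.2 + β • h.unstableVec (Θ p).2.2 +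
        h.graphDeriv (Θ p).2.2 z with hS
      have hSn : ‖S‖ ≤ B * ‖Φ' p S‖ := by
        conv_lhs => rw [← hr p hp S]
        exact hB' p hp _
      have key : ∀ X : ℝ × ℝ × U, ‖X‖ ≤ b * ‖S‖ → ‖Φ' p X‖ ≤ B * B * (b + 1) * ‖Φ' p S‖ := by
        intro X hX
        have hn := norm_nonneg (Φ' p S)
        calc ‖Φ' p X‖ ≤ B * ‖X‖ := hB p hp X
          _ ≤ B * (b * (B * ‖Φ' p S‖)) :=
            mul_le_mul_of_nonneg_left (hX.trans (mul_le_mul_of_nonneg_left hSn hb0)) hB0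
          _ = B * B * b * ‖Φ' p S‖ := by ring
          _ ≤ _ := by
            refine mul_le_mul_of_nonneg_right ?_ hn
            exact mul_le_mul_of_nonneg_left (by linarith) (mul_nonneg hB0 hB0)
      refine ⟨key _ ?_, key _ ?_, key _ ?_⟩
      · rw [norm_smul]
        exact (mul_le_of_le_one_right (norm_nonneg _) s2).trans h1
      · rw [norm_smul]
        exact (mul_le_of_le_one_right (norm_nonneg _) u2).trans h2
      · exact (h.norm_graphDeriv_le _ z).trans h3
  · intro L hL γ v hγ
    have hγO := fun s hs => (⟨hM (hγ s hs).1, (hγ s hs).2⟩ : γ s ∈ O ∧ _)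
    have seg := h.segment_of_chart hO hΘ hF hbox hconj hγO
    have m0 := (hγ 0 (left_mem_Icc.2 hL)).1
    have mL := (hγ L (right_mem_Icc.2 hL)).1
    have h0 := hgraph _ m0
    refine ⟨fun hv => ?_, fun hv => ?_, fun hv => ?_⟩
    · obtain ⟨c, hc⟩ := Submodule.mem_span_singleton.1 hv
      obtain ⟨⟨c', hc'⟩, hn⟩ := seg.stable h hL h0 (c := c) (by
        rw [← hc, map_smul, hr _ m0])
      refine ⟨Submodule.mem_span_singleton.2 ⟨c', ?_⟩, back mL m0 (Real.exp_pos _).le _ _ hn⟩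
      rw [← map_smul, ← hc', hl _ mL]
    · obtain ⟨c, hc⟩ := Submodule.mem_span_singleton.1 hv
      obtain ⟨⟨c', hc'⟩, hn⟩ := seg.unstable h hL h0 (c := c) (by
        rw [← hc, map_smul, hr _ m0])
      refine ⟨Submodule.mem_span_singleton.2 ⟨c', ?_⟩, back m0 mL (Real.exp_pos _).le _ _ hn⟩
      rw [← map_smul, ← hc', hl _ mL]
    · obtain ⟨z, hz⟩ := (hT _ m0 _).1 hv
      obtain ⟨⟨z', hz'⟩, hn, hn'⟩ := seg.tangent h hL h0 (w := z) (by rw [← hz, hr _ m0])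
      refine ⟨(hT _ mL _).2 ⟨z', ?_⟩, back mL m0 (Real.exp_pos _).le _ _ hn,
        back m0 mL (Real.exp_pos _).le _ _ hn'⟩
      rw [← hz', hl _ mL]

end SaddleField

end LyapunovPerron

namespace LyapunovPerron

/-! ### Orders of magnitude -/

/-- `x` is of size at most `η ^ n`. For `η ≤ 1 / 2` such bounds can be multiplied, and can be added
at the expense of one power of `η`. -/
def SizeLE {E : Type*} [Norm E] (η : ℝ) (n : ℤ) (x : E) : Prop := ‖x‖ ≤ η ^ n

namespace SizeLE

variable {E F : Type*} [NormedAddCommGroup E] [NormedSpace ℝ E] [NormedAddCommGroup F]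
  [NormedSpace ℝ F] {η : ℝ} {n m k : ℤ}

theorem mono (h0 : 0 < η) (h1 : η ≤ 1 / 2) {x : E} (h : SizeLE η n x) (hk : k ≤ n) : SizeLE η k x :=
  h.trans (zpow_le_zpow_right_of_le_one₀ h0 (by linarith) hk)

theorem two_mul_zpow_le (h0 : 0 < η) (h1 : η ≤ 1 / 2) (hn : k + 1 ≤ n) : 2 * η ^ n ≤ η ^ k := by
  have h2 : η ^ n ≤ η ^ (k + 1) := zpow_le_zpow_right_of_le_one₀ h0 (by linarith) hn
  rw [zpow_add_one₀ h0.ne'] at h2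
  have h3 := zpow_pos h0 k
  nlinarith

theorem add (h0 : 0 < η) (h1 : η ≤ 1 / 2) {x y : E} (hx : SizeLE η n x) (hy : SizeLE η m y)
    (hn : k + 1 ≤ n) (hm : k + 1 ≤ m) : SizeLE η k (x + y) := by
  have h2 := two_mul_zpow_le h0 h1 hn
  have h3 := two_mul_zpow_le h0 h1 hm
  have h4 := norm_add_le x y
  unfold SizeLE at *
  linarith

theorem neg {x : E} (hx : SizeLE η n x) : SizeLE η n (-x) := by
  unfold SizeLE at *; rwa [norm_neg]

theorem sub (h0 : 0 < η) (h1 : η ≤ 1 / 2) {x y : E} (hx : SizeLE η n x) (hy : SizeLE η m y)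
    (hn : k + 1 ≤ n) (hm : k + 1 ≤ m) : SizeLE η k (x - y) := by
  rw [sub_eq_add_neg]; exact hx.add h0 h1 hy.neg hn hm

theorem mul (h0 : 0 < η) (h1 : η ≤ 1 / 2) {x y : ℝ} (hx : SizeLE η n x) (hy : SizeLE η m y)
    (hk : k ≤ n + m) : SizeLE η k (x * y) := by
  refine SizeLE.mono h0 h1 (n := n + m) ?_ hk
  unfold SizeLE at *
  rw [norm_mul, zpow_add₀ h0.ne']
  gcongr

theorem apply (h0 : 0 < η) (h1 : η ≤ 1 / 2) {A : E →L[ℝ] F} {y : E} (hx : SizeLE η n A)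
    (hy : SizeLE η m y) (hk : k ≤ n + m) : SizeLE η k (A y) := by
  refine SizeLE.mono h0 h1 (n := n + m) ?_ hk
  unfold SizeLE at *
  rw [zpow_add₀ h0.ne']
  exact (A.le_opNorm y).trans (by gcongr)

theorem div (h0 : 0 < η) (h1 : η ≤ 1 / 2) {x y : ℝ} (hx : SizeLE η n x) (hy : η ^ m ≤ |y|)
    (hk : k ≤ n - m) : SizeLE η k (x / y) := by
  refine SizeLE.mono h0 h1 (n := n - m) ?_ hk
  unfold SizeLE at *
  rw [norm_div, zpow_sub₀ h0.ne']
  have := zpow_pos h0 m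
  have := zpow_pos h0 n
  exact div_le_div₀ (by positivity) hx (by positivity) hy

theorem prod {x : E} {y : F} (hx : SizeLE η n x) (hy : SizeLE η n y) : SizeLE η n (x, y) :=
  max_le hx hy

end SizeLE

/-! ### Clamping an interval -/

/-- A `C¹` map of the line into a small neighbourhood of an interval, which is the identity on a
smaller neighbourhood of the interval and does not expand. -/
theorem exists_clamp {α β ζ : ℝ} (hαβ : α ≤ β) (hζ : 0 < ζ) :
    ∃ c c' : ℝ → ℝ, (∀ y, HasDerivAt c (c' y) y) ∧ Continuous c' ∧ (∀ y, 0 ≤ c' y ∧ c' y ≤ 1) ∧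
      (∀ y ∈ Ioo (α - ζ) (β + ζ), c y = y) ∧ ∀ y, c y ∈ Icc (α - 2 * ζ) (β + 2 * ζ) := by
  set k : ℝ → ℝ := fun y => max 0 (min 1 (min (2 - (α - y) / ζ) (2 - (y - β) / ζ))) with hk
  have hkc : Continuous k := by fun_prop
  have hk01 : ∀ y, 0 ≤ k y ∧ k y ≤ 1 := fun y =>
    ⟨le_max_left _ _, max_le zero_le_one (min_le_left _ _)⟩
  have hk1 : ∀ y ∈ Icc (α - ζ) (β + ζ), k y = 1 := by
    intro y hy
    have h1 : 1 ≤ 2 - (α - y) / ζ := by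
      have : (α - y) / ζ ≤ 1 := (div_le_one hζ).2 (by linarith [hy.1])
      linarith
    have h2 : 1 ≤ 2 - (y - β) / ζ := by
      have : (y - β) / ζ ≤ 1 := (div_le_one hζ).2 (by linarith [hy.2])
      linarith
    simp only [hk]
    rw [min_eq_left (le_min h1 h2), max_eq_right zero_le_one]
  have hkr : ∀ y, β + 2 * ζ ≤ y → k y = 0 := by
    intro y hy
    refine max_eq_left ((min_le_right _ _).trans ((min_le_right _ _).trans ?_))
    have : 2 ≤ (y - β) / ζ := (le_div_iff₀ hζ).2 (by linarith)
    linarith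
  have hkl : ∀ y, y ≤ α - 2 * ζ → k y = 0 := by
    intro y hy
    refine max_eq_left ((min_le_right _ _).trans ((min_le_left _ _).trans ?_))
    have : 2 ≤ (α - y) / ζ := (le_div_iff₀ hζ).2 (by linarith)
    linarith
  set c : ℝ → ℝ := fun y => α + ∫ s in α..y, k s with hc
  have hd : ∀ y, HasDerivAt c (k y) y := fun y =>
    (intervalIntegral.integral_hasDerivAt_right (hkc.intervalIntegrable _ _)
      (hkc.stronglyMeasurableAtFilter _ _) hkc.continuousAt).const_add α
  have hid : ∀ y ∈ Icc (α - ζ) (β + ζ), c y = y := by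
    intro y hy
    have hα : α ∈ Icc (α - ζ) (β + ζ) := ⟨by linarith, by linarith⟩
    have : ∫ s in α..y, k s = ∫ _ in α..y, (1 : ℝ) :=
      intervalIntegral.integral_congr fun s hs => hk1 s ((convex_Icc _ _).ordConnected.uIcc_subset hα hy hs)
    simp only [hc, this]
    simp
  have hmono : Monotone c := monotone_of_deriv_nonneg (fun y => (hd y).differentiableAt)
    fun y => by rw [(hd y).deriv]; exact (hk01 y).1
  have hanti : Antitone fun y => c y - y := antitone_of_deriv_nonpos
    (fun y => ((hd y).sub (hasDerivAt_id y)).differentiableAt) fun y => by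
      have e : (c - id) = fun y => c y - y := rfl
      rw [← e, ((hd y).sub (hasDerivAt_id y)).deriv]
      linarith [(hk01 y).2]
  have hconst : ∀ u v, u ≤ v → (∀ s ∈ Icc u v, k s = 0) → c v = c u := by
    intro u v huv h0
    have e : c v - c u = ∫ s in u..v, k s := by
      simp only [hc, add_sub_add_left_eq_sub]
      exact intervalIntegral.integral_interval_sub_left (hkc.intervalIntegrable _ _)
        (hkc.intervalIntegrable _ _)
    have : ∫ s in u..v, k s = ∫ _ in u..v, (0 : ℝ) :=
      intervalIntegral.integral_congr fun s hs => h0 s (by rwa [uIcc_of_le huv] at hs)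
    rw [this] at e
    simp only [intervalIntegral.integral_zero] at e
    linarith
  refine ⟨c, k, hd, hkc, hk01, fun y hy => hid y (Ioo_subset_Icc_self hy), fun y => ⟨?_, ?_⟩⟩
  · rcases le_total (α - 2 * ζ) y with h | h
    · rcases le_total y α with h' | h'
      · have := hanti h'
        simp only [hid α ⟨by linarith, by linarith⟩, sub_self] at this
        linarith
      · have := hmono h'
        rw [hid α ⟨by linarith, by linarith⟩] at this
        linarith
    · have := hconst y (α - 2 * ζ) h fun s hs => hkl s hs.2
      have h2 : α - 2 * ζ ≤ α := by linarith
      have := hanti h2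
      simp only [hid α ⟨by linarith, by linarith⟩, sub_self] at this
      linarith
  · rcases le_total y (β + 2 * ζ) with h | h
    · rcases le_total β y with h' | h'
      · have := hanti h'
        simp only [hid β ⟨by linarith, by linarith⟩, sub_self] at this
        linarith
      · have := hmono h'
        rw [hid β ⟨by linarith, by linarith⟩] at this
        linarith
    · have := hconst (β + 2 * ζ) y h fun s hs => hkr s hs.1
      have h2 : β ≤ β + 2 * ζ := by linarith
      have := hanti h2
      simp only [hid β ⟨by linarith, by linarith⟩, sub_self] at this
      linarith

/-! ### Averages -/

/-- The average of `s` over an interval of length `w`: a smoother approximation of `s`. -/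
noncomputable def average (w : ℝ) (s : ℝ → ℝ) (y : ℝ) : ℝ := w⁻¹ * ∫ v in y..y + w, s v

theorem hasDerivAt_average {w : ℝ} {s : ℝ → ℝ} (hs : Continuous s) (y : ℝ) :
    HasDerivAt (average w s) (w⁻¹ * (s (y + w) - s y)) y := by
  have h1 : ∀ y, HasDerivAt (fun y => ∫ v in (0 : ℝ)..y, s v) (s y) y := fun y =>
    intervalIntegral.integral_hasDerivAt_right (hs.intervalIntegrable _ _)
      (hs.stronglyMeasurableAtFilter _ _) hs.continuousAt
  have h2 : average w s = fun y => w⁻¹ * ((∫ v in (0 : ℝ)..y + w, s v) - ∫ v in (0 : ℝ)..y, s v) := by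
    funext y
    rw [intervalIntegral.integral_interval_sub_left (hs.intervalIntegrable _ _)
      (hs.intervalIntegrable _ _)]
    rfl
  rw [h2]
  exact (((h1 (y + w)).comp_add_const y w).sub (h1 y)).const_mul _

theorem abs_average_sub_le {w : ℝ} (hw : 0 < w) {s : ℝ → ℝ} (hs : Continuous s) {y a b : ℝ}
    (h : ∀ v ∈ Icc y (y + w), |s v - a| ≤ b) : |average w s y - a| ≤ b := by
  have e : average w s y - a = w⁻¹ * ∫ v in y..y + w, (s v - a) := by
    rw [intervalIntegral.integral_sub (hs.intervalIntegrable _ _) (by simp)]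
    simp only [intervalIntegral.integral_const, smul_eq_mul, average]
    field_simp
    ring
  have h2 : ‖∫ v in y..y + w, (s v - a)‖ ≤ b * |y + w - y| :=
    intervalIntegral.norm_integral_le_of_norm_le_const fun v hv => by
      rw [uIoc_of_le (by linarith)] at hv
      exact h v (Ioc_subset_Icc_self hv)
  rw [e, abs_mul, abs_of_pos (inv_pos.2 hw)]
  rw [add_sub_cancel_left, abs_of_pos hw, Real.norm_eq_abs] at h2
  calc w⁻¹ * |∫ v in y..y + w, (s v - a)| ≤ w⁻¹ * (b * w) := by gcongr
    _ = b := by field_simp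

end LyapunovPerron

set_option maxSynthPendingDepth 3

namespace SingleResonance

open LyapunovPerron

/-! ### The curve of saddles -/

/-- The variables `(ψˢ, Jˢ, Jᶠ)` of the truncated Hamiltonian. -/
def slow (p : Phase) : ℝ × ℝ × ℝ := (p.1.1, p.2.1.1, p.2.1.2)

/-- A Hamiltonian `g(ψˢ, Jˢ, Jᶠ) + R` with a `C¹` curve of saddles of `g`, measured in powers of `η`:
the squares of the eigenvalues of the saddles are at least `η ^ 102`, the remainder `R`, which may
depend on all variables, is at most `η ^ 1790` in `C²`, and `g` is smooth on a neighbourhood of size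
`η ^ 5` of the curve. Only three derivatives of `g` are bounded. -/
structure SaddleFamily (η : ℝ) (g : ℝ × ℝ × ℝ → ℝ) (R : Phase → ℝ) (Ω : Set (ℝ × ℝ × ℝ))
    (I : Set ℝ) (ψ j : ℝ → ℝ) : Prop where
  pos : 0 < η
  le : η ≤ 1 / 2
  isOpen : IsOpen Ω
  isOpen_I : IsOpen I
  g_smooth : ContDiffOn ℝ 3 g Ω
  R_smooth : ContDiffOn ℝ 2 R (slow ⁻¹' Ω)
  g₁ : ∀ z ∈ Ω, SizeLE η (-1) (fderiv ℝ g z)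
  g₂ : ∀ z ∈ Ω, SizeLE η (-1) (fderiv ℝ (fderiv ℝ g) z)
  g₃ : ∀ z ∈ Ω, SizeLE η (-1) (fderiv ℝ (fderiv ℝ (fderiv ℝ g)) z)
  R₁ : ∀ p, slow p ∈ Ω → SizeLE η 1790 (fderiv ℝ R p)
  R₂ : ∀ p, slow p ∈ Ω → SizeLE η 1790 (fderiv ℝ (fderiv ℝ R) p)
  mem : ∀ y ∈ I, ∀ s J, |J - j y| ≤ η ^ 5 → ((s, J, y) : ℝ × ℝ × ℝ) ∈ Ω
  ψ_smooth : ContDiffOn ℝ 1 ψ I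
  j_smooth : ContDiffOn ℝ 1 j I
  crit₁ : ∀ y ∈ I, fderiv ℝ g (ψ y, j y, y) (1, 0, 0) = 0
  crit₂ : ∀ y ∈ I, fderiv ℝ g (ψ y, j y, y) (0, 1, 0) = 0
  convex : ∀ y ∈ I, η ≤ fderiv ℝ (fderiv ℝ g) (ψ y, j y, y) (0, 1, 0) (0, 1, 0)
  saddle : ∀ y ∈ I, η ^ 102 ≤
    fderiv ℝ (fderiv ℝ g) (ψ y, j y, y) (1, 0, 0) (0, 1, 0) ^ 2
      - fderiv ℝ (fderiv ℝ g) (ψ y, j y, y) (1, 0, 0) (1, 0, 0)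
        * fderiv ℝ (fderiv ℝ g) (ψ y, j y, y) (0, 1, 0) (0, 1, 0)

namespace SaddleFamily

variable {η : ℝ} {g : ℝ × ℝ × ℝ → ℝ} {R : Phase → ℝ} {Ω : Set (ℝ × ℝ × ℝ)} {I : Set ℝ} {ψ j : ℝ → ℝ}
  {y : ℝ}

theorem curve_mem (h : SaddleFamily η g R Ω I ψ j) (hy : y ∈ I) :
    ((ψ y, j y, y) : ℝ × ℝ × ℝ) ∈ Ω :=
  h.mem y hy _ _ (by rw [sub_self, abs_zero]; exact pow_nonneg h.pos.le 5)

theorem hasDerivAt_ψ (h : SaddleFamily η g R Ω I ψ j) (hy : y ∈ I) :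
    HasDerivAt ψ (deriv ψ y) y :=
  ((h.ψ_smooth.contDiffAt (h.isOpen_I.mem_nhds hy)).differentiableAt (by norm_num)).hasDerivAt

theorem hasDerivAt_j (h : SaddleFamily η g R Ω I ψ j) (hy : y ∈ I) :
    HasDerivAt j (deriv j y) y :=
  ((h.j_smooth.contDiffAt (h.isOpen_I.mem_nhds hy)).differentiableAt (by norm_num)).hasDerivAt

theorem hasDerivAt_curve (h : SaddleFamily η g R Ω I ψ j) (hy : y ∈ I) :
    HasDerivAt (fun y => ((ψ y, j y, y) : ℝ × ℝ × ℝ)) (deriv ψ y, deriv j y, 1) y :=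
  (h.hasDerivAt_ψ hy).prodMk ((h.hasDerivAt_j hy).prodMk (hasDerivAt_id y))

theorem contDiffOn_fderiv (h : SaddleFamily η g R Ω I ψ j) : ContDiffOn ℝ 2 (fderiv ℝ g) Ω :=
  h.g_smooth.fderiv_of_isOpen h.isOpen (by norm_num)

theorem contDiffOn_hess (h : SaddleFamily η g R Ω I ψ j) :
    ContDiffOn ℝ 1 (fderiv ℝ (fderiv ℝ g)) Ω :=
  h.contDiffOn_fderiv.fderiv_of_isOpen h.isOpen (by norm_num)

theorem hasFDerivAt_fderiv (h : SaddleFamily η g R Ω I ψ j) {z : ℝ × ℝ × ℝ} (hz : z ∈ Ω) :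
    HasFDerivAt (fderiv ℝ g) (fderiv ℝ (fderiv ℝ g) z) z :=
  ((h.contDiffOn_fderiv.contDiffAt (h.isOpen.mem_nhds hz)).differentiableAt
    (by norm_num)).hasFDerivAt

theorem hasFDerivAt_hess (h : SaddleFamily η g R Ω I ψ j) {z : ℝ × ℝ × ℝ} (hz : z ∈ Ω) :
    HasFDerivAt (fderiv ℝ (fderiv ℝ g)) (fderiv ℝ (fderiv ℝ (fderiv ℝ g)) z) z :=
  ((h.contDiffOn_hess.contDiffAt (h.isOpen.mem_nhds hz)).differentiableAt
    (by norm_num)).hasFDerivAt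

theorem hess_symm (h : SaddleFamily η g R Ω I ψ j) {z : ℝ × ℝ × ℝ} (hz : z ∈ Ω)
    (v w : ℝ × ℝ × ℝ) :
    fderiv ℝ (fderiv ℝ g) z v w = fderiv ℝ (fderiv ℝ g) z w v :=
  ((h.g_smooth.contDiffAt (h.isOpen.mem_nhds hz)).isSymmSndFDerivAt
    (by simp; norm_num)) v w

/-- An entry of the Hessian along the curve. -/
noncomputable def entry (g : ℝ × ℝ × ℝ → ℝ) (ψ j : ℝ → ℝ) (a b : ℝ × ℝ × ℝ) (y : ℝ) : ℝ :=
  fderiv ℝ (fderiv ℝ g) (ψ y, j y, y) a b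

theorem hasDerivAt_entry (h : SaddleFamily η g R Ω I ψ j) (hy : y ∈ I) (a b : ℝ × ℝ × ℝ) :
    HasDerivAt (entry g ψ j a b)
      (fderiv ℝ (fderiv ℝ (fderiv ℝ g)) (ψ y, j y, y) (deriv ψ y, deriv j y, 1) a b) y := by
  have h1 := (h.hasFDerivAt_hess (h.curve_mem hy)).comp_hasDerivAt y (h.hasDerivAt_curve hy)
  have h2 := (h1.clm_apply (hasDerivAt_const y a)).clm_apply (hasDerivAt_const y b)
  simp only [Function.comp_apply, map_zero, add_zero] at h2
  exact h2

theorem contDiffOn_entry (h : SaddleFamily η g R Ω I ψ j) (a b : ℝ × ℝ × ℝ) :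
    ContDiffOn ℝ 1 (entry g ψ j a b) I := by
  have h1 : ContDiffOn ℝ 1 (fun y => ((ψ y, j y, y) : ℝ × ℝ × ℝ)) I :=
    h.ψ_smooth.prodMk (h.j_smooth.prodMk contDiffOn_id)
  exact ((h.contDiffOn_hess.comp h1 fun y hy => h.curve_mem hy).clm_apply
    contDiffOn_const).clm_apply contDiffOn_const

theorem hess_curve (h : SaddleFamily η g R Ω I ψ j) (hy : y ∈ I) (a : ℝ × ℝ × ℝ)
    (ha : ∀ y ∈ I, fderiv ℝ g (ψ y, j y, y) a = 0) :
    fderiv ℝ (fderiv ℝ g) (ψ y, j y, y) (deriv ψ y, deriv j y, 1) a = 0 := by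
  have h1 := (h.hasFDerivAt_fderiv (h.curve_mem hy)).comp_hasDerivAt y (h.hasDerivAt_curve hy)
  have h2 := h1.clm_apply (hasDerivAt_const y a)
  have h3 : HasDerivAt (fun y => (fderiv ℝ g ∘ fun y => ((ψ y, j y, y) : ℝ × ℝ × ℝ)) y a) 0 y :=
    (hasDerivAt_const y (0 : ℝ)).congr_of_eventuallyEq (by
      filter_upwards [h.isOpen_I.mem_nhds hy] with v hv
      exact ha v hv)
  simpa using h2.unique h3

/-- The determinant of the Hessian of the truncated Hamiltonian, up to the sign: the square of the
eigenvalue. -/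
noncomputable def disc (g : ℝ × ℝ × ℝ → ℝ) (ψ j : ℝ → ℝ) (y : ℝ) : ℝ :=
  entry g ψ j (1, 0, 0) (0, 1, 0) y * entry g ψ j (1, 0, 0) (0, 1, 0) y
    - entry g ψ j (1, 0, 0) (1, 0, 0) y * entry g ψ j (0, 1, 0) (0, 1, 0) y

theorem le_disc (h : SaddleFamily η g R Ω I ψ j) (hy : y ∈ I) : η ^ (102 : ℤ) ≤ disc g ψ j y := by
  have := h.saddle y hy
  rw [sq] at this
  exact_mod_cast this

theorem disc_pos (h : SaddleFamily η g R Ω I ψ j) (hy : y ∈ I) : 0 < disc g ψ j y :=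
  (zpow_pos h.pos _).trans_le (h.le_disc hy)

theorem basis_eq (a b c : ℝ) :
    ((a, b, c) : ℝ × ℝ × ℝ) = a • (1, 0, 0) + b • (0, 1, 0) + c • (0, 0, 1) := by
  ext <;> simp

/-- Implicit differentiation of the equations `∂_ψ g = ∂_J g = 0` along the curve, by the rule of
Cramer. -/
theorem deriv_eq (h : SaddleFamily η g R Ω I ψ j) (hy : y ∈ I) :
    deriv ψ y = (entry g ψ j (0, 1, 0) (0, 1, 0) y * entry g ψ j (1, 0, 0) (0, 0, 1) y
      - entry g ψ j (1, 0, 0) (0, 1, 0) y * entry g ψ j (0, 1, 0) (0, 0, 1) y) / disc g ψ j y ∧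
    deriv j y = (entry g ψ j (1, 0, 0) (1, 0, 0) y * entry g ψ j (0, 1, 0) (0, 0, 1) y
      - entry g ψ j (1, 0, 0) (0, 1, 0) y * entry g ψ j (1, 0, 0) (0, 0, 1) y) / disc g ψ j y := by
  have h1 := h.hess_curve hy _ h.crit₁
  have h2 := h.hess_curve hy _ h.crit₂
  have hm := h.curve_mem hy
  rw [h.hess_symm hm, basis_eq (deriv ψ y)] at h1 h2
  simp only [map_add, map_smul, smul_eq_mul, one_mul] at h1 h2
  rw [h.hess_symm hm (0, 1, 0) (1, 0, 0)] at h2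
  have hd := (h.disc_pos hy).ne'
  rw [eq_div_iff hd, eq_div_iff hd]
  simp only [disc, entry]
  generalize fderiv ℝ (fderiv ℝ g) (ψ y, j y, y) (1, 0, 0) (1, 0, 0) = q11 at *
  generalize fderiv ℝ (fderiv ℝ g) (ψ y, j y, y) (1, 0, 0) (0, 1, 0) = q12 at *
  generalize fderiv ℝ (fderiv ℝ g) (ψ y, j y, y) (1, 0, 0) (0, 0, 1) = q13 at *
  generalize fderiv ℝ (fderiv ℝ g) (ψ y, j y, y) (0, 1, 0) (0, 1, 0) = q22 at *
  generalize fderiv ℝ (fderiv ℝ g) (ψ y, j y, y) (0, 1, 0) (0, 0, 1) = q23 at *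
  constructor
  · linear_combination q12 * h2 - q22 * h1
  · linear_combination q12 * h1 - q11 * h2

theorem small_e₁ (η : ℝ) : SizeLE η 0 ((1, 0, 0) : ℝ × ℝ × ℝ) := by simp [SizeLE, Prod.norm_def]
theorem small_e₂ (η : ℝ) : SizeLE η 0 ((0, 1, 0) : ℝ × ℝ × ℝ) := by simp [SizeLE, Prod.norm_def]
theorem small_e₃ (η : ℝ) : SizeLE η 0 ((0, 0, 1) : ℝ × ℝ × ℝ) := by simp [SizeLE, Prod.norm_def]

theorem small_entry (h : SaddleFamily η g R Ω I ψ j) (hy : y ∈ I) {a b : ℝ × ℝ × ℝ}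
    (ha : SizeLE η 0 a) (hb : SizeLE η 0 b) : SizeLE η (-1) (entry g ψ j a b y) :=
  ((h.g₂ _ (h.curve_mem hy)).apply h.pos h.le ha (k := -1) (by norm_num)).apply h.pos h.le hb
    (by norm_num)

theorem small_quotient (h : SaddleFamily η g R Ω I ψ j) (hy : y ∈ I) {a b c d : ℝ}
    (ha : SizeLE η (-1) a) (hb : SizeLE η (-1) b) (hc : SizeLE η (-1) c) (hd : SizeLE η (-1) d) :
    SizeLE η (-105) ((a * b - c * d) / disc g ψ j y) :=
  ((ha.mul h.pos h.le hb (k := -2) (by norm_num)).sub h.pos h.le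
    (hc.mul h.pos h.le hd (k := -2) (by norm_num)) (k := -3) (by norm_num) (by norm_num)).div
    h.pos h.le ((h.le_disc hy).trans (le_abs_self _)) (by norm_num)

theorem small_ψ (h : SaddleFamily η g R Ω I ψ j) (hy : y ∈ I) : SizeLE η (-105) (deriv ψ y) := by
  rw [(h.deriv_eq hy).1]
  exact h.small_quotient hy (h.small_entry hy (small_e₂ η) (small_e₂ η))
    (h.small_entry hy (small_e₁ η) (small_e₃ η)) (h.small_entry hy (small_e₁ η) (small_e₂ η))
    (h.small_entry hy (small_e₂ η) (small_e₃ η))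

theorem small_j (h : SaddleFamily η g R Ω I ψ j) (hy : y ∈ I) : SizeLE η (-105) (deriv j y) := by
  rw [(h.deriv_eq hy).2]
  exact h.small_quotient hy (h.small_entry hy (small_e₁ η) (small_e₁ η))
    (h.small_entry hy (small_e₂ η) (small_e₃ η)) (h.small_entry hy (small_e₁ η) (small_e₂ η))
    (h.small_entry hy (small_e₁ η) (small_e₃ η))

theorem small_curve (h : SaddleFamily η g R Ω I ψ j) (hy : y ∈ I) :
    SizeLE η (-105) ((deriv ψ y, deriv j y, 1) : ℝ × ℝ × ℝ) := by
  refine (h.small_ψ hy).prod ((h.small_j hy).prod ?_)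
  exact SizeLE.mono h.pos h.le (n := 0) (by simp [SizeLE]) (by norm_num)

theorem exists_deriv_entry (h : SaddleFamily η g R Ω I ψ j) (hy : y ∈ I) {a b : ℝ × ℝ × ℝ}
    (ha : SizeLE η 0 a) (hb : SizeLE η 0 b) :
    ∃ q', HasDerivAt (entry g ψ j a b) q' y ∧ SizeLE η (-106) q' :=
  ⟨_, h.hasDerivAt_entry hy a b,
    (((h.g₃ _ (h.curve_mem hy)).apply h.pos h.le (h.small_curve hy) (k := -106)
      (by norm_num)).apply h.pos h.le ha (k := -106) (by norm_num)).apply h.pos h.le hb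
      (by norm_num)⟩

/-- The derivative of a product of two entries of the Hessian. -/
theorem exists_deriv_mul (h : SaddleFamily η g R Ω I ψ j) {p q : ℝ → ℝ} {p' q' : ℝ}
    (hp : HasDerivAt p p' y) (hq : HasDerivAt q q' y) (hp' : SizeLE η (-106) p')
    (hq' : SizeLE η (-106) q') (sp : SizeLE η (-1) (p y)) (sq : SizeLE η (-1) (q y)) :
    ∃ r, HasDerivAt (fun v => p v * q v) r y ∧ SizeLE η (-108) r :=
  ⟨_, hp.mul hq, (hp'.mul h.pos h.le sq (k := -107) (by norm_num)).add h.pos h.le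
    (sp.mul h.pos h.le hq' (k := -107) (by norm_num)) (by norm_num) (by norm_num)⟩

/-- The minors of the Hessian have derivatives of size `η ^ (-109)` along the curve. -/
theorem exists_deriv_minor (h : SaddleFamily η g R Ω I ψ j) (hy : y ∈ I)
    {a b c d a' b' c' d' : ℝ × ℝ × ℝ} (ha : SizeLE η 0 a) (hb : SizeLE η 0 b) (hc : SizeLE η 0 c)
    (hd : SizeLE η 0 d) (ha' : SizeLE η 0 a') (hb' : SizeLE η 0 b') (hc' : SizeLE η 0 c')
    (hd' : SizeLE η 0 d') :
    ∃ r, HasDerivAt (fun v => entry g ψ j a a' v * entry g ψ j b b' v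
      - entry g ψ j c c' v * entry g ψ j d d' v) r y ∧ SizeLE η (-109) r ∧
      SizeLE η (-3) (entry g ψ j a a' y * entry g ψ j b b' y
      - entry g ψ j c c' y * entry g ψ j d d' y) := by
  obtain ⟨_, a1, a2⟩ := h.exists_deriv_entry hy ha ha'
  obtain ⟨_, b1, b2⟩ := h.exists_deriv_entry hy hb hb'
  obtain ⟨_, c1, c2⟩ := h.exists_deriv_entry hy hc hc'
  obtain ⟨_, d1, d2⟩ := h.exists_deriv_entry hy hd hd'
  have a3 := h.small_entry hy ha ha'
  have b3 := h.small_entry hy hb hb'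
  have c3 := h.small_entry hy hc hc'
  have d3 := h.small_entry hy hd hd'
  obtain ⟨_, p1, p2⟩ := h.exists_deriv_mul a1 b1 a2 b2 a3 b3
  obtain ⟨_, q1, q2⟩ := h.exists_deriv_mul c1 d1 c2 d2 c3 d3
  exact ⟨_, p1.sub q1, p2.sub h.pos h.le q2 (by norm_num) (by norm_num),
    (a3.mul h.pos h.le b3 (k := -2) (by norm_num)).sub h.pos h.le
    (c3.mul h.pos h.le d3 (k := -2) (by norm_num)) (by norm_num) (by norm_num)⟩

theorem exists_deriv_quotient (h : SaddleFamily η g R Ω I ψ j) (hy : y ∈ I)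
    {N : ℝ → ℝ} (hN : ∃ r, HasDerivAt N r y ∧ SizeLE η (-109) r ∧ SizeLE η (-3) (N y)) :
    ∃ r, HasDerivAt (fun v => N v / disc g ψ j v) r y ∧ SizeLE η (-318) r := by
  obtain ⟨_, n1, n2, n3⟩ := hN
  obtain ⟨_, d1, d2, d3⟩ := h.exists_deriv_minor hy (small_e₁ η) (small_e₁ η) (small_e₁ η)
    (small_e₂ η) (small_e₂ η) (small_e₂ η) (small_e₁ η) (small_e₂ η)
  refine ⟨_, n1.div d1 (h.disc_pos hy).ne', ?_⟩
  refine ((n2.mul h.pos h.le d3 (k := -112) (by norm_num)).sub h.pos h.le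
    (n3.mul h.pos h.le d2 (k := -112) (by norm_num)) (k := -113) (by norm_num)
    (by norm_num)).div h.pos h.le (m := 204) ?_ (by norm_num)
  have h1 : η ^ (204 : ℤ) = (η ^ (102 : ℤ)) ^ 2 := by norm_cast; rw [← pow_mul]
  rw [h1]
  refine le_trans ?_ (le_abs_self _)
  exact pow_le_pow_left₀ (zpow_nonneg h.pos.le _) (h.le_disc hy) 2

theorem contDiffOn_quotient (h : SaddleFamily η g R Ω I ψ j) {N : ℝ → ℝ}
    (hN : ContDiffOn ℝ 1 N I) : ContDiffOn ℝ 1 (fun v => N v / disc g ψ j v) I :=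
  hN.div (((h.contDiffOn_entry _ _).mul (h.contDiffOn_entry _ _)).sub
    ((h.contDiffOn_entry _ _).mul (h.contDiffOn_entry _ _))) fun _ hy => (h.disc_pos hy).ne'

/-- The curve is of class `C²`: its derivative is a quotient of minors of the Hessian, and `g` is of
class `C³`. -/
theorem deriv_smooth (h : SaddleFamily η g R Ω I ψ j) :
    ContDiffOn ℝ 1 (deriv ψ) I ∧ ContDiffOn ℝ 1 (deriv j) I :=
  ⟨(h.contDiffOn_quotient (((h.contDiffOn_entry _ _).mul (h.contDiffOn_entry _ _)).sub
    ((h.contDiffOn_entry _ _).mul (h.contDiffOn_entry _ _)))).congr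
      fun _ hy => (h.deriv_eq hy).1,
  (h.contDiffOn_quotient (((h.contDiffOn_entry _ _).mul (h.contDiffOn_entry _ _)).sub
    ((h.contDiffOn_entry _ _).mul (h.contDiffOn_entry _ _)))).congr
      fun _ hy => (h.deriv_eq hy).2⟩

theorem deriv_deriv (h : SaddleFamily η g R Ω I ψ j) (hy : y ∈ I) :
    (HasDerivAt (deriv ψ) (deriv (deriv ψ) y) y ∧ SizeLE η (-318) (deriv (deriv ψ) y)) ∧
    HasDerivAt (deriv j) (deriv (deriv j) y) y ∧ SizeLE η (-318) (deriv (deriv j) y) := by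
  have hI := h.isOpen_I.mem_nhds hy
  obtain ⟨_, p1, p2⟩ := h.exists_deriv_quotient hy (h.exists_deriv_minor hy (small_e₂ η)
    (small_e₁ η) (small_e₁ η) (small_e₂ η) (small_e₂ η) (small_e₃ η) (small_e₂ η) (small_e₃ η))
  obtain ⟨_, q1, q2⟩ := h.exists_deriv_quotient hy (h.exists_deriv_minor hy (small_e₁ η)
    (small_e₂ η) (small_e₁ η) (small_e₁ η) (small_e₁ η) (small_e₃ η) (small_e₂ η) (small_e₃ η))
  have p3 := p1.congr_of_eventuallyEq (f₁ := deriv ψ) (by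
    filter_upwards [hI] with v hv using (h.deriv_eq hv).1)
  have q3 := q1.congr_of_eventuallyEq (f₁ := deriv j) (by
    filter_upwards [hI] with v hv using (h.deriv_eq hv).2)
  rw [p3.deriv, q3.deriv]
  exact ⟨⟨p3, p2⟩, q3, q2⟩

/-- The slope of the shear which diagonalises the Hessian along the curve. -/
noncomputable def slope (g : ℝ × ℝ × ℝ → ℝ) (ψ j : ℝ → ℝ) (y : ℝ) : ℝ :=
  -(entry g ψ j (1, 0, 0) (0, 1, 0) y / entry g ψ j (0, 1, 0) (0, 1, 0) y)

theorem le_entry₂₂ (h : SaddleFamily η g R Ω I ψ j) (hy : y ∈ I) :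
    η ^ (1 : ℤ) ≤ |entry g ψ j (0, 1, 0) (0, 1, 0) y| := by
  rw [zpow_one]
  exact (h.convex y hy).trans (le_abs_self _)

theorem entry₂₂_pos (h : SaddleFamily η g R Ω I ψ j) (hy : y ∈ I) :
    0 < entry g ψ j (0, 1, 0) (0, 1, 0) y := h.pos.trans_le (h.convex y hy)

theorem small_slope (h : SaddleFamily η g R Ω I ψ j) (hy : y ∈ I) :
    SizeLE η (-2) (slope g ψ j y) :=
  ((h.small_entry hy (small_e₁ η) (small_e₂ η)).div h.pos h.le (h.le_entry₂₂ hy)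
    (by norm_num)).neg

theorem deriv_slope (h : SaddleFamily η g R Ω I ψ j) (hy : y ∈ I) :
    HasDerivAt (slope g ψ j) (deriv (slope g ψ j) y) y ∧
      SizeLE η (-110) (deriv (slope g ψ j) y) := by
  obtain ⟨_, a1, a2⟩ := h.exists_deriv_entry hy (small_e₁ η) (small_e₂ η)
  obtain ⟨_, b1, b2⟩ := h.exists_deriv_entry hy (small_e₂ η) (small_e₂ η)
  have a3 := h.small_entry hy (small_e₁ η) (small_e₂ η)
  have b3 := h.small_entry hy (small_e₂ η) (small_e₂ η)
  have h1 := (a1.div b1 (h.entry₂₂_pos hy).ne').neg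
  have h2 : HasDerivAt (slope g ψ j) _ y := h1
  rw [h2.deriv]
  refine ⟨h2, SizeLE.neg ?_⟩
  refine ((a2.mul h.pos h.le b3 (k := -107) (by norm_num)).sub h.pos h.le
    (a3.mul h.pos h.le b2 (k := -107) (by norm_num)) (k := -108) (by norm_num)
    (by norm_num)).div h.pos h.le (m := 2) ?_ (by norm_num)
  rw [abs_pow]
  have h3 : η ^ (2 : ℤ) = (η ^ (1 : ℤ)) ^ 2 := by norm_cast; rw [← pow_mul]
  rw [h3]
  exact pow_le_pow_left₀ (zpow_nonneg h.pos.le _) (h.le_entry₂₂ hy) 2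

theorem slope_smooth (h : SaddleFamily η g R Ω I ψ j) : ContDiffOn ℝ 1 (slope g ψ j) I :=
  ((h.contDiffOn_entry _ _).div (h.contDiffOn_entry _ _)
    fun _ hy => (h.entry₂₂_pos hy).ne').neg

end SaddleFamily

/-! ### The shear along the curve of saddles -/

/-- A shear, of slope `s(y)`, which almost diagonalises the Hessian of `g` along the curve of saddles
over `I₀`, and has bounded derivatives. The vectors `(1, s, 0)` and `(0, 1, 0)` are the new
directions. The mixed entry `cross` of the Hessian need not vanish, but it is smaller than the
strength of the saddles, and `diag` bounds the remaining diagonal entry from below. -/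
structure Shear (η : ℝ) (g : ℝ × ℝ × ℝ → ℝ) (I₀ : Set ℝ) (ψ j s s₁ s₂ : ℝ → ℝ) : Prop where
  deriv : ∀ y, HasDerivAt s (s₁ y) y
  deriv₁ : ∀ y, HasDerivAt s₁ (s₂ y) y
  cont₂ : Continuous s₂
  size : ∀ y ∈ I₀, SizeLE η (-3) (s y)
  size₁ : ∀ y ∈ I₀, SizeLE η (-110) (s₁ y)
  size₂ : ∀ y ∈ I₀, SizeLE η (-331) (s₂ y)
  cross : ∀ y ∈ I₀, SizeLE η 107 (fderiv ℝ (fderiv ℝ g) (ψ y, j y, y) (1, s y, 0) (0, 1, 0))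
  diag : ∀ y ∈ I₀, η ^ (104 : ℤ) ≤
    -fderiv ℝ (fderiv ℝ g) (ψ y, j y, y) (1, s y, 0) (1, s y, 0)

namespace SaddleFamily

variable {η : ℝ} {g : ℝ × ℝ × ℝ → ℝ} {R : Phase → ℝ} {Ω : Set (ℝ × ℝ × ℝ)} {I : Set ℝ} {ψ j : ℝ → ℝ}
  {y : ℝ}

theorem abs_slope_sub_le (h : SaddleFamily η g R Ω I ψ j) {a b : ℝ} (hI : Icc a b ⊆ I) {x y : ℝ}
    (hx : x ∈ Icc a b) (hy : y ∈ Icc a b) :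
    |slope g ψ j x - slope g ψ j y| ≤ η ^ (-110 : ℤ) * |x - y| :=
  (convex_Icc a b).norm_image_sub_le_of_norm_hasDerivWithin_le
    (fun _ hv => (h.deriv_slope (hI hv)).1.hasDerivWithinAt)
    (fun _ hv => (h.deriv_slope (hI hv)).2) hy hx

/-- The slope which diagonalises the Hessian is only once differentiable with bounds, since `g` has
only bounds on three derivatives; its averages over intervals of length `η ^ 220` are smoother, and
differ from it by `η ^ (-110 + 218)`, which is harmless. -/
theorem exists_shear (h : SaddleFamily η g R Ω I ψ j) {α β ζ : ℝ} (hαβ : α ≤ β) (hζ : 0 < ζ)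
    (hζ' : 4 * ζ ≤ η ^ (220 : ℤ)) (hI : Icc (α - 2 * ζ) (β + 2 * ζ) ⊆ I) :
    ∃ s s₁ s₂ : ℝ → ℝ, Shear η g (Icc (α - 2 * ζ) (β + 2 * ζ)) ψ j s s₁ s₂ := by
  obtain ⟨c, c', hc, hc', hc01, hid, hmem⟩ := exists_clamp hαβ hζ
  have hw : 0 < η ^ (220 : ℤ) := zpow_pos h.pos _
  set w := η ^ (220 : ℤ) with hwdef
  set σ : ℝ → ℝ := fun y => slope g ψ j (c y) with hσ
  set σ' : ℝ → ℝ := fun y => deriv (slope g ψ j) (c y) * c' y with hσ'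
  have hcc : Continuous c := continuous_iff_continuousAt.2 fun y => (hc y).continuousAt
  have hσd : ∀ y, HasDerivAt σ (σ' y) y := fun y =>
    (h.deriv_slope (hI (hmem y))).1.comp y (hc y)
  have hσc : Continuous σ := continuous_iff_continuousAt.2 fun y => (hσd y).continuousAt
  have hσ'c : Continuous σ' :=
    ((h.slope_smooth.continuousOn_deriv_of_isOpen h.isOpen_I le_rfl).comp_continuous hcc
      fun y => hI (hmem y)).mul hc'
  have hσ'b : ∀ y, SizeLE η (-110) (σ' y) := fun y => by
    refine (h.deriv_slope (hI (hmem y))).2.mul h.pos h.le (m := 0) ?_ (by norm_num)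
    rw [SizeLE, zpow_zero, Real.norm_eq_abs, abs_of_nonneg (hc01 y).1]
    exact (hc01 y).2
  -- the clamp does not expand
  have hcl : ∀ x y, |c x - c y| ≤ |x - y| := fun x y => by
    have := convex_univ.norm_image_sub_le_of_norm_hasDerivWithin_le (C := 1)
      (fun v _ => (hc v).hasDerivWithinAt) (fun v _ => by
        rw [Real.norm_eq_abs, abs_of_nonneg (hc01 v).1]; exact (hc01 v).2)
      (mem_univ y) (mem_univ x)
    simpa using this
  have hcy : ∀ y ∈ Icc (α - 2 * ζ) (β + 2 * ζ), |c y - y| ≤ w := by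
    intro y hy
    obtain ⟨v, hv, hvy⟩ : ∃ v ∈ Icc α β, |y - v| ≤ 2 * ζ := by
      rcases le_total y α with h1 | h1
      · exact ⟨α, ⟨le_rfl, hαβ⟩, by rw [abs_le]; constructor <;> linarith [hy.1]⟩
      rcases le_total y β with h2 | h2
      · exact ⟨y, ⟨h1, h2⟩, by simp; positivity⟩
      · exact ⟨β, ⟨hαβ, le_rfl⟩, by rw [abs_le]; constructor <;> linarith [hy.2]⟩
    have h1 := hid v ⟨by linarith [hv.1], by linarith [hv.2]⟩
    have h2 := hcl y v
    rw [h1] at h2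
    have e : c y - y = (c y - v) - (y - v) := by ring
    rw [e]
    refine (abs_sub _ _).trans ?_
    linarith
  have key : ∀ y ∈ Icc (α - 2 * ζ) (β + 2 * ζ),
      SizeLE η 108 (average w σ y - slope g ψ j y) := by
    intro y hy
    have h1 : |average w σ y - slope g ψ j y| ≤ η ^ (-110 : ℤ) * (2 * w) := by
      refine abs_average_sub_le hw hσc fun v hv => ?_
      refine (h.abs_slope_sub_le hI (hmem v) hy).trans ?_
      refine mul_le_mul_of_nonneg_left ?_ (zpow_nonneg h.pos.le _)
      have e : c v - y = (c v - c y) + (c y - y) := by ring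
      have h2 := hcl v y
      have h3 : |v - y| ≤ w := by rw [abs_le]; constructor <;> linarith [hv.1, hv.2]
      rw [e]
      refine (abs_add_le _ _).trans ?_
      linarith [hcy y hy]
    refine h1.trans ?_
    have h2 : 2 * w ≤ η ^ (218 : ℤ) := SizeLE.two_mul_zpow_le h.pos h.le (by norm_num)
    calc η ^ (-110 : ℤ) * (2 * w) ≤ η ^ (-110 : ℤ) * η ^ (218 : ℤ) :=
          mul_le_mul_of_nonneg_left h2 (zpow_nonneg h.pos.le _)
      _ = η ^ (108 : ℤ) := by rw [← zpow_add₀ h.pos.ne']; norm_num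
  have hwinv : SizeLE η (-220) w⁻¹ := by
    rw [SizeLE, Real.norm_eq_abs, abs_of_pos (inv_pos.2 hw), hwdef, zpow_neg]
  refine ⟨average w σ, fun y => w⁻¹ * (σ (y + w) - σ y), fun y => w⁻¹ * (σ' (y + w) - σ' y),
    hasDerivAt_average hσc, fun y => ?_, ?_, fun y hy => ?_, fun y hy => ?_, fun y hy => ?_,
    fun y hy => ?_, fun y hy => ?_⟩
  · exact (((hσd (y + w)).comp_add_const y w).sub (hσd y)).const_mul _
  · exact continuous_const.mul ((hσ'c.comp (continuous_id.add continuous_const)).sub hσ'c)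
  · have := (key y hy).add h.pos h.le (h.small_slope (hI hy)) (k := -3) (by norm_num) (by norm_num)
    rwa [sub_add_cancel] at this
  · have h1 := h.abs_slope_sub_le hI (hmem (y + w)) (hmem y)
    have h2 := hcl (y + w) y
    rw [add_sub_cancel_left, abs_of_pos hw] at h2
    rw [SizeLE, norm_mul, Real.norm_eq_abs, Real.norm_eq_abs, abs_of_pos (inv_pos.2 hw)]
    have h3 : |σ (y + w) - σ y| ≤ η ^ (-110 : ℤ) * w :=
      h1.trans (mul_le_mul_of_nonneg_left h2 (zpow_nonneg h.pos.le _))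
    calc w⁻¹ * |σ (y + w) - σ y| ≤ w⁻¹ * (η ^ (-110 : ℤ) * w) :=
          mul_le_mul_of_nonneg_left h3 (inv_pos.2 hw).le
      _ = η ^ (-110 : ℤ) := by field_simp
  · exact hwinv.mul h.pos h.le ((hσ'b _).sub h.pos h.le (hσ'b _) (k := -111) (by norm_num)
      (by norm_num)) (by norm_num)
  · obtain ⟨d, hd⟩ : ∃ d, d = average w σ y - slope g ψ j y := ⟨_, rfl⟩
    have hk := key y hy
    rw [← hd] at hk
    have hs : average w σ y = slope g ψ j y + d := by rw [hd]; ring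
    have h22 := h.small_entry (hI hy) (small_e₂ η) (small_e₂ η)
    have e : fderiv ℝ (fderiv ℝ g) (ψ y, j y, y) (1, average w σ y, 0) (0, 1, 0)
        = d * entry g ψ j (0, 1, 0) (0, 1, 0) y := by
      have h0 := (h.entry₂₂_pos (hI hy)).ne'
      rw [basis_eq 1]
      simp only [map_add, map_smul, smul_eq_mul, one_mul, zero_mul, add_apply, smul_apply]
      rw [hs]
      simp only [slope, entry] at h0 ⊢
      field_simp
      ring
    rw [e]
    exact hk.mul h.pos h.le h22 (by norm_num)
  · obtain ⟨d, hd⟩ : ∃ d, d = average w σ y - slope g ψ j y := ⟨_, rfl⟩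
    have hk := key y hy
    rw [← hd] at hk
    have hs : average w σ y = slope g ψ j y + d := by rw [hd]; ring
    have h22 := h.small_entry (hI hy) (small_e₂ η) (small_e₂ η)
    have h0 := h.entry₂₂_pos (hI hy)
    have e : -fderiv ℝ (fderiv ℝ g) (ψ y, j y, y) (1, average w σ y, 0) (1, average w σ y, 0)
        = disc g ψ j y / entry g ψ j (0, 1, 0) (0, 1, 0) y
          - d * (d * entry g ψ j (0, 1, 0) (0, 1, 0) y) := by
      have h0 := h0.ne'
      rw [basis_eq 1]
      simp only [map_add, map_smul, smul_eq_mul, one_mul, zero_mul, add_apply, smul_apply]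
      rw [hs, h.hess_symm (h.curve_mem (hI hy)) (0, 1, 0) (1, 0, 0)]
      simp only [slope, entry, disc] at h0 ⊢
      field_simp
      ring
    rw [e]
    have h1 : SizeLE η 214 (d * (d * entry g ψ j (0, 1, 0) (0, 1, 0) y)) :=
      hk.mul h.pos h.le (hk.mul h.pos h.le h22 (k := 107) (by norm_num)) (by norm_num)
    have h2 : η ^ (103 : ℤ) ≤ disc g ψ j y / entry g ψ j (0, 1, 0) (0, 1, 0) y := by
      rw [le_div_iff₀ h0]
      refine le_trans ?_ (h.le_disc (hI hy))
      have h3 : entry g ψ j (0, 1, 0) (0, 1, 0) y ≤ η ^ (-1 : ℤ) := (le_abs_self _).trans h22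
      calc η ^ (103 : ℤ) * entry g ψ j (0, 1, 0) (0, 1, 0) y ≤ η ^ (103 : ℤ) * η ^ (-1 : ℤ) :=
            mul_le_mul_of_nonneg_left h3 (zpow_nonneg h.pos.le _)
        _ = η ^ (102 : ℤ) := by rw [← zpow_add₀ h.pos.ne']; norm_num
    have h3 : 2 * η ^ (104 : ℤ) ≤ η ^ (103 : ℤ) := SizeLE.two_mul_zpow_le h.pos h.le (by norm_num)
    have h4 : η ^ (214 : ℤ) ≤ η ^ (104 : ℤ) :=
      zpow_le_zpow_right_of_le_one₀ h.pos (by linarith [h.le]) (by norm_num)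
    have h5 := (le_abs_self _).trans h1
    linarith

end SaddleFamily

/-! ### The chart along the curve of saddles -/

/-- The data of a chart along a curve `(ψ, j)` of saddles of `g`: it uses the shear with the slope
`s`, and covers a neighbourhood of the curve of size `η ^ N`. -/
structure Chart where
  η : ℝ
  N : ℤ
  g : ℝ × ℝ × ℝ → ℝ
  R : Phase → ℝ
  ψ : ℝ → ℝ
  j : ℝ → ℝ
  s : ℝ → ℝ
  s₁ : ℝ → ℝ
  s₂ : ℝ → ℝ

/-- The image of a chart: an unstable and a stable coordinate, and the rescaled `(ψᶠ, Jᶠ, t)`. -/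
abbrev Coord := ℝ × ℝ × (ℝ × ℝ × ℝ)

namespace Chart

variable (c : Chart)

/-- The properties of the data of a chart. -/
structure Adapted (Ω : Set (ℝ × ℝ × ℝ)) (I I₀ : Set ℝ) : Prop where
  family : SaddleFamily c.η c.g c.R Ω I c.ψ c.j
  shear : Shear c.η c.g I₀ c.ψ c.j c.s c.s₁ c.s₂
  sub : I₀ ⊆ I
  le_N : 140 ≤ c.N
  N_le : c.N ≤ 560

/-- The size of the chart. -/
noncomputable def e : ℝ := c.η ^ c.N

/-- The ratio of the two axes of the chart. Near a saddle `J² - η ^ 104 ψ²` the stable and the unstable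
directions have the slopes `± η ^ 52`. -/
noncomputable def σ : ℝ := c.η ^ (52 : ℤ)

/-- The scale of `Jᶠ`, and the inverse of the scale of `ψᶠ`. In the rescaled variables the curve of
saddles and its shear vary slowly, so that the rates of the base are negligible. -/
noncomputable def ω : ℝ := c.η ^ (400 : ℤ)

/-- The action `Jᶠ` of a point in the chart. -/
noncomputable def act (q : Coord) : ℝ := c.ω * q.2.2.2.1

/-- The distance in `ψˢ` from the curve of a point in the chart. -/
noncomputable def dψ (q : Coord) : ℝ := c.e * (q.1 + q.2.1)

/-- The distance in `Jˢ` from the sheared axis of a point in the chart. -/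
noncomputable def dj (q : Coord) : ℝ := c.e * c.σ * (q.1 - q.2.1)

/-- The inverse of the chart. -/
noncomputable def inv (q : Coord) : Phase :=
  ((c.ψ (c.act q) + c.dψ q, q.2.2.1 / c.ω),
    (c.j (c.act q) + (c.s (c.act q) * c.dψ q + c.dj q), c.act q), q.2.2.2.2)

/-- The point of `Coord` whose coordinates `ψˢ - ψ` and `Jˢ - j - s (ψˢ - ψ)` are `X` and `V`. -/
noncomputable def split (X V : ℝ) (u : ℝ × ℝ × ℝ) : Coord :=
  ((X / c.e + V / (c.e * c.σ)) / 2, (X / c.e - V / (c.e * c.σ)) / 2, (c.ω * u.1, u.2.1 / c.ω, u.2.2))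

/-- The chart. -/
noncomputable def fwd (p : Phase) : Coord :=
  c.split (p.1.1 - c.ψ p.2.1.2)
    (p.2.1.1 - c.j p.2.1.2 - c.s p.2.1.2 * (p.1.1 - c.ψ p.2.1.2)) (p.1.2, p.2.1.2, p.2.2)

/-- The derivative of the inverse of the chart. -/
noncomputable def dinv (q v : Coord) : Phase :=
  ((deriv c.ψ (c.act q) * c.act v + c.dψ v, v.2.2.1 / c.ω),
    (deriv c.j (c.act q) * c.act v + (c.s₁ (c.act q) * c.act v * c.dψ q + c.s (c.act q) * c.dψ v
      + c.dj v), c.act v), v.2.2.2.2)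

/-- The derivative of the chart. -/
noncomputable def dfwd (p v : Phase) : Coord :=
  c.split (v.1.1 - deriv c.ψ p.2.1.2 * v.2.1.2)
    (v.2.1.1 - deriv c.j p.2.1.2 * v.2.1.2 - (c.s₁ p.2.1.2 * v.2.1.2 * (p.1.1 - c.ψ p.2.1.2)
      + c.s p.2.1.2 * (v.1.1 - deriv c.ψ p.2.1.2 * v.2.1.2))) (v.1.2, v.2.1.2, v.2.2)

/-- The direction in which the remainder is differentiated in the equation for `ψˢ - ψ`. -/
noncomputable def dir₁ (q : Coord) : Phase := ((0, deriv c.ψ (c.act q)), (1, 0), 0)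

/-- The direction in which the remainder is differentiated in the equation for
`Jˢ - j - s (ψˢ - ψ)`. -/
noncomputable def dir₂ (q : Coord) : Phase :=
  ((-1, deriv c.j (c.act q) + (c.s₁ (c.act q) * c.dψ q - c.s (c.act q) * deriv c.ψ (c.act q))),
    (-c.s (c.act q), 0), 0)

/-- The Hamiltonian vector field of `g + R` in the chart. -/
noncomputable def field (q : Coord) : Coord :=
  c.split
    (fderiv ℝ c.g (slow (c.inv q)) (0, 1, 0) + fderiv ℝ c.R (c.inv q) (c.dir₁ q))
    (-fderiv ℝ c.g (slow (c.inv q)) (1, c.s (c.act q), 0) + fderiv ℝ c.R (c.inv q) (c.dir₂ q))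
    (fderiv ℝ c.g (slow (c.inv q)) (0, 0, 1) + fderiv ℝ c.R (c.inv q) ((0, 0), (0, 1), 0),
      -fderiv ℝ c.R (c.inv q) ((0, 1), (0, 0), 0), 1)

/-- The domain of the vector field in the chart. -/
def dom (Ω : Set (ℝ × ℝ × ℝ)) (I : Set ℝ) : Set Coord := {q | c.act q ∈ I ∧ slow (c.inv q) ∈ Ω}

variable {c} {Ω : Set (ℝ × ℝ × ℝ)} {I I₀ : Set ℝ} {q v : Coord} {p : Phase}

theorem Adapted.η_pos (h : c.Adapted Ω I I₀) : 0 < c.η := h.family.pos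
theorem Adapted.η_le (h : c.Adapted Ω I I₀) : c.η ≤ 1 / 2 := h.family.le
theorem Adapted.e_pos (h : c.Adapted Ω I I₀) : 0 < c.e := zpow_pos h.η_pos _
theorem Adapted.σ_pos (h : c.Adapted Ω I I₀) : 0 < c.σ := zpow_pos h.η_pos _
theorem Adapted.ω_pos (h : c.Adapted Ω I I₀) : 0 < c.ω := zpow_pos h.η_pos _

theorem fwd_inv (h : c.Adapted Ω I I₀) (q : Coord) : c.fwd (c.inv q) = q := by
  have h1 := h.e_pos.ne'
  have h2 := h.σ_pos.ne'
  have h3 := h.ω_pos.ne'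
  ext <;> simp only [fwd, inv, split, dψ, dj, act] <;> field_simp <;> ring

theorem inv_fwd (h : c.Adapted Ω I I₀) (p : Phase) : c.inv (c.fwd p) = p := by
  have h1 := h.e_pos.ne'
  have h2 := h.σ_pos.ne'
  have h3 := h.ω_pos.ne'
  have h4 : c.act (c.fwd p) = p.2.1.2 := by simp only [act, fwd, split]; field_simp
  have h5 : c.dψ (c.fwd p) = p.1.1 - c.ψ p.2.1.2 := by simp only [dψ, fwd, split]; field_simp; ring
  have h6 : c.dj (c.fwd p) = p.2.1.1 - c.j p.2.1.2 - c.s p.2.1.2 * (p.1.1 - c.ψ p.2.1.2) := by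
    simp only [dj, fwd, split]; field_simp; ring
  ext <;> simp only [inv, h4, h5, h6] <;> try simp only [fwd, split]
  · ring
  · field_simp
  · ring

theorem act_fwd (h : c.Adapted Ω I I₀) (p : Phase) : c.act (c.fwd p) = p.2.1.2 := by
  have h3 := h.ω_pos.ne'
  simp only [act, fwd, split]; field_simp

theorem dψ_fwd (h : c.Adapted Ω I I₀) (p : Phase) : c.dψ (c.fwd p) = p.1.1 - c.ψ p.2.1.2 := by
  have h1 := h.e_pos.ne'
  simp only [dψ, fwd, split]; field_simp; ring

theorem dfwd_dinv (h : c.Adapted Ω I I₀) (q v : Coord) : c.dfwd (c.inv q) (c.dinv q v) = v := by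
  have h1 := h.e_pos.ne'
  have h2 := h.σ_pos.ne'
  have h3 := h.ω_pos.ne'
  ext <;> simp only [dfwd, inv, dinv, split]
  · simp only [dψ, dj]; field_simp; ring
  · simp only [dψ, dj]; field_simp; ring
  · field_simp
  · simp only [act]; field_simp

theorem dinv_dfwd (h : c.Adapted Ω I I₀) (p v : Phase) : c.dinv (c.fwd p) (c.dfwd p v) = v := by
  have h1 := h.e_pos.ne'
  have h2 := h.σ_pos.ne'
  have h3 := h.ω_pos.ne'
  have h4 : c.act (c.dfwd p v) = v.2.1.2 := by simp only [act, dfwd, split]; field_simp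
  have h5 : c.dψ (c.dfwd p v) = v.1.1 - deriv c.ψ p.2.1.2 * v.2.1.2 := by
    simp only [dψ, dfwd, split]; field_simp; ring
  have h6 : c.dj (c.dfwd p v) = v.2.1.1 - deriv c.j p.2.1.2 * v.2.1.2 -
      (c.s₁ p.2.1.2 * v.2.1.2 * (p.1.1 - c.ψ p.2.1.2)
      + c.s p.2.1.2 * (v.1.1 - deriv c.ψ p.2.1.2 * v.2.1.2)) := by
    simp only [dj, dfwd, split]; field_simp; ring
  ext <;> simp only [dinv, h4, h5, h6, act_fwd h, dψ_fwd h] <;> try simp only [dfwd, split]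
  · ring
  · field_simp
  · ring

theorem contDiffOn_ψ (h : c.Adapted Ω I I₀) : ContDiffOn ℝ 2 c.ψ I := by
  rw [show (2 : WithTop ℕ∞) = 1 + 1 by norm_num,
    contDiffOn_succ_iff_deriv_of_isOpen h.family.isOpen_I]
  exact ⟨h.family.ψ_smooth.differentiableOn (by norm_num), by simp, h.family.deriv_smooth.1⟩

theorem contDiffOn_j (h : c.Adapted Ω I I₀) : ContDiffOn ℝ 2 c.j I := by
  rw [show (2 : WithTop ℕ∞) = 1 + 1 by norm_num,
    contDiffOn_succ_iff_deriv_of_isOpen h.family.isOpen_I]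
  exact ⟨h.family.j_smooth.differentiableOn (by norm_num), by simp, h.family.deriv_smooth.2⟩

theorem contDiff_s₁ (h : c.Adapted Ω I I₀) : ContDiff ℝ 1 c.s₁ := by
  rw [contDiff_one_iff_deriv]
  have : deriv c.s₁ = c.s₂ := funext fun y => (h.shear.deriv₁ y).deriv
  rw [this]
  exact ⟨fun y => (h.shear.deriv₁ y).differentiableAt, h.shear.cont₂⟩

theorem contDiff_s (h : c.Adapted Ω I I₀) : ContDiff ℝ 2 c.s := by
  rw [show (2 : WithTop ℕ∞) = 1 + 1 by norm_num, contDiff_succ_iff_deriv]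
  have : deriv c.s = c.s₁ := funext fun y => (h.shear.deriv y).deriv
  rw [this]
  exact ⟨fun y => (h.shear.deriv y).differentiableAt, by simp, contDiff_s₁ h⟩

theorem contDiff_act : ContDiff ℝ 2 c.act := by unfold act; fun_prop
theorem contDiff_dψ : ContDiff ℝ 2 c.dψ := by unfold dψ; fun_prop
theorem contDiff_dj : ContDiff ℝ 2 c.dj := by unfold dj; fun_prop

theorem contDiffOn_inv (h : c.Adapted Ω I I₀) : ContDiffOn ℝ 2 c.inv {q | c.act q ∈ I} := by
  have h1 : ContDiffOn ℝ 2 c.act {q | c.act q ∈ I} := contDiff_act.contDiffOn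
  have h2 : ContDiffOn ℝ 2 c.dψ {q | c.act q ∈ I} := contDiff_dψ.contDiffOn
  have h3 : ContDiffOn ℝ 2 c.dj {q | c.act q ∈ I} := contDiff_dj.contDiffOn
  have hψ := (contDiffOn_ψ h).comp h1 fun _ hq => hq
  have hj := (contDiffOn_j h).comp h1 fun _ hq => hq
  have hs := (contDiff_s h).comp_contDiffOn h1
  have hx : ContDiff ℝ 2 fun q : Coord => q.2.2.1 / c.ω := by fun_prop
  have ht : ContDiff ℝ 2 fun q : Coord => q.2.2.2.2 := by fun_prop
  exact ((hψ.add h2).prodMk hx.contDiffOn).prodMk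
    (((hj.add ((hs.mul h2).add h3)).prodMk h1).prodMk ht.contDiffOn)

theorem contDiffOn_fwd (h : c.Adapted Ω I I₀) : ContDiffOn ℝ 2 c.fwd {p | p.2.1.2 ∈ I} := by
  have h1 : ContDiffOn ℝ 2 (fun p : Phase => p.2.1.2) {p | p.2.1.2 ∈ I} :=
    ContDiff.contDiffOn (by fun_prop)
  have hψ := (contDiffOn_ψ h).comp h1 fun _ hq => hq
  have hj := (contDiffOn_j h).comp h1 fun _ hq => hq
  have hs := (contDiff_s h).comp_contDiffOn h1
  have a1 : ContDiffOn ℝ 2 (fun p : Phase => p.1.1) {p | p.2.1.2 ∈ I} :=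
    ContDiff.contDiffOn (by fun_prop)
  have a2 : ContDiffOn ℝ 2 (fun p : Phase => p.2.1.1) {p | p.2.1.2 ∈ I} :=
    ContDiff.contDiffOn (by fun_prop)
  have a3 : ContDiffOn ℝ 2 (fun p : Phase => (c.ω * p.1.2, p.2.1.2 / c.ω, p.2.2))
    {p | p.2.1.2 ∈ I} := ContDiff.contDiffOn (by fun_prop)
  have hX := a1.sub hψ
  have hV := (a2.sub hj).sub (hs.mul hX)
  exact (((hX.div_const c.e).add (hV.div_const (c.e * c.σ))).div_const 2).prodMk
    ((((hX.div_const c.e).sub (hV.div_const (c.e * c.σ))).div_const 2).prodMk a3)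

theorem isOpen_act (h : c.Adapted Ω I I₀) : IsOpen {q | c.act q ∈ I} :=
  h.family.isOpen_I.preimage (contDiff_act (c := c)).continuous

theorem continuous_slow : Continuous slow := by unfold slow; fun_prop

theorem contDiff_slow {n : WithTop ℕ∞} : ContDiff ℝ n slow := by unfold slow; fun_prop

theorem isOpen_dom (h : c.Adapted Ω I I₀) : IsOpen (c.dom Ω I) :=
  (continuous_slow.comp_continuousOn (contDiffOn_inv h).continuousOn).isOpen_inter_preimage
    (isOpen_act h) h.family.isOpen

theorem contDiffOn_split {n : WithTop ℕ∞} {D : Set Coord} {X V : Coord → ℝ}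
    {u : Coord → ℝ × ℝ × ℝ} (hX : ContDiffOn ℝ n X D) (hV : ContDiffOn ℝ n V D)
    (hu : ContDiffOn ℝ n u D) : ContDiffOn ℝ n (fun q => c.split (X q) (V q) (u q)) D :=
  (((hX.div_const c.e).add (hV.div_const (c.e * c.σ))).div_const 2).prodMk
    ((((hX.div_const c.e).sub (hV.div_const (c.e * c.σ))).div_const 2).prodMk
      ((contDiffOn_const.mul hu.fst).prodMk ((hu.snd.fst.div_const c.ω).prodMk hu.snd.snd)))

theorem contDiffOn_field (h : c.Adapted Ω I I₀) : ContDiffOn ℝ 1 c.field (c.dom Ω I) := by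
  have hI : ContDiffOn ℝ 1 c.inv (c.dom Ω I) :=
    ((contDiffOn_inv h).mono fun q hq => hq.1).of_le (by norm_num)
  have hsl : ContDiffOn ℝ 1 (fun q => slow (c.inv q)) (c.dom Ω I) :=
    (contDiff_slow (n := 1)).comp_contDiffOn hI
  have hG : ContDiffOn ℝ 1 (fun q => fderiv ℝ c.g (slow (c.inv q))) (c.dom Ω I) :=
    (h.family.contDiffOn_fderiv.of_le (by norm_num)).comp hsl fun q hq => hq.2
  have hR : ContDiffOn ℝ 1 (fun q => fderiv ℝ c.R (c.inv q)) (c.dom Ω I) :=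
    (h.family.R_smooth.fderiv_of_isOpen (h.family.isOpen.preimage continuous_slow)
      (by norm_num : (1 : WithTop ℕ∞) + 1 ≤ 2)).comp hI fun q hq => hq.2
  have h1 : ContDiffOn ℝ 1 c.act (c.dom Ω I) := (contDiff_act.of_le (by norm_num)).contDiffOn
  have h2 : ContDiffOn ℝ 1 c.dψ (c.dom Ω I) := (contDiff_dψ.of_le (by norm_num)).contDiffOn
  have hψ : ContDiffOn ℝ 1 (fun q => deriv c.ψ (c.act q)) (c.dom Ω I) :=
    h.family.deriv_smooth.1.comp h1 fun q hq => hq.1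
  have hj : ContDiffOn ℝ 1 (fun q => deriv c.j (c.act q)) (c.dom Ω I) :=
    h.family.deriv_smooth.2.comp h1 fun q hq => hq.1
  have hs : ContDiffOn ℝ 1 (fun q => c.s (c.act q)) (c.dom Ω I) :=
    ((contDiff_s h).of_le (by norm_num)).comp_contDiffOn h1
  have hs₁ : ContDiffOn ℝ 1 (fun q => c.s₁ (c.act q)) (c.dom Ω I) :=
    (contDiff_s₁ h).comp_contDiffOn h1
  have d1 : ContDiffOn ℝ 1 c.dir₁ (c.dom Ω I) :=
    (contDiffOn_const.prodMk hψ).prodMk contDiffOn_const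
  have d2 : ContDiffOn ℝ 1 c.dir₂ (c.dom Ω I) :=
    (contDiffOn_const.prodMk (hj.add ((hs₁.mul h2).sub (hs.mul hψ)))).prodMk
      ((hs.neg.prodMk contDiffOn_const).prodMk contDiffOn_const)
  exact contDiffOn_split ((hG.clm_apply contDiffOn_const).add (hR.clm_apply d1))
    ((hG.clm_apply (contDiffOn_const.prodMk (hs.prodMk contDiffOn_const))).neg.add
      (hR.clm_apply d2))
    (((hG.clm_apply contDiffOn_const).add (hR.clm_apply contDiffOn_const)).prodMk
      ((hR.clm_apply contDiffOn_const).neg.prodMk contDiffOn_const))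

end Chart

namespace Chart

variable {c : Chart} {Ω : Set (ℝ × ℝ × ℝ)} {I I₀ : Set ℝ} {q v : Coord} {p : Phase}

/-! ### The vector field in the chart and its derivative -/

theorem fderiv_apply_eq {E F : Type*} [NormedAddCommGroup E] [NormedSpace ℝ E]
    [NormedAddCommGroup F] [NormedSpace ℝ F] {f : E → F} {x v : E} {f' : F}
    (hf : DifferentiableAt ℝ f x) (h : HasDerivAt (fun r : ℝ => f (x + r • v)) f' 0) :
    fderiv ℝ f x v = f' :=
  (hf.hasFDerivAt.hasLineDerivAt v).unique h

theorem line_comp {F : ℝ → ℝ} {F' : ℝ} {a : Coord → ℝ}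
    (ha : ∀ r : ℝ, a (q + r • v) = a q + r * a v) (hF : HasDerivAt F F' (a q)) :
    HasDerivAt (fun r : ℝ => F (a (q + r • v))) (F' * a v) 0 := by
  have h1 : HasDerivAt (fun r : ℝ => a (q + r • v)) (a v) 0 := by
    simp only [ha]
    simpa using ((hasDerivAt_id (0 : ℝ)).mul_const (a v)).const_add (a q)
  exact HasDerivAt.comp_of_eq 0 hF h1 (by simp)

theorem act_line (r : ℝ) : c.act (q + r • v) = c.act q + r * c.act v := by
  simp [act]; ring

theorem dψ_line (r : ℝ) : c.dψ (q + r • v) = c.dψ q + r * c.dψ v := by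
  simp [dψ]; ring

theorem dj_line (r : ℝ) : c.dj (q + r • v) = c.dj q + r * c.dj v := by
  simp [dj]; ring

theorem hasDerivAt_act : HasDerivAt (fun r : ℝ => c.act (q + r • v)) (c.act v) 0 := by
  simpa using line_comp (a := c.act) act_line (hasDerivAt_id (c.act q))

theorem hasDerivAt_dψ : HasDerivAt (fun r : ℝ => c.dψ (q + r • v)) (c.dψ v) 0 := by
  simpa using line_comp (a := c.dψ) dψ_line (hasDerivAt_id (c.dψ q))

theorem hasDerivAt_dj : HasDerivAt (fun r : ℝ => c.dj (q + r • v)) (c.dj v) 0 := by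
  simpa using line_comp (a := c.dj) dj_line (hasDerivAt_id (c.dj q))

theorem hasDerivAt_inv (h : c.Adapted Ω I I₀) (hq : c.act q ∈ I) :
    HasDerivAt (fun r : ℝ => c.inv (q + r • v)) (c.dinv q v) 0 := by
  have h1 : HasDerivAt (fun r : ℝ => c.ψ (c.act (q + r • v))) _ 0 :=
    line_comp act_line (h.family.hasDerivAt_ψ hq)
  have h2 : HasDerivAt (fun r : ℝ => c.j (c.act (q + r • v))) _ 0 :=
    line_comp act_line (h.family.hasDerivAt_j hq)
  have h3 : HasDerivAt (fun r : ℝ => c.s (c.act (q + r • v))) _ 0 :=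
    line_comp act_line (h.shear.deriv _)
  have h4 := h3.mul (hasDerivAt_dψ (c := c) (q := q) (v := v))
  have h5 : HasDerivAt (fun r : ℝ => (q + r • v).2.2.1 / c.ω) (v.2.2.1 / c.ω) 0 := by
    have := (((hasDerivAt_id (0 : ℝ)).mul_const v.2.2.1).const_add q.2.2.1).div_const c.ω
    simpa using this
  have h6 : HasDerivAt (fun r : ℝ => (q + r • v).2.2.2.2) v.2.2.2.2 0 := by
    have := ((hasDerivAt_id (0 : ℝ)).mul_const v.2.2.2.2).const_add q.2.2.2.2
    simpa using this
  have h7 := ((h1.add (hasDerivAt_dψ (c := c) (q := q) (v := v))).prodMk h5).prodMk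
    (((h2.add (h4.add (hasDerivAt_dj (c := c) (q := q) (v := v)))).prodMk
      (hasDerivAt_act (c := c) (q := q) (v := v))).prodMk h6)
  simp only [zero_smul, add_zero] at h7
  exact h7

theorem differentiableAt_inv (h : c.Adapted Ω I I₀) (hq : c.act q ∈ I) :
    DifferentiableAt ℝ c.inv q :=
  ((contDiffOn_inv h).contDiffAt ((isOpen_act h).mem_nhds hq)).differentiableAt (by norm_num)

theorem fderiv_inv (h : c.Adapted Ω I I₀) (hq : c.act q ∈ I) (v : Coord) :
    fderiv ℝ c.inv q v = c.dinv q v :=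
  fderiv_apply_eq (differentiableAt_inv h hq) (hasDerivAt_inv h hq)

theorem isOpen_phase (h : c.Adapted Ω I I₀) : IsOpen {p : Phase | p.2.1.2 ∈ I} :=
  h.family.isOpen_I.preimage (by fun_prop)

theorem hasDerivAt_split {X V : ℝ → ℝ} {u : ℝ → ℝ × ℝ × ℝ} {X' V' : ℝ} {u' : ℝ × ℝ × ℝ} {r : ℝ}
    (hX : HasDerivAt X X' r) (hV : HasDerivAt V V' r) (hu : HasDerivAt u u' r) :
    HasDerivAt (fun r => c.split (X r) (V r) (u r)) (c.split X' V' u') r := by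
  have hu1 : HasDerivAt (fun r => (u r).1) u'.1 r :=
    (ContinuousLinearMap.fst ℝ ℝ (ℝ × ℝ)).hasFDerivAt.comp_hasDerivAt r hu
  have hu2 : HasDerivAt (fun r => (u r).2) u'.2 r :=
    (ContinuousLinearMap.snd ℝ ℝ (ℝ × ℝ)).hasFDerivAt.comp_hasDerivAt r hu
  have hu3 : HasDerivAt (fun r => (u r).2.1) u'.2.1 r :=
    (ContinuousLinearMap.fst ℝ ℝ ℝ).hasFDerivAt.comp_hasDerivAt r hu2
  have hu4 : HasDerivAt (fun r => (u r).2.2) u'.2.2 r :=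
    (ContinuousLinearMap.snd ℝ ℝ ℝ).hasFDerivAt.comp_hasDerivAt r hu2
  exact (((hX.div_const c.e).add (hV.div_const (c.e * c.σ))).div_const 2).prodMk
    ((((hX.div_const c.e).sub (hV.div_const (c.e * c.σ))).div_const 2).prodMk
      ((hu1.const_mul c.ω).prodMk ((hu3.div_const c.ω).prodMk hu4)))

theorem differentiableAt_fwd (h : c.Adapted Ω I I₀) (hp : p.2.1.2 ∈ I) :
    DifferentiableAt ℝ c.fwd p :=
  ((contDiffOn_fwd h).contDiffAt ((isOpen_phase h).mem_nhds hp)).differentiableAt (by norm_num)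

theorem fderiv_fwd (h : c.Adapted Ω I I₀) (hp : p.2.1.2 ∈ I) (v : Phase) :
    fderiv ℝ c.fwd p v = c.dfwd p v := by
  -- the chart inverts `inv`, and the derivatives are inverse to each other
  obtain ⟨q, rfl⟩ : ∃ q, p = c.inv q := ⟨c.fwd p, (inv_fwd h p).symm⟩
  have hq : c.act q ∈ I := hp
  have h1 : HasFDerivAt (fun q => c.fwd (c.inv q))
      ((fderiv ℝ c.fwd (c.inv q)).comp (fderiv ℝ c.inv q)) q :=
    (differentiableAt_fwd h hp).hasFDerivAt.comp q (differentiableAt_inv h hq).hasFDerivAt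
  have h2 : (fun q => c.fwd (c.inv q)) = id := funext fun q => fwd_inv h q
  rw [h2] at h1
  have h3 := congrArg (fun A => A (c.dfwd (c.inv q) v)) (h1.unique (hasFDerivAt_id q))
  simp only [ContinuousLinearMap.comp_apply, ContinuousLinearMap.id_apply, fderiv_inv h hq] at h3
  have h4 := dinv_dfwd h (c.inv q) v
  rw [fwd_inv h] at h4
  rwa [h4] at h3

/-- The Hamiltonian. -/
def ham (c : Chart) (p : Phase) : ℝ := c.g (slow p) + c.R p

theorem hasFDerivAt_slow (p : Phase) : HasFDerivAt slow
    (((ContinuousLinearMap.fst ℝ ℝ ℝ).comp (ContinuousLinearMap.fst ℝ (ℝ × ℝ) ((ℝ × ℝ) × ℝ))).prod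
      ((ContinuousLinearMap.fst ℝ (ℝ × ℝ) ℝ).comp
        (ContinuousLinearMap.snd ℝ (ℝ × ℝ) ((ℝ × ℝ) × ℝ)))) p :=
  ContinuousLinearMap.hasFDerivAt (((ContinuousLinearMap.fst ℝ ℝ ℝ).comp
    (ContinuousLinearMap.fst ℝ (ℝ × ℝ) ((ℝ × ℝ) × ℝ))).prod
      ((ContinuousLinearMap.fst ℝ (ℝ × ℝ) ℝ).comp
        (ContinuousLinearMap.snd ℝ (ℝ × ℝ) ((ℝ × ℝ) × ℝ))))

theorem hasFDerivAt_R (h : c.Adapted Ω I I₀) (hp : slow p ∈ Ω) :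
    HasFDerivAt c.R (fderiv ℝ c.R p) p :=
  ((h.family.R_smooth.contDiffAt ((h.family.isOpen.preimage continuous_slow).mem_nhds
    hp)).differentiableAt (by norm_num)).hasFDerivAt

theorem hasFDerivAt_fderiv_R (h : c.Adapted Ω I I₀) (hp : slow p ∈ Ω) :
    HasFDerivAt (fderiv ℝ c.R) (fderiv ℝ (fderiv ℝ c.R) p) p :=
  (((h.family.R_smooth.contDiffAt ((h.family.isOpen.preimage continuous_slow).mem_nhds
    hp)).fderiv_right (m := 1) (by norm_num)).differentiableAt (by norm_num)).hasFDerivAt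

theorem hasFDerivAt_g (h : c.Adapted Ω I I₀) {z : ℝ × ℝ × ℝ} (hz : z ∈ Ω) :
    HasFDerivAt c.g (fderiv ℝ c.g z) z :=
  ((h.family.g_smooth.contDiffAt (h.family.isOpen.mem_nhds hz)).differentiableAt
    (by norm_num)).hasFDerivAt

theorem fderiv_ham (h : c.Adapted Ω I I₀) (hp : slow p ∈ Ω) (v : Phase) :
    fderiv ℝ c.ham p v = fderiv ℝ c.g (slow p) (slow v) + fderiv ℝ c.R p v := by
  have h1 := ((hasFDerivAt_g h hp).comp p (hasFDerivAt_slow p)).add (hasFDerivAt_R h hp)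
  have h2 : HasFDerivAt c.ham _ p := h1
  rw [h2.fderiv]
  rfl

/-- The chart conjugates the Hamiltonian vector field to `field`. -/
theorem field_fwd (h : c.Adapted Ω I I₀) (hp : p.2.1.2 ∈ I) (hpΩ : slow p ∈ Ω) :
    c.field (c.fwd p) = fderiv ℝ c.fwd p (hamField c.ham p) := by
  rw [fderiv_fwd h hp]
  simp only [field, dfwd, hamField, inv_fwd h, fderiv_ham h hpΩ, dir₁, dir₂, act_fwd h, dψ_fwd h,
    slow]
  have b : ∀ z : ℝ × ℝ × ℝ, ∀ a : ℝ, fderiv ℝ c.g z (1, a, 0)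
      = fderiv ℝ c.g z (1, 0, 0) + a * fderiv ℝ c.g z (0, 1, 0) := fun z a => by
    rw [SaddleFamily.basis_eq 1]
    simp only [map_add, map_smul, smul_eq_mul, one_mul, zero_mul, add_zero]
  have b₁ : ∀ p : Phase, ∀ a b d x : ℝ, fderiv ℝ c.R p ((a, b), (d, x), 0)
      = a * fderiv ℝ c.R p ((1, 0), (0, 0), 0) + b * fderiv ℝ c.R p ((0, 1), (0, 0), 0)
        + d * fderiv ℝ c.R p ((0, 0), (1, 0), 0) + x * fderiv ℝ c.R p ((0, 0), (0, 1), 0) :=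
    fun p a b d x => by
      simp only [← smul_eq_mul, ← map_smul, ← map_add]
      congr 1
      ext <;> simp
  rw [b, b₁ p 0, b₁ p (-1)]
  have e0 : fderiv ℝ c.g (p.1.1, p.2.1.1, p.2.1.2) (0, 0, 0) = 0 := map_zero _
  rw [e0]
  congr 1 <;> ring_nf

/-- The derivative of `dir₁`. -/
noncomputable def ddir₁ (c : Chart) (q v : Coord) : Phase :=
  ((0, deriv (deriv c.ψ) (c.act q) * c.act v), (0, 0), 0)

/-- The derivative of `dir₂`. -/
noncomputable def ddir₂ (c : Chart) (q v : Coord) : Phase :=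
  ((0, deriv (deriv c.j) (c.act q) * c.act v
      + ((c.s₂ (c.act q) * c.act v * c.dψ q + c.s₁ (c.act q) * c.dψ v)
        - (c.s₁ (c.act q) * c.act v * deriv c.ψ (c.act q)
          + c.s (c.act q) * (deriv (deriv c.ψ) (c.act q) * c.act v)))),
    (-(c.s₁ (c.act q) * c.act v), 0), 0)

theorem fderiv_field (h : c.Adapted Ω I I₀) (hq : q ∈ c.dom Ω I) (v : Coord) :
    fderiv ℝ c.field q v = c.split
      (fderiv ℝ (fderiv ℝ c.g) (slow (c.inv q)) (slow (c.dinv q v)) (0, 1, 0)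
        + (fderiv ℝ (fderiv ℝ c.R) (c.inv q) (c.dinv q v) (c.dir₁ q)
          + fderiv ℝ c.R (c.inv q) (c.ddir₁ q v)))
      (-(fderiv ℝ (fderiv ℝ c.g) (slow (c.inv q)) (slow (c.dinv q v)) (1, c.s (c.act q), 0)
          + fderiv ℝ c.g (slow (c.inv q)) (0, c.s₁ (c.act q) * c.act v, 0))
        + (fderiv ℝ (fderiv ℝ c.R) (c.inv q) (c.dinv q v) (c.dir₂ q)
          + fderiv ℝ c.R (c.inv q) (c.ddir₂ q v)))
      (fderiv ℝ (fderiv ℝ c.g) (slow (c.inv q)) (slow (c.dinv q v)) (0, 0, 1)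
        + fderiv ℝ (fderiv ℝ c.R) (c.inv q) (c.dinv q v) ((0, 0), (0, 1), 0),
        -fderiv ℝ (fderiv ℝ c.R) (c.inv q) (c.dinv q v) ((0, 1), (0, 0), 0), 0) := by
  refine fderiv_apply_eq (((contDiffOn_field h).contDiffAt
    ((isOpen_dom h).mem_nhds hq)).differentiableAt (by norm_num)) ?_
  have hI := hasDerivAt_inv (v := v) h hq.1
  have q0 : q + (0 : ℝ) • v = q := by simp
  have hS : HasDerivAt (fun r : ℝ => slow (c.inv (q + r • v))) (slow (c.dinv q v)) 0 :=
    (hasFDerivAt_slow (c.inv q)).comp_hasDerivAt_of_eq 0 hI (by rw [q0])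
  have hG : HasDerivAt (fun r : ℝ => fderiv ℝ c.g (slow (c.inv (q + r • v))))
      (fderiv ℝ (fderiv ℝ c.g) (slow (c.inv q)) (slow (c.dinv q v))) 0 :=
    (h.family.hasFDerivAt_fderiv hq.2).comp_hasDerivAt_of_eq 0 hS (by rw [q0])
  have hR : HasDerivAt (fun r : ℝ => fderiv ℝ c.R (c.inv (q + r • v)))
      (fderiv ℝ (fderiv ℝ c.R) (c.inv q) (c.dinv q v)) 0 :=
    (hasFDerivAt_fderiv_R h hq.2).comp_hasDerivAt_of_eq 0 hI (by rw [q0])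
  obtain ⟨⟨hψψ, -⟩, hjj, -⟩ := h.family.deriv_deriv hq.1
  have h1 : HasDerivAt (fun r : ℝ => deriv c.ψ (c.act (q + r • v))) _ 0 := line_comp act_line hψψ
  have h2 : HasDerivAt (fun r : ℝ => deriv c.j (c.act (q + r • v))) _ 0 := line_comp act_line hjj
  have h3 : HasDerivAt (fun r : ℝ => c.s (c.act (q + r • v))) _ 0 :=
    line_comp act_line (h.shear.deriv _)
  have h4 : HasDerivAt (fun r : ℝ => c.s₁ (c.act (q + r • v))) _ 0 :=
    line_comp act_line (h.shear.deriv₁ _)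
  have hd1 : HasDerivAt (fun r : ℝ => c.dir₁ (q + r • v)) (c.ddir₁ q v) 0 :=
    ((hasDerivAt_const 0 (0 : ℝ)).prodMk h1).prodMk
      (((hasDerivAt_const 0 (1 : ℝ)).prodMk (hasDerivAt_const 0 (0 : ℝ))).prodMk
        (hasDerivAt_const 0 (0 : ℝ)))
  have hd2 : HasDerivAt (fun r : ℝ => c.dir₂ (q + r • v)) (c.ddir₂ q v) 0 := by
    have := ((hasDerivAt_const 0 (-1 : ℝ)).prodMk
      (h2.add ((h4.mul (hasDerivAt_dψ (c := c) (q := q) (v := v))).sub (h3.mul h1)))).prodMk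
      ((h3.neg.prodMk (hasDerivAt_const 0 (0 : ℝ))).prodMk (hasDerivAt_const 0 (0 : ℝ)))
    simp only [zero_smul, add_zero] at this
    exact this
  have hu : HasDerivAt (fun r : ℝ => ((1, c.s (c.act (q + r • v)), 0) : ℝ × ℝ × ℝ))
      (0, c.s₁ (c.act q) * c.act v, 0) 0 :=
    (hasDerivAt_const 0 (1 : ℝ)).prodMk (h3.prodMk (hasDerivAt_const 0 (0 : ℝ)))
  have r1 := hR.clm_apply hd1
  have r2 := hR.clm_apply hd2
  have g2 := hG.clm_apply hu
  have g1 := hG.clm_apply (hasDerivAt_const 0 ((0, 1, 0) : ℝ × ℝ × ℝ))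
  have g3 := hG.clm_apply (hasDerivAt_const 0 ((0, 0, 1) : ℝ × ℝ × ℝ))
  have r3 := hR.clm_apply (hasDerivAt_const 0 (((0, 0), (0, 1), 0) : Phase))
  have r4 := hR.clm_apply (hasDerivAt_const 0 (((0, 1), (0, 0), 0) : Phase))
  simp only [zero_smul, add_zero, map_zero] at r1 r2 g1 g2 g3 r3 r4
  exact hasDerivAt_split (g1.add r1) (g2.neg.add r2)
    ((g3.add r3).prodMk (r4.neg.prodMk (hasDerivAt_const 0 (1 : ℝ))))

end Chart

namespace Chart

variable {c : Chart} {Ω : Set (ℝ × ℝ × ℝ)} {I I₀ : Set ℝ} {q v : Coord} {p : Phase} {y : ℝ}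

/-! ### Estimates in the chart -/

/-- The point of the curve of saddles over `y`. -/
noncomputable def center (c : Chart) (y : ℝ) : ℝ × ℝ × ℝ := (c.ψ y, c.j y, y)

/-- The gradient of `g`. -/
noncomputable def grad (c : Chart) : ℝ × ℝ × ℝ → ℝ × ℝ × ℝ →L[ℝ] ℝ := fderiv ℝ c.g

/-- The Hessian of `g`. -/
noncomputable def hess (c : Chart) : ℝ × ℝ × ℝ → ℝ × ℝ × ℝ →L[ℝ] ℝ × ℝ × ℝ →L[ℝ] ℝ :=
  fderiv ℝ (fderiv ℝ c.g)

section Size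

variable (h : c.Adapted Ω I I₀) (hy : c.act q ∈ I₀) (hq : ‖q.1‖ ≤ 1 ∧ ‖q.2.1‖ ≤ 1) (hv : ‖v‖ ≤ 1)
include h

theorem size_e : SizeLE c.η c.N c.e := by
  rw [SizeLE, Real.norm_eq_abs, abs_of_pos h.e_pos, e]

theorem size_σ : SizeLE c.η 52 c.σ := by
  rw [SizeLE, Real.norm_eq_abs, abs_of_pos h.σ_pos, σ]

theorem size_ω : SizeLE c.η 400 c.ω := by
  rw [SizeLE, Real.norm_eq_abs, abs_of_pos h.ω_pos, ω]

theorem size_zero {x : ℝ} (hx : ‖x‖ ≤ 1) : SizeLE c.η 0 x := by rwa [SizeLE, zpow_zero]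

theorem size_dψ (h1 : ‖v.1‖ ≤ 1) (h2 : ‖v.2.1‖ ≤ 1) : SizeLE c.η (c.N - 1) (c.dψ v) :=
  (size_e h).mul h.η_pos h.η_le ((size_zero h h1).add h.η_pos h.η_le (size_zero h h2) (k := -1)
    (by norm_num) (by norm_num)) (by linarith)

theorem size_dj (h1 : ‖v.1‖ ≤ 1) (h2 : ‖v.2.1‖ ≤ 1) : SizeLE c.η (c.N + 51) (c.dj v) :=
  ((size_e h).mul h.η_pos h.η_le (size_σ h) le_rfl).mul h.η_pos h.η_le
    ((size_zero h h1).sub h.η_pos h.η_le (size_zero h h2) (k := -1)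
    (by norm_num) (by norm_num)) (by linarith)

theorem size_act (h1 : ‖v.2.2.2.1‖ ≤ 1) : SizeLE c.η 400 (c.act v) :=
  (size_ω h).mul h.η_pos h.η_le (size_zero h h1) (by norm_num)

omit h in
theorem slow_inv (q : Coord) : slow (c.inv q)
    = (c.ψ (c.act q) + c.dψ q, c.j (c.act q) + (c.s (c.act q) * c.dψ q + c.dj q), c.act q) := rfl

include hy hq in
theorem size_offset : SizeLE c.η (c.N - 5) (c.s (c.act q) * c.dψ q + c.dj q) :=
  ((h.shear.size _ hy).mul h.η_pos h.η_le (size_dψ h hq.1 hq.2) (k := c.N - 4) (by linarith)).add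
    h.η_pos h.η_le (size_dj h hq.1 hq.2) (by linarith) (by linarith)

include hy hq in
theorem abs_offset_le : |c.s (c.act q) * c.dψ q + c.dj q| ≤ c.η ^ 5 := by
  have := (size_offset h hy hq).mono h.η_pos h.η_le (k := 5) (by linarith [h.le_N])
  exact_mod_cast this

include hy hq in
theorem mem_dom : q ∈ c.dom Ω I := by
  refine ⟨h.sub hy, ?_⟩
  rw [slow_inv]
  refine h.family.mem _ (h.sub hy) _ _ ?_
  rw [add_sub_cancel_left]
  exact abs_offset_le h hy hq

include hy hq in
theorem size_sub_center : SizeLE c.η (c.N - 5) (slow (c.inv q) - c.center (c.act q)) := by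
  have e : slow (c.inv q) - c.center (c.act q)
      = (c.dψ q, c.s (c.act q) * c.dψ q + c.dj q, 0) := by
    rw [slow_inv, center]; ext <;> simp
  rw [e]
  refine ((size_dψ h hq.1 hq.2).mono h.η_pos h.η_le (by linarith)).prod
    ((size_offset h hy hq).prod ?_)
  rw [SizeLE, norm_zero]; exact (zpow_pos h.η_pos _).le

omit hy hq hv in
theorem lipschitz_of_deriv {E : Type*} [NormedAddCommGroup E] [NormedSpace ℝ E]
    {G : ℝ × ℝ × ℝ → E} {G' : ℝ × ℝ × ℝ → ℝ × ℝ × ℝ →L[ℝ] E}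
    (hG : ∀ z ∈ Ω, HasFDerivAt G (G' z) z) (hG' : ∀ z ∈ Ω, SizeLE c.η (-1) (G' z))
    (hy : c.act q ∈ I₀) (hq : ‖q.1‖ ≤ 1 ∧ ‖q.2.1‖ ≤ 1) :
    SizeLE c.η (c.N - 6) (G (slow (c.inv q)) - G (c.center (c.act q))) := by
  set D : Set (ℝ × ℝ × ℝ) := univ ×ˢ (Metric.closedBall (c.j (c.act q)) (c.η ^ 5) ×ˢ {c.act q})
    with hD
  have hDc : Convex ℝ D := convex_univ.prod ((convex_closedBall _ _).prod (convex_singleton _))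
  have hDΩ : D ⊆ Ω := by
    rintro ⟨a, b, d⟩ ⟨-, hb, rfl⟩
    exact h.family.mem _ (h.sub hy) _ _ hb
  have h1 : slow (c.inv q) ∈ D := by
    refine ⟨mem_univ _, ?_, rfl⟩
    rw [Metric.mem_closedBall, Real.dist_eq, slow_inv, add_sub_cancel_left]
    exact abs_offset_le h hy hq
  have h2 : c.center (c.act q) ∈ D :=
    ⟨mem_univ _, Metric.mem_closedBall_self (pow_nonneg h.η_pos.le _), rfl⟩
  have h3 := hDc.norm_image_sub_le_of_norm_hasFDerivWithin_le
    (fun z hz => (hG z (hDΩ hz)).hasFDerivWithinAt) (fun z hz => hG' z (hDΩ hz)) h2 h1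
  have h4 := size_sub_center h hy hq
  refine h3.trans ?_
  have e : c.η ^ (c.N - 6) = c.η ^ (-1 : ℤ) * c.η ^ (c.N - 5) := by
    rw [← zpow_add₀ h.η_pos.ne']; congr 1; ring
  rw [e]
  exact mul_le_mul_of_nonneg_left h4 (zpow_nonneg h.η_pos.le _)

include hy hq in
theorem size_grad_sub :
    SizeLE c.η (c.N - 6) (c.grad (slow (c.inv q)) - c.grad (c.center (c.act q))) :=
  lipschitz_of_deriv h (fun _ hz => h.family.hasFDerivAt_fderiv hz) h.family.g₂ hy hq

include hy hq in
theorem size_hess_sub :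
    SizeLE c.η (c.N - 6) (c.hess (slow (c.inv q)) - c.hess (c.center (c.act q))) :=
  lipschitz_of_deriv h (fun _ hz => h.family.hasFDerivAt_hess hz) h.family.g₃ hy hq

omit hy hq in
theorem size_shear {y : ℝ} (hy : y ∈ I₀) : SizeLE c.η (-3) ((1, c.s y, 0) : ℝ × ℝ × ℝ) := by
  refine SizeLE.prod ?_ ((h.shear.size _ hy).prod ?_)
  · exact (size_zero h (x := 1) (by simp)).mono h.η_pos h.η_le (by norm_num)
  · exact (size_zero h (x := 0) (by simp)).mono h.η_pos h.η_le (by norm_num)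

include hv in
omit h in
theorem comp_le : ‖v.1‖ ≤ 1 ∧ ‖v.2.1‖ ≤ 1 ∧ ‖v.2.2.1‖ ≤ 1 ∧ ‖v.2.2.2.1‖ ≤ 1 ∧ ‖v.2.2.2.2‖ ≤ 1 := by
  simp only [Prod.norm_def, max_le_iff] at hv
  exact ⟨hv.1, hv.2.1, hv.2.2.1, hv.2.2.2.1, hv.2.2.2.2⟩

include hy hq hv in
theorem size_slow_dinv : SizeLE c.η 133 (slow (c.dinv q v)) := by
  obtain ⟨v1, v2, v3, v4, v5⟩ := comp_le hv
  have hN := h.le_N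
  have hI := h.sub hy
  refine SizeLE.prod ?_ (SizeLE.prod ?_ ?_)
  · exact ((h.family.small_ψ hI).mul h.η_pos h.η_le (size_act h v4) (k := 295) (by norm_num)).add
      h.η_pos h.η_le (size_dψ h v1 v2) (by norm_num) (by linarith)
  · have h1 := ((h.shear.size₁ _ hy).mul h.η_pos h.η_le (size_act h v4)
      (k := 290) (by norm_num)).mul h.η_pos h.η_le (size_dψ h hq.1 hq.2) (k := 290) (by linarith)
    have h2 := (h.shear.size _ hy).mul h.η_pos h.η_le (size_dψ h v1 v2) (k := 136) (by linarith)
    have h3 := (h1.add h.η_pos h.η_le h2 (k := 135) (by norm_num) (by norm_num)).add h.η_pos h.η_le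
      (size_dj h v1 v2) (k := 134) (by norm_num) (by linarith)
    exact ((h.family.small_j hI).mul h.η_pos h.η_le (size_act h v4) (k := 295)
      (by norm_num)).add h.η_pos h.η_le h3 (by norm_num) (by norm_num)
  · exact (size_act h v4).mono h.η_pos h.η_le (by norm_num)

include hy hq hv in
theorem size_dinv : SizeLE c.η (-400) (c.dinv q v) := by
  obtain ⟨h1, h2⟩ : SizeLE c.η 133 (c.dinv q v).1.1 ∧ SizeLE c.η 133 (c.dinv q v).2.1 := by
    have := size_slow_dinv h hy hq hv
    simp only [SizeLE, slow, Prod.norm_def, max_le_iff] at this ⊢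
    exact ⟨this.1, this.2⟩
  obtain ⟨v1, v2, v3, v4, v5⟩ := comp_le hv
  refine SizeLE.prod (SizeLE.prod (h1.mono h.η_pos h.η_le (by norm_num)) ?_)
    (SizeLE.prod (h2.mono h.η_pos h.η_le (by norm_num))
      ((size_zero h v5).mono h.η_pos h.η_le (by norm_num)))
  exact (size_zero h v3).div h.η_pos h.η_le (m := 400) (le_abs_self _) (by norm_num)

include hy in
theorem grad_center : c.grad (c.center (c.act q)) (0, 1, 0) = 0 ∧
    c.grad (c.center (c.act q)) (1, c.s (c.act q), 0) = 0 := by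
  have h1 := h.family.crit₁ _ (h.sub hy)
  have h2 := h.family.crit₂ _ (h.sub hy)
  refine ⟨h2, ?_⟩
  rw [SaddleFamily.basis_eq 1]
  simp only [map_add, map_smul, smul_eq_mul, one_mul, zero_mul, add_zero]
  unfold grad center
  rw [h1, h2]
  simp

/-- The entry of the Hessian at the saddle over `y` for the second direction `(0, 1, 0)` of the
chart. -/
noncomputable def h₂₂ (c : Chart) (y : ℝ) : ℝ := c.hess (c.center y) (0, 1, 0) (0, 1, 0)

/-- The entry of the Hessian at the saddle over `y` for the first direction `(1, s, 0)` of the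
chart. -/
noncomputable def h₁₁ (c : Chart) (y : ℝ) : ℝ := c.hess (c.center y) (1, c.s y, 0) (1, c.s y, 0)

/-- The mixed entry of the Hessian at the saddle over `y`, which the shear makes small. -/
noncomputable def h₁₂ (c : Chart) (y : ℝ) : ℝ := c.hess (c.center y) (1, c.s y, 0) (0, 1, 0)

include hy in
theorem hess_center_dinv :
    c.hess (c.center (c.act q)) (slow (c.dinv q v)) (0, 1, 0)
      = c.dψ v * c.h₁₂ (c.act q)
        + (c.s₁ (c.act q) * c.act v * c.dψ q + c.dj v) * c.h₂₂ (c.act q) ∧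
    c.hess (c.center (c.act q)) (slow (c.dinv q v)) (1, c.s (c.act q), 0)
      = c.dψ v * c.h₁₁ (c.act q)
        + (c.s₁ (c.act q) * c.act v * c.dψ q + c.dj v) * c.h₁₂ (c.act q) := by
  have hI := h.sub hy
  have e : slow (c.dinv q v) = c.act v • ((deriv c.ψ (c.act q), deriv c.j (c.act q), 1) : ℝ × ℝ × ℝ)
      + (c.dψ v • ((1, c.s (c.act q), 0) : ℝ × ℝ × ℝ)
        + (c.s₁ (c.act q) * c.act v * c.dψ q + c.dj v) • ((0, 1, 0) : ℝ × ℝ × ℝ)) := by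
    simp only [slow, dinv]
    ext <;> simp <;> ring
  have h1 : c.hess (c.center (c.act q)) (deriv c.ψ (c.act q), deriv c.j (c.act q), 1) (1, 0, 0) = 0 :=
    h.family.hess_curve hI _ h.family.crit₁
  have h2 : c.hess (c.center (c.act q)) (deriv c.ψ (c.act q), deriv c.j (c.act q), 1) (0, 1, 0) = 0 :=
    h.family.hess_curve hI _ h.family.crit₂
  have h3 : c.hess (c.center (c.act q)) (deriv c.ψ (c.act q), deriv c.j (c.act q), 1)
      (1, c.s (c.act q), 0) = 0 := by
    rw [SaddleFamily.basis_eq 1 (c.s (c.act q))]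
    rw [map_add, map_add, map_smul, map_smul, map_smul, h1, h2]
    simp
  have h4 : c.hess (c.center (c.act q)) (0, 1, 0) (1, c.s (c.act q), 0) = c.h₁₂ (c.act q) :=
    h.family.hess_symm (h.family.curve_mem hI) _ _
  rw [e]
  simp only [map_add, map_smul, add_apply, smul_apply, smul_eq_mul, h2, h3, h4]
  constructor
  · simp only [h₁₂, h₂₂]; ring
  · simp only [h₁₁]; ring

include hy hq hv in
/-- The derivative of the first main term. -/
theorem size_main₁ : SizeLE c.η (c.N + 104)
    (c.hess (slow (c.inv q)) (slow (c.dinv q v)) (0, 1, 0) - c.dj v * c.h₂₂ (c.act q)) := by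
  obtain ⟨v1, v2, v3, v4, v5⟩ := comp_le hv
  have hN := h.le_N
  have e : c.hess (slow (c.inv q)) (slow (c.dinv q v)) (0, 1, 0) - c.dj v * c.h₂₂ (c.act q)
      = (c.dψ v * c.h₁₂ (c.act q) + c.s₁ (c.act q) * c.act v * c.dψ q * c.h₂₂ (c.act q))
        + (c.hess (slow (c.inv q)) - c.hess (c.center (c.act q))) (slow (c.dinv q v)) (0, 1, 0) := by
    rw [sub_apply, sub_apply, (hess_center_dinv h hy).1]
    ring
  rw [e]
  have h1 := (size_dψ h v1 v2).mul h.η_pos h.η_le (h.shear.cross _ hy) (k := c.N + 106) (by linarith)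
  have h22 : SizeLE c.η (-1) (c.h₂₂ (c.act q)) := h.family.small_entry (h.sub hy)
    (SaddleFamily.small_e₂ _) (SaddleFamily.small_e₂ _)
  have h2 := (((h.shear.size₁ _ hy).mul h.η_pos h.η_le (size_act h v4)
      (k := 290) (by norm_num)).mul h.η_pos h.η_le (size_dψ h hq.1 hq.2) (k := c.N + 280)
      (by linarith)).mul h.η_pos h.η_le h22 (k := c.N + 106) (by linarith)
  have h3 := ((size_hess_sub h hy hq).apply h.η_pos h.η_le (size_slow_dinv h hy hq hv)
    (k := c.N + 127) (by linarith)).apply h.η_pos h.η_le (SaddleFamily.small_e₂ _) (k := c.N + 105)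
    (by linarith)
  exact (h1.add h.η_pos h.η_le h2 (k := c.N + 105) (by linarith) (by linarith)).add h.η_pos h.η_le h3
    (by linarith) (by linarith)

include hy hq hv in
/-- The derivative of the second main term. -/
theorem size_main₂ : SizeLE c.η (c.N + 120)
    (-(c.hess (slow (c.inv q)) (slow (c.dinv q v)) (1, c.s (c.act q), 0)
          + c.grad (slow (c.inv q)) (0, c.s₁ (c.act q) * c.act v, 0))
      - c.dψ v * -c.h₁₁ (c.act q)) := by
  obtain ⟨v1, v2, v3, v4, v5⟩ := comp_le hv
  have hN := h.le_N
  have e0 : ((0, c.s₁ (c.act q) * c.act v, 0) : ℝ × ℝ × ℝ)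
      = (c.s₁ (c.act q) * c.act v) • (0, 1, 0) := by ext <;> simp
  have e : -(c.hess (slow (c.inv q)) (slow (c.dinv q v)) (1, c.s (c.act q), 0)
          + c.grad (slow (c.inv q)) (0, c.s₁ (c.act q) * c.act v, 0))
      - c.dψ v * -c.h₁₁ (c.act q)
      = -(((c.s₁ (c.act q) * c.act v * c.dψ q + c.dj v) * c.h₁₂ (c.act q)
        + (c.hess (slow (c.inv q)) - c.hess (c.center (c.act q))) (slow (c.dinv q v))
          (1, c.s (c.act q), 0))
        + (c.s₁ (c.act q) * c.act v) *
          (c.grad (slow (c.inv q)) - c.grad (c.center (c.act q))) (0, 1, 0)) := by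
    rw [sub_apply, sub_apply, sub_apply, (hess_center_dinv h hy).2, (grad_center h hy).1, e0,
      map_smul, smul_eq_mul]
    ring
  rw [e]
  have h0 := (h.shear.size₁ _ hy).mul h.η_pos h.η_le (size_act h v4) (k := 290) (by norm_num)
  have h1 := (h0.mul h.η_pos h.η_le (size_dψ h hq.1 hq.2) (k := c.N + 50)
      (by linarith)).add h.η_pos h.η_le (size_dj h v1 v2) (k := c.N + 49) (by linarith) (by linarith)
  have h2 := h1.mul h.η_pos h.η_le (h.shear.cross _ hy) (k := c.N + 122) (by linarith)
  have h3 := ((size_hess_sub h hy hq).apply h.η_pos h.η_le (size_slow_dinv h hy hq hv)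
    (k := c.N + 127) (by linarith)).apply h.η_pos h.η_le (size_shear h hy) (k := c.N + 122)
    (by linarith)
  have h4 := h0.mul h.η_pos h.η_le ((size_grad_sub h hy hq).apply h.η_pos h.η_le
    (SaddleFamily.small_e₂ _) (k := c.N - 6) (by linarith)) (k := c.N + 122) (by linarith)
  exact ((h2.add h.η_pos h.η_le h3 (k := c.N + 121) (by linarith) (by linarith)).add h.η_pos h.η_le h4
    (by linarith) (by linarith)).neg

include hy hq in
theorem size_dir : SizeLE c.η (-110) (c.dir₁ q) ∧ SizeLE c.η (-110) (c.dir₂ q) := by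
  have hN := h.le_N
  have hI := h.sub hy
  have z : SizeLE c.η (-110) (0 : ℝ) := (size_zero h (by simp)).mono h.η_pos h.η_le (by norm_num)
  have o : SizeLE c.η (-110) (1 : ℝ) := (size_zero h (by simp)).mono h.η_pos h.η_le (by norm_num)
  have hψ := h.family.small_ψ hI
  have hj := h.family.small_j hI
  have hs := h.shear.size _ hy
  have h1 := (h.shear.size₁ _ hy).mul h.η_pos h.η_le (size_dψ h hq.1 hq.2) (k := 0) (by linarith)
  have h2 := hs.mul h.η_pos h.η_le hψ (k := -108) (by norm_num)
  refine ⟨(z.prod (hψ.mono h.η_pos h.η_le (by norm_num))).prod ((o.prod z).prod z),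
    (o.neg.prod ?_).prod (((hs.neg.mono h.η_pos h.η_le (by norm_num)).prod z).prod z)⟩
  exact hj.add h.η_pos h.η_le (h1.sub h.η_pos h.η_le h2 (k := -109) (by norm_num) (by norm_num))
    (by norm_num) (by norm_num)

include hy hq hv in
theorem size_ddir : SizeLE c.η 0 (c.ddir₁ q v) ∧ SizeLE c.η 0 (c.ddir₂ q v) := by
  obtain ⟨v1, v2, v3, v4, v5⟩ := comp_le hv
  have hN := h.le_N
  have hI := h.sub hy
  have z : SizeLE c.η 0 (0 : ℝ) := size_zero h (by simp)
  have hψ := h.family.small_ψ hI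
  obtain ⟨⟨-, hψψ⟩, -, hjj⟩ := h.family.deriv_deriv hI
  have hs := h.shear.size _ hy
  have hk := size_act h v4
  have hψk := hψψ.mul h.η_pos h.η_le hk (k := 82) (by norm_num)
  have hjk := hjj.mul h.η_pos h.η_le hk (k := 82) (by norm_num)
  have h1k := (h.shear.size₁ _ hy).mul h.η_pos h.η_le hk (k := 290) (by norm_num)
  have h1 := ((h.shear.size₂ _ hy).mul h.η_pos h.η_le hk (k := 69) (by norm_num)).mul h.η_pos h.η_le
    (size_dψ h hq.1 hq.2) (k := 20) (by linarith)
  have h2 := (h.shear.size₁ _ hy).mul h.η_pos h.η_le (size_dψ h v1 v2) (k := 20) (by linarith)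
  have h3 := h1k.mul h.η_pos h.η_le hψ (k := 20) (by norm_num)
  have h4 := hs.mul h.η_pos h.η_le hψk (k := 20) (by norm_num)
  refine ⟨(z.prod (hψk.mono h.η_pos h.η_le (by norm_num))).prod ((z.prod z).prod z),
    (z.prod ?_).prod (((h1k.neg.mono h.η_pos h.η_le (by norm_num)).prod z).prod z)⟩
  exact hjk.add h.η_pos h.η_le ((h1.add h.η_pos h.η_le h2 (k := 19) (by norm_num)
    (by norm_num)).sub h.η_pos h.η_le (h3.add h.η_pos h.η_le h4 (k := 19) (by norm_num)
    (by norm_num)) (k := 18) (by norm_num) (by norm_num)) (by norm_num) (by norm_num)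

include hy hq hv in
/-- The derivatives of the terms of the remainder. -/
theorem size_rem {d d' : Phase} (hd : SizeLE c.η (-110) d) (hd' : SizeLE c.η 0 d') :
    SizeLE c.η 1270 (fderiv ℝ (fderiv ℝ c.R) (c.inv q) (c.dinv q v) d
      + fderiv ℝ c.R (c.inv q) d') := by
  have hm := (mem_dom h hy hq).2
  exact (((h.family.R₂ _ hm).apply h.η_pos h.η_le (size_dinv h hy hq hv) (k := 1390)
    (by norm_num)).apply h.η_pos h.η_le hd (k := 1280) (by norm_num)).add h.η_pos h.η_le
    ((h.family.R₁ _ hm).apply h.η_pos h.η_le hd' (k := 1280) (by norm_num)) (by norm_num)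
    (by norm_num)

end Size

end Chart

namespace Chart

variable {c : Chart} {Ω : Set (ℝ × ℝ × ℝ)} {I I₀ : Set ℝ} {q v : Coord} {p : Phase} {y : ℝ}

/-- The rate of expansion in the chart. -/
noncomputable def rate (c : Chart) : ℝ := c.η ^ (-62 : ℤ)

/-- The margin of hyperbolicity in the chart: half of the lower bound `η ^ 53` for the eigenvalues is
left after all errors. -/
noncomputable def margin (c : Chart) : ℝ := c.η ^ (54 : ℤ)

/-- In diagonalising coordinates, `Λ` dominates the linear saddle by the smaller of the two
entries `X`, `Y` of its matrix. -/
theorem abs_saddle_sub_le {X Y Λ m a b N : ℝ} (hX : m ≤ X) (hY : m ≤ Y) (hXΛ : X ≤ Λ) (hYΛ : Y ≤ Λ)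
    (ha : |a| ≤ N) (hb : |b| ≤ N) :
    |(X * (a - b) + Y * (a + b)) / 2 - Λ * a| ≤ (Λ - m) * N ∧
      |(X * (a - b) - Y * (a + b)) / 2 + Λ * b| ≤ (Λ - m) * N := by
  have hN : 0 ≤ N := (abs_nonneg a).trans ha
  have key : |Y - X| / 2 + (Λ - (X + Y) / 2) ≤ Λ - m := by
    rcases abs_cases (Y - X) with ⟨h1, -⟩ | ⟨h1, -⟩ <;> rw [h1] <;> linarith
  have h0 : 0 ≤ Λ - (X + Y) / 2 := by linarith
  have aux : ∀ u w : ℝ, |u| ≤ N → |w| ≤ N →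
      |(Λ - (X + Y) / 2) * u + (Y - X) / 2 * w| ≤ (Λ - m) * N := by
    intro u w hu hw
    refine (abs_add_le _ _).trans ?_
    rw [abs_mul, abs_mul, abs_of_nonneg h0, abs_div, abs_two]
    have h1 := mul_le_mul_of_nonneg_left hu h0
    have h2 := mul_le_mul_of_nonneg_left hw (by positivity : 0 ≤ |Y - X| / 2)
    have h3 := mul_le_mul_of_nonneg_right key hN
    linarith
  constructor
  · have := aux (-a) b (by rwa [abs_neg]) hb
    convert this using 2
    ring
  · have := aux b (-a) hb (by rwa [abs_neg])
    convert this using 2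
    ring

section Size

variable (h : c.Adapted Ω I I₀) (hy : c.act q ∈ I₀) (hq : ‖q.1‖ ≤ 1 ∧ ‖q.2.1‖ ≤ 1) (hv : ‖v‖ ≤ 1)
include h hy

/-- The two entries of the linear saddle in the chart: the ratio `σ` of the axes makes both of them at
least `η ^ 53`. -/
theorem axes : c.η ^ (53 : ℤ) ≤ c.σ * c.h₂₂ (c.act q) ∧ c.σ * c.h₂₂ (c.act q) ≤ c.rate ∧
    c.η ^ (53 : ℤ) ≤ -c.h₁₁ (c.act q) / c.σ ∧ -c.h₁₁ (c.act q) / c.σ ≤ c.rate := by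
  have h22 : SizeLE c.η (-1) (c.h₂₂ (c.act q)) := h.family.small_entry (h.sub hy)
    (SaddleFamily.small_e₂ _) (SaddleFamily.small_e₂ _)
  have h11 : SizeLE c.η (-10) (c.h₁₁ (c.act q)) :=
    ((h.family.g₂ _ (h.family.curve_mem (h.sub hy))).apply h.η_pos h.η_le (size_shear h hy)
      (k := -4) (by norm_num)).apply h.η_pos h.η_le (size_shear h hy) (by norm_num)
  refine ⟨?_, ?_, ?_, ?_⟩
  · have h1 : c.η ≤ c.h₂₂ (c.act q) := h.family.convex _ (h.sub hy)
    calc c.η ^ (53 : ℤ) = c.σ * c.η := by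
          rw [σ, ← zpow_add_one₀ h.η_pos.ne']; norm_num
      _ ≤ _ := mul_le_mul_of_nonneg_left h1 h.σ_pos.le
  · exact (le_abs_self _).trans ((size_σ h).mul h.η_pos h.η_le h22 (k := -62) (by norm_num))
  · rw [le_div_iff₀ h.σ_pos]
    refine le_trans ?_ (h.shear.diag _ hy)
    rw [σ, ← zpow_add₀ h.η_pos.ne']
    exact zpow_le_zpow_right_of_le_one₀ h.η_pos (by linarith [h.η_le]) (by norm_num)
  · exact (le_abs_self _).trans (h11.neg.div h.η_pos h.η_le (m := 52) (le_abs_self _) (by norm_num))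

include hq hv

/-- The derivative of the field in the chart is close to a linear saddle. -/
theorem size_fderiv_field :
    SizeLE c.η 54 ((fderiv ℝ c.field q v).1 - (c.σ * c.h₂₂ (c.act q) * (v.1 - v.2.1)
      + -c.h₁₁ (c.act q) / c.σ * (v.1 + v.2.1)) / 2) ∧
    SizeLE c.η 54 ((fderiv ℝ c.field q v).2.1 - (c.σ * c.h₂₂ (c.act q) * (v.1 - v.2.1)
      - -c.h₁₁ (c.act q) / c.σ * (v.1 + v.2.1)) / 2) ∧
    SizeLE c.η 500 (fderiv ℝ c.field q v).2.2 := by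
  have hN := h.le_N
  have hN' := h.N_le
  have he := h.e_pos.ne'
  have hσ := h.σ_pos.ne'
  have m1 := size_main₁ h hy hq hv
  have m2 := size_main₂ h hy hq hv
  have r1 := size_rem h hy hq hv (size_dir h hy hq).1 (size_ddir h hy hq hv).1
  have r2 := size_rem h hy hq hv (size_dir h hy hq).2 (size_ddir h hy hq hv).2
  have hm := (mem_dom h hy hq).2
  rw [fderiv_field h (mem_dom h hy hq)]
  have f1 := (m1.add h.η_pos h.η_le r1 (k := c.N + 103) (by linarith) (by linarith))
  have f2 := (m2.add h.η_pos h.η_le r2 (k := c.N + 119) (by linarith) (by linarith))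
  have g1 := f1.div h.η_pos h.η_le (m := c.N) (y := c.e) (le_abs_self _) (k := 103) (by linarith)
  have g2 := f2.div h.η_pos h.η_le (m := c.N + 52) (y := c.e * c.σ) (by
    rw [e, σ, ← zpow_add₀ h.η_pos.ne']; exact le_abs_self _) (k := 67) (by linarith)
  have half : ∀ {x : ℝ}, SizeLE c.η 54 x → SizeLE c.η 54 (x / 2) := fun {x} hx => by
    rw [SizeLE, norm_div]
    refine (div_le_self (norm_nonneg _) (by norm_num)).trans hx
  have k1 := half (g1.add h.η_pos h.η_le g2 (by norm_num) (by norm_num))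
  have k2 := half (g1.sub h.η_pos h.η_le g2 (by norm_num) (by norm_num))
  simp only [split, hess, grad] at k1 k2 ⊢
  refine ⟨?_, ?_, ?_⟩
  · convert k1 using 1
    simp only [dψ, dj]
    field_simp
    ring
  · convert k2 using 1
    simp only [dψ, dj]
    field_simp
    ring
  · have q3 : SizeLE c.η 132 (c.hess (slow (c.inv q)) (slow (c.dinv q v)) (0, 0, 1)) :=
      ((h.family.g₂ _ hm).apply h.η_pos h.η_le (size_slow_dinv h hy hq hv) (k := 132)
        (by norm_num)).apply h.η_pos h.η_le (SaddleFamily.small_e₃ _) (by norm_num)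
    have o : ∀ d : Phase, ‖d‖ ≤ 1 →
        SizeLE c.η 1390 (fderiv ℝ (fderiv ℝ c.R) (c.inv q) (c.dinv q v) d) := fun d hd =>
      ((h.family.R₂ _ hm).apply h.η_pos h.η_le (size_dinv h hy hq hv) (k := 1390)
        (by norm_num)).apply h.η_pos h.η_le (m := 0) (by rwa [SizeLE, zpow_zero]) (by norm_num)
    have o1 := o ((0, 0), (0, 1), 0) (by simp [Prod.norm_def])
    have o2 := o ((0, 1), (0, 0), 0) (by simp [Prod.norm_def])
    refine SizeLE.prod ?_ (SizeLE.prod ?_ ?_)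
    · exact (size_ω h).mul h.η_pos h.η_le (q3.add h.η_pos h.η_le o1 (k := 131) (by norm_num)
        (by norm_num)) (by norm_num)
    · exact o2.neg.div h.η_pos h.η_le (m := 400) (le_abs_self _) (by norm_num)
    · rw [SizeLE, norm_zero]; exact zpow_nonneg h.η_pos.le _

end Size

/-- On the curve of saddles only the remainder contributes to the field in the first two
directions. -/
theorem size_field_zero (h : c.Adapted Ω I I₀) (hq : q.1 = 0 ∧ q.2.1 = 0) (hy : c.act q ∈ I₀) :
    SizeLE c.η 1000 (c.field q).1 ∧ SizeLE c.η 1000 (c.field q).2.1 ∧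
      SizeLE c.η (-3) (c.field q).2.2 := by
  have hN := h.le_N
  have hN' := h.N_le
  have hq' : ‖q.1‖ ≤ 1 ∧ ‖q.2.1‖ ≤ 1 := by rw [hq.1, hq.2]; simp
  have hm := (mem_dom h hy hq').2
  have hc : slow (c.inv q) = c.center (c.act q) := by
    rw [slow_inv, center]; simp [dψ, dj, hq.1, hq.2]
  have r : ∀ d : Phase, SizeLE c.η (-110) d → SizeLE c.η 1680 (fderiv ℝ c.R (c.inv q) d) :=
    fun d hd => (h.family.R₁ _ hm).apply h.η_pos h.η_le hd (by norm_num)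
  have r1 := r _ (size_dir h hy hq').1
  have r2 := r _ (size_dir h hy hq').2
  have g1 := r1.div h.η_pos h.η_le (m := c.N) (y := c.e) (le_abs_self _) (k := 1001) (by linarith)
  have g2 := r2.div h.η_pos h.η_le (m := c.N + 52) (y := c.e * c.σ) (by
    rw [e, σ, ← zpow_add₀ h.η_pos.ne']; exact le_abs_self _) (k := 1001) (by linarith)
  have half : ∀ {x : ℝ}, SizeLE c.η 1000 x → SizeLE c.η 1000 (x / 2) := fun {x} hx => by
    rw [SizeLE, norm_div]
    refine (div_le_self (norm_nonneg _) (by norm_num)).trans hx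
  have k1 := half (g1.add h.η_pos h.η_le g2 (k := 1000) (by norm_num) (by norm_num))
  have k2 := half (g1.sub h.η_pos h.η_le g2 (k := 1000) (by norm_num) (by norm_num))
  obtain ⟨z1, z2⟩ := grad_center h hy
  have e1 : fderiv ℝ c.g (slow (c.inv q)) (0, 1, 0) = 0 := by rw [hc]; exact z1
  have e2 : fderiv ℝ c.g (slow (c.inv q)) (1, c.s (c.act q), 0) = 0 := by rw [hc]; exact z2
  simp only [field, e1, e2, split, zero_add, neg_zero]
  refine ⟨k1, k2, ?_⟩
  have o : ∀ d : Phase, ‖d‖ ≤ 1 → SizeLE c.η 1680 (fderiv ℝ c.R (c.inv q) d) := fun d hd =>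
    r d (SizeLE.mono h.η_pos h.η_le (n := 0) (by rwa [SizeLE, zpow_zero]) (by norm_num))
  have o1 := o ((0, 0), (0, 1), 0) (by simp [Prod.norm_def])
  have o2 := o ((0, 1), (0, 0), 0) (by simp [Prod.norm_def])
  have q3 : SizeLE c.η (-1) (fderiv ℝ c.g (slow (c.inv q)) (0, 0, 1)) :=
    (h.family.g₁ _ hm).apply h.η_pos h.η_le (SaddleFamily.small_e₃ _) (by norm_num)
  refine SizeLE.prod ?_ (SizeLE.prod ?_ ?_)
  · exact (size_ω h).mul h.η_pos h.η_le (q3.add h.η_pos h.η_le o1 (k := -2) (by norm_num)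
      (by norm_num)) (by norm_num)
  · exact o2.neg.div h.η_pos h.η_le (m := 400) (le_abs_self _) (by norm_num)
  · exact (size_zero h (x := 1) (by simp)).mono h.η_pos h.η_le (by norm_num)

/-! ### The field extended beyond the ends of the curve -/

/-- The projection forgetting `Jᶠ`. -/
def forget : Coord →L[ℝ] Coord :=
  (ContinuousLinearMap.fst ℝ ℝ _).prod
    (((ContinuousLinearMap.fst ℝ ℝ _).comp (ContinuousLinearMap.snd ℝ ℝ _)).prod
    ((((ContinuousLinearMap.fst ℝ ℝ _).comp (ContinuousLinearMap.snd ℝ ℝ _)).comp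
      (ContinuousLinearMap.snd ℝ ℝ _)).prod ((0 : Coord →L[ℝ] ℝ).prod
      ((((ContinuousLinearMap.snd ℝ ℝ _).comp (ContinuousLinearMap.snd ℝ ℝ _)).comp
      (ContinuousLinearMap.snd ℝ ℝ _)).comp (ContinuousLinearMap.snd ℝ ℝ _)))))

/-- The coordinate `Jᶠ`. -/
def actCoord : Coord →L[ℝ] ℝ :=
  (((ContinuousLinearMap.fst ℝ ℝ ℝ).comp (ContinuousLinearMap.snd ℝ ℝ _)).comp
      (ContinuousLinearMap.snd ℝ ℝ _)).comp (ContinuousLinearMap.snd ℝ ℝ _)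

/-- The map of the chart which clamps `Jᶠ` by the function `k`. The curve of saddles has end points,
while the base of a saddle field is a whole vector space. Evaluating the field at `clamp c k q`, with
a map `k` into the range of the curve that is the identity near the interval of interest, changes
neither the field over this interval nor its symmetries. -/
noncomputable def clamp (c : Chart) (k : ℝ → ℝ) (q : Coord) : Coord :=
  forget q + (k (c.act q) * c.ω⁻¹) • (0, 0, (0, 1, 0))

/-- The derivative of the clamping map. -/
noncomputable def clampDeriv (c : Chart) (k' : ℝ → ℝ) (q : Coord) : Coord →L[ℝ] Coord :=
  forget + k' (c.act q) • actCoord.smulRight (0, 0, (0, 1, 0))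

theorem hasFDerivAt_clamp (h : c.Adapted Ω I I₀) {k k' : ℝ → ℝ} (hk : ∀ y, HasDerivAt k (k' y) y)
    (q : Coord) : HasFDerivAt (c.clamp k) (c.clampDeriv k' q) q := by
  have h1 : HasFDerivAt c.act (c.ω • actCoord) q := (actCoord.hasFDerivAt).const_mul c.ω
  have h2 := (((hk (c.act q)).comp_hasFDerivAt q h1).mul_const c.ω⁻¹).smul_const
    ((0, 0, (0, 1, 0)) : Coord)
  have h3 := (forget.hasFDerivAt (x := q)).add h2
  have e : c.clampDeriv k' q
      = forget + (c.ω⁻¹ • k' (c.act q) • c.ω • actCoord).smulRight ((0, 0, (0, 1, 0)) : Coord) := by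
    have h0 := h.ω_pos.ne'
    refine ContinuousLinearMap.ext fun v => ?_
    have e0 : c.ω⁻¹ * (k' (c.act q) * (c.ω * actCoord v)) = k' (c.act q) * actCoord v := by
      field_simp
    simp [clampDeriv, e0]
  rw [e]
  exact h3

theorem clamp_eq (k : ℝ → ℝ) (q : Coord) :
    c.clamp k q = (q.1, q.2.1, (q.2.2.1, k (c.act q) / c.ω, q.2.2.2.2)) := by
  simp [clamp, forget, div_eq_mul_inv]

theorem clampDeriv_apply (k' : ℝ → ℝ) (q v : Coord) :
    c.clampDeriv k' q v = (v.1, v.2.1, (v.2.2.1, k' (c.act q) * v.2.2.2.1, v.2.2.2.2)) := by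
  simp [clampDeriv, forget, actCoord]

theorem act_clamp (h : c.Adapted Ω I I₀) (k : ℝ → ℝ) (q : Coord) :
    c.act (c.clamp k q) = k (c.act q) := by
  have := h.ω_pos.ne'
  simp only [clamp_eq, act]
  field_simp

theorem norm_clampDeriv_le {k' : ℝ → ℝ} (hk : ∀ y, 0 ≤ k' y ∧ k' y ≤ 1) (q v : Coord) :
    ‖c.clampDeriv k' q v‖ ≤ ‖v‖ := by
  rw [clampDeriv_apply]
  have h1 : ‖k' (c.act q) * v.2.2.2.1‖ ≤ ‖v.2.2.2.1‖ := by
    rw [norm_mul, Real.norm_eq_abs, abs_of_nonneg (hk _).1]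
    exact mul_le_of_le_one_left (norm_nonneg _) (hk _).2
  simp only [Prod.norm_def]
  gcongr

/-- The derivative of the clamped field. -/
noncomputable def fieldDeriv (c : Chart) (k k' : ℝ → ℝ) (q : Coord) : Coord →L[ℝ] Coord :=
  (fderiv ℝ c.field (c.clamp k q)).comp (c.clampDeriv k' q)

theorem abs_le_of_unit {A : Coord →L[ℝ] ℝ} {b : ℝ} (hb : 0 ≤ b) (hA : ∀ v, ‖v‖ ≤ 1 → ‖A v‖ ≤ b)
    (v : Coord) : |A v| ≤ b * ‖v‖ :=
  A.le_of_opNorm_le (A.opNorm_le_of_unit_norm hb fun v hv => hA v hv.le) v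

/-- In the chart, the Hamiltonian vector field with clamped `Jᶠ` is a saddle field. -/
theorem saddleField (h : c.Adapted Ω I I₀) {k k' : ℝ → ℝ} (hk : ∀ y, HasDerivAt k (k' y) y)
    (hk' : Continuous k') (hk01 : ∀ y, 0 ≤ k' y ∧ k' y ≤ 1) (hkI : ∀ y, k y ∈ I₀) :
    SaddleField (U := ℝ × ℝ × ℝ) (fun q => c.field (c.clamp k q)) (c.fieldDeriv k k')
      c.rate c.margin (c.η ^ (500 : ℤ)) (c.η ^ (1000 : ℤ)) := by
  have hη := h.η_pos
  have hη' := h.η_le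
  have hbox : ∀ q ∈ box (ℝ × ℝ × ℝ), c.act (c.clamp k q) ∈ I₀ ∧
      (‖(c.clamp k q).1‖ ≤ 1 ∧ ‖(c.clamp k q).2.1‖ ≤ 1) := fun q hq => by
    rw [act_clamp h]
    exact ⟨hkI _, by rw [clamp_eq]; exact hq⟩
  have hdom : ∀ q ∈ box (ℝ × ℝ × ℝ), c.clamp k q ∈ c.dom Ω I := fun q hq =>
    mem_dom h (hbox q hq).1 (hbox q hq).2
  have hm : 2 * c.margin ≤ c.η ^ (53 : ℤ) := SizeLE.two_mul_zpow_le hη hη' (by norm_num)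
  have hm0 : 0 < c.margin := zpow_pos hη _
  have hcont : Continuous (c.clamp k) :=
    continuous_iff_continuousAt.2 fun q => (hasFDerivAt_clamp h hk q).continuousAt
  have row : ∀ q ∈ box (ℝ × ℝ × ℝ), ∀ v,
      |(c.fieldDeriv k k' q v).1 - c.rate * v.1| ≤ (c.rate - c.margin) * ‖v‖ ∧
      |(c.fieldDeriv k k' q v).2.1 + c.rate * v.2.1| ≤ (c.rate - c.margin) * ‖v‖ ∧
      ‖(c.fieldDeriv k k' q v).2.2‖ ≤ c.η ^ (500 : ℤ) * ‖v‖ := by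
    intro q hq v
    obtain ⟨hy, hq'⟩ := hbox q hq
    obtain ⟨a1, a2, a3, a4⟩ := axes h hy
    set X := c.σ * c.h₂₂ (c.act (c.clamp k q)) with hX
    set Y := -c.h₁₁ (c.act (c.clamp k q)) / c.σ with hY
    set w := c.clampDeriv k' q v with hw
    have w1 : w.1 = v.1 := by rw [hw, clampDeriv_apply]
    have w2 : w.2.1 = v.2.1 := by rw [hw, clampDeriv_apply]
    have wv : ‖w‖ ≤ ‖v‖ := norm_clampDeriv_le hk01 q v
    have n1 : |v.1| ≤ ‖v‖ := norm_fst_le v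
    have n2 : |v.2.1| ≤ ‖v‖ := (norm_fst_le _).trans (norm_snd_le v)
    obtain ⟨b1, b2⟩ := abs_saddle_sub_le a1 a3 a2 a4 n1 n2
    set T := fderiv ℝ c.field (c.clamp k q) with hT
    have hm' := fun v (hv : ‖v‖ ≤ 1) => size_fderiv_field (v := v) h hy hq' hv
    have c1 := abs_le_of_unit (b := c.margin) hm0.le
      (A := (ContinuousLinearMap.fst ℝ ℝ _).comp T - ((2 : ℝ)⁻¹) • (X • (ContinuousLinearMap.fst ℝ ℝ _
        - (ContinuousLinearMap.fst ℝ ℝ _).comp (ContinuousLinearMap.snd ℝ ℝ _))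
        + Y • (ContinuousLinearMap.fst ℝ ℝ _
        + (ContinuousLinearMap.fst ℝ ℝ _).comp (ContinuousLinearMap.snd ℝ ℝ _))))
      (fun v hv => by
        have := (hm' v hv).1
        rw [div_eq_inv_mul] at this
        exact this) w
    have c2 := abs_le_of_unit (b := c.margin) hm0.le
      (A := ((ContinuousLinearMap.fst ℝ ℝ _).comp (ContinuousLinearMap.snd ℝ ℝ _)).comp T
        - ((2 : ℝ)⁻¹) • (X • (ContinuousLinearMap.fst ℝ ℝ _
        - (ContinuousLinearMap.fst ℝ ℝ _).comp (ContinuousLinearMap.snd ℝ ℝ _))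
        - Y • (ContinuousLinearMap.fst ℝ ℝ _
        + (ContinuousLinearMap.fst ℝ ℝ _).comp (ContinuousLinearMap.snd ℝ ℝ _))))
      (fun v hv => by
        have := (hm' v hv).2.1
        rw [div_eq_inv_mul] at this
        exact this) w
    have d1 : |(T w).1 - (X * (v.1 - v.2.1) + Y * (v.1 + v.2.1)) / 2| ≤ c.margin * ‖v‖ := by
      rw [← w1, ← w2, div_eq_inv_mul]
      exact c1.trans (mul_le_mul_of_nonneg_left wv hm0.le)
    have d2 : |(T w).2.1 - (X * (v.1 - v.2.1) - Y * (v.1 + v.2.1)) / 2| ≤ c.margin * ‖v‖ := by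
      rw [← w1, ← w2, div_eq_inv_mul]
      exact c2.trans (mul_le_mul_of_nonneg_left wv hm0.le)
    have hfin : (c.rate - c.η ^ (53 : ℤ)) * ‖v‖ + c.margin * ‖v‖ ≤ (c.rate - c.margin) * ‖v‖ := by
      rw [← add_mul]
      exact mul_le_mul_of_nonneg_right (by linarith) (norm_nonneg _)
    refine ⟨?_, ?_, ?_⟩
    · refine le_trans ?_ hfin
      have e1 : (T w).1 - c.rate * v.1 = ((X * (v.1 - v.2.1) + Y * (v.1 + v.2.1)) / 2 - c.rate * v.1)
        + ((T w).1 - (X * (v.1 - v.2.1) + Y * (v.1 + v.2.1)) / 2) := by ring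
      change |(T w).1 - c.rate * v.1| ≤ _
      rw [e1]
      exact (abs_add_le _ _).trans (add_le_add b1 d1)
    · refine le_trans ?_ hfin
      have e1 : (T w).2.1 + c.rate * v.2.1
        = ((X * (v.1 - v.2.1) - Y * (v.1 + v.2.1)) / 2 + c.rate * v.2.1)
        + ((T w).2.1 - (X * (v.1 - v.2.1) - Y * (v.1 + v.2.1)) / 2) := by ring
      change |(T w).2.1 + c.rate * v.2.1| ≤ _
      rw [e1]
      exact (abs_add_le _ _).trans (add_le_add b2 d2)
    · set A := ((ContinuousLinearMap.snd ℝ ℝ (ℝ × ℝ × ℝ)).comp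
        (ContinuousLinearMap.snd ℝ ℝ (ℝ × ℝ × ℝ × ℝ))).comp T with hA
      have c3 : ‖A‖ ≤ c.η ^ (500 : ℤ) :=
        A.opNorm_le_of_unit_norm (zpow_nonneg hη.le _) fun v hv => (hm' v hv.le).2.2
      exact (A.le_of_opNorm_le c3 w).trans (mul_le_mul_of_nonneg_left wv (zpow_nonneg hη.le _))
  have hzero : ∀ u : ℝ × ℝ × ℝ, SizeLE c.η 1000 (c.field (c.clamp k (0, 0, u))).1 ∧
      SizeLE c.η 1000 (c.field (c.clamp k (0, 0, u))).2.1 ∧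
      SizeLE c.η (-3) (c.field (c.clamp k (0, 0, u))).2.2 := fun u =>
    size_field_zero h (by rw [clamp_eq]; simp) (by rw [act_clamp h]; exact hkI _)
  refine
    { deriv := fun q hq => ?_
      cont := ?_
      row₁ := fun q hq v => (row q hq v).1
      row₂ := fun q hq v => (row q hq v).2.1
      row₃ := fun q hq v => (row q hq v).2.2
      small₁ := fun u => (hzero u).1
      small₂ := fun u => (hzero u).2.1
      base := ⟨_, fun u => (hzero u).2.2⟩
      lam_pos := hm0
      lam_le := zpow_le_zpow_right_of_le_one₀ hη (by linarith) (by norm_num)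
      μ_nonneg := zpow_nonneg hη.le _
      gap := ?_
      ε_nonneg := zpow_nonneg hη.le _
      ε_le := zpow_le_zpow_right_of_le_one₀ hη (by linarith) (by norm_num) }
  · exact ((((contDiffOn_field h).contDiffAt
      ((isOpen_dom h).mem_nhds (hdom q hq))).differentiableAt (by norm_num)).hasFDerivAt).comp q
      (hasFDerivAt_clamp h hk q)
  · have h1 : ContinuousOn (fun q => fderiv ℝ c.field (c.clamp k q)) (box (ℝ × ℝ × ℝ)) :=
      ((contDiffOn_field h).continuousOn_fderiv_of_isOpen (isOpen_dom h) le_rfl).comp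
        hcont.continuousOn hdom
    have h2 : Continuous (c.clampDeriv k') :=
      continuous_const.add ((hk'.comp contDiff_act.continuous).smul continuous_const)
    exact h1.clm_comp h2.continuousOn
  · have e1 : c.η ^ (500 : ℤ) * c.rate = c.η ^ (438 : ℤ) := by
      rw [rate, ← zpow_add₀ hη.ne']; norm_num
    have e2 : c.margin ^ 2 = c.η ^ (108 : ℤ) := by
      rw [margin, sq, ← zpow_add₀ hη.ne']; norm_num
    rw [mul_assoc, e1, e2]
    have t1 : 2 * c.η ^ (438 : ℤ) ≤ c.η ^ (437 : ℤ) := SizeLE.two_mul_zpow_le hη hη' (by norm_num)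
    have t2 : 2 * c.η ^ (437 : ℤ) ≤ c.η ^ (436 : ℤ) := SizeLE.two_mul_zpow_le hη hη' (by norm_num)
    have t3 : 2 * c.η ^ (436 : ℤ) ≤ c.η ^ (435 : ℤ) := SizeLE.two_mul_zpow_le hη hη' (by norm_num)
    have t4 : 2 * c.η ^ (435 : ℤ) ≤ c.η ^ (108 : ℤ) := SizeLE.two_mul_zpow_le hη hη' (by norm_num)
    linarith

end Chart

namespace Chart

variable {c : Chart} {Ω : Set (ℝ × ℝ × ℝ)} {I I₀ : Set ℝ} {q v : Coord} {p : Phase} {y : ℝ}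

/-- Points near the curve of saddles lie in the image of the box under the inverse chart. -/
theorem size_fwd (h : c.Adapted Ω I I₀) {n : ℤ} (hn : c.N + 60 ≤ n)
    (h1 : SizeLE c.η n (p.1.1 - c.ψ p.2.1.2))
    (h2 : SizeLE c.η (n - 4) (p.2.1.1 - c.j p.2.1.2 - c.s p.2.1.2 * (p.1.1 - c.ψ p.2.1.2))) :
    ‖(c.fwd p).1‖ ≤ 1 ∧ ‖(c.fwd p).2.1‖ ≤ 1 := by
  have g1 := h1.div h.η_pos h.η_le (m := c.N) (y := c.e) (le_abs_self _) (k := 1) (by linarith)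
  have g2 := h2.div h.η_pos h.η_le (m := c.N + 52) (y := c.e * c.σ) (by
    rw [e, σ, ← zpow_add₀ h.η_pos.ne']; exact le_abs_self _) (k := 1) (by linarith)
  have half : ∀ {x : ℝ}, SizeLE c.η 0 x → ‖x / 2‖ ≤ 1 := fun {x} hx => by
    rw [SizeLE, zpow_zero] at hx
    rw [norm_div]
    refine (div_le_self (norm_nonneg _) (by norm_num)).trans hx
  exact ⟨half (g1.add h.η_pos h.η_le g2 (by norm_num) (by norm_num)),
    half (g1.sub h.η_pos h.η_le g2 (by norm_num) (by norm_num))⟩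

theorem size_dfwd (h : c.Adapted Ω I I₀) {v : Phase} (hy : p.2.1.2 ∈ I₀)
    (hq : ‖(c.fwd p).1‖ ≤ 1 ∧ ‖(c.fwd p).2.1‖ ≤ 1) (hv : ‖v‖ ≤ 1) :
    SizeLE c.η (-730) (c.dfwd p v) := by
  have hN := h.le_N
  have hN' := h.N_le
  have hI := h.sub hy
  simp only [Prod.norm_def, max_le_iff] at hv
  obtain ⟨⟨v1, v2⟩, ⟨v3, v4⟩, v5⟩ := hv
  have k := size_zero h v4
  have x1 := (size_zero h v1).sub h.η_pos h.η_le ((h.family.small_ψ hI).mul h.η_pos h.η_le k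
    (k := -105) (by norm_num)) (k := -106) (by norm_num) (by norm_num)
  have hξ : SizeLE c.η 0 (p.1.1 - c.ψ p.2.1.2) := by
    rw [← dψ_fwd h]
    exact (size_dψ h hq.1 hq.2).mono h.η_pos h.η_le (by linarith)
  have x2 := (((h.shear.size₁ _ hy).mul h.η_pos h.η_le k (k := -110) (by norm_num)).mul h.η_pos
    h.η_le hξ (k := -110) (by norm_num)).add h.η_pos h.η_le ((h.shear.size _ hy).mul h.η_pos h.η_le
    x1 (k := -110) (by norm_num)) (k := -111) (by norm_num) (by norm_num)
  have x3 := ((size_zero h v3).sub h.η_pos h.η_le ((h.family.small_j hI).mul h.η_pos h.η_le k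
    (k := -105) (by norm_num)) (k := -106) (by norm_num) (by norm_num)).sub h.η_pos h.η_le x2
    (k := -112) (by norm_num) (by norm_num)
  have g1 := x1.div h.η_pos h.η_le (m := c.N) (y := c.e) (le_abs_self _) (k := -727) (by linarith)
  have g2 := x3.div h.η_pos h.η_le (m := c.N + 52) (y := c.e * c.σ) (by
    rw [e, σ, ← zpow_add₀ h.η_pos.ne']; exact le_abs_self _) (k := -727) (by linarith)
  have half : ∀ {x : ℝ}, SizeLE c.η (-730) x → SizeLE c.η (-730) (x / 2) := fun {x} hx => by
    rw [SizeLE, norm_div]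
    refine (div_le_self (norm_nonneg _) (by norm_num)).trans hx
  refine (half (g1.add h.η_pos h.η_le g2 (by norm_num) (by norm_num))).prod
    ((half (g1.sub h.η_pos h.η_le g2 (by norm_num) (by norm_num))).prod (SizeLE.prod ?_
    (SizeLE.prod ?_ ?_)))
  · exact (size_ω h).mul h.η_pos h.η_le (size_zero h v2) (by norm_num)
  · exact k.div h.η_pos h.η_le (m := 400) (le_abs_self _) (by norm_num)
  · exact (size_zero h v5).mono h.η_pos h.η_le (by norm_num)

/-! ### The invariant cylinder -/

theorem contDiffOn_ham (h : c.Adapted Ω I I₀) : ContDiffOn ℝ 2 c.ham (slow ⁻¹' Ω) :=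
  ((h.family.g_smooth.of_le (by norm_num)).comp contDiff_slow.contDiffOn fun _ hp => hp).add
    h.family.R_smooth

theorem differentiableAt_hamField (h : c.Adapted Ω I I₀) (hp : slow p ∈ Ω) :
    DifferentiableAt ℝ (hamField c.ham) p := by
  have h1 : DifferentiableAt ℝ (fderiv ℝ c.ham) p :=
    (((contDiffOn_ham h).contDiffAt ((h.family.isOpen.preimage continuous_slow).mem_nhds
      hp)).fderiv_right (m := 1) (by norm_num)).differentiableAt (by norm_num)
  have h2 : ∀ d : Phase, DifferentiableAt ℝ (fun p => fderiv ℝ c.ham p d) p := fun d =>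
    h1.clm_apply (differentiableAt_const d)
  exact ((h2 _).prodMk (h2 _)).prodMk
    (((h2 _).neg.prodMk (h2 _).neg).prodMk (differentiableAt_const _))

/-- The rescaling of `(ψᶠ, Jᶠ, t)`. -/
noncomputable def scale (c : Chart) : ℝ × ℝ × ℝ →L[ℝ] ℝ × ℝ × ℝ :=
  (c.ω • ContinuousLinearMap.fst ℝ ℝ _).prod
    ((c.ω⁻¹ • (ContinuousLinearMap.fst ℝ ℝ ℝ).comp (ContinuousLinearMap.snd ℝ ℝ _)).prod
      ((ContinuousLinearMap.snd ℝ ℝ ℝ).comp (ContinuousLinearMap.snd ℝ ℝ _)))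

theorem scale_apply (u : ℝ × ℝ × ℝ) : c.scale u = (c.ω * u.1, c.ω⁻¹ * u.2.1, u.2.2) := rfl

theorem scale_surjective (h : c.Adapted Ω I I₀) : Function.Surjective c.scale := fun u =>
  ⟨(c.ω⁻¹ * u.1, c.ω * u.2.1, u.2.2), by
    have := h.ω_pos.ne'
    rw [scale_apply]
    ext <;> simp [this]⟩

theorem fwd_base (p : Phase) : (c.fwd p).2.2 = c.scale (p.1.2, p.2.1.2, p.2.2) := by
  simp only [fwd, split, scale_apply, div_eq_inv_mul]

section Cylinder

variable {k k' : ℝ → ℝ} (h : c.Adapted Ω I I₀)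
  (sf : SaddleField (U := ℝ × ℝ × ℝ) (fun q => c.field (c.clamp k q)) (c.fieldDeriv k k')
      c.rate c.margin (c.η ^ (500 : ℤ)) (c.η ^ (1000 : ℤ)))

include h in
theorem ratio_eq : c.η ^ (1000 : ℤ) / c.margin = c.η ^ (946 : ℤ) := by
  rw [margin, ← zpow_sub₀ h.η_pos.ne']; norm_num

/-- The point of the cylinder over `u = (ψᶠ, Jᶠ, t)`. -/
noncomputable def cyl (u : ℝ × ℝ × ℝ) : Phase := c.inv (sf.graph (c.scale u))

include h

theorem act_graph (u : ℝ × ℝ × ℝ) : c.act (sf.graph (c.scale u)) = u.2.1 := by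
  have := h.ω_pos.ne'
  rw [act, sf.graph_base, scale_apply]
  field_simp

theorem graphMap_cyl :
    graphMap (fun u => (cyl sf u).1.1) (fun u => (cyl sf u).2.1.1) = cyl sf := by
  have := h.ω_pos.ne'
  funext u
  have e1 : (cyl sf u).1.2 = u.1 := by
    change (sf.graph (c.scale u)).2.2.1 / c.ω = u.1
    rw [sf.graph_base, scale_apply]
    field_simp
  have e2 : (cyl sf u).2.1.2 = u.2.1 := act_graph h sf u
  have e3 : (cyl sf u).2.2 = u.2.2 := by
    change (sf.graph (c.scale u)).2.2.2.2 = u.2.2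
    rw [sf.graph_base, scale_apply]
  rw [graphMap, ← e1, ← e2, ← e3]

theorem cyl_base (u : ℝ × ℝ × ℝ) : ((cyl sf u).1.2, (cyl sf u).2.1.2, (cyl sf u).2.2) = u := by
  have := congrFun (graphMap_cyl h sf) u
  rw [← this]
  rfl

theorem fwd_cyl (u : ℝ × ℝ × ℝ) : c.fwd (cyl sf u) = sf.graph (c.scale u) := fwd_inv h _

theorem graph_le_one (u : ℝ × ℝ × ℝ) : |(sf.graph u).1| ≤ c.η ^ (946 : ℤ) ∧
    |(sf.graph u).2.1| ≤ c.η ^ (946 : ℤ) := by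
  rw [← ratio_eq h]; exact sf.graph_le u

theorem hasFDerivAt_cyl {u : ℝ × ℝ × ℝ} (hu : u.2.1 ∈ I) :
    HasFDerivAt (cyl sf) ((fderiv ℝ c.inv (sf.graph (c.scale u))).comp
      ((sf.graphDeriv (c.scale u)).comp c.scale)) u := by
  have h1 : c.act (sf.graph (c.scale u)) ∈ I := by rwa [act_graph h]
  exact (differentiableAt_inv h h1).hasFDerivAt.comp u
    ((sf.hasStrictFDerivAt_graph _).hasFDerivAt.comp u c.scale.hasFDerivAt)

theorem contDiffOn_cyl : ContDiffOn ℝ 1 (cyl sf) (params I) :=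
  ((contDiffOn_inv h).of_le (by norm_num)).comp
    ((sf.contDiff_graph.comp c.scale.contDiff).contDiffOn) fun u hu => by
      change c.act (sf.graph (c.scale u)) ∈ I
      rw [act_graph h]
      exact hu

omit h in
theorem params_eq (Y : Set ℝ) : params Y = univ ×ˢ (Y ×ˢ univ) := by ext u; simp [params]

omit h in
theorem uniqueDiffOn_params {α β : ℝ} (hαβ : α < β) : UniqueDiffOn ℝ (params (Icc α β)) := by
  rw [params_eq]
  exact uniqueDiffOn_univ.prod ((uniqueDiffOn_Icc hαβ).prod uniqueDiffOn_univ)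

theorem cylTangent_cyl {α β : ℝ} (hαβ : α < β) (hY : Icc α β ⊆ I) {u : ℝ × ℝ × ℝ}
    (hu : u ∈ params (Icc α β)) (w : Phase) :
    w ∈ cylTangent (Icc α β) (fun u => (cyl sf u).1.1) (fun u => (cyl sf u).2.1.1) (cyl sf u) ↔
      ∃ z, fderiv ℝ c.inv (sf.graph (c.scale u)) (sf.graphDeriv (c.scale u) z) = w := by
  rw [cylTangent, graphMap_cyl h, cyl_base h,
    (hasFDerivAt_cyl h sf (hY hu)).hasFDerivWithinAt.fderivWithin (uniqueDiffOn_params hαβ u hu)]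
  constructor
  · rintro ⟨z, rfl⟩
    exact ⟨c.scale z, rfl⟩
  · rintro ⟨z, rfl⟩
    obtain ⟨z, rfl⟩ := scale_surjective h z
    exact ⟨z, rfl⟩

/-- The part of the phase space in which the clamped field describes the Hamiltonian flow. -/
def region (c : Chart) (W : Set ℝ) : Set Phase :=
  {p | p.2.1.2 ∈ W ∧ (|(c.fwd p).1| < 1 ∧ |(c.fwd p).2.1| < 1)}

theorem isOpen_region {W : Set ℝ} (hW : IsOpen W) (hWI : W ⊆ I) : IsOpen (c.region W) := by
  have h1 : IsOpen {p : Phase | p.2.1.2 ∈ W} := hW.preimage (by fun_prop)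
  have h2 : IsOpen {q : Coord | |q.1| < 1 ∧ |q.2.1| < 1} :=
    (isOpen_lt (f := fun q : Coord => |q.1|) (by fun_prop) continuous_const).inter
      (isOpen_lt (f := fun q : Coord => |q.2.1|) (by fun_prop) continuous_const)
  exact ((contDiffOn_fwd h).continuousOn.mono fun p hp => hWI hp).isOpen_inter_preimage h1 h2

theorem mem_slow (hp : p.2.1.2 ∈ I₀) (hq : ‖(c.fwd p).1‖ ≤ 1 ∧ ‖(c.fwd p).2.1‖ ≤ 1) :
    slow p ∈ Ω := by
  have := (mem_dom h (q := c.fwd p) (by rwa [act_fwd h]) hq).2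
  rwa [inv_fwd h] at this

theorem clamp_fwd {W : Set ℝ} (hk : ∀ y ∈ W, k y = y) (hp : p.2.1.2 ∈ W) :
    c.clamp k (c.fwd p) = c.fwd p := by
  rw [clamp_eq, act_fwd h, hk _ hp]
  simp only [fwd, split]

theorem field_clamp_fwd {W : Set ℝ} (hk : ∀ y ∈ W, k y = y) (hp : p.2.1.2 ∈ W) (hW : W ⊆ I₀)
    (hq : ‖(c.fwd p).1‖ ≤ 1 ∧ ‖(c.fwd p).2.1‖ ≤ 1) :
    c.field (c.clamp k (c.fwd p)) = fderiv ℝ c.fwd p (hamField c.ham p) := by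
  rw [clamp_fwd h hk hp, field_fwd h (h.sub (hW hp)) (mem_slow h (hW hp) hq)]

theorem cyl_mem_region {W : Set ℝ} {u : ℝ × ℝ × ℝ} (hu : u.2.1 ∈ W) : cyl sf u ∈ c.region W := by
  have h1 : c.η ^ (946 : ℤ) < 1 :=
    zpow_lt_one₀ h.η_pos (by linarith [h.η_le]) (by norm_num)
  refine ⟨?_, ?_⟩
  · have : (cyl sf u).2.1.2 = u.2.1 := act_graph h sf u
    rwa [this]
  · rw [fwd_cyl h]
    obtain ⟨h2, h3⟩ := graph_le_one h sf (c.scale u)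
    exact ⟨h2.trans_lt h1, h3.trans_lt h1⟩

omit h in
theorem exists_param {Y : Set ℝ} {g₁ g₂ : ℝ × ℝ × ℝ → ℝ} (hp : p ∈ cylinder Y g₁ g₂) :
    ∃ u ∈ params Y, graphMap g₁ g₂ u = p := hp

theorem cyl_invariant {α β : ℝ} (hαβ : α < β) {W : Set ℝ} (hk : ∀ y ∈ W, k y = y) (hW : W ⊆ I₀)
    (hY : Icc α β ⊆ W) {u : ℝ × ℝ × ℝ} (hu : u ∈ params (Icc α β)) :
    hamField c.ham (cyl sf u) ∈
      cylTangent (Icc α β) (fun u => (cyl sf u).1.1) (fun u => (cyl sf u).2.1.1) (cyl sf u) := by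
  rw [cylTangent_cyl h sf hαβ (hY.trans (hW.trans h.sub)) hu]
  obtain ⟨m1, m2, m3⟩ := cyl_mem_region h sf (W := W) (hY hu)
  have h1 := field_clamp_fwd h hk m1 hW ⟨m2.le, m3.le⟩
  have h2 := sf.field_graph (c.scale u)
  change c.field (c.clamp k (sf.graph (c.scale u)))
    = sf.graphDeriv (c.scale u) (c.field (c.clamp k (sf.graph (c.scale u)))).2.2 at h2
  rw [← fwd_cyl h, h1] at h2
  refine ⟨(fderiv ℝ c.fwd (cyl sf u) (hamField c.ham (cyl sf u))).2.2, ?_⟩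
  rw [← h2, ← fwd_cyl h, fderiv_fwd h (h.sub (hW m1)), fderiv_inv h
    (by rw [act_fwd h]; exact h.sub (hW m1)), dinv_dfwd h]

theorem cyl_normallyHyperbolic {α β : ℝ} (hαβ : α < β) {W : Set ℝ} (hWo : IsOpen W)
    (hk : ∀ y ∈ W, k y = y) (hW : W ⊆ I₀) (hY : Icc α β ⊆ W) :
    NormallyHyperbolic (hamField c.ham)
      (cylinder (Icc α β) (fun u => (cyl sf u).1.1) (fun u => (cyl sf u).2.1.1))
      (cylTangent (Icc α β) (fun u => (cyl sf u).1.1) (fun u => (cyl sf u).2.1.1)) := by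
  have hM : ∀ p ∈ cylinder (Icc α β) (fun u => (cyl sf u).1.1) (fun u => (cyl sf u).2.1.1),
      ∃ u ∈ params (Icc α β), cyl sf u = p := by
    intro p hp
    obtain ⟨u, hu, rfl⟩ := exists_param hp
    exact ⟨u, hu, by rw [graphMap_cyl h]⟩
  have hWI := hW.trans h.sub
  have hη : 0 ≤ c.η ^ (-730 : ℤ) := zpow_nonneg h.η_pos.le _
  refine sf.normallyHyperbolic_of_chart (O := c.region W) (Θ := c.fwd)
    (Φ' := fun p => fderiv ℝ c.inv (c.fwd p)) (B := c.η ^ (-730 : ℤ))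
    (isOpen_region h hWo hWI)
    ((contDiffOn_fwd h).mono fun p hp => hWI hp.1)
    (fun p hp => differentiableAt_hamField h (mem_slow h (hW hp.1) ⟨hp.2.1.le, hp.2.2.le⟩))
    (fun p hp => ⟨hp.2.1.le, hp.2.2.le⟩)
    (fun p hp => field_clamp_fwd h hk hp.1 hW ⟨hp.2.1.le, hp.2.2.le⟩) ?_ ?_ ?_ ?_ ?_ ?_ ?_
  · intro p hp v
    obtain ⟨u, hu, rfl⟩ := hM p hp
    have m := hWI (cyl_mem_region h sf (W := W) (hY hu)).1
    rw [fderiv_fwd h m, fderiv_inv h (by rw [act_fwd h]; exact m), dinv_dfwd h]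
  · intro p hp z
    obtain ⟨u, hu, rfl⟩ := hM p hp
    have m := hWI (cyl_mem_region h sf (W := W) (hY hu)).1
    rw [fderiv_fwd h m, fderiv_inv h (by rw [act_fwd h]; exact m)]
    have := dfwd_dinv h (c.fwd (cyl sf u)) z
    rwa [inv_fwd h] at this
  · intro p hp z
    obtain ⟨u, hu, rfl⟩ := hM p hp
    obtain ⟨m1, m2, m3⟩ := cyl_mem_region h sf (W := W) (hY hu)
    refine ContinuousLinearMap.le_of_opNorm_le _ (ContinuousLinearMap.opNorm_le_of_unit_norm hη
      fun v hv => ?_) z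
    rw [fderiv_inv h (by rw [act_fwd h]; exact hWI m1)]
    exact (size_dinv h (by rw [act_fwd h]; exact hW m1) ⟨m2.le, m3.le⟩ hv.le).mono h.η_pos h.η_le
      (by norm_num)
  · intro p hp z
    obtain ⟨u, hu, rfl⟩ := hM p hp
    obtain ⟨m1, m2, m3⟩ := cyl_mem_region h sf (W := W) (hY hu)
    refine ContinuousLinearMap.le_of_opNorm_le _ (ContinuousLinearMap.opNorm_le_of_unit_norm hη
      fun v hv => ?_) z
    rw [fderiv_fwd h (hWI m1)]
    exact size_dfwd h (hW m1) ⟨m2.le, m3.le⟩ hv.le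
  · intro p hp
    obtain ⟨u, hu, rfl⟩ := hM p hp
    exact cyl_mem_region h sf (hY hu)
  · intro p hp
    obtain ⟨u, hu, rfl⟩ := hM p hp
    rw [fwd_cyl h, sf.graph_base]
  · intro p hp w
    obtain ⟨u, hu, rfl⟩ := hM p hp
    rw [cylTangent_cyl h sf hαβ (hY.trans hWI) hu, fwd_cyl h, sf.graph_base]

theorem cyl_dψ (u : ℝ × ℝ × ℝ) :
    (cyl sf u).1.1 - c.ψ u.2.1 = c.dψ (sf.graph (c.scale u)) := by
  have : (cyl sf u).1.1 = c.ψ (c.act (sf.graph (c.scale u))) + c.dψ (sf.graph (c.scale u)) := rfl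
  rw [this, act_graph h]
  ring

/-- The distance of the cylinder from the curve of saddles: the size of the chart times the quotient of
the error of the zero section and the margin. -/
theorem cyl_near {u : ℝ × ℝ × ℝ} (hu : u.2.1 ∈ I₀) :
    SizeLE c.η (c.N + 945) ((cyl sf u).1.1 - c.ψ u.2.1) ∧
    SizeLE c.η (c.N + 940) ((cyl sf u).2.1.1 - c.j u.2.1) := by
  obtain ⟨h1, h2⟩ := graph_le_one h sf (c.scale u)
  have h1' : SizeLE c.η 946 (sf.graph (c.scale u)).1 := h1
  have h2' : SizeLE c.η 946 (sf.graph (c.scale u)).2.1 := h2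
  have d1 : SizeLE c.η (c.N + 945) (c.dψ (sf.graph (c.scale u))) :=
    (size_e h).mul h.η_pos h.η_le (h1'.add h.η_pos h.η_le h2' (k := 945) (by norm_num) (by norm_num))
      (by linarith)
  have d2 : SizeLE c.η (c.N + 945) (c.dj (sf.graph (c.scale u))) :=
    ((size_e h).mul h.η_pos h.η_le (size_σ h) (k := c.N + 52) le_rfl).mul h.η_pos h.η_le
      (h1'.sub h.η_pos h.η_le h2' (k := 945) (by norm_num) (by norm_num)) (by linarith)
  refine ⟨by rw [cyl_dψ h]; exact d1, ?_⟩
  have : (cyl sf u).2.1.1 = c.j (c.act (sf.graph (c.scale u)))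
    + (c.s (c.act (sf.graph (c.scale u))) * c.dψ (sf.graph (c.scale u))
      + c.dj (sf.graph (c.scale u))) := rfl
  rw [this, act_graph h, add_sub_cancel_left]
  exact ((h.shear.size _ hu).mul h.η_pos h.η_le d1 (k := c.N + 942) (by linarith)).add h.η_pos h.η_le
    d2 (by linarith) (by linarith)

theorem abs_dψ_graph_sub_le (u w : ℝ × ℝ × ℝ) :
    |c.dψ (sf.graph (c.scale u)) - c.dψ (sf.graph (c.scale w))| ≤ 2 * c.e * ‖c.scale u - c.scale w‖ := by
  have h1 := sf.norm_graph_sub_le (c.scale u) (c.scale w)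
  set A := sf.graph (c.scale u)
  set B := sf.graph (c.scale w)
  have n1 : |A.1 - B.1| ≤ ‖A - B‖ := norm_fst_le (A - B)
  have n2 : |A.2.1 - B.2.1| ≤ ‖A - B‖ := (norm_fst_le _).trans (norm_snd_le (A - B))
  have e : c.dψ A - c.dψ B = c.e * ((A.1 - B.1) + (A.2.1 - B.2.1)) := by simp only [dψ]; ring
  rw [e, abs_mul, abs_of_pos h.e_pos]
  have h2 := abs_add_le (A.1 - B.1) (A.2.1 - B.2.1)
  have h3 := mul_le_mul_of_nonneg_left (h2.trans (add_le_add (n1.trans h1) (n2.trans h1))) h.e_pos.le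
  linarith

/-- The graph has Lipschitz constant `1` in the chart, so that its slope is at most the size of the
chart divided by the scale of `ψᶠ`, up to a factor. -/
theorem abs_deriv_cyl_le (hN : c.N = 560) (x y t : ℝ) :
    |deriv (fun x' => (cyl sf (x', y, t)).1.1) x| ≤ c.η ^ (155 : ℤ) := by
  have e1 : (fun x' => (cyl sf (x', y, t)).1.1)
      = fun x' => c.ψ y + c.dψ (sf.graph (c.scale (x', y, t))) := by
    funext x'
    have := cyl_dψ h sf (x', y, t)
    simp only at this
    linarith
  rw [e1]
  rw [← Real.norm_eq_abs]
  refine norm_deriv_le_of_lip' (zpow_nonneg h.η_pos.le _) (Eventually.of_forall fun x' => ?_)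
  rw [add_sub_add_left_eq_sub]
  have h1 := abs_dψ_graph_sub_le h sf (x', y, t) (x, y, t)
  have h2 : ‖c.scale (x', y, t) - c.scale (x, y, t)‖ = c.ω * ‖x' - x‖ := by
    rw [← map_sub, scale_apply]
    simp [Prod.norm_def, abs_of_pos h.ω_pos]
    exact mul_nonneg h.ω_pos.le (abs_nonneg _)
  rw [h2] at h1
  refine h1.trans ?_
  rw [← mul_assoc]
  refine mul_le_mul_of_nonneg_right ?_ (norm_nonneg _)
  have e2 : c.e * c.ω = c.η ^ (960 : ℤ) := by
    rw [e, ω, hN, ← zpow_add₀ h.η_pos.ne']; norm_num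
  rw [mul_assoc, e2]
  exact SizeLE.two_mul_zpow_le h.η_pos h.η_le (by norm_num)

theorem abs_derivWithin_cyl_le (hN : c.N = 560) {α β : ℝ} (hαβ : α < β) (x t : ℝ) {y : ℝ}
    (hy : y ∈ Icc α β) :
    |derivWithin (fun y' => (cyl sf (x, y', t)).1.1 - c.ψ y') (Icc α β) y| ≤ c.η ^ (155 : ℤ) := by
  have e1 : (fun y' => (cyl sf (x, y', t)).1.1 - c.ψ y')
      = fun y' => c.dψ (sf.graph (c.scale (x, y', t))) := by
    funext y'
    exact cyl_dψ h sf (x, y', t)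
  have hd : DifferentiableAt ℝ (fun y' => c.dψ (sf.graph (c.scale (x, y', t)))) y := by
    have h1 : Differentiable ℝ fun y' : ℝ => c.scale (x, y', t) :=
      c.scale.differentiable.comp (by fun_prop)
    exact ((contDiff_dψ (c := c)).differentiable (by norm_num)).comp
      ((sf.contDiff_graph.differentiable (by norm_num)).comp h1) y
  rw [e1, hd.derivWithin (uniqueDiffOn_Icc hαβ y hy)]
  rw [← Real.norm_eq_abs]
  refine norm_deriv_le_of_lip' (zpow_nonneg h.η_pos.le _) (Eventually.of_forall fun y' => ?_)
  have h1 := abs_dψ_graph_sub_le h sf (x, y', t) (x, y, t)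
  have h2 : ‖c.scale (x, y', t) - c.scale (x, y, t)‖ = c.ω⁻¹ * ‖y' - y‖ := by
    rw [← map_sub, scale_apply]
    simp [Prod.norm_def, abs_of_pos h.ω_pos]
    exact mul_nonneg (inv_pos.2 h.ω_pos).le (abs_nonneg _)
  rw [h2] at h1
  refine h1.trans ?_
  rw [← mul_assoc]
  refine mul_le_mul_of_nonneg_right ?_ (norm_nonneg _)
  have e2 : c.e * c.ω⁻¹ = c.η ^ (160 : ℤ) := by
    rw [e, ω, hN, ← zpow_neg, ← zpow_add₀ h.η_pos.ne']; norm_num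
  rw [mul_assoc, e2]
  exact SizeLE.two_mul_zpow_le h.η_pos h.η_le (by norm_num)

/-- The cylinder inherits the translation symmetries of the remainder. -/
theorem cyl_add {Δ T : ℝ} (hR : ∀ p : Phase, c.R ((p.1.1, p.1.2 + Δ), p.2.1, p.2.2 + T) = c.R p)
    (u : ℝ × ℝ × ℝ) : cyl sf (u + (Δ, 0, T)) = cyl sf u + ((0, Δ), (0, 0), T) := by
  have hω := h.ω_pos.ne'
  have hR' : ∀ p : Phase, fderiv ℝ c.R (p + ((0, Δ), (0, 0), T)) = fderiv ℝ c.R p := fun p => by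
    have e1 : (fun p : Phase => c.R (p + ((0, Δ), (0, 0), T))) = c.R := by
      funext p
      rw [← hR p]
      congr 1
      ext <;> simp
    rw [← fderiv_comp_add_right, e1]
  have hact : ∀ q : Coord, c.act (q + (0, 0, c.scale (Δ, 0, T))) = c.act q := fun q => by
    simp [act, scale_apply]
  have hinv : ∀ q : Coord, c.inv (q + (0, 0, c.scale (Δ, 0, T)))
      = c.inv q + ((0, Δ), (0, 0), T) := fun q => by
    have e1 : c.dψ (q + (0, 0, c.scale (Δ, 0, T))) = c.dψ q := by simp [dψ]
    have e2 : c.dj (q + (0, 0, c.scale (Δ, 0, T))) = c.dj q := by simp [dj]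
    simp only [inv, hact, e1, e2]
    simp only [scale_apply]
    ext <;> simp
    field_simp
  have hsl : ∀ p : Phase, slow (p + ((0, Δ), (0, 0), T)) = slow p := fun p => by
    simp [slow]
  have hf : ∀ q : Coord, c.field (q + (0, 0, c.scale (Δ, 0, T))) = c.field q := fun q => by
    have e1 : c.dψ (q + (0, 0, c.scale (Δ, 0, T))) = c.dψ q := by simp [dψ]
    simp only [field, dir₁, dir₂, hinv, hR', hsl, hact, e1]
  have hc : ∀ q : Coord, c.clamp k (q + (0, 0, c.scale (Δ, 0, T)))
      = c.clamp k q + (0, 0, c.scale (Δ, 0, T)) := fun q => by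
    simp only [clamp_eq, hact]
    simp [scale_apply]
  have := sf.graph_add (w := c.scale (Δ, 0, T)) (fun q => by
    change c.field (c.clamp k (q + (0, 0, c.scale (Δ, 0, T)))) = c.field (c.clamp k q)
    rw [hc, hf]) (c.scale u)
  rw [cyl, map_add, this, hinv]
  rfl

/-- Full orbits of the Hamiltonian near the curve are orbits in the box. -/
theorem orbit_fwd {W : Set ℝ} (hk : ∀ y ∈ W, k y = y) (hW : W ⊆ I₀) {γ : ℝ → Phase}
    (hγ : ∀ s, HasDerivAt γ (hamField c.ham (γ s)) s) (hγW : ∀ s, (γ s).2.1.2 ∈ W)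
    (hq : ∀ s, ‖(c.fwd (γ s)).1‖ ≤ 1 ∧ ‖(c.fwd (γ s)).2.1‖ ≤ 1) :
    SaddleField.Orbit (U := ℝ × ℝ × ℝ) (fun q => c.field (c.clamp k q)) fun s => c.fwd (γ s) := by
  intro s
  refine ⟨?_, hq s⟩
  change HasDerivAt _ (c.field (c.clamp k (c.fwd (γ s)))) s
  rw [field_clamp_fwd h hk (hγW s) hW (hq s)]
  exact (differentiableAt_fwd h (h.sub (hW (hγW s)))).hasFDerivAt.comp_hasDerivAt s (hγ s)

end Cylinder

end Chart

theorem Chart.dj_fwd {c : Chart} {Ω : Set (ℝ × ℝ × ℝ)} {I I₀ : Set ℝ} (h : c.Adapted Ω I I₀)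
    (p : Phase) : c.dj (c.fwd p)
      = p.2.1.1 - c.j p.2.1.2 - c.s p.2.1.2 * (p.1.1 - c.ψ p.2.1.2) := by
  have := h.e_pos.ne'
  have := h.σ_pos.ne'
  simp only [dj, fwd, split]
  field_simp
  ring

/-- There is room for the clamp at both ends, on the scale on which the shear is averaged. -/
theorem SaddleFamily.shrink {η : ℝ} {g : ℝ × ℝ × ℝ → ℝ} {R : Phase → ℝ} {Ω : Set (ℝ × ℝ × ℝ)}
    {I : Set ℝ} {ψ j : ℝ → ℝ} (h : SaddleFamily η g R Ω I ψ j) {α β : ℝ} (hαβ : α ≤ β)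
    (hI : Icc α β ⊆ I) :
    ∃ ζ, 0 < ζ ∧ 4 * ζ ≤ η ^ (220 : ℤ) ∧ Icc (α - 2 * ζ) (β + 2 * ζ) ⊆ I := by
  obtain ⟨ε, hε, hεI⟩ := isCompact_Icc.exists_thickening_subset_open h.isOpen_I hI
  have hw := zpow_pos h.pos 220
  refine ⟨min (ε / 4) (η ^ (220 : ℤ) / 4), by positivity, ?_, fun y hy => hεI ?_⟩
  · have := min_le_right (ε / 4) (η ^ (220 : ℤ) / 4)
    linarith
  · have h1 := min_le_left (ε / 4) (η ^ (220 : ℤ) / 4)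
    rw [Metric.mem_thickening_iff]
    rcases le_total y α with h2 | h2
    · exact ⟨α, ⟨le_rfl, hαβ⟩, by rw [Real.dist_eq, abs_lt]; constructor <;> linarith [hy.1]⟩
    rcases le_total y β with h3 | h3
    · exact ⟨y, ⟨h2, h3⟩, by simpa using hε⟩
    · exact ⟨β, ⟨hαβ, le_rfl⟩, by rw [Real.dist_eq, abs_lt]; constructor <;> linarith [hy.2]⟩

/-- A normally hyperbolic invariant cylinder along a curve of saddles. The remainder `R` may depend
on all variables. The chart of size `η ^ 140` shows that full orbits near the curve stay very close
to it; the invariant graph is constructed in the chart of size `η ^ 560`. -/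
theorem SaddleFamily.exists_cylinder {η : ℝ} {g : ℝ × ℝ × ℝ → ℝ} {R : Phase → ℝ}
    {Ω : Set (ℝ × ℝ × ℝ)} {I : Set ℝ} {ψ j : ℝ → ℝ} (h : SaddleFamily η g R Ω I ψ j) {α β : ℝ}
    (hαβ : α < β) (hI : Icc α β ⊆ I) {H : Phase → ℝ} (hH : H = fun p => g (slow p) + R p) :
    ∃ Ψ 𝒥 : ℝ × ℝ × ℝ → ℝ,
      ContDiffOn ℝ 1 Ψ (params (Icc α β)) ∧ ContDiffOn ℝ 1 𝒥 (params (Icc α β)) ∧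
      (∀ Δ T : ℝ, (∀ p : Phase, R ((p.1.1, p.1.2 + Δ), p.2.1, p.2.2 + T) = R p) →
        ∀ x y t, Ψ (x + Δ, y, t + T) = Ψ (x, y, t) ∧ 𝒥 (x + Δ, y, t + T) = 𝒥 (x, y, t)) ∧
      (∀ p ∈ cylinder (Icc α β) Ψ 𝒥, hamField H p ∈ cylTangent (Icc α β) Ψ 𝒥 p) ∧
      NormallyHyperbolic (hamField H) (cylinder (Icc α β) Ψ 𝒥) (cylTangent (Icc α β) Ψ 𝒥) ∧
      (∀ γ : ℝ → Phase, (∀ s, HasDerivAt γ (hamField H (γ s)) s) →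
        (∀ s, γ s ∈ tube (Icc α β) ψ j (η ^ (200 : ℤ)) (η ^ (200 : ℤ))) →
        ∀ s, γ s ∈ cylinder (Icc α β) Ψ 𝒥) ∧
      ∀ x t : ℝ, ∀ y ∈ Icc α β,
        |Ψ (x, y, t) - ψ y| ≤ η ^ (1500 : ℤ) ∧ |𝒥 (x, y, t) - j y| ≤ η ^ (1500 : ℤ) ∧
        |derivWithin (fun y' => Ψ (x, y', t) - ψ y') (Icc α β) y| ≤ η ^ (155 : ℤ) ∧
        |deriv (fun x' => Ψ (x', y, t)) x| ≤ η ^ (155 : ℤ) := by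
  subst hH
  obtain ⟨ζ, hζ, hζ', hζI⟩ := h.shrink hαβ.le hI
  obtain ⟨s, s₁, s₂, hs⟩ := h.exists_shear hαβ.le hζ hζ' hζI
  obtain ⟨k, k', hk, hk', hk01, hid, hkI⟩ := exists_clamp hαβ.le hζ
  set I₀ := Icc (α - 2 * ζ) (β + 2 * ζ)
  set W := Ioo (α - ζ) (β + ζ)
  have hWI : W ⊆ I₀ := fun y hy => ⟨by linarith [hy.1], by linarith [hy.2]⟩
  have hYW : Icc α β ⊆ W := fun y hy => ⟨by linarith [hy.1], by linarith [hy.2]⟩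
  obtain ⟨c, hc⟩ : ∃ c : Chart, c = ⟨η, 560, g, R, ψ, j, s, s₁, s₂⟩ := ⟨_, rfl⟩
  obtain ⟨c', hc'⟩ : ∃ c : Chart, c = ⟨η, 140, g, R, ψ, j, s, s₁, s₂⟩ := ⟨_, rfl⟩
  have ad : c.Adapted Ω I I₀ := by subst hc; exact ⟨h, hs, hζI, by norm_num, by norm_num⟩
  have ad' : c'.Adapted Ω I I₀ := by subst hc'; exact ⟨h, hs, hζI, by norm_num, by norm_num⟩
  have sf := Chart.saddleField ad hk hk' hk01 hkI
  have sf' := Chart.saddleField ad' hk hk' hk01 hkI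
  have e1 : (fun p => g (slow p) + R p) = c.ham := by subst hc; rfl
  have e2 : (fun p => g (slow p) + R p) = c'.ham := by subst hc'; rfl
  have eη : c.η = η := by subst hc; rfl
  have eN : c.N = 560 := by subst hc; rfl
  have eψ : c.ψ = ψ := by subst hc; rfl
  have ej : c.j = j := by subst hc; rfl
  have es : c.s = s := by subst hc; rfl
  have eR : c.R = R := by subst hc; rfl
  have eη' : c'.η = η := by subst hc'; rfl
  have eN' : c'.N = 140 := by subst hc'; rfl
  have eψ' : c'.ψ = ψ := by subst hc'; rfl
  have ej' : c'.j = j := by subst hc'; rfl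
  have es' : c'.s = s := by subst hc'; rfl
  have hWo : IsOpen W := isOpen_Ioo
  clear_value I₀ W
  refine ⟨fun u => (Chart.cyl sf u).1.1, fun u => (Chart.cyl sf u).2.1.1, ?_, ?_, ?_, ?_, ?_, ?_, ?_⟩
  · exact ((Chart.contDiffOn_cyl ad sf).mono fun u hu => hI hu).fst.fst
  · exact ((Chart.contDiffOn_cyl ad sf).mono fun u hu => hI hu).snd.fst.fst
  · intro Δ T hR x y t
    have := Chart.cyl_add ad sf (Δ := Δ) (T := T) (by rw [eR]; exact hR) (x, y, t)
    have e : ((x, y, t) : ℝ × ℝ × ℝ) + (Δ, 0, T) = (x + Δ, y, t + T) := by simp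
    rw [e] at this
    simp only [this]
    constructor <;> simp
  · intro p hp
    obtain ⟨u, hu, rfl⟩ := Chart.exists_param hp
    rw [e1, Chart.graphMap_cyl ad sf]
    exact Chart.cyl_invariant ad sf hαβ hid hWI hYW hu
  · rw [e1]
    exact Chart.cyl_normallyHyperbolic ad sf hαβ hWo hid hWI hYW
  · intro γ hγ hγV s'
    have hY : ∀ s, (γ s).2.1.2 ∈ I₀ := fun s => hWI (hYW (hγV s).1)
    have hq' : ∀ s, ‖(c'.fwd (γ s)).1‖ ≤ 1 ∧ ‖(c'.fwd (γ s)).2.1‖ ≤ 1 := fun s => by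
      obtain ⟨-, h1, h2⟩ := hγV s
      refine Chart.size_fwd ad' (n := 200) (by rw [eN']; norm_num) ?_ ?_
      · rw [eη', eψ']; exact h1
      · rw [eη', eψ', ej', es']
        exact SizeLE.sub h.pos h.le (n := 200) (m := 197) h2
          ((hs.size _ (hY s)).mul h.pos h.le (m := 200) h1 (by norm_num)) (by norm_num)
          (by norm_num)
    -- in the large chart the max principle improves `η ^ 200` to the size of the small chart
    have ho := Chart.orbit_fwd ad' hid hWI (by rw [← e2]; exact hγ) (fun s => hYW (hγV s).1) hq'
    have hq : ∀ s, ‖(c.fwd (γ s)).1‖ ≤ 1 ∧ ‖(c.fwd (γ s)).2.1‖ ≤ 1 := fun s => by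
      obtain ⟨h1, h2⟩ := ho.le sf' s
      rw [Chart.ratio_eq ad'] at h1 h2
      refine Chart.size_fwd ad (n := 1000) (by rw [eN]; norm_num) ?_ ?_
      · have := Chart.dψ_fwd ad' (γ s)
        rw [eψ'] at this
        rw [eη, eψ, ← this, ← eη']
        refine (Chart.size_e ad').mul ad'.η_pos ad'.η_le (SizeLE.add ad'.η_pos ad'.η_le (n := 946)
          (m := 946) h1 h2 (k := 945) (by norm_num) (by norm_num)) (by rw [eN']; norm_num)
      · have := Chart.dj_fwd ad' (γ s)
        rw [eψ', ej', es'] at this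
        rw [eη, eψ, ej, es, ← this, ← eη']
        refine ((Chart.size_e ad').mul ad'.η_pos ad'.η_le (Chart.size_σ ad') (k := 192)
          (by rw [eN']; norm_num)).mul
          ad'.η_pos ad'.η_le (SizeLE.sub ad'.η_pos ad'.η_le (n := 946)
          (m := 946) h1 h2 (k := 945) (by norm_num) (by norm_num)) (by norm_num)
    have ho' := Chart.orbit_fwd ad hid hWI (by rw [← e1]; exact hγ) (fun s => hYW (hγV s).1) hq
    refine ⟨((γ s').1.2, (γ s').2.1.2, (γ s').2.2), (hγV s').1, ?_⟩
    rw [Chart.graphMap_cyl ad sf, Chart.cyl, ← Chart.fwd_base, ← ho'.eq_graph sf s', Chart.inv_fwd ad]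
  · intro x t y hy
    obtain ⟨h1, h2⟩ := Chart.cyl_near ad sf (u := (x, y, t)) (hWI (hYW hy))
    have h1' := h1.mono ad.η_pos ad.η_le (k := 1500) (by rw [eN]; norm_num)
    have h2' := h2.mono ad.η_pos ad.η_le (k := 1500) (by rw [eN]; norm_num)
    have h3 := Chart.abs_derivWithin_cyl_le ad sf eN hαβ x t hy
    have h4 := Chart.abs_deriv_cyl_le ad sf eN x y t
    rw [eη] at h1' h2' h3 h4
    rw [eψ] at h1' h3
    rw [ej] at h2'
    exact ⟨h1', h2', h3, h4⟩

/-! ### The critical level of a family of convex Hamiltonians -/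

/-- A family `g(s, J, y)` of Hamiltonians with one degree of freedom on `𝕋 × ℝ`, depending on the
parameter `y`, which is convex in `J`. For `y ∈ B` the domain of `J` is an interval in which the
minimum over `J` is attained. -/
structure ConvexFamily (g : ℝ × ℝ × ℝ → ℝ) (O : Set (ℝ × ℝ)) (B : Set ℝ) : Prop where
  isOpen : IsOpen O
  smooth : ContDiffOn ℝ 3 g {z | z.2 ∈ O}
  periodic : ∀ s x, g (s + 1, x) = g (s, x)
  convex : ∀ z : ℝ × ℝ × ℝ, z.2 ∈ O → 0 < fderiv ℝ (fderiv ℝ g) z (0, 1, 0) (0, 1, 0)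
  ordConnected : ∀ y ∈ B, {J | (J, y) ∈ O}.OrdConnected
  exists_zero : ∀ y ∈ B, ∀ s, ∃ J, (J, y) ∈ O ∧ fderiv ℝ g (s, J, y) (0, 1, 0) = 0

/-- The point `J` at which `g(s, J, y)` is minimal, defined as the zero of the derivative; it is used
for `y ∈ B` only. -/
noncomputable def argmin (g : ℝ × ℝ × ℝ → ℝ) (O : Set (ℝ × ℝ)) (s y : ℝ) : ℝ :=
  Classical.epsilon fun J => (J, y) ∈ O ∧ fderiv ℝ g (s, J, y) (0, 1, 0) = 0

/-- The minimum of `g(s, J, y)` over `J`. -/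
noncomputable def minVal (g : ℝ × ℝ × ℝ → ℝ) (O : Set (ℝ × ℝ)) (s y : ℝ) : ℝ :=
  g (s, argmin g O s y, y)

/-- The maximum over `s` of the minimum over `J`. -/
noncomputable def level (g : ℝ × ℝ × ℝ → ℝ) (O : Set (ℝ × ℝ)) (y : ℝ) : ℝ :=
  sSup ((fun s => minVal g O s y) '' Icc 0 1)

/-- A continuous function of period one is the uniform limit of smooth functions of period one. -/
theorem exists_periodic_smooth {f : ℝ → ℝ} (hf : Continuous f) (hp : ∀ s, f (s + 1) = f s) {ε : ℝ}
    (hε : 0 < ε) : ∃ ω : ℝ → ℝ, ContDiff ℝ (⊤ : ℕ∞) ω ∧ (∀ s, ω (s + 1) = ω s) ∧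
      ∀ s, |ω s - f s| ≤ ε := by
  have hper : Function.Periodic f 1 := hp
  obtain ⟨δ, hδ, hδf⟩ := Metric.uniformContinuousOn_iff.1
    ((isCompact_Icc (a := (-1 : ℝ)) (b := 2)).uniformContinuousOn_of_continuous hf.continuousOn) ε hε
  have huni : ∀ a, ∀ x ∈ Metric.ball a (min δ 1), dist (f x) (f a) ≤ ε := by
    intro a x hx
    rw [Metric.mem_ball, lt_min_iff, Real.dist_eq] at hx
    have e1 : f (x - ⌊a⌋) = f x := by
      have h := hper.sub_int_mul_eq (x := x) ⌊a⌋
      rwa [mul_one] at h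
    have e2 : f (a - ⌊a⌋) = f a := by
      have h := hper.sub_int_mul_eq (x := a) ⌊a⌋
      rwa [mul_one] at h
    rw [← e1, ← e2]
    have h0 := Int.floor_le a
    have h1 := Int.lt_floor_add_one a
    have h2 := abs_lt.1 hx.2
    refine (hδf _ ⟨by linarith, by linarith⟩ _ ⟨by linarith, by linarith⟩ ?_).le
    rw [Real.dist_eq, sub_sub_sub_cancel_right]
    exact hx.1
  set φ : ContDiffBump (0 : ℝ) := ⟨min δ 1 / 2, min δ 1, by positivity,
    half_lt_self (by positivity)⟩ with hφ
  refine ⟨_, (φ.hasCompactSupport_normed (μ := MeasureTheory.volume)).contDiff_convolution_left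
    (μ := MeasureTheory.volume) (ContinuousLinearMap.lsmul ℝ ℝ) φ.contDiff_normed
    (hf.locallyIntegrable (μ := MeasureTheory.volume)), fun s => ?_, fun s => ?_⟩
  · simp only [MeasureTheory.convolution_def]
    congr 1
    funext t
    rw [add_sub_right_comm, hp]
  · rw [← Real.dist_eq]
    exact φ.dist_normed_convolution_le (μ := MeasureTheory.volume) hf.aestronglyMeasurable (huni s)

theorem hasDerivAt_fderiv_snd {g : ℝ × ℝ × ℝ → ℝ} {s J y : ℝ} (hg : ContDiffAt ℝ 3 g (s, J, y)) :
    HasDerivAt (fun J => fderiv ℝ g (s, J, y) (0, 1, 0))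
      (fderiv ℝ (fderiv ℝ g) (s, J, y) (0, 1, 0) (0, 1, 0)) J := by
  have h1 : HasDerivAt (fun J : ℝ => ((s, J, y) : ℝ × ℝ × ℝ)) (0, 1, 0) J :=
    (hasDerivAt_const J s).prodMk ((hasDerivAt_id J).prodMk (hasDerivAt_const J y))
  have h2 : HasFDerivAt (fderiv ℝ g) (fderiv ℝ (fderiv ℝ g) (s, J, y)) (s, J, y) :=
    ((hg.fderiv_right (m := 1) (by norm_num)).differentiableAt (by norm_num)).hasFDerivAt
  have h3 : HasDerivAt (fun J => fderiv ℝ g (s, J, y))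
      (fderiv ℝ (fderiv ℝ g) (s, J, y) (0, 1, 0)) J := h2.comp_hasDerivAt J h1
  exact ((ContinuousLinearMap.apply ℝ ℝ ((0, 1, 0) : ℝ × ℝ × ℝ)).hasFDerivAt.comp_hasDerivAt J h3)

namespace ConvexFamily

variable {g : ℝ × ℝ × ℝ → ℝ} {O : Set (ℝ × ℝ)} {B : Set ℝ} {s J y : ℝ}

theorem isOpen_dom (h : ConvexFamily g O B) : IsOpen {z : ℝ × ℝ × ℝ | z.2 ∈ O} :=
  h.isOpen.preimage continuous_snd

theorem contDiffAt (h : ConvexFamily g O B) {z : ℝ × ℝ × ℝ} (hz : z.2 ∈ O) :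
    ContDiffAt ℝ 3 g z :=
  h.smooth.contDiffAt (h.isOpen_dom.mem_nhds hz)

theorem contDiffOn_fderiv (h : ConvexFamily g O B) :
    ContDiffOn ℝ 2 (fderiv ℝ g) {z | z.2 ∈ O} :=
  h.smooth.fderiv_of_isOpen h.isOpen_dom (by norm_num)

theorem hasDerivAt (h : ConvexFamily g O B) (hJ : (J, y) ∈ O) :
    HasDerivAt (fun J => g (s, J, y)) (fderiv ℝ g (s, J, y) (0, 1, 0)) J := by
  have h1 : HasDerivAt (fun J : ℝ => ((s, J, y) : ℝ × ℝ × ℝ)) (0, 1, 0) J :=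
    (hasDerivAt_const J s).prodMk ((hasDerivAt_id J).prodMk (hasDerivAt_const J y))
  exact ((h.contDiffAt (z := (s, J, y)) hJ).differentiableAt
    (by norm_num)).hasFDerivAt.comp_hasDerivAt J h1

theorem hasDerivAt_fderiv (h : ConvexFamily g O B) (hJ : (J, y) ∈ O) :
    HasDerivAt (fun J => fderiv ℝ g (s, J, y) (0, 1, 0))
      (fderiv ℝ (fderiv ℝ g) (s, J, y) (0, 1, 0) (0, 1, 0)) J :=
  hasDerivAt_fderiv_snd (h.contDiffAt (z := (s, J, y)) hJ)

theorem strictMonoOn (h : ConvexFamily g O B) (hy : y ∈ B) (s : ℝ) :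
    StrictMonoOn (fun J => fderiv ℝ g (s, J, y) (0, 1, 0)) {J | (J, y) ∈ O} := by
  refine strictMonoOn_of_deriv_pos (h.ordConnected y hy).convex
    (fun J hJ => (h.hasDerivAt_fderiv hJ).continuousAt.continuousWithinAt) fun J hJ => ?_
  rw [(h.hasDerivAt_fderiv (interior_subset (s := {J | (J, y) ∈ O}) hJ)).deriv]
  exact h.convex _ (interior_subset (s := {J | (J, y) ∈ O}) hJ)

theorem argmin_spec (h : ConvexFamily g O B) (hy : y ∈ B) (s : ℝ) :
    (argmin g O s y, y) ∈ O ∧ fderiv ℝ g (s, argmin g O s y, y) (0, 1, 0) = 0 :=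
  Classical.epsilon_spec (h.exists_zero y hy s)

theorem eq_argmin (h : ConvexFamily g O B) (hy : y ∈ B) (hJ : (J, y) ∈ O)
    (h0 : fderiv ℝ g (s, J, y) (0, 1, 0) = 0) : J = argmin g O s y :=
  (h.strictMonoOn hy s).injOn hJ (h.argmin_spec hy s).1 (by
    simp only [h0, (h.argmin_spec hy s).2])

theorem fderiv_add_one (h : ConvexFamily g O B) (z : ℝ × ℝ × ℝ) :
    fderiv ℝ g (z + (1, 0, 0)) = fderiv ℝ g z := by
  have e1 : (fun z : ℝ × ℝ × ℝ => g (z + (1, 0, 0))) = g := by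
    funext z
    rw [← h.periodic z.1 z.2]
    congr 1
    ext <;> simp
  rw [← fderiv_comp_add_right, e1]

theorem argmin_add_one (h : ConvexFamily g O B) (s y : ℝ) :
    argmin g O (s + 1) y = argmin g O s y := by
  have : ∀ J, fderiv ℝ g (s + 1, J, y) = fderiv ℝ g (s, J, y) := fun J => by
    rw [← h.fderiv_add_one (s, J, y)]
    simp
  simp only [argmin, this]

theorem minVal_add_one (h : ConvexFamily g O B) (s y : ℝ) :
    minVal g O (s + 1) y = minVal g O s y := by
  simp only [minVal, h.argmin_add_one, h.periodic]

theorem minVal_le (h : ConvexFamily g O B) (hy : y ∈ B) (hJ : (J, y) ∈ O) :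
    minVal g O s y ≤ g (s, J, y) := by
  obtain ⟨h1, h2⟩ := h.argmin_spec hy s
  have hmem : ∀ x ∈ uIcc (argmin g O s y) J, (x, y) ∈ O := fun x hx =>
    (h.ordConnected y hy).uIcc_subset h1 hJ hx
  have hmono := (h.strictMonoOn hy s).monotoneOn
  rw [minVal]
  rcases lt_trichotomy (argmin g O s y) J with h3 | h3 | h3
  · rw [uIcc_of_le h3.le] at hmem
    obtain ⟨x, hx, e⟩ := exists_hasDerivAt_eq_slope (fun J => g (s, J, y)) _ h3
      (fun x hx => (h.hasDerivAt (hmem x hx)).continuousAt.continuousWithinAt)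
      fun x hx => h.hasDerivAt (hmem x ⟨hx.1.le, hx.2.le⟩)
    have h4 := hmono h1 (hmem x ⟨hx.1.le, hx.2.le⟩) hx.1.le
    simp only [h2] at h4
    rw [eq_div_iff (by linarith)] at e
    nlinarith [mul_nonneg h4 (sub_nonneg.2 h3.le)]
  · rw [h3]
  · rw [uIcc_of_ge h3.le] at hmem
    obtain ⟨x, hx, e⟩ := exists_hasDerivAt_eq_slope (fun J => g (s, J, y)) _ h3
      (fun x hx => (h.hasDerivAt (hmem x hx)).continuousAt.continuousWithinAt)
      fun x hx => h.hasDerivAt (hmem x ⟨hx.1.le, hx.2.le⟩)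
    have h4 := hmono (hmem x ⟨hx.1.le, hx.2.le⟩) h1 hx.2.le
    simp only [h2] at h4
    rw [eq_div_iff (by linarith)] at e
    nlinarith [mul_nonneg (neg_nonneg.2 h4) (sub_nonneg.2 h3.le)]

/-- The minimum is continuous also in the parameter: the derivative in `J` is increasing and changes
its sign between two points on both sides, also for nearby parameters. -/
theorem continuousOn_argmin (h : ConvexFamily g O B) :
    ContinuousOn (fun p : ℝ × ℝ => argmin g O p.1 p.2) (univ ×ˢ B) := by
  rintro ⟨s₀, y₀⟩ ⟨-, hy₀⟩
  obtain ⟨h1, h2⟩ := h.argmin_spec hy₀ s₀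
  simp only at hy₀
  rw [ContinuousWithinAt, Metric.tendsto_nhds]
  intro ε hε
  -- two points on both sides of the minimum, which stay in the domain for nearby parameters
  obtain ⟨ε', hε', hO⟩ : ∃ ε' > 0, ∀ x, |x - argmin g O s₀ y₀| ≤ ε' → (x, y₀) ∈ O := by
    have : {x | (x, y₀) ∈ O} ∈ 𝓝 (argmin g O s₀ y₀) :=
      (h.isOpen.preimage (by fun_prop)).mem_nhds h1
    obtain ⟨r, hr, hr'⟩ := Metric.nhds_basis_closedBall.mem_iff.1 this
    exact ⟨r, hr, fun x hx => hr' hx⟩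
  set d := min ε' (ε / 2) with hd
  have hd0 : 0 < d := by positivity
  have side : ∀ u, |u - argmin g O s₀ y₀| ≤ d →
      ContinuousAt (fun p : ℝ × ℝ => fderiv ℝ g (p.1, u, p.2) (0, 1, 0)) (s₀, y₀) ∧
      ∀ᶠ p : ℝ × ℝ in 𝓝 (s₀, y₀), (u, p.2) ∈ O := by
    intro u hu
    have hu' := hO u (hu.trans (min_le_left _ _))
    constructor
    · have h3 : ContinuousAt (fderiv ℝ g) (s₀, u, y₀) :=
        (h.contDiffOn_fderiv.contDiffAt (h.isOpen_dom.mem_nhds hu')).continuousAt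
      have h4 : ContinuousAt (fun p : ℝ × ℝ => fderiv ℝ g (p.1, u, p.2)) (s₀, y₀) :=
        ContinuousAt.comp (g := fderiv ℝ g) (f := fun p : ℝ × ℝ => ((p.1, u, p.2) : ℝ × ℝ × ℝ)) h3
          (by fun_prop)
      exact h4.clm_apply continuousAt_const
    · exact (h.isOpen.preimage (by fun_prop : Continuous fun p : ℝ × ℝ => (u, p.2))).mem_nhds hu'
  obtain ⟨c1, m1⟩ := side (argmin g O s₀ y₀ - d) (by
    rw [sub_sub_cancel_left, abs_neg, abs_of_pos hd0])
  obtain ⟨c2, m2⟩ := side (argmin g O s₀ y₀ + d) (by rw [add_sub_cancel_left, abs_of_pos hd0])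
  have hmono := h.strictMonoOn hy₀ s₀
  have n1 := hmono (hO (argmin g O s₀ y₀ - d) (by
    rw [sub_sub_cancel_left, abs_neg, abs_of_pos hd0]; exact min_le_left _ _)) h1 (by linarith)
  have n2 := hmono h1 (hO (argmin g O s₀ y₀ + d) (by
    rw [add_sub_cancel_left, abs_of_pos hd0]; exact min_le_left _ _)) (by linarith)
  simp only [h2] at n1 n2
  filter_upwards [nhdsWithin_le_nhds (c1.eventually_lt_const n1),
    nhdsWithin_le_nhds (c2.eventually_const_lt n2), nhdsWithin_le_nhds m1, nhdsWithin_le_nhds m2,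
    self_mem_nhdsWithin] with p k1 k2 k3 k4 hp
  obtain ⟨h3, h4⟩ := h.argmin_spec hp.2 p.1
  have hm := h.strictMonoOn hp.2 p.1
  have l1 := (hm.lt_iff_lt k3 h3).1 (by simpa only [h4] using k1)
  have l2 := (hm.lt_iff_lt h3 k4).1 (by simpa only [h4] using k2)
  have := min_le_right ε' (ε / 2)
  rw [Real.dist_eq, abs_lt]
  constructor <;> linarith

theorem continuousOn_minVal (h : ConvexFamily g O B) :
    ContinuousOn (fun p : ℝ × ℝ => minVal g O p.1 p.2) (univ ×ˢ B) :=
  h.smooth.continuousOn.comp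
    (continuousOn_fst.prodMk (h.continuousOn_argmin.prodMk continuousOn_snd))
    fun p hp => (h.argmin_spec hp.2 p.1).1

theorem continuous_argmin (h : ConvexFamily g O B) (hy : y ∈ B) :
    Continuous fun s => argmin g O s y :=
  h.continuousOn_argmin.comp_continuous (f := fun s : ℝ => (s, y)) (by fun_prop)
    fun s => ⟨mem_univ _, hy⟩

theorem continuous_minVal (h : ConvexFamily g O B) (hy : y ∈ B) :
    Continuous fun s => minVal g O s y :=
  h.continuousOn_minVal.comp_continuous (f := fun s : ℝ => (s, y)) (by fun_prop)
    fun s => ⟨mem_univ _, hy⟩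

theorem continuousOn_level (h : ConvexFamily g O B) : ContinuousOn (level g O) B := by
  rw [continuousOn_iff_continuous_domRestrict]
  refine IsCompact.continuous_sSup (f := fun (y : B) s => minVal g O s y) isCompact_Icc ?_
  exact h.continuousOn_minVal.comp_continuous (f := fun p : B × ℝ => (p.2, (p.1 : ℝ)))
    (by fun_prop) fun p => ⟨mem_univ _, p.1.2⟩

theorem minVal_le_level (h : ConvexFamily g O B) (hy : y ∈ B) (s : ℝ) :
    minVal g O s y ≤ level g O y := by
  have hper : Function.Periodic (fun s => minVal g O s y) 1 := fun s => h.minVal_add_one s y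
  obtain ⟨t, ht, e⟩ := hper.exists_mem_Ico₀ one_pos s
  rw [e]
  exact le_csSup ((isCompact_Icc.image (h.continuous_minVal hy)).bddAbove)
    (mem_image_of_mem _ ⟨ht.1, ht.2.le⟩)

theorem exists_level (h : ConvexFamily g O B) (hy : y ∈ B) :
    ∃ s, minVal g O s y = level g O y := by
  obtain ⟨s, -, e⟩ := (isCompact_Icc.image (h.continuous_minVal hy)).sSup_mem
    ((nonempty_Icc.2 zero_le_one).image (fun s => minVal g O s y))
  exact ⟨s, e⟩

/-- The graph of `s ↦ argmin g O s y`, slightly smoothed, lies in `{g < E}` for every `E` above `level`,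
and no graph lies in `{g < E}` for smaller `E`. -/
theorem criticalLevel_eq (h : ConvexFamily g O B) (hy : y ∈ B) :
    criticalLevel (fun x => g (x.1, x.2, y)) {J | (J, y) ∈ O} = level g O y := by
  have key : ∀ E, level g O y < E → ∃ ω : ℝ → ℝ, ContDiff ℝ (⊤ : ℕ∞) ω ∧ (∀ s, ω (s + 1) = ω s) ∧
      (∀ s, ω s ∈ {J | (J, y) ∈ O}) ∧ ∀ s, g (s, ω s, y) < E := by
    intro E hE
    have hW : IsOpen {z : ℝ × ℝ × ℝ | z.2 ∈ O ∧ g z < E} :=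
      h.smooth.continuousOn.isOpen_inter_preimage h.isOpen_dom isOpen_Iio
    have hK : IsCompact ((fun s => ((s, argmin g O s y, y) : ℝ × ℝ × ℝ)) '' Icc 0 1) :=
      isCompact_Icc.image (by have := h.continuous_argmin hy; fun_prop)
    obtain ⟨ε, hε, hεW⟩ := hK.exists_thickening_subset_open hW (by
      rintro _ ⟨s, -, rfl⟩
      exact ⟨(h.argmin_spec hy s).1, (h.minVal_le_level hy s).trans_lt hE⟩)
    obtain ⟨ω, h1, h2, h3⟩ := exists_periodic_smooth (h.continuous_argmin hy)
      (fun s => h.argmin_add_one s y) (half_pos hε)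
    have h4 : ∀ s ∈ Icc (0 : ℝ) 1, (ω s, y) ∈ O ∧ g (s, ω s, y) < E := fun s hs => by
      have : ((s, ω s, y) : ℝ × ℝ × ℝ) ∈ {z : ℝ × ℝ × ℝ | z.2 ∈ O ∧ g z < E} := by
        refine hεW (Metric.mem_thickening_iff.2 ⟨_, mem_image_of_mem _ hs, ?_⟩)
        have := h3 s
        rw [← Real.dist_eq] at this
        simp only [Prod.dist_eq, dist_self]
        rw [max_eq_left dist_nonneg, max_eq_right dist_nonneg]
        linarith
      exact this
    have h5 : ∀ s, (ω s, y) ∈ O ∧ g (s, ω s, y) < E := fun s => by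
      have hper : Function.Periodic (fun s => (ω s, g (s, ω s, y))) 1 := fun s => by
        simp only [h2, h.periodic]
      obtain ⟨t, ht, e⟩ := hper.exists_mem_Ico₀ one_pos s
      simp only [Prod.mk.injEq] at e
      rw [e.1]
      rw [e.1] at e
      rw [e.2]
      exact h4 t ⟨ht.1, ht.2.le⟩
    exact ⟨ω, h1, h2, fun s => (h5 s).1, fun s => (h5 s).2⟩
  refine csInf_eq_of_forall_ge_of_forall_gt_exists_lt ?_ ?_ ?_
  · exact ⟨level g O y + 1, key _ (by linarith)⟩
  · rintro E ⟨ω, -, -, h3, h4⟩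
    obtain ⟨s, hs⟩ := h.exists_level hy
    rw [← hs]
    exact (h.minVal_le hy (h3 s)).trans (h4 s).le
  · intro E hE
    obtain ⟨E', h1, h2⟩ := exists_between hE
    exact ⟨E', key E' h1, h2⟩

theorem fderiv_slice (h : ConvexFamily g O B) {x : ℝ × ℝ} (hx : (x.2, y) ∈ O) (v : ℝ × ℝ) :
    fderiv ℝ (fun x : ℝ × ℝ => g (x.1, x.2, y)) x v = fderiv ℝ g (x.1, x.2, y) (v.1, v.2, 0) := by
  have h1 : HasFDerivAt (fun x : ℝ × ℝ => ((x.1, x.2, y) : ℝ × ℝ × ℝ))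
      ((ContinuousLinearMap.fst ℝ ℝ ℝ).prod ((ContinuousLinearMap.snd ℝ ℝ ℝ).prod 0)) x :=
    hasFDerivAt_fst.prodMk (hasFDerivAt_snd.prodMk (hasFDerivAt_const y x))
  have h2 := ((h.contDiffAt (z := (x.1, x.2, y)) hx).differentiableAt
    (by norm_num)).hasFDerivAt.comp x h1
  have h3 : fderiv ℝ (fun x : ℝ × ℝ => g (x.1, x.2, y)) x = _ := h2.fderiv
  rw [h3]
  rfl

theorem eq_argmin_of_critical (h : ConvexFamily g O B) (hy : y ∈ B) {x : ℝ × ℝ} (hx : (x.2, y) ∈ O)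
    (h0 : fderiv ℝ (fun x : ℝ × ℝ => g (x.1, x.2, y)) x = 0) : x.2 = argmin g O x.1 y :=
  h.eq_argmin hy hx (by have := h.fderiv_slice hx (0, 1); rw [h0] at this; exact this.symm)

/-- Minimal critical points are the points on the graph of the minima over the maxima of `minVal`. -/
theorem isMinimalCritical_iff (h : ConvexFamily g O B) (hy : y ∈ B) {x : ℝ × ℝ} :
    IsMinimalCritical (fun x => g (x.1, x.2, y)) {J | (J, y) ∈ O} x ↔
      x.2 = argmin g O x.1 y ∧ fderiv ℝ g (x.1, x.2, y) (1, 0, 0) = 0 ∧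
        minVal g O x.1 y = level g O y := by
  rw [IsMinimalCritical, h.criticalLevel_eq hy]
  constructor
  · rintro ⟨h1, h2, h3⟩
    have h4 := h.eq_argmin_of_critical hy h1 h2
    refine ⟨h4, ?_, ?_⟩
    · rw [← h.fderiv_slice h1 (1, 0), h2]; rfl
    · rw [minVal, ← h4]; exact h3
  · rintro ⟨h1, h2, h3⟩
    obtain ⟨h4, h5⟩ := h.argmin_spec hy x.1
    rw [← h1] at h4 h5
    refine ⟨h4, ?_, ?_⟩
    · ext
      · rw [ContinuousLinearMap.comp_apply, h.fderiv_slice h4]; simpa using h2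
      · rw [ContinuousLinearMap.comp_apply, h.fderiv_slice h4]; simpa using h5
    · rw [minVal, ← h1] at h3; exact h3

/-- Upper semicontinuity of the set of minimal critical points. -/
theorem eventually_minimal_mem (h : ConvexFamily g O B) (hy : y ∈ B) {U : Set (ℝ × ℝ × ℝ)}
    (hU : IsOpen U) (hmem : ∀ x : ℝ × ℝ,
      IsMinimalCritical (fun x => g (x.1, x.2, y)) {J | (J, y) ∈ O} x → (x.1, x.2, y) ∈ U) :
    ∀ᶠ y' in 𝓝[B] y, ∀ x : ℝ × ℝ, x.1 ∈ Icc (0 : ℝ) 1 →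
      IsMinimalCritical (fun x => g (x.1, x.2, y')) {J | (J, y') ∈ O} x → (x.1, x.2, y') ∈ U := by
  have key : ∀ s ∈ Icc (0 : ℝ) 1, ∀ᶠ p : ℝ × ℝ in 𝓝 (y, s), p.1 ∈ B →
      fderiv ℝ g (p.2, argmin g O p.2 p.1, p.1) (1, 0, 0) = 0 →
        minVal g O p.2 p.1 = level g O p.1 → (p.2, argmin g O p.2 p.1, p.1) ∈ U := by
    intro s _
    have hT : Tendsto (fun p : ℝ × ℝ => (p.2, p.1)) (𝓝[B ×ˢ univ] (y, s)) (𝓝[univ ×ˢ B] (s, y)) :=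
      tendsto_nhdsWithin_of_tendsto_nhds_of_eventually_within _
        ((by fun_prop : Continuous fun p : ℝ × ℝ => (p.2, p.1)).continuousAt.mono_left
          nhdsWithin_le_nhds) (by
          filter_upwards [self_mem_nhdsWithin] with p hp using ⟨mem_univ _, hp.1⟩)
    have c1 : Tendsto (fun p : ℝ × ℝ => argmin g O p.2 p.1) (𝓝[B ×ˢ univ] (y, s))
        (𝓝 (argmin g O s y)) := (h.continuousOn_argmin (s, y) ⟨mem_univ _, hy⟩).tendsto.comp hT
    have c2 : Tendsto (fun p : ℝ × ℝ => minVal g O p.2 p.1) (𝓝[B ×ˢ univ] (y, s))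
        (𝓝 (minVal g O s y)) := (h.continuousOn_minVal (s, y) ⟨mem_univ _, hy⟩).tendsto.comp hT
    have c3 : Tendsto (fun p : ℝ × ℝ => level g O p.1) (𝓝[B ×ˢ univ] (y, s))
        (𝓝 (level g O y)) := (h.continuousOn_level y hy).tendsto.comp
      (tendsto_nhdsWithin_of_tendsto_nhds_of_eventually_within _
        (continuous_fst.continuousAt.mono_left nhdsWithin_le_nhds) (by
          filter_upwards [self_mem_nhdsWithin] with p hp using hp.1))
    have c4 : Tendsto (fun p : ℝ × ℝ => ((p.2, argmin g O p.2 p.1, p.1) : ℝ × ℝ × ℝ))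
        (𝓝[B ×ˢ univ] (y, s)) (𝓝 (s, argmin g O s y, y)) :=
      (continuous_snd.continuousAt.mono_left nhdsWithin_le_nhds).prodMk_nhds
        (c1.prodMk_nhds (continuous_fst.continuousAt.mono_left nhdsWithin_le_nhds))
    have c5 : Tendsto (fun p : ℝ × ℝ => fderiv ℝ g (p.2, argmin g O p.2 p.1, p.1) (1, 0, 0))
        (𝓝[B ×ˢ univ] (y, s)) (𝓝 (fderiv ℝ g (s, argmin g O s y, y) (1, 0, 0))) := by
      have h3 : ContinuousAt (fun z => fderiv ℝ g z (1, 0, 0)) (s, argmin g O s y, y) :=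
        (h.contDiffOn_fderiv.contDiffAt (h.isOpen_dom.mem_nhds
          (h.argmin_spec hy s).1)).continuousAt.clm_apply continuousAt_const
      exact h3.tendsto.comp c4
    have goal : ∀ᶠ p : ℝ × ℝ in 𝓝[B ×ˢ univ] (y, s),
        fderiv ℝ g (p.2, argmin g O p.2 p.1, p.1) (1, 0, 0) = 0 →
        minVal g O p.2 p.1 = level g O p.1 → (p.2, argmin g O p.2 p.1, p.1) ∈ U := by
      by_cases k1 : fderiv ℝ g (s, argmin g O s y, y) (1, 0, 0) = 0
      · by_cases k2 : minVal g O s y = level g O y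
        · have := hmem (s, argmin g O s y) ((h.isMinimalCritical_iff hy).2 ⟨rfl, k1, k2⟩)
          filter_upwards [c4.eventually (hU.mem_nhds this)] with p hp _ _ using hp
        · filter_upwards [(c2.prodMk_nhds c3).eventually (isClosed_diagonal.isOpen_compl.mem_nhds
            (show (minVal g O s y, level g O y) ∈ (diagonal ℝ)ᶜ from k2))] with p hp _ hp'
          exact absurd hp' hp
      · filter_upwards [c5.eventually_ne k1] with p hp hp'
        exact absurd hp' hp
    rw [eventually_nhdsWithin_iff] at goal
    filter_upwards [goal] with p hp hpB using hp ⟨hpB, mem_univ _⟩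
  have := isCompact_Icc.eventually_forall_of_forall_eventually (P := fun y' s => y' ∈ B →
    fderiv ℝ g (s, argmin g O s y', y') (1, 0, 0) = 0 → minVal g O s y' = level g O y' →
      (s, argmin g O s y', y') ∈ U) key
  rw [eventually_nhdsWithin_iff]
  filter_upwards [this] with y' h1 hy' x hx hmin
  obtain ⟨h2, h3, h4⟩ := (h.isMinimalCritical_iff hy').1 hmin
  have := h1 x.1 hx hy'
  rw [← h2] at this
  exact this h3 h4

end ConvexFamily

/-! ### Branches of saddles -/

/-- The points at which `g(·, ·, y)` is critical. -/
def Critical (g : ℝ × ℝ × ℝ → ℝ) (z : ℝ × ℝ × ℝ) : Prop :=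
  fderiv ℝ g z (1, 0, 0) = 0 ∧ fderiv ℝ g z (0, 1, 0) = 0

/-- The determinant of the Hessian of `g(·, ·, y)`, up to the sign. At a saddle it is the square of
the eigenvalue. -/
noncomputable def negHess (g : ℝ × ℝ × ℝ → ℝ) (z : ℝ × ℝ × ℝ) : ℝ :=
  fderiv ℝ (fderiv ℝ g) z (1, 0, 0) (0, 1, 0) ^ 2
    - fderiv ℝ (fderiv ℝ g) z (1, 0, 0) (1, 0, 0) * fderiv ℝ (fderiv ℝ g) z (0, 1, 0) (0, 1, 0)

/-- The point of `γ` over `y`. -/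
def lift (γ : ℝ → ℝ × ℝ) (y : ℝ) : ℝ × ℝ × ℝ := ((γ y).1, (γ y).2, y)

/-- The implicit function theorem for critical points with nondegenerate Hessian. -/
theorem exists_implicit {g : ℝ × ℝ × ℝ → ℝ} {z₀ : ℝ × ℝ × ℝ} (hg : ContDiffAt ℝ 3 g z₀)
    (h0 : Critical g z₀) (hd : 0 < negHess g z₀) :
    ∃ γ : ℝ → ℝ × ℝ, ContDiffAt ℝ 2 γ z₀.2.2 ∧ γ z₀.2.2 = (z₀.1, z₀.2.1) ∧
      ∀ᶠ z in 𝓝 z₀, Critical g z ↔ γ z.2.2 = (z.1, z.2.1) := by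
  obtain ⟨P, hP⟩ : ∃ P : ℝ × (ℝ × ℝ) →L[ℝ] ℝ × ℝ × ℝ, ∀ v, P v = (v.2.1, v.2.2, v.1) :=
    ⟨((ContinuousLinearMap.fst ℝ ℝ ℝ).comp (ContinuousLinearMap.snd ℝ ℝ _)).prod
      (((ContinuousLinearMap.snd ℝ ℝ ℝ).comp (ContinuousLinearMap.snd ℝ ℝ _)).prod
        (ContinuousLinearMap.fst ℝ ℝ _)), fun v => rfl⟩
  set f : ℝ × (ℝ × ℝ) → ℝ × ℝ := fun v =>
    (fderiv ℝ g (P v) (1, 0, 0), fderiv ℝ g (P v) (0, 1, 0)) with hf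
  set u : ℝ × (ℝ × ℝ) := (z₀.2.2, (z₀.1, z₀.2.1)) with hu
  have hPu : P u = z₀ := by rw [hP]
  have hg1 : ContDiffAt ℝ 2 (fderiv ℝ g) (P u) := by
    rw [hPu]; exact hg.fderiv_right (by norm_num)
  have hg2 : ContDiffAt ℝ 2 (fun v => fderiv ℝ g (P v)) u :=
    ContDiffAt.comp u (g := fderiv ℝ g) (f := P) hg1 P.contDiff.contDiffAt
  have cdf : ContDiffAt ℝ 2 f u :=
    (hg2.clm_apply contDiffAt_const).prodMk (hg2.clm_apply contDiffAt_const)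
  have hder : HasFDerivAt (fun v => fderiv ℝ g (P v)) ((fderiv ℝ (fderiv ℝ g) z₀).comp P) u := by
    have := (hg1.differentiableAt (by norm_num)).hasFDerivAt.comp u P.hasFDerivAt
    rwa [hPu] at this
  have hfd : ∀ w, fderiv ℝ f u w = (fderiv ℝ (fderiv ℝ g) z₀ (P w) (1, 0, 0),
      fderiv ℝ (fderiv ℝ g) z₀ (P w) (0, 1, 0)) := by
    intro w
    have e1 : ∀ e : ℝ × ℝ × ℝ, HasFDerivAt (fun v => fderiv ℝ g (P v) e)
        ((ContinuousLinearMap.apply ℝ ℝ e).comp ((fderiv ℝ (fderiv ℝ g) z₀).comp P)) u := fun e =>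
      (ContinuousLinearMap.apply ℝ ℝ e).hasFDerivAt.comp u hder
    have e2 : HasFDerivAt f _ u := (e1 (1, 0, 0)).prodMk (e1 (0, 1, 0))
    rw [e2.fderiv]
    rfl
  have hsymm : fderiv ℝ (fderiv ℝ g) z₀ (0, 1, 0) (1, 0, 0)
      = fderiv ℝ (fderiv ℝ g) z₀ (1, 0, 0) (0, 1, 0) :=
    (hg.isSymmSndFDerivAt (by simp; norm_num)) _ _
  have hinv : (fderiv ℝ f u ∘L ContinuousLinearMap.inr ℝ ℝ (ℝ × ℝ)).IsInvertible := by
    have hinj : Function.Injective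
        ((fderiv ℝ f u ∘L ContinuousLinearMap.inr ℝ ℝ (ℝ × ℝ)) : ℝ × ℝ →ₗ[ℝ] ℝ × ℝ) := by
      rw [injective_iff_map_eq_zero]
      intro x hx
      have e : P (0, x) = x.1 • ((1, 0, 0) : ℝ × ℝ × ℝ) + x.2 • ((0, 1, 0) : ℝ × ℝ × ℝ) := by
        rw [hP]; ext <;> simp
      have hx' : fderiv ℝ f u (0, x) = 0 := hx
      rw [hfd, e] at hx'
      simp only [map_add, map_smul, smul_eq_mul, add_apply, smul_apply, Prod.mk_eq_zero,
        hsymm] at hx'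
      obtain ⟨k1, k2⟩ := hx'
      unfold negHess at hd
      set A := fderiv ℝ (fderiv ℝ g) z₀ (1, 0, 0) (1, 0, 0)
      set B := fderiv ℝ (fderiv ℝ g) z₀ (1, 0, 0) (0, 1, 0)
      set C := fderiv ℝ (fderiv ℝ g) z₀ (0, 1, 0) (0, 1, 0)
      have l1 : x.1 * (B ^ 2 - A * C) = 0 := by linear_combination B * k2 - C * k1
      have l2 : x.2 * (B ^ 2 - A * C) = 0 := by linear_combination B * k1 - A * k2
      exact Prod.ext ((mul_eq_zero.1 l1).resolve_right hd.ne')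
        ((mul_eq_zero.1 l2).resolve_right hd.ne')
    exact ⟨(LinearEquiv.ofInjectiveEndo _ hinj).toContinuousLinearEquiv, by ext <;> rfl⟩
  refine ⟨cdf.implicitFunction (by norm_num) hinv, cdf.contDiffAt_implicitFunction (by norm_num) hinv,
    cdf.implicitFunction_apply_self (by norm_num) hinv, ?_⟩
  have hfu : f u = 0 := by
    simp only [hf, hPu]
    exact Prod.ext h0.1 h0.2
  have hT : Tendsto (fun z : ℝ × ℝ × ℝ => ((z.2.2, (z.1, z.2.1)) : ℝ × (ℝ × ℝ))) (𝓝 z₀) (𝓝 u) :=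
    (by fun_prop : Continuous fun z : ℝ × ℝ × ℝ =>
      ((z.2.2, (z.1, z.2.1)) : ℝ × (ℝ × ℝ))).continuousAt
  filter_upwards [hT.eventually (cdf.eventually_apply_eq_iff_implicitFunction (by norm_num) hinv)]
    with z hz
  rw [← hz, hfu, Critical, hf]
  simp only [hP, Prod.mk_eq_zero]

namespace ConvexFamily

variable {g : ℝ × ℝ × ℝ → ℝ} {O : Set (ℝ × ℝ)} {B : Set ℝ} {s J y : ℝ}

/-- A curve of nondegenerate saddles, `C¹` at every point of `I`. -/
structure Branch (g : ℝ × ℝ × ℝ → ℝ) (O : Set (ℝ × ℝ)) (I : Set ℝ) (γ : ℝ → ℝ × ℝ) : Prop where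
  smooth : ∀ y ∈ I, ContDiffAt ℝ 1 γ y
  mem : ∀ y ∈ I, ((γ y).2, y) ∈ O
  critical : ∀ y ∈ I, Critical g (lift γ y)
  pos : ∀ y ∈ I, 0 < negHess g (lift γ y)

theorem Branch.mono {I I' : Set ℝ} {γ : ℝ → ℝ × ℝ} (hγ : Branch g O I γ) (hI : I' ⊆ I) :
    Branch g O I' γ :=
  ⟨fun y hy => hγ.1 y (hI hy), fun y hy => hγ.2 y (hI hy), fun y hy => hγ.3 y (hI hy),
    fun y hy => hγ.4 y (hI hy)⟩

theorem continuousAt_negHess (h : ConvexFamily g O B) {z : ℝ × ℝ × ℝ} (hz : z.2 ∈ O) :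
    ContinuousAt (negHess g) z := by
  have h1 : ContDiffOn ℝ 1 (fderiv ℝ (fderiv ℝ g)) {z | z.2 ∈ O} :=
    h.contDiffOn_fderiv.fderiv_of_isOpen h.isOpen_dom (by norm_num)
  have h2 : ContinuousAt (fderiv ℝ (fderiv ℝ g)) z :=
    (h1.contDiffAt (h.isOpen_dom.mem_nhds hz)).continuousAt
  have h3 : ∀ a b : ℝ × ℝ × ℝ, ContinuousAt (fun z => fderiv ℝ (fderiv ℝ g) z a b) z := fun a b =>
    (h2.clm_apply continuousAt_const).clm_apply continuousAt_const
  exact ((h3 _ _).pow 2).sub ((h3 _ _).mul (h3 _ _))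

theorem exists_branch (h : ConvexFamily g O B) {x : ℝ × ℝ} (hx : (x.2, y) ∈ O)
    (h0 : Critical g (x.1, x.2, y)) (hd : 0 < negHess g (x.1, x.2, y)) :
    ∃ ε > 0, ∃ γ : ℝ → ℝ × ℝ, Branch g O (Ioo (y - ε) (y + ε)) γ ∧ γ y = x ∧
      ∀ᶠ z in 𝓝 ((x.1, x.2, y) : ℝ × ℝ × ℝ), Critical g z → γ z.2.2 = (z.1, z.2.1) := by
  obtain ⟨γ, h1, h2, h3⟩ := exists_implicit (h.contDiffAt (z := (x.1, x.2, y)) hx) h0 hd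
  simp only at h1 h2
  have hl : ContinuousAt (lift γ) y := by
    have := h1.continuousAt
    exact (this.fst).prodMk (this.snd.prodMk continuousAt_id)
  have ely : lift γ y = (x.1, x.2, y) := by rw [lift, h2]
  have e1 : ∀ᶠ y' in 𝓝 y, ContDiffAt ℝ 1 γ y' :=
    (h1.of_le (by norm_num)).eventually (by simp)
  have e2 : ∀ᶠ y' in 𝓝 y, (lift γ y').2 ∈ O :=
    hl.eventually (by rw [ely]; exact h.isOpen_dom.mem_nhds hx)
  have e3 : ∀ᶠ y' in 𝓝 y, Critical g (lift γ y') ↔ γ y' = γ y' := by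
    rw [← ely] at h3
    exact hl.eventually h3
  have e4 : ∀ᶠ y' in 𝓝 y, 0 < negHess g (lift γ y') := by
    have h4 : ContinuousAt (negHess g) (lift γ y) := by
      rw [ely]; exact h.continuousAt_negHess hx
    exact (h4.comp hl).eventually_const_lt (by rw [Function.comp_apply, ely]; exact hd)
  obtain ⟨ε, hε, hall⟩ := Metric.eventually_nhds_iff_ball.1 (e1.and (e2.and (e3.and e4)))
  rw [Real.ball_eq_Ioo] at hall
  exact ⟨ε, hε, γ, ⟨fun y hy => (hall y hy).1, fun y hy => (hall y hy).2.1,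
    fun y hy => (hall y hy).2.2.1.2 rfl, fun y hy => (hall y hy).2.2.2⟩, h2,
    h3.mono fun z hz => hz.1⟩

/-- Curves of saddles are locally determined by their value at one point. -/
theorem eventually_eq (h : ConvexFamily g O B) {Y : Set ℝ} {γ γ' : ℝ → ℝ × ℝ}
    (hγ : ContinuousWithinAt γ Y y) (hγ' : ContinuousWithinAt γ' Y y)
    (hc : ∀ y ∈ Y, Critical g (lift γ y)) (hc' : ∀ y ∈ Y, Critical g (lift γ' y)) (hy : y ∈ Y)
    (hO : ((γ y).2, y) ∈ O) (hd : 0 < negHess g (lift γ y)) (he : γ y = γ' y) :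
    ∀ᶠ y' in 𝓝[Y] y, γ y' = γ' y' := by
  obtain ⟨-, -, β, -, -, h3⟩ := h.exists_branch hO (hc y hy) hd
  have hl : ∀ {γ : ℝ → ℝ × ℝ}, ContinuousWithinAt γ Y y → ContinuousWithinAt (lift γ) Y y :=
    fun hγ => hγ.fst.prodMk (hγ.snd.prodMk continuousWithinAt_id)
  have e : lift γ y = lift γ' y := by rw [lift, he, lift]
  filter_upwards [(hl hγ).eventually h3, (hl hγ').eventually (by rw [← e]; exact h3),
    self_mem_nhdsWithin] with y' k1 k2 hy'
  rw [← show β y' = γ y' from k1 (hc y' hy'), ← show β y' = γ' y' from k2 (hc' y' hy')]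

/-- Two curves of critical points, one of which is nondegenerate, agree once they meet. -/
theorem eqOn_of_isPreconnected (h : ConvexFamily g O B) {Y : Set ℝ} (hY : IsPreconnected Y)
    {γ γ' : ℝ → ℝ × ℝ} (hγ : ContinuousOn γ Y) (hγ' : ContinuousOn γ' Y)
    (hc : ∀ y ∈ Y, Critical g (lift γ y)) (hc' : ∀ y ∈ Y, Critical g (lift γ' y))
    (hO : ∀ y ∈ Y, ((γ y).2, y) ∈ O) (hd : ∀ y ∈ Y, 0 < negHess g (lift γ y)) (hy : y ∈ Y)
    (he : γ y = γ' y) : EqOn γ γ' Y := by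
  intro y' hy'
  refine (hY.induction₂ (fun y y' => γ y = γ' y ↔ γ y' = γ' y') (fun y hy => ?_)
    (fun _ _ _ _ _ _ h1 h2 => h1.trans h2) (fun _ _ _ _ h1 => h1.symm) hy hy').1 he
  by_cases he : γ y = γ' y
  · filter_upwards [h.eventually_eq (hγ y hy) (hγ' y hy) hc hc' hy (hO y hy) (hd y hy) he]
      with y' k using iff_of_true he k
  · have := ((hγ y hy).prodMk (hγ' y hy)).tendsto.eventually
      (isClosed_diagonal.isOpen_compl.mem_nhds (show (γ y, γ' y) ∈ (diagonal (ℝ × ℝ))ᶜ from he))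
    filter_upwards [this] with y' k using iff_of_false he k

/-- `x` is a minimal critical point of `g(·, ·, y)`. -/
def Minimal (g : ℝ × ℝ × ℝ → ℝ) (O : Set (ℝ × ℝ)) (y : ℝ) (x : ℝ × ℝ) : Prop :=
  IsMinimalCritical (fun x => g (x.1, x.2, y)) {J | (J, y) ∈ O} x

theorem Minimal.mem {x : ℝ × ℝ} (hx : Minimal g O y x) : (x.2, y) ∈ O := hx.1

theorem critical_iff (h : ConvexFamily g O B) {x : ℝ × ℝ} (hx : (x.2, y) ∈ O) :
    fderiv ℝ (fun x : ℝ × ℝ => g (x.1, x.2, y)) x = 0 ↔ Critical g (x.1, x.2, y) := by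
  constructor
  · intro h1
    constructor
    · rw [← h.fderiv_slice hx (1, 0), h1]; rfl
    · rw [← h.fderiv_slice hx (0, 1), h1]; rfl
  · rintro ⟨h1, h2⟩
    ext
    · rw [ContinuousLinearMap.comp_apply, h.fderiv_slice hx]; simpa using h1
    · rw [ContinuousLinearMap.comp_apply, h.fderiv_slice hx]; simpa using h2

theorem Minimal.critical (h : ConvexFamily g O B) {x : ℝ × ℝ} (hx : Minimal g O y x) :
    Critical g (x.1, x.2, y) := (h.critical_iff hx.1).1 hx.2.1

theorem minimal_iff (h : ConvexFamily g O B) (hy : y ∈ B) {x : ℝ × ℝ} (hx : (x.2, y) ∈ O)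
    (h0 : Critical g (x.1, x.2, y)) : Minimal g O y x ↔ g (x.1, x.2, y) = level g O y := by
  rw [Minimal, IsMinimalCritical, h.criticalLevel_eq hy, h.critical_iff hx]
  exact ⟨fun h1 => h1.2.2, fun h1 => ⟨hx, h0, h1⟩⟩

theorem add_intCast (h : ConvexFamily g O B) (n : ℤ) (z : ℝ × ℝ × ℝ) :
    g (z + ((n : ℝ), 0, 0)) = g z := by
  have hper : Function.Periodic (fun s => g (s, z.2)) 1 := fun s => h.periodic s z.2
  have := hper.int_mul n z.1
  simp only [mul_one] at this
  rw [show z + ((n : ℝ), 0, 0) = (z.1 + n, z.2) by ext <;> simp, this]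

theorem fderiv_add_intCast (h : ConvexFamily g O B) (n : ℤ) (z : ℝ × ℝ × ℝ) :
    fderiv ℝ g (z + ((n : ℝ), 0, 0)) = fderiv ℝ g z := by
  have e1 : (fun z : ℝ × ℝ × ℝ => g (z + ((n : ℝ), 0, 0))) = g := funext (h.add_intCast n)
  rw [← fderiv_comp_add_right, e1]

theorem negHess_add_intCast (h : ConvexFamily g O B) (n : ℤ) (z : ℝ × ℝ × ℝ) :
    negHess g (z + ((n : ℝ), 0, 0)) = negHess g z := by
  have e1 : (fun z : ℝ × ℝ × ℝ => fderiv ℝ g (z + ((n : ℝ), 0, 0))) = fderiv ℝ g :=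
    funext (h.fderiv_add_intCast n)
  have e2 : fderiv ℝ (fderiv ℝ g) (z + ((n : ℝ), 0, 0)) = fderiv ℝ (fderiv ℝ g) z := by
    rw [← fderiv_comp_add_right, e1]
  rw [negHess, negHess, e2]

theorem critical_add_intCast (h : ConvexFamily g O B) (n : ℤ) (z : ℝ × ℝ × ℝ) :
    Critical g (z + ((n : ℝ), 0, 0)) ↔ Critical g z := by
  rw [Critical, Critical, h.fderiv_add_intCast]

theorem lift_add (γ : ℝ → ℝ × ℝ) (n y : ℝ) :
    lift (fun y => γ y + ((n : ℝ), 0)) y = lift γ y + ((n : ℝ), 0, 0) := by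
  simp [lift]

theorem Branch.add_intCast (h : ConvexFamily g O B) {I : Set ℝ} {γ : ℝ → ℝ × ℝ}
    (hγ : Branch g O I γ) (n : ℤ) : Branch g O I fun y => γ y + ((n : ℝ), 0) :=
  ⟨fun y hy => (hγ.smooth y hy).add contDiffAt_const, fun y hy => by simpa using hγ.mem y hy,
    fun y hy => by rw [lift_add, h.critical_add_intCast]; exact hγ.critical y hy,
    fun y hy => by rw [lift_add, h.negHess_add_intCast]; exact hγ.pos y hy⟩

theorem Minimal.add_intCast (h : ConvexFamily g O B) (hy : y ∈ B) {x : ℝ × ℝ}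
    (hx : Minimal g O y x) (n : ℤ) : Minimal g O y (x + ((n : ℝ), 0)) := by
  have e : (((x + ((n : ℝ), 0)).1, (x + ((n : ℝ), 0)).2, y) : ℝ × ℝ × ℝ)
      = (x.1, x.2, y) + ((n : ℝ), 0, 0) := by simp
  have h1 : ((x + ((n : ℝ), 0)).2, y) ∈ O := by simpa using hx.1
  have h2 := Minimal.critical h hx
  rw [h.minimal_iff hy h1 (by rw [e, h.critical_add_intCast]; exact h2), e, h.add_intCast]
  exact (h.minimal_iff hy hx.1 h2).1 hx

end ConvexFamily

theorem SamePoint.symm {x x' : ℝ × ℝ} (h : SamePoint x x') : SamePoint x' x := by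
  obtain ⟨n, rfl⟩ := h
  exact ⟨-n, by ext <;> simp⟩

theorem SamePoint.trans {x x' x'' : ℝ × ℝ} (h : SamePoint x x') (h' : SamePoint x' x'') :
    SamePoint x x'' := by
  obtain ⟨n, rfl⟩ := h
  obtain ⟨m, rfl⟩ := h'
  exact ⟨n + m, by ext <;> simp; ring⟩

theorem isClosed_samePoint : IsClosed {p : (ℝ × ℝ) × (ℝ × ℝ) | SamePoint p.1 p.2} := by
  have e : {p : (ℝ × ℝ) × (ℝ × ℝ) | SamePoint p.1 p.2}
      = (fun p : (ℝ × ℝ) × (ℝ × ℝ) => p.2.1 - p.1.1) ⁻¹' range ((↑) : ℤ → ℝ) ∩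
        {p | p.2.2 = p.1.2} := by
    ext ⟨x, x'⟩
    simp only [SamePoint, mem_ofPred_eq, mem_inter_iff, mem_preimage, mem_range]
    constructor
    · rintro ⟨n, rfl⟩
      exact ⟨⟨n, by simp⟩, rfl⟩
    · rintro ⟨⟨n, hn⟩, h2⟩
      exact ⟨n, Prod.ext (by simp only; linarith) h2⟩
  rw [e]
  exact (Int.isClosedEmbedding_coe_real.isClosed_range.preimage (by fun_prop)).inter
    (isClosed_eq (by fun_prop) (by fun_prop))

namespace ConvexFamily

/-! ### The curve of minimal saddles -/

variable {g : ℝ × ℝ × ℝ → ℝ} {O : Set (ℝ × ℝ)} {B : Set ℝ} {s J y : ℝ}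

theorem Branch.continuousOn_lift {I : Set ℝ} {γ : ℝ → ℝ × ℝ} (hγ : Branch g O I γ) :
    ContinuousOn (lift γ) I := fun y hy => by
  have := (hγ.smooth y hy).continuousAt
  exact ((this.fst).prodMk (this.snd.prodMk continuousAt_id)).continuousWithinAt

/-- Minimality is a closed condition along a curve of critical points. -/
theorem Branch.eventually_not_minimal (h : ConvexFamily g O B) {I T : Set ℝ} {γ : ℝ → ℝ × ℝ}
    (hγ : Branch g O I γ) (hI : T ⊆ I) (hB : T ⊆ B) (hy : y ∈ T) (hm : ¬ Minimal g O y (γ y)) :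
    ∀ᶠ y' in 𝓝[T] y, ¬ Minimal g O y' (γ y') := by
  have hiff : ∀ y ∈ T, Minimal g O y (γ y) ↔ g (lift γ y) = level g O y := fun y hy =>
    h.minimal_iff (hB hy) (hγ.mem y (hI hy)) (hγ.critical y (hI hy))
  rw [hiff y hy] at hm
  have c1 : ContinuousWithinAt (fun y => g (lift γ y)) T y :=
    ContinuousAt.comp_continuousWithinAt (g := g)
      (h.contDiffAt (z := lift γ y) (hγ.mem y (hI hy))).continuousAt
      ((hγ.continuousOn_lift.mono hI) y hy)
  have c2 : ContinuousWithinAt (level g O) T y := (h.continuousOn_level.mono hB) y hy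
  have := (c1.prodMk c2).tendsto.eventually
    (isClosed_diagonal.isOpen_compl.mem_nhds
      (show (g (lift γ y), level g O y) ∈ (diagonal ℝ)ᶜ from hm))
  filter_upwards [this, self_mem_nhdsWithin] with y' k hy'
  rw [hiff y' hy']
  exact k

/-- Near a parameter with at most two minimal critical points, one of the two branches through them
is minimal. -/
theorem eventually_minimal_or (h : ConvexFamily g O B) (hy : y ∈ B) {x₁ x₂ : ℝ × ℝ}
    (hmin : ∀ x, Minimal g O y x → SamePoint x₁ x ∨ SamePoint x₂ x)
    (hex : ∀ y ∈ B, ∃ x, Minimal g O y x) {γ₁ γ₂ : ℝ → ℝ × ℝ}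
    (h1 : ∀ᶠ z in 𝓝 ((x₁.1, x₁.2, y) : ℝ × ℝ × ℝ), Critical g z → γ₁ z.2.2 = (z.1, z.2.1))
    (h2 : ∀ᶠ z in 𝓝 ((x₂.1, x₂.2, y) : ℝ × ℝ × ℝ), Critical g z → γ₂ z.2.2 = (z.1, z.2.1)) :
    ∀ᶠ y' in 𝓝[B] y, Minimal g O y' (γ₁ y') ∨ Minimal g O y' (γ₂ y') := by
  obtain ⟨U₁, hU₁, hU₁o, hx₁⟩ := eventually_nhds_iff.1 h1
  obtain ⟨U₂, hU₂, hU₂o, hx₂⟩ := eventually_nhds_iff.1 h2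
  have hU : IsOpen (⋃ n : ℤ, (fun z : ℝ × ℝ × ℝ => z + ((n : ℝ), 0, 0)) ⁻¹' (U₁ ∪ U₂)) :=
    isOpen_iUnion fun n => (hU₁o.union hU₂o).preimage (by fun_prop)
  have hmem : ∀ x : ℝ × ℝ, Minimal g O y x → (x.1, x.2, y) ∈
      ⋃ n : ℤ, (fun z : ℝ × ℝ × ℝ => z + ((n : ℝ), 0, 0)) ⁻¹' (U₁ ∪ U₂) := fun x hx => by
    rcases hmin x hx with hs | hs
    all_goals
      obtain ⟨n, rfl⟩ := hs
      refine mem_iUnion.2 ⟨-n, ?_⟩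
      simp [hx₁, hx₂]
  filter_upwards [h.eventually_minimal_mem hy hU hmem, self_mem_nhdsWithin]
    with y' hy' hB
  obtain ⟨x, hx⟩ := hex y' hB
  have hx' := Minimal.add_intCast h hB hx (-⌊x.1⌋)
  have hmem := hy' (x + (((-⌊x.1⌋ : ℤ) : ℝ), 0)) (by
    have k1 := Int.floor_le x.1
    have k2 := Int.lt_floor_add_one x.1
    simp only [Prod.fst_add, Int.cast_neg]
    constructor <;> linarith) hx'
  obtain ⟨n, hn⟩ := mem_iUnion.1 hmem
  have hx'' := Minimal.add_intCast h hB hx' n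
  have hc := Minimal.critical h hx''
  set x' := x + (((-⌊x.1⌋ : ℤ) : ℝ), 0) + ((n : ℝ), 0) with hx'def
  have e : (((x + (((-⌊x.1⌋ : ℤ) : ℝ), 0)).1, (x + (((-⌊x.1⌋ : ℤ) : ℝ), 0)).2, y') : ℝ × ℝ × ℝ)
      + ((n : ℝ), 0, 0) = (x'.1, x'.2, y') := by simp [hx'def]
  rw [mem_preimage, e] at hn
  rcases hn with hn | hn
  · exact Or.inl (by rw [show γ₁ y' = x' from hU₁ _ hn hc]; exact hx'')
  · exact Or.inr (by rw [show γ₂ y' = x' from hU₂ _ hn hc]; exact hx'')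

/-- The assumptions on the minimal critical points, up to integer translations: over `B` they exist,
are nondegenerate, and there are at most two of them; over the open interval `(a, b)` they are
unique. -/
structure MinimalInterval (g : ℝ × ℝ × ℝ → ℝ) (O : Set (ℝ × ℝ)) (B : Set ℝ) (a b : ℝ) : Prop where
  lt : a < b
  sub : Icc a b ⊆ B
  ex : ∀ y ∈ B, ∃ x, Minimal g O y x
  pos : ∀ y ∈ B, ∀ x, Minimal g O y x → 0 < negHess g (x.1, x.2, y)
  unique : ∀ y ∈ Ioo a b, ∀ x x', Minimal g O y x → Minimal g O y x' → SamePoint x x'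
  two : ∀ y ∈ B, ∃ x₁ x₂, Minimal g O y x₁ ∧ Minimal g O y x₂ ∧
    ∀ x, Minimal g O y x → SamePoint x₁ x ∨ SamePoint x₂ x

variable {a b : ℝ}

/-- Near every point of `[a, b]`, end points included, there is a curve of saddles that is minimal over
`[a, b]`. -/
theorem exists_local (h : ConvexFamily g O B) (hm : MinimalInterval g O B a b) (hy : y ∈ Icc a b) :
    ∃ ε > 0, ∃ γ : ℝ → ℝ × ℝ, Branch g O (Ioo (y - ε) (y + ε)) γ ∧
      ∀ y' ∈ Icc a b, y' ∈ Ioo (y - ε) (y + ε) → Minimal g O y' (γ y') := by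
  have hyB := hm.sub hy
  obtain ⟨x₁, x₂, hx₁, hx₂, hall⟩ := hm.two y hyB
  obtain ⟨ε₁, hε₁, γ₁, hγ₁, e₁, n₁⟩ := h.exists_branch hx₁.mem (Minimal.critical h hx₁)
    (hm.pos y hyB x₁ hx₁)
  by_cases hs : SamePoint x₁ x₂
  · have := h.eventually_minimal_or hyB (x₁ := x₁) (x₂ := x₁)
      (fun x hx => (hall x hx).imp id fun h' => hs.trans h') hm.ex n₁ n₁
    simp only [or_self] at this
    rw [eventually_nhdsWithin_iff] at this
    obtain ⟨ε₀, hε₀, k⟩ := Metric.eventually_nhds_iff_ball.1 this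
    rw [Real.ball_eq_Ioo] at k
    refine ⟨min ε₁ ε₀, by positivity, γ₁, hγ₁.mono (Ioo_subset_Ioo ?_ ?_), fun y' h1 h2 =>
      k y' ⟨?_, ?_⟩ (hm.sub h1)⟩
    · linarith [min_le_left ε₁ ε₀]
    · linarith [min_le_left ε₁ ε₀]
    · linarith [min_le_right ε₁ ε₀, h2.1]
    · linarith [min_le_right ε₁ ε₀, h2.2]
  · -- at a bifurcation value, uniqueness on one side selects one of the two branches
    have hnot : y ∉ Ioo a b := fun hy' => hs (hm.unique y hy' _ _ hx₁ hx₂)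
    obtain ⟨ε₂, hε₂, γ₂, hγ₂, e₂, n₂⟩ := h.exists_branch hx₂.mem (Minimal.critical h hx₂)
      (hm.pos y hyB x₂ hx₂)
    have hor := h.eventually_minimal_or hyB hall hm.ex n₁ n₂
    rw [eventually_nhdsWithin_iff] at hor
    have hyI : ∀ {ε : ℝ}, 0 < ε → y ∈ Ioo (y - ε) (y + ε) := fun h =>
      ⟨by linarith, by linarith⟩
    have hns : ∀ᶠ y' in 𝓝 y, ¬ SamePoint (γ₁ y') (γ₂ y') :=
      ((hγ₁.smooth y (hyI hε₁)).continuousAt.prodMk (hγ₂.smooth y (hyI hε₂)).continuousAt).tendsto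
        |>.eventually (isClosed_samePoint.isOpen_compl.mem_nhds
        (show (γ₁ y, γ₂ y) ∈ {p : (ℝ × ℝ) × (ℝ × ℝ) | SamePoint p.1 p.2}ᶜ by
          rw [e₁, e₂]; exact hs))
    obtain ⟨ε₀, hε₀, k⟩ := Metric.eventually_nhds_iff_ball.1 (hor.and hns)
    rw [Real.ball_eq_Ioo] at k
    obtain ⟨ε, hε, l1, l2, l3, l4⟩ : ∃ ε > 0, ε ≤ ε₀ ∧ ε ≤ ε₁ ∧ ε ≤ ε₂ ∧ ε ≤ b - a :=
      ⟨min (min ε₀ ε₁) (min ε₂ (b - a)), by have := sub_pos.2 hm.lt; positivity,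
        (min_le_left _ _).trans (min_le_left _ _), (min_le_left _ _).trans (min_le_right _ _),
        (min_le_right _ _).trans (min_le_left _ _), (min_le_right _ _).trans (min_le_right _ _)⟩
    have b₁ : Branch g O (Ioo (y - ε) (y + ε)) γ₁ :=
      hγ₁.mono (Ioo_subset_Ioo (by linarith) (by linarith))
    have b₂ : Branch g O (Ioo (y - ε) (y + ε)) γ₂ :=
      hγ₂.mono (Ioo_subset_Ioo (by linarith) (by linarith))
    set T := Ioo a b ∩ Ioo (y - ε) (y + ε) with hT
    have hTB : T ⊆ B := fun y' h' => hm.sub (Ioo_subset_Icc_self h'.1)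
    have hkT : ∀ y' ∈ T, (Minimal g O y' (γ₁ y') ∨ Minimal g O y' (γ₂ y')) ∧
        ¬ (Minimal g O y' (γ₁ y') ∧ Minimal g O y' (γ₂ y')) := fun y' h' => by
      obtain ⟨k1, k2⟩ := k y' ⟨by linarith [h'.2.1], by linarith [h'.2.2]⟩
      exact ⟨k1 (hTB h'), fun hh => k2 (hm.unique y' h'.1 _ _ hh.1 hh.2)⟩
    have hcover : ∀ y' ∈ Icc a b, y' ∈ Ioo (y - ε) (y + ε) → y' = y ∨ y' ∈ T := by
      intro y' h1 h2
      by_contra! hne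
      have hy'T : ¬ (y' ∈ Ioo a b) := fun h' => hne.2 ⟨h', h2⟩
      have c1 : y = a ∨ y = b := by
        by_contra! hh
        exact hnot ⟨lt_of_le_of_ne hy.1 hh.1.symm, lt_of_le_of_ne hy.2 hh.2⟩
      have c2 : y' = a ∨ y' = b := by
        by_contra! hh
        exact hy'T ⟨lt_of_le_of_ne h1.1 hh.1.symm, lt_of_le_of_ne h1.2 hh.2⟩
      have c3 := hne.1
      rcases c1 with rfl | rfl <;> rcases c2 with rfl | rfl <;>
        first
        | exact c3 rfl
        | linarith [h2.1, h2.2]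
    by_cases hT1 : ∃ y₁ ∈ T, Minimal g O y₁ (γ₁ y₁)
    · obtain ⟨y₁, hy₁, hy₁'⟩ := hT1
      refine ⟨ε, hε, γ₁, b₁, fun y' h1 h2 => ?_⟩
      rcases hcover y' h1 h2 with rfl | h3
      · rw [e₁]; exact hx₁
      have hpre : IsPreconnected T := (ordConnected_Ioo.inter ordConnected_Ioo).isPreconnected
      refine (hpre.induction₂ (fun y y' => Minimal g O y (γ₁ y) ↔ Minimal g O y' (γ₁ y'))
        (fun t ht => ?_) (fun _ _ _ _ _ _ h1 h2 => h1.trans h2) (fun _ _ _ _ h1 => h1.symm)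
        hy₁ h3).1 hy₁'
      by_cases ht' : Minimal g O t (γ₁ t)
      · have := b₂.eventually_not_minimal h inter_subset_right hTB ht
          (fun hh => (hkT t ht).2 ⟨ht', hh⟩)
        filter_upwards [this, self_mem_nhdsWithin] with t' k1 k2
        exact iff_of_true ht' ((hkT t' k2).1.resolve_right k1)
      · filter_upwards [b₁.eventually_not_minimal h inter_subset_right hTB ht ht'] with t' k1
        exact iff_of_false ht' k1
    · push Not at hT1
      refine ⟨ε, hε, γ₂, b₂, fun y' h1 h2 => ?_⟩
      rcases hcover y' h1 h2 with rfl | h3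
      · rw [e₂]; exact hx₂
      exact (hkT y' h3).1.resolve_left (hT1 y' h3)

/-- Two overlapping minimal branches can be glued, since they differ by an integer at a point of the
overlap. -/
theorem Branch.glue (h : ConvexFamily g O B) (hm : MinimalInterval g O B a b) {t t' t₀ ε ε₀ : ℝ}
    (hat : a ≤ t) (htt' : t < t') (htb : t' ≤ b) (hε : 0 < ε) {γ γ₀ : ℝ → ℝ × ℝ}
    (hγ : Branch g O (Ioo (a - ε) (t + ε)) γ)
    (hγm : ∀ y ∈ Icc a b, y ∈ Ioo (a - ε) (t + ε) → Minimal g O y (γ y))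
    (hγ₀ : Branch g O (Ioo (t₀ - ε₀) (t₀ + ε₀)) γ₀)
    (hγ₀m : ∀ y ∈ Icc a b, y ∈ Ioo (t₀ - ε₀) (t₀ + ε₀) → Minimal g O y (γ₀ y))
    (ht : t ∈ Ioo (t₀ - ε₀) (t₀ + ε₀)) (ht' : t' ∈ Ioo (t₀ - ε₀) (t₀ + ε₀)) :
    ∃ ε > 0, ∃ γ : ℝ → ℝ × ℝ, Branch g O (Ioo (a - ε) (t' + ε)) γ ∧
      ∀ y ∈ Icc a b, y ∈ Ioo (a - ε) (t' + ε) → Minimal g O y (γ y) := by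
  obtain ⟨p, hp1, hp2⟩ := exists_between (lt_min (show t < t + ε by linarith) htt')
  rw [lt_min_iff] at hp2
  have hpab : p ∈ Ioo a b := ⟨by linarith, by linarith [hp2.2]⟩
  have hpI : p ∈ Ioo (a - ε) (t + ε) := ⟨by linarith, hp2.1⟩
  have hpI₀ : p ∈ Ioo (t₀ - ε₀) (t₀ + ε₀) := ⟨by linarith [ht.1], by linarith [ht'.2, hp2.2]⟩
  have hpB := Ioo_subset_Icc_self hpab
  obtain ⟨n, hn⟩ := hm.unique p hpab _ _ (hγ₀m p hpB hpI₀) (hγm p hpB hpI)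
  have hγ₁ := hγ₀.add_intCast h n
  set γ₁ : ℝ → ℝ × ℝ := fun y => γ₀ y + ((n : ℝ), 0) with hγ₁def
  have hγ₁m : ∀ y ∈ Icc a b, y ∈ Ioo (t₀ - ε₀) (t₀ + ε₀) → Minimal g O y (γ₁ y) := fun y h1 h2 =>
    Minimal.add_intCast h (hm.sub h1) (hγ₀m y h1 h2) n
  have hp : γ p = γ₁ p := by rw [hn, hγ₁def]; ext <;> simp
  have hnear : ∀ᶠ y in 𝓝 p, γ y = γ₁ y := by
    have hN : Ioo (a - ε) (t + ε) ∩ Ioo (t₀ - ε₀) (t₀ + ε₀) ∈ 𝓝 p :=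
      inter_mem (isOpen_Ioo.mem_nhds hpI) (isOpen_Ioo.mem_nhds hpI₀)
    have := h.eventually_eq (hγ.smooth p hpI).continuousAt.continuousWithinAt
      (hγ₁.smooth p hpI₀).continuousAt.continuousWithinAt
      (Y := Ioo (a - ε) (t + ε) ∩ Ioo (t₀ - ε₀) (t₀ + ε₀))
      (fun y hy => hγ.critical y hy.1) (fun y hy => hγ₁.critical y hy.2) ⟨hpI, hpI₀⟩
      (hγ.mem p hpI) (hγ.pos p hpI) hp
    rwa [nhdsWithin_eq_nhds.2 hN] at this
  set γ' : ℝ → ℝ × ℝ := fun y => if y < p then γ y else γ₁ y with hγ'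
  have el : ∀ y, y < p → ∀ᶠ y' in 𝓝 y, γ' y' = γ y' := fun y hy => by
    filter_upwards [isOpen_Iio.mem_nhds hy] with y' hy' using if_pos hy'
  have er : ∀ y, p ≤ y → ∀ᶠ y' in 𝓝 y, γ' y' = γ₁ y' := fun y hy => by
    rcases hy.lt_or_eq with hy | rfl
    · filter_upwards [isOpen_Ioi.mem_nhds hy] with y' hy'
      exact if_neg (not_lt.2 (le_of_lt hy'))
    · filter_upwards [hnear] with y' hy'
      by_cases hlt : y' < p
      · rw [← hy']; exact if_pos hlt
      · exact if_neg hlt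
  have hε' : 0 < min ε (t₀ + ε₀ - t') := lt_min hε (by linarith [ht'.2])
  have m1 := min_le_left ε (t₀ + ε₀ - t')
  have m2 := min_le_right ε (t₀ + ε₀ - t')
  have cases : ∀ y ∈ Ioo (a - min ε (t₀ + ε₀ - t')) (t' + min ε (t₀ + ε₀ - t')),
      (y ∈ Ioo (a - ε) (t + ε) ∧ (∀ᶠ y' in 𝓝 y, γ' y' = γ y')) ∨
      (y ∈ Ioo (t₀ - ε₀) (t₀ + ε₀) ∧ (∀ᶠ y' in 𝓝 y, γ' y' = γ₁ y')) := by
    intro y hy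
    rcases lt_or_ge y p with hyp | hyp
    · exact Or.inl ⟨⟨by linarith [hy.1], by linarith⟩, el y hyp⟩
    · exact Or.inr ⟨⟨by linarith [ht.1], by linarith [hy.2]⟩, er y hyp⟩
  refine ⟨_, hε', γ', ⟨fun y hy => ?_, fun y hy => ?_, fun y hy => ?_, fun y hy => ?_⟩,
    fun y hab hy => ?_⟩
  · rcases cases y hy with ⟨h1, h2⟩ | ⟨h1, h2⟩
    · exact (hγ.smooth y h1).congr_of_eventuallyEq h2
    · exact (hγ₁.smooth y h1).congr_of_eventuallyEq h2
  all_goals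
    rcases cases y hy with ⟨h1, h2⟩ | ⟨h1, h2⟩
    all_goals
      have h3 := h2.self_of_nhds
      try rw [lift]
      rw [h3]
  · exact hγ.mem y h1
  · exact hγ₁.mem y h1
  · exact hγ.critical y h1
  · exact hγ₁.critical y h1
  · exact hγ.pos y h1
  · exact hγ₁.pos y h1
  · exact hγm y hab h1
  · exact hγ₁m y hab h1

/-- The minimal critical points over `[a, b]` form a curve, which extends beyond the end points. -/
theorem exists_minimal_branch (h : ConvexFamily g O B) (hm : MinimalInterval g O B a b) :
    ∃ ε > 0, ∃ γ : ℝ → ℝ × ℝ, Branch g O (Ioo (a - ε) (b + ε)) γ ∧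
      ∀ y ∈ Icc a b, Minimal g O y (γ y) := by
  set P : ℝ → Prop := fun t => ∃ ε > 0, ∃ γ : ℝ → ℝ × ℝ, Branch g O (Ioo (a - ε) (t + ε)) γ ∧
    ∀ y ∈ Icc a b, y ∈ Ioo (a - ε) (t + ε) → Minimal g O y (γ y) with hP
  have hPa : P a := h.exists_local hm (left_mem_Icc.2 hm.lt.le)
  have hPb : P b := by
    refine (isPreconnected_Icc.induction₂ (fun t t' => P t ↔ P t') (fun t₀ ht₀ => ?_)
      (fun _ _ _ _ _ _ h1 h2 => h1.trans h2) (fun _ _ _ _ h1 => h1.symm)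
      (left_mem_Icc.2 hm.lt.le) (right_mem_Icc.2 hm.lt.le)).1 hPa
    obtain ⟨ε₀, hε₀, γ₀, hγ₀, hγ₀m⟩ := h.exists_local hm ht₀
    have key : ∀ t ∈ Icc a b, ∀ t' ∈ Icc a b, t ∈ Ioo (t₀ - ε₀) (t₀ + ε₀) →
        t' ∈ Ioo (t₀ - ε₀) (t₀ + ε₀) → P t → P t' := by
      rintro t ht t' ht' h1 h2 ⟨ε, hε, γ, hγ, hγm⟩
      rcases lt_or_ge t t' with hlt | hle
      · exact Branch.glue h hm ht.1 hlt ht'.2 hε hγ hγm hγ₀ hγ₀m h1 h2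
      · exact ⟨ε, hε, γ, hγ.mono (Ioo_subset_Ioo le_rfl (by linarith)), fun y k1 k2 =>
          hγm y k1 ⟨k2.1, by linarith [k2.2]⟩⟩
    have h0 : t₀ ∈ Ioo (t₀ - ε₀) (t₀ + ε₀) := ⟨by linarith, by linarith⟩
    filter_upwards [self_mem_nhdsWithin, nhdsWithin_le_nhds (isOpen_Ioo.mem_nhds h0)] with t ht ht'
    exact ⟨key t₀ ht₀ t ht h0 ht', key t ht t₀ ht₀ ht' h0⟩
  obtain ⟨ε, hε, γ, h1, h2⟩ := hPb
  exact ⟨ε, hε, γ, h1, fun y hy => h2 y hy ⟨by linarith [hy.1], by linarith [hy.2]⟩⟩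

/-- Two curves of critical points which are minimal over `[a, b]` differ by an integer. -/
theorem Branch.eq_add_int (h : ConvexFamily g O B) (hm : MinimalInterval g O B a b) {I Y : Set ℝ}
    {γ γ' : ℝ → ℝ × ℝ} (hγ : Branch g O I γ) (hγm : ∀ y ∈ Icc a b, Minimal g O y (γ y))
    (hYI : Y ⊆ I) (hYc : IsPreconnected Y) (hab : Icc a b ⊆ Y) (hγ' : ContinuousOn γ' Y)
    (hc : ∀ y ∈ Y, Critical g (lift γ' y)) (hγm' : ∀ y ∈ Icc a b, Minimal g O y (γ' y)) :
    ∃ n : ℤ, ∀ y ∈ Y, γ' y = γ y + ((n : ℝ), 0) := by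
  obtain ⟨p, hp⟩ := exists_between hm.lt
  have hp' : p ∈ Icc a b := ⟨hp.1.le, hp.2.le⟩
  obtain ⟨n, hn⟩ := hm.unique p hp _ _ (hγm p hp') (hγm' p hp')
  refine ⟨n, fun y hy => ?_⟩
  have hγn := (hγ.mono hYI).add_intCast h n
  exact (h.eqOn_of_isPreconnected hYc
    (fun y hy => (hγn.smooth y hy).continuousAt.continuousWithinAt) hγ' hγn.critical hc
    hγn.mem hγn.pos (hab hp') (by rw [hn]; ext <;> simp) hy).symm

end ConvexFamily

/-! ### Derivatives of compositions with linear maps -/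

section Calculus

variable {E F : Type*} [NormedAddCommGroup E] [NormedSpace ℝ E] [NormedAddCommGroup F]
  [NormedSpace ℝ F]

theorem iteratedFDeriv_comp_clm {n : WithTop ℕ∞} {f : F → ℝ} {s : Set F} (hs : IsOpen s)
    (hf : ContDiffOn ℝ n f s) (L : E →L[ℝ] F) {x : E} (hx : L x ∈ s) {i : ℕ} (hi : i ≤ n) :
    iteratedFDeriv ℝ i (fun x => f (L x)) x
      = (iteratedFDeriv ℝ i f (L x)).compContinuousLinearMap fun _ => L := by
  have ho : IsOpen (L ⁻¹' s) := hs.preimage L.continuous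
  have := L.iteratedFDerivWithin_comp_right hf hs.uniqueDiffOn ho.uniqueDiffOn hx hi
  rw [iteratedFDerivWithin_of_isOpen i ho hx, iteratedFDerivWithin_of_isOpen i hs hx] at this
  exact this

theorem norm_iteratedFDeriv_comp_clm_le {n : WithTop ℕ∞} {f : F → ℝ} {s : Set F} (hs : IsOpen s)
    (hf : ContDiffOn ℝ n f s) (L : E →L[ℝ] F) {x : E} (hx : L x ∈ s) {i : ℕ} (hi : i ≤ n) :
    ‖iteratedFDeriv ℝ i (fun x => f (L x)) x‖ ≤ ‖iteratedFDeriv ℝ i f (L x)‖ * ‖L‖ ^ i := by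
  rw [iteratedFDeriv_comp_clm hs hf L hx hi]
  refine (ContinuousMultilinearMap.norm_compContinuousLinearMap_le _ _).trans ?_
  simp

theorem norm_fderiv₂ (f : E → ℝ) (x : E) :
    ‖fderiv ℝ (fderiv ℝ f) x‖ = ‖iteratedFDeriv ℝ 2 f x‖ := by
  rw [← norm_iteratedFDeriv_one, norm_iteratedFDeriv_fderiv]

theorem norm_fderiv₃ (f : E → ℝ) (x : E) :
    ‖fderiv ℝ (fderiv ℝ (fderiv ℝ f)) x‖ = ‖iteratedFDeriv ℝ 3 f x‖ := by
  rw [← norm_iteratedFDeriv_one, norm_iteratedFDeriv_fderiv, norm_iteratedFDeriv_fderiv]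

theorem iteratedFDeriv_clm_of_two_le (ℓ : E →L[ℝ] ℝ) {i : ℕ} (hi : 2 ≤ i) (x : E) :
    iteratedFDeriv ℝ i (fun x => ℓ x) x = 0 := by
  obtain ⟨k, rfl⟩ := Nat.exists_eq_add_of_le' hi
  have e : fderiv ℝ (fun x => ℓ x) = fun _ => ℓ := by
    funext x
    exact ℓ.fderiv
  rw [← norm_eq_zero, ← norm_iteratedFDeriv_fderiv, e, iteratedFDeriv_const_of_ne (by omega)]
  simp

theorem norm_iteratedFDeriv_clm_le (ℓ : E →L[ℝ] ℝ) {i : ℕ} (hi : 1 ≤ i) (x : E) :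
    ‖iteratedFDeriv ℝ i (fun x => ℓ x) x‖ ≤ ‖ℓ‖ := by
  rcases hi.eq_or_lt with rfl | hi
  · rw [norm_iteratedFDeriv_one, show fderiv ℝ (fun x => ℓ x) x = ℓ from ℓ.fderiv]
  · rw [iteratedFDeriv_clm_of_two_le ℓ hi]
    simp

end Calculus

namespace ConvexFamily

variable {g : ℝ × ℝ × ℝ → ℝ} {O : Set (ℝ × ℝ)} {B : Set ℝ} {y : ℝ}

/-! ### Eigenvalues of saddles -/

theorem fderiv_planarField (h : ConvexFamily g O B) {x : ℝ × ℝ} (hx : (x.2, y) ∈ O) (v : ℝ × ℝ) :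
    fderiv ℝ (planarField fun x => g (x.1, x.2, y)) x v =
      (fderiv ℝ (fderiv ℝ g) (x.1, x.2, y) (v.1, v.2, 0) (0, 1, 0),
        -fderiv ℝ (fderiv ℝ g) (x.1, x.2, y) (v.1, v.2, 0) (1, 0, 0)) := by
  have hO : ∀ᶠ x' : ℝ × ℝ in 𝓝 x, (x'.2, y) ∈ O :=
    (h.isOpen.preimage (by fun_prop : Continuous fun x : ℝ × ℝ => (x.2, y))).mem_nhds hx
  have e : planarField (fun x => g (x.1, x.2, y)) =ᶠ[𝓝 x] fun x =>
      (fderiv ℝ g (x.1, x.2, y) (0, 1, 0), -fderiv ℝ g (x.1, x.2, y) (1, 0, 0)) := by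
    filter_upwards [hO] with x' hx'
    rw [planarField, h.fderiv_slice hx', h.fderiv_slice hx']
  rw [e.fderiv_eq]
  have h1 : HasFDerivAt (fun x : ℝ × ℝ => ((x.1, x.2, y) : ℝ × ℝ × ℝ))
      ((ContinuousLinearMap.fst ℝ ℝ ℝ).prod ((ContinuousLinearMap.snd ℝ ℝ ℝ).prod 0)) x :=
    hasFDerivAt_fst.prodMk (hasFDerivAt_snd.prodMk (hasFDerivAt_const y x))
  have h2 : HasFDerivAt (fun x : ℝ × ℝ => fderiv ℝ g (x.1, x.2, y))
      ((fderiv ℝ (fderiv ℝ g) (x.1, x.2, y)).comp ((ContinuousLinearMap.fst ℝ ℝ ℝ).prod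
        ((ContinuousLinearMap.snd ℝ ℝ ℝ).prod 0))) x :=
    HasFDerivAt.comp x (g := fderiv ℝ g) ((h.contDiffOn_fderiv.contDiffAt (h.isOpen_dom.mem_nhds
      (show ((x.1, x.2, y) : ℝ × ℝ × ℝ).2 ∈ O from hx))).differentiableAt (by norm_num)).hasFDerivAt h1
  have h3 : ∀ e : ℝ × ℝ × ℝ, HasFDerivAt (fun x : ℝ × ℝ => fderiv ℝ g (x.1, x.2, y) e)
      ((ContinuousLinearMap.apply ℝ ℝ e).comp ((fderiv ℝ (fderiv ℝ g) (x.1, x.2, y)).comp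
        ((ContinuousLinearMap.fst ℝ ℝ ℝ).prod ((ContinuousLinearMap.snd ℝ ℝ ℝ).prod 0)))) x :=
    fun e => (ContinuousLinearMap.apply ℝ ℝ e).hasFDerivAt.comp x h2
  have h4 := ((h3 (0, 1, 0)).prodMk (h3 (1, 0, 0)).neg).fderiv
  exact (DFunLike.congr_fun h4 v).trans rfl

theorem fderiv_planarField_eq (h : ConvexFamily g O B) {x : ℝ × ℝ} (hx : (x.2, y) ∈ O)
    (v : ℝ × ℝ) :
    fderiv ℝ (planarField fun x => g (x.1, x.2, y)) x v =
      (v.1 * fderiv ℝ (fderiv ℝ g) (x.1, x.2, y) (1, 0, 0) (0, 1, 0)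
        + v.2 * fderiv ℝ (fderiv ℝ g) (x.1, x.2, y) (0, 1, 0) (0, 1, 0),
      -(v.1 * fderiv ℝ (fderiv ℝ g) (x.1, x.2, y) (1, 0, 0) (1, 0, 0)
        + v.2 * fderiv ℝ (fderiv ℝ g) (x.1, x.2, y) (1, 0, 0) (0, 1, 0))) := by
  have hsymm : fderiv ℝ (fderiv ℝ g) (x.1, x.2, y) (0, 1, 0) (1, 0, 0)
      = fderiv ℝ (fderiv ℝ g) (x.1, x.2, y) (1, 0, 0) (0, 1, 0) :=
    ((h.contDiffAt (z := (x.1, x.2, y)) hx).isSymmSndFDerivAt (by simp; norm_num)) _ _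
  have e : ((v.1, v.2, 0) : ℝ × ℝ × ℝ)
      = v.1 • ((1, 0, 0) : ℝ × ℝ × ℝ) + v.2 • ((0, 1, 0) : ℝ × ℝ × ℝ) := by ext <;> simp
  rw [h.fderiv_planarField hx, e]
  simp only [map_add, map_smul, smul_eq_mul, add_apply, smul_apply, hsymm]

/-- The square of an eigenvalue of the linearised Hamiltonian flow is minus the determinant of the
Hessian. -/
theorem negHess_of_isSaddle (h : ConvexFamily g O B) {x : ℝ × ℝ} (hx : (x.2, y) ∈ O) {lam : ℝ}
    (hlam : 0 ≤ lam) (hs : IsSaddle (fun x => g (x.1, x.2, y)) lam x) :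
    0 < negHess g (x.1, x.2, y) ∧ lam ^ 2 ≤ negHess g (x.1, x.2, y) := by
  obtain ⟨-, μ, hμ, hle, hev, -⟩ := hs
  obtain ⟨v, hv⟩ := hev.exists_hasEigenvector
  have h1 := hv.apply_eq_smul
  have h2 := hv.2
  have h1' : fderiv ℝ (planarField fun x => g (x.1, x.2, y)) x v = μ • v := h1
  rw [h.fderiv_planarField_eq hx] at h1'
  have k1 := congrArg Prod.fst h1'
  have k2 := congrArg Prod.snd h1'
  simp only [Prod.smul_fst, Prod.smul_snd, smul_eq_mul] at k1 k2
  have key : negHess g (x.1, x.2, y) = μ ^ 2 := by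
    unfold negHess
    set A := fderiv ℝ (fderiv ℝ g) (x.1, x.2, y) (1, 0, 0) (1, 0, 0)
    set C := fderiv ℝ (fderiv ℝ g) (x.1, x.2, y) (0, 1, 0) (0, 1, 0)
    set b := fderiv ℝ (fderiv ℝ g) (x.1, x.2, y) (1, 0, 0) (0, 1, 0)
    have l1 : v.1 * (b ^ 2 - A * C - μ ^ 2) = 0 := by linear_combination (b + μ) * k1 + C * k2
    have l2 : v.2 * (b ^ 2 - A * C - μ ^ 2) = 0 := by linear_combination (-A) * k1 - (b - μ) * k2
    by_contra hne
    have hne' : b ^ 2 - A * C - μ ^ 2 ≠ 0 := fun h0 => hne (by linarith)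
    exact h2 (Prod.ext ((mul_eq_zero.1 l1).resolve_right hne')
      ((mul_eq_zero.1 l2).resolve_right hne'))
  rw [key]
  exact ⟨by positivity, pow_le_pow_left₀ hlam hle 2⟩

theorem isSaddle_of_negHess (h : ConvexFamily g O B) {x : ℝ × ℝ} (hx : (x.2, y) ∈ O)
    (hc : Critical g (x.1, x.2, y)) (hd : 0 < negHess g (x.1, x.2, y)) :
    IsSaddle (fun x => g (x.1, x.2, y)) 0 x := by
  have hC := h.convex (x.1, x.2, y) hx
  have hμ := Real.sqrt_pos.2 hd
  have hsq := Real.sq_sqrt hd.le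
  have key : ∀ μ : ℝ, μ ^ 2 = negHess g (x.1, x.2, y) → Module.End.HasEigenvalue
      (fderiv ℝ (planarField fun x => g (x.1, x.2, y)) x : (ℝ × ℝ) →ₗ[ℝ] (ℝ × ℝ)) μ := by
    intro μ hμ
    refine Module.End.hasEigenvalue_of_hasEigenvector
      (x := (fderiv ℝ (fderiv ℝ g) (x.1, x.2, y) (0, 1, 0) (0, 1, 0),
        μ - fderiv ℝ (fderiv ℝ g) (x.1, x.2, y) (1, 0, 0) (0, 1, 0)))
      ⟨Module.End.mem_eigenspace_iff.2 ?_, fun h0 => hC.ne' (congrArg Prod.fst h0)⟩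
    rw [ContinuousLinearMap.coe_coe, h.fderiv_planarField_eq hx]
    unfold negHess at hμ
    refine Prod.ext ?_ ?_
    · simp only [Prod.smul_fst, smul_eq_mul]
      ring
    · simp only [Prod.smul_snd, smul_eq_mul]
      linear_combination (-1) * hμ
  exact ⟨(h.critical_iff hx).2 hc, _, hμ, hμ.le, key _ hsq, key _ (by rw [neg_sq, hsq])⟩

end ConvexFamily

/-! ### The normal form in slow-fast variables -/

/-- The scale `ρ` is small compared to all constants. The bound `K` on the integer vectors is a
small negative power of `ρ`. -/
structure Scale (r : ℕ) (D C₀ c κ K ρ : ℝ) : Prop where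
  pos : 0 < ρ
  le : ρ ≤ 1 / 100
  r_le : 2018 ≤ r
  D_pos : 0 < D
  D_le : ρ ≤ D⁻¹
  C_le : C₀ ≤ ρ⁻¹
  c_le : ρ ≤ c
  κ_le : ρ ≤ κ
  one_le_K : 1 ≤ K
  K_le : K ≤ ρ⁻¹

/-- The unit `η` with `η ^ 100 = ρ ^ (14 r)`. The squares of the eigenvalues of the saddles are at
least `η ^ 100 * ρ ^ 3`, and `ρ ^ 3` is much larger than `η`. -/
noncomputable def unit (r : ℕ) (ρ : ℝ) : ℝ := ρ ^ (14 / 100 * (r : ℝ))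

namespace Scale

variable {r : ℕ} {D C₀ c κ K ρ : ℝ}

theorem half (sc : Scale r D C₀ c κ K ρ) : ρ ≤ 1 / 2 := by linarith [sc.le]

theorem rpow_le (sc : Scale r D C₀ c κ K ρ) {a b : ℝ} (h : b ≤ a) : ρ ^ a ≤ ρ ^ b :=
  Real.rpow_le_rpow_of_exponent_ge sc.pos (by linarith [sc.le]) h

theorem zpow_le (sc : Scale r D C₀ c κ K ρ) {a b : ℤ} (h : b ≤ a) : ρ ^ a ≤ ρ ^ b :=
  zpow_le_zpow_right_of_le_one₀ sc.pos (by linarith [sc.le]) h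

theorem r_real (sc : Scale r D C₀ c κ K ρ) : (2018 : ℝ) ≤ r := by exact_mod_cast sc.r_le

theorem inv_eq (ρ : ℝ) : ρ⁻¹ = ρ ^ (-1 : ℤ) := by rw [zpow_neg_one]

theorem num_le (sc : Scale r D C₀ c κ K ρ) {x : ℝ} (hx : x ≤ 100) : x ≤ ρ ^ (-1 : ℤ) := by
  rw [← inv_eq]
  refine hx.trans ?_
  rw [le_inv_comm₀ (by norm_num) sc.pos]
  linarith [sc.le]

theorem unit_pos (sc : Scale r D C₀ c κ K ρ) : 0 < unit r ρ := Real.rpow_pos_of_pos sc.pos _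

theorem unit_zpow (sc : Scale r D C₀ c κ K ρ) (n : ℤ) :
    unit r ρ ^ n = ρ ^ (14 / 100 * (r : ℝ) * n) := by
  rw [unit, Real.rpow_mul_intCast sc.pos.le]

theorem unit_le (sc : Scale r D C₀ c κ K ρ) : unit r ρ ≤ 1 / 2 := by
  refine le_trans ?_ sc.half
  have := sc.rpow_le (a := 14 / 100 * (r : ℝ)) (b := 1) (by linarith [sc.r_real])
  rwa [Real.rpow_one] at this

theorem unit_zpow_le (sc : Scale r D C₀ c κ K ρ) {n : ℤ} {b : ℝ} (h : b ≤ 14 / 100 * (r : ℝ) * n) :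
    unit r ρ ^ n ≤ ρ ^ b := by
  rw [sc.unit_zpow]
  exact sc.rpow_le h

theorem le_unit_zpow (sc : Scale r D C₀ c κ K ρ) {n : ℤ} {b : ℝ} (h : 14 / 100 * (r : ℝ) * n ≤ b) :
    ρ ^ b ≤ unit r ρ ^ n := by
  rw [sc.unit_zpow]
  exact sc.rpow_le h

theorem C_mul_le (sc : Scale r D C₀ c κ K ρ) {a : ℝ} {n : ℤ} (h : n + 1 ≤ a) :
    C₀ * ρ ^ a ≤ ρ ^ n := by
  have h1 : ρ ^ a ≤ ρ ^ (n + 1) := by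
    have := sc.rpow_le h
    rwa [show (n : ℝ) + 1 = ((n + 1 : ℤ) : ℝ) by push_cast; ring, Real.rpow_intCast] at this
  calc C₀ * ρ ^ a ≤ ρ⁻¹ * ρ ^ (n + 1) :=
        mul_le_mul sc.C_le h1 (Real.rpow_nonneg sc.pos.le _) (inv_nonneg.2 sc.pos.le)
    _ = ρ ^ n := by rw [inv_eq, ← zpow_add₀ sc.pos.ne']; congr 1; ring

end Scale

namespace SlowFast

variable (A : SlowFast)

/-- The change of the actions as a linear map. -/
def actionL : ℝ × ℝ →L[ℝ] ℝ × ℝ :=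
  ((A.k 0 : ℝ) • ContinuousLinearMap.fst ℝ ℝ ℝ + (A.f 0 : ℝ) • ContinuousLinearMap.snd ℝ ℝ ℝ).prod
    ((A.k 1 : ℝ) • ContinuousLinearMap.fst ℝ ℝ ℝ + (A.f 1 : ℝ) • ContinuousLinearMap.snd ℝ ℝ ℝ)

/-- The change of variables as a linear map of the phase space. -/
noncomputable def phaseL : Phase →L[ℝ] Phase :=
  let ψs : Phase →L[ℝ] ℝ := (ContinuousLinearMap.fst ℝ ℝ ℝ).comp (ContinuousLinearMap.fst ℝ _ _)
  let ψf : Phase →L[ℝ] ℝ := (ContinuousLinearMap.snd ℝ ℝ ℝ).comp (ContinuousLinearMap.fst ℝ _ _)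
  let t : Phase →L[ℝ] ℝ := (ContinuousLinearMap.snd ℝ _ ℝ).comp (ContinuousLinearMap.snd ℝ _ _)
  ((A.det⁻¹ • ((A.f 1 : ℝ) • (ψs - (A.k 2 : ℝ) • t) - (A.k 1 : ℝ) • ψf)).prod
      (A.det⁻¹ • ((A.k 0 : ℝ) • ψf - (A.f 0 : ℝ) • (ψs - (A.k 2 : ℝ) • t)))).prod
    ((A.actionL.comp ((ContinuousLinearMap.fst ℝ _ ℝ).comp (ContinuousLinearMap.snd ℝ _ _))).prod t)

theorem phaseL_apply (p : Phase) :
    A.phaseL p = (A.angle p.1 p.2.2, A.action p.2.1, p.2.2) := by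
  simp only [phaseL, angle, div_eq_inv_mul]
  rfl

end SlowFast

namespace NormalForm

variable {S : NormalForm} {r : ℕ} {D C₀ c κ K ρ : ℝ}

/-- The truncated Hamiltonian as a function of `(ψˢ, Jˢ, Jᶠ)`. -/
def slowHam (S : NormalForm) (z : ℝ × ℝ × ℝ) : ℝ := S.trunc z.2.2 (z.1, z.2.1)

/-- The remainder in slow-fast variables. -/
noncomputable def slowRem (S : NormalForm) (p : Phase) : ℝ := S.R (S.A.phaseL p)

/-- The single resonance zone in slow-fast actions. -/
def slowZone (S : NormalForm) (c ρ : ℝ) : Set (ℝ × ℝ) := {x | S.A.action x ∈ S.zone c ρ}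

/-- The arguments of the resonant part. -/
def resL (S : NormalForm) : ℝ × ℝ × ℝ →L[ℝ] ℝ × (ℝ × ℝ) :=
  (ContinuousLinearMap.fst ℝ ℝ _).prod (S.A.actionL.comp (ContinuousLinearMap.snd ℝ ℝ _))

/-- The original actions. -/
def sndL (S : NormalForm) : ℝ × ℝ × ℝ →L[ℝ] ℝ × ℝ :=
  S.A.actionL.comp (ContinuousLinearMap.snd ℝ ℝ _)

/-- The term `k₃ Jˢ`. -/
def shiftL (S : NormalForm) : ℝ × ℝ × ℝ →L[ℝ] ℝ :=
  (S.A.k 2 : ℝ) • (ContinuousLinearMap.fst ℝ ℝ ℝ).comp (ContinuousLinearMap.snd ℝ ℝ _)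

theorem slowHam_eq (S : NormalForm) (z : ℝ × ℝ × ℝ) : S.slowHam z
    = (S.H₀ (S.sndL z) + S.shiftL z) + S.Z (S.resL z) :=
  rfl

theorem sfHam_eq_slow (h : S.A.det ≠ 0) : S.sfHam = fun p => S.slowHam (slow p) + S.slowRem p := by
  funext p
  rw [S.sfHam_eq h, slowRem, S.A.phaseL_apply]
  rfl

namespace Estimates

variable (h : S.Estimates r D C₀ c K ρ) (sc : Scale r D C₀ c κ K ρ) {z : ℝ × ℝ × ℝ} {y : ℝ}

theorem isOpen_zone (S : NormalForm) (c ρ : ℝ) : IsOpen (S.zone c ρ) := Metric.isOpen_thickening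

theorem isOpen_slowZone (S : NormalForm) (c ρ : ℝ) : IsOpen (S.slowZone c ρ) :=
  (isOpen_zone S c ρ).preimage S.A.actionL.continuous

theorem isOpen_resZone (S : NormalForm) (c ρ : ℝ) :
    IsOpen ((univ : Set ℝ) ×ˢ S.zone c ρ) := isOpen_univ.prod (isOpen_zone S c ρ)

theorem isOpen_phaseZone (S : NormalForm) (c ρ : ℝ) :
    IsOpen ((univ : Set (ℝ × ℝ)) ×ˢ S.zone c ρ ×ˢ (univ : Set ℝ)) :=
  isOpen_univ.prod ((isOpen_zone S c ρ).prod isOpen_univ)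

include h sc

theorem size_actionL : SizeLE ρ (-2) S.A.actionL := by
  have hK : 0 ≤ K := by linarith [sc.one_le_K]
  have h1 : ‖S.A.actionL‖ ≤ 2 * K := by
    refine ContinuousLinearMap.opNorm_le_bound _ (by positivity) fun v => ?_
    have key : ∀ a b : ℝ, |a| ≤ K → |b| ≤ K → |a * v.1 + b * v.2| ≤ 2 * K * ‖v‖ := fun a b ha hb => by
      have k1 : |v.1| ≤ ‖v‖ := norm_fst_le v
      have k2 : |v.2| ≤ ‖v‖ := norm_snd_le v
      have k3 := abs_add_le (a * v.1) (b * v.2)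
      rw [abs_mul, abs_mul] at k3
      have k4 := mul_le_mul ha k1 (abs_nonneg _) hK
      have k5 := mul_le_mul hb k2 (abs_nonneg _) hK
      linarith
    exact max_le (key _ _ (h.k_le 0) (h.f_le 0)) (key _ _ (h.k_le 1) (h.f_le 1))
  calc ‖S.A.actionL‖ ≤ 2 * K := h1
    _ ≤ ρ ^ (-1 : ℤ) * ρ ^ (-1 : ℤ) := mul_le_mul (sc.num_le (by norm_num))
        (by rw [← Scale.inv_eq]; exact sc.K_le) hK (zpow_nonneg sc.pos.le _)
    _ = ρ ^ (-2 : ℤ) := by rw [← zpow_add₀ sc.pos.ne']; norm_num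

/-- The determinant is a nonzero integer. -/
theorem one_le_det : 1 ≤ |S.A.det| := by
  have h1 : S.A.det = ((S.A.k 0 * S.A.f 1 - S.A.k 1 * S.A.f 0 : ℤ) : ℝ) := by
    simp [SlowFast.det]
  have h2 := h.det_ne
  rw [h1] at h2 ⊢
  have h3 : S.A.k 0 * S.A.f 1 - S.A.k 1 * S.A.f 0 ≠ 0 := by exact_mod_cast h2
  exact_mod_cast Int.one_le_abs h3

theorem one_le_k : (1 : ℝ) ≤ (S.A.k 0 : ℝ) ^ 2 + (S.A.k 1 : ℝ) ^ 2 := by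
  have h2 := h.det_ne
  have : (1 : ℤ) ≤ S.A.k 0 ^ 2 + S.A.k 1 ^ 2 := by
    by_contra! hlt
    have k0 : S.A.k 0 ^ 2 = 0 := by nlinarith [sq_nonneg (S.A.k 0), sq_nonneg (S.A.k 1)]
    have k1 : S.A.k 1 ^ 2 = 0 := by nlinarith [sq_nonneg (S.A.k 0), sq_nonneg (S.A.k 1)]
    have k0' := pow_eq_zero_iff (two_ne_zero) |>.1 k0
    have k1' := pow_eq_zero_iff (two_ne_zero) |>.1 k1
    exact h2 (by simp [SlowFast.det, k0', k1'])
  exact_mod_cast this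

theorem size_phaseL : SizeLE ρ (-3) S.A.phaseL := by
  have hK : 0 ≤ K := by linarith [sc.one_le_K]
  have hdet := h.one_le_det sc
  have hdi : |S.A.det⁻¹| ≤ 1 := by rw [abs_inv]; exact inv_le_one_of_one_le₀ hdet
  have h3 : 3 * K ^ 2 ≤ ρ ^ (-3 : ℤ) := by
    have hK' : K ≤ ρ ^ (-1 : ℤ) := by rw [← Scale.inv_eq]; exact sc.K_le
    have hz := zpow_nonneg sc.pos.le (-1)
    calc 3 * K ^ 2 ≤ ρ ^ (-1 : ℤ) * (ρ ^ (-1 : ℤ)) ^ 2 :=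
          mul_le_mul (sc.num_le (by norm_num)) (pow_le_pow_left₀ hK hK' 2) (by positivity) hz
      _ = ρ ^ (-3 : ℤ) := by rw [← zpow_natCast, ← zpow_mul, ← zpow_add₀ sc.pos.ne']; norm_num
  refine ContinuousLinearMap.opNorm_le_bound _ (zpow_nonneg sc.pos.le _) fun p => ?_
  have n1 : |p.1.1| ≤ ‖p‖ := (norm_fst_le p.1).trans (norm_fst_le p)
  have n2 : |p.1.2| ≤ ‖p‖ := (norm_snd_le p.1).trans (norm_fst_le p)
  have n3 : |p.2.2| ≤ ‖p‖ := (norm_snd_le p.2).trans (norm_snd_le p)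
  have n4 : ‖p.2.1‖ ≤ ‖p‖ := (norm_fst_le p.2).trans (norm_snd_le p)
  have hp := norm_nonneg p
  have hb : |p.1.1 - S.A.k 2 * p.2.2| ≤ 2 * K * ‖p‖ := by
    have k1 := abs_sub p.1.1 (S.A.k 2 * p.2.2)
    rw [abs_mul] at k1
    have k2 := mul_le_mul (h.k_le 2) n3 (abs_nonneg _) hK
    have k3 := mul_le_mul_of_nonneg_right sc.one_le_K hp
    linarith
  have key : ∀ a b : ℝ, |a| ≤ K → |b| ≤ K →
      |S.A.det⁻¹ * (a * (p.1.1 - S.A.k 2 * p.2.2) - b * p.1.2)| ≤ ρ ^ (-3 : ℤ) * ‖p‖ := by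
    intro a b ha hb'
    have k1 := abs_sub (a * (p.1.1 - S.A.k 2 * p.2.2)) (b * p.1.2)
    rw [abs_mul, abs_mul b] at k1
    have k2 := mul_le_mul ha hb (abs_nonneg _) hK
    have k3 := mul_le_mul hb' n2 (abs_nonneg _) hK
    have k4 : K * ‖p‖ ≤ K ^ 2 * ‖p‖ :=
      mul_le_mul_of_nonneg_right (by nlinarith [sc.one_le_K]) hp
    rw [abs_mul]
    refine (mul_le_mul hdi le_rfl (abs_nonneg _) zero_le_one).trans ?_
    rw [one_mul]
    refine le_trans ?_ (mul_le_mul_of_nonneg_right h3 hp)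
    nlinarith
  refine max_le (max_le ?_ ?_) (max_le ?_ ?_)
  · exact key _ _ (h.f_le 1) (h.k_le 1)
  · have := key _ _ (h.f_le 0) (h.k_le 0)
    rw [← abs_neg, ← mul_neg, neg_sub] at this
    exact this
  · refine (S.A.actionL.le_opNorm p.2.1).trans ?_
    exact mul_le_mul ((h.size_actionL sc).mono sc.pos sc.half (by norm_num)) n4 (norm_nonneg _)
      (zpow_nonneg sc.pos.le _)
  · refine n3.trans ?_
    have := sc.zpow_le (a := 0) (b := -3) (by norm_num)
    rw [zpow_zero] at this
    exact le_mul_of_one_le_left hp this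

theorem size_resL : SizeLE ρ (-2) S.resL := by
  refine ContinuousLinearMap.opNorm_le_bound _ (zpow_nonneg sc.pos.le _) fun v => max_le ?_ ?_
  · have := sc.zpow_le (a := 0) (b := -2) (by norm_num)
    rw [zpow_zero] at this
    exact (norm_fst_le v).trans (le_mul_of_one_le_left (norm_nonneg v) this)
  · exact (S.A.actionL.le_opNorm v.2).trans (mul_le_mul (h.size_actionL sc) (norm_snd_le v)
      (norm_nonneg _) (zpow_nonneg sc.pos.le _))

theorem size_sndL : SizeLE ρ (-2) S.sndL :=
  ContinuousLinearMap.opNorm_le_bound _ (zpow_nonneg sc.pos.le _) fun v =>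
    (S.A.actionL.le_opNorm v.2).trans (mul_le_mul (h.size_actionL sc) (norm_snd_le v)
      (norm_nonneg _) (zpow_nonneg sc.pos.le _))

theorem size_shiftL : SizeLE ρ (-1) S.shiftL := by
  refine ContinuousLinearMap.opNorm_le_bound _ (zpow_nonneg sc.pos.le _) fun v => ?_
  have k1 : |v.2.1| ≤ ‖v‖ := (norm_fst_le v.2).trans (norm_snd_le v)
  change ‖(S.A.k 2 : ℝ) * v.2.1‖ ≤ _
  rw [norm_mul]
  exact mul_le_mul ((h.k_le 2).trans (by rw [← Scale.inv_eq]; exact sc.K_le)) k1 (abs_nonneg _)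
    (zpow_nonneg sc.pos.le _)

omit sc in
theorem three_le (hr : 2018 ≤ r) : ((3 : ℕ) : WithTop ℕ∞) ≤ (r : WithTop ℕ∞) := by
  exact_mod_cast (by omega : 3 ≤ r)

theorem smooth_sum (hz : z.2 ∈ S.slowZone c ρ) :
    ContDiffAt ℝ 3 (fun z => S.H₀ (S.sndL z)) z ∧
    ContDiffAt ℝ 3 (fun z => S.Z (S.resL z)) z := by
  have h3 := h.three_le sc.r_le
  constructor
  · exact ContDiffAt.comp z (g := S.H₀) (((h.smooth_H₀.of_le h3).contDiffAt
      ((isOpen_zone S c ρ).mem_nhds hz))) (ContinuousLinearMap.contDiff _).contDiffAt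
  · exact ContDiffAt.comp z (g := S.Z) (((h.smooth_Z.of_le h3).contDiffAt
      ((isOpen_resZone S c ρ).mem_nhds ⟨mem_univ _, hz⟩)))
      (ContinuousLinearMap.contDiff _).contDiffAt

theorem iteratedFDeriv_slowHam (hz : z.2 ∈ S.slowZone c ρ) {i : ℕ} (hi : i ≤ 3) :
    iteratedFDeriv ℝ i S.slowHam z
      = (iteratedFDeriv ℝ i (fun z => S.H₀ (S.sndL z)) z
        + iteratedFDeriv ℝ i (fun z => S.shiftL z) z)
        + iteratedFDeriv ℝ i (fun z => S.Z (S.resL z)) z := by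
  obtain ⟨h1, h2⟩ := h.smooth_sum sc hz
  have hi' : (i : WithTop ℕ∞) ≤ 3 := by exact_mod_cast hi
  have e : S.slowHam = ((fun z => S.H₀ (S.sndL z))
      + (fun z => S.shiftL z)) + fun z => S.Z (S.resL z) := funext S.slowHam_eq
  have h4 : ContDiffAt ℝ i (fun z => S.shiftL z) z := S.shiftL.contDiff.contDiffAt
  have h5 : ContDiffAt ℝ i ((fun z => S.H₀ (S.sndL z)) + fun z => S.shiftL z) z :=
    (h1.of_le hi').add h4
  rw [e, iteratedFDeriv_add_apply h5 (h2.of_le hi'), iteratedFDeriv_add_apply (h1.of_le hi') h4]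

theorem contDiffOn_slowHam : ContDiffOn ℝ 3 S.slowHam {z | z.2 ∈ S.slowZone c ρ} := fun z hz => by
  obtain ⟨h1, h2⟩ := h.smooth_sum sc hz
  exact ((h1.add S.shiftL.contDiff.contDiffAt).add h2).contDiffWithinAt

theorem size_slowHam (hz : z.2 ∈ S.slowZone c ρ) {i : ℕ} (hi0 : 1 ≤ i) (hi : i ≤ 3) :
    SizeLE ρ (-9) (iteratedFDeriv ℝ i S.slowHam z) := by
  have h3 := h.three_le sc.r_le
  have hi' : (i : WithTop ℕ∞) ≤ r := by
    refine le_trans ?_ h3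
    exact_mod_cast hi
  have hC : C₀ ≤ ρ ^ (-1 : ℤ) := by rw [← Scale.inv_eq]; exact sc.C_le
  have hpow : ∀ x : ℝ, 0 ≤ x → x ≤ ρ ^ (-2 : ℤ) → C₀ * x ^ i ≤ ρ ^ (-7 : ℤ) := fun x h0 hx => by
    have h1 : (1 : ℝ) ≤ ρ ^ (-2 : ℤ) := by
      have := sc.zpow_le (a := 0) (b := -2) (by norm_num)
      rwa [zpow_zero] at this
    calc C₀ * x ^ i ≤ ρ ^ (-1 : ℤ) * (ρ ^ (-2 : ℤ)) ^ 3 :=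
          mul_le_mul hC ((pow_le_pow_left₀ h0 hx i).trans (pow_le_pow_right₀ h1 hi))
            (pow_nonneg h0 _) (zpow_nonneg sc.pos.le _)
      _ = ρ ^ (-7 : ℤ) := by rw [← zpow_natCast, ← zpow_mul, ← zpow_add₀ sc.pos.ne']; norm_num
  rw [h.iteratedFDeriv_slowHam sc hz hi]
  refine SizeLE.add sc.pos sc.half (n := -8) (m := -7) (SizeLE.add sc.pos sc.half (n := -7)
    (m := -1) ?_ ?_ (by norm_num) (by norm_num)) ?_ (by norm_num) (by norm_num)
  · refine (norm_iteratedFDeriv_comp_clm_le (isOpen_zone S c ρ) h.smooth_H₀ S.sndL hz hi').trans ?_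
    refine le_trans (mul_le_mul_of_nonneg_right (h.bound_H₀ i hi (S.sndL z) hz) (by positivity)) ?_
    exact hpow _ (norm_nonneg _) (h.size_sndL sc)
  · exact (norm_iteratedFDeriv_clm_le _ hi0 z).trans (h.size_shiftL sc)
  · have hz' : S.resL z ∈ (univ : Set ℝ) ×ˢ S.zone c ρ := ⟨mem_univ _, hz⟩
    refine (norm_iteratedFDeriv_comp_clm_le (isOpen_resZone S c ρ) h.smooth_Z S.resL hz' hi').trans ?_
    refine le_trans (mul_le_mul_of_nonneg_right (h.bound_Z₃ i hi (S.resL z) hz') (by positivity)) ?_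
    exact hpow _ (norm_nonneg _) (h.size_resL sc)

omit h in
theorem bound_Z_le : C₀ * ρ ^ (4 / 3 * (r : ℝ) - 2 * mExp) ≤ ρ ^ (1173 : ℤ) :=
  sc.C_mul_le (by rw [mExp]; push_cast; linarith [sc.r_real])

/-- The second derivative in `Jˢ` is that of `H₀` in the direction `(k₁, k₂)`, an integer vector of
length at least `1`, up to the contribution of `Z`. -/
theorem convex_slowHam (hz : z.2 ∈ S.slowZone c ρ) :
    ρ ^ (2 : ℤ) ≤ fderiv ℝ (fderiv ℝ S.slowHam) z (0, 1, 0) (0, 1, 0) := by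
  have h3 : ((2 : ℕ) : WithTop ℕ∞) ≤ r := le_trans (by norm_num) (h.three_le sc.r_le)
  have hz' : S.resL z ∈ (univ : Set ℝ) ×ˢ S.zone c ρ := ⟨mem_univ _, hz⟩
  have e := iteratedFDeriv_two_apply (𝕜 := ℝ) S.slowHam z ![(0, 1, 0), (0, 1, 0)]
  simp only [Matrix.cons_val_zero, Matrix.cons_val_one] at e
  rw [← e, h.iteratedFDeriv_slowHam sc hz (by norm_num), iteratedFDeriv_clm_of_two_le _ le_rfl,
    add_zero, add_apply,
    iteratedFDeriv_comp_clm (isOpen_zone S c ρ) h.smooth_H₀ S.sndL hz h3]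
  have c1 := (h.convex_H₀ (S.sndL z) hz (S.A.k 0, S.A.k 1)).1
  have e2 : (iteratedFDeriv ℝ 2 S.H₀ (S.sndL z)
      |>.compContinuousLinearMap fun _ => S.sndL)
        ![(0, 1, 0), (0, 1, 0)]
      = iteratedFDeriv ℝ 2 S.H₀ (S.sndL z)
        ![((S.A.k 0 : ℝ), (S.A.k 1 : ℝ)), ((S.A.k 0 : ℝ), (S.A.k 1 : ℝ))] := by
    rw [ContinuousMultilinearMap.compContinuousLinearMap_apply]
    congr 1
    funext i
    fin_cases i <;> simp [sndL, SlowFast.actionL]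
  rw [e2]
  have c2 : |iteratedFDeriv ℝ 2 (fun z => S.Z (S.resL z)) z ![(0, 1, 0), (0, 1, 0)]|
      ≤ ρ ^ (1169 : ℤ) := by
    refine (ContinuousMultilinearMap.le_opNorm (iteratedFDeriv ℝ 2 (fun z => S.Z (S.resL z)) z)
      ![(0, 1, 0), (0, 1, 0)]).trans ?_
    have n1 : ‖((0, 1, 0) : ℝ × ℝ × ℝ)‖ = 1 := by simp [Prod.norm_def]
    rw [Fin.prod_univ_two]
    simp only [Matrix.cons_val_zero, Matrix.cons_val_one, n1, mul_one]
    refine (norm_iteratedFDeriv_comp_clm_le (isOpen_resZone S c ρ) h.smooth_Z S.resL hz' h3).trans ?_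
    calc ‖iteratedFDeriv ℝ 2 S.Z (S.resL z)‖ * ‖S.resL‖ ^ 2
        ≤ ρ ^ (1173 : ℤ) * (ρ ^ (-2 : ℤ)) ^ 2 :=
          mul_le_mul ((h.bound_Z 2 le_rfl (S.resL z) hz').trans (bound_Z_le sc))
            (pow_le_pow_left₀ (norm_nonneg _) (h.size_resL sc) 2) (by positivity)
            (zpow_nonneg sc.pos.le _)
      _ = ρ ^ (1169 : ℤ) := by rw [← zpow_natCast, ← zpow_mul, ← zpow_add₀ sc.pos.ne']; norm_num
  have c3 : ρ ≤ D⁻¹ * ((S.A.k 0 : ℝ) ^ 2 + (S.A.k 1 : ℝ) ^ 2) :=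
    sc.D_le.trans (le_mul_of_one_le_right (inv_nonneg.2 sc.D_pos.le) (h.one_le_k sc))
  have c4 : 2 * ρ ^ (2 : ℤ) ≤ ρ ^ (1 : ℤ) := SizeLE.two_mul_zpow_le sc.pos sc.half (by norm_num)
  have c5 : ρ ^ (1169 : ℤ) ≤ ρ ^ (2 : ℤ) := sc.zpow_le (by norm_num)
  rw [zpow_one] at c4
  have c6 := (abs_le.1 c2).1
  linarith

end Estimates

end NormalForm

open ConvexFamily

namespace NormalForm

variable {S : NormalForm} {r : ℕ} {D C₀ c κ K ρ : ℝ}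

/-- The radius of the single resonance zone. -/
noncomputable def width (c ρ : ℝ) : ℝ := c * ρ ^ (mExp + thetaExp / 3 + 1)

namespace Estimates

variable (h : S.Estimates r D C₀ c K ρ) (sc : Scale r D C₀ c κ K ρ) {z : ℝ × ℝ × ℝ} {y s J : ℝ}

include h sc

/-! ### The zone and its fibers -/

omit h in
/-- The radius is `c ρ ^ (758 + 757 / 3 + 1)`, and `758 + 757 / 3 + 1 < 1012`. -/
theorem le_width : ρ ^ (1013 : ℤ) ≤ width c ρ := by
  have h1 : ρ ^ (1012 : ℝ) ≤ ρ ^ (mExp + thetaExp / 3 + 1) :=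
    sc.rpow_le (by rw [mExp, thetaExp]; norm_num)
  calc ρ ^ (1013 : ℤ) = ρ * ρ ^ (1012 : ℝ) := by
        rw [show (1013 : ℤ) = 1 + 1012 by norm_num, zpow_add₀ sc.pos.ne', zpow_one,
          ← Real.rpow_intCast]
        norm_num
    _ ≤ width c ρ := mul_le_mul sc.c_le h1 (Real.rpow_nonneg sc.pos.le _) (sc.pos.le.trans sc.c_le)

omit h in
theorem lt_half_width : ρ ^ (1015 : ℤ) < width c ρ / 2 := by
  have h1 := le_width sc
  have h2 : 2 * ρ ^ (1015 : ℤ) ≤ ρ ^ (1014 : ℤ) :=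
    SizeLE.two_mul_zpow_le sc.pos sc.half (by norm_num)
  have h3 : 2 * ρ ^ (1014 : ℤ) ≤ ρ ^ (1013 : ℤ) :=
    SizeLE.two_mul_zpow_le sc.pos sc.half (by norm_num)
  have := zpow_pos sc.pos 1014
  linarith

omit h sc in
theorem mem_thickening_arc {w : ℝ} {x : ℝ × ℝ} :
    S.A.action x ∈ Metric.thickening w S.arc ↔
      ∃ y ∈ Icc S.bm S.bp, ‖S.A.actionL (x - (S.res y, y))‖ < w := by
  rw [Metric.mem_thickening_iff]
  constructor
  · rintro ⟨_, ⟨y, hy, rfl⟩, hd⟩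
    refine ⟨y, hy, ?_⟩
    rw [map_sub, ← dist_eq_norm]
    exact hd
  · rintro ⟨y, hy, hd⟩
    refine ⟨_, ⟨y, hy, rfl⟩, ?_⟩
    rw [map_sub, ← dist_eq_norm] at hd
    exact hd

/-- Going from `(J, y)` to `(J', y)` does not leave the zone if `J - J'` is small. -/
theorem mem_thickening_of_near {w : ℝ} {J' : ℝ}
    (hm : S.A.action (J, y) ∈ Metric.thickening w S.arc) {n : ℤ} (hJ : SizeLE ρ n (J' - J)) :
    S.A.action (J', y) ∈ Metric.thickening (w + ρ ^ (n - 2)) S.arc := by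
  rw [mem_thickening_arc] at hm ⊢
  obtain ⟨y', hy', hlt⟩ := hm
  refine ⟨y', hy', ?_⟩
  have e : ((J', y) : ℝ × ℝ) - (S.res y', y') = ((J, y) - (S.res y', y')) + (J' - J, 0) := by
    ext <;> simp
  have h1 : SizeLE ρ n ((J' - J, 0) : ℝ × ℝ) := by
    refine hJ.prod ?_
    rw [SizeLE, norm_zero]
    exact zpow_nonneg sc.pos.le _
  have h2 : SizeLE ρ (n - 2) (S.A.actionL (J' - J, 0)) :=
    (h.size_actionL sc).apply sc.pos sc.half h1 (by linarith)
  rw [e, map_add]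
  exact (norm_add_le _ _).trans_lt (add_lt_add_of_lt_of_le hlt h2)

omit h sc in
theorem arc_mem {w : ℝ} (hw : 0 < w) (hy : y ∈ Icc S.bm S.bp) :
    S.A.action (S.res y, y) ∈ Metric.thickening w S.arc := by
  rw [mem_thickening_arc]
  exact ⟨y, hy, by simpa using hw⟩

omit h in
/-- Points at distance `ρ ^ 1017` in `Jˢ` of the tube of half the radius lie in the zone, as the change of
actions has norm at most `ρ ^ (-2)`. -/
theorem near_mem_zone {n : ℤ} (hn : 1017 ≤ n) (hJ : SizeLE ρ n (J - s))
    (h : S.Estimates r D C₀ c K ρ)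
    (hs : S.A.action (s, y) ∈ Metric.thickening (width c ρ / 2) S.arc) :
    (J, y) ∈ S.slowZone c ρ := by
  refine Metric.thickening_mono ?_ _ (h.mem_thickening_of_near sc hs hJ)
  have h1 := lt_half_width sc
  have h2 : ρ ^ (n - 2) ≤ ρ ^ (1015 : ℤ) := sc.zpow_le (by linarith)
  change _ ≤ width c ρ
  linarith

omit sc in
/-- The fibers are star-shaped about the resonant arc: balls are convex and symmetric, so that a
point between `(res y, y)` and a point of the ball about `(res y', y')` lies in the ball about an
intermediate point of the arc. -/
theorem uIcc_subset_fiber (hy : y ∈ Icc S.bm S.bp) (hJ : (J, y) ∈ S.slowZone c ρ) {u : ℝ}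
    (hu : u ∈ uIcc (S.res y) J) : (u, y) ∈ S.slowZone c ρ := by
  obtain ⟨y', hy', hlt⟩ := mem_thickening_arc.1 hJ
  set Y : ℝ → ℝ := fun θ => y + θ * (y' - y) with hY
  have hYmem : ∀ θ ∈ Icc (0 : ℝ) 1, Y θ ∈ Icc S.bm S.bp := fun θ hθ => by
    have := (convex_Icc S.bm S.bp) hy hy' (sub_nonneg.2 hθ.2) hθ.1 (by ring)
    simp only [smul_eq_mul] at this
    have e : Y θ = (1 - θ) * y + θ * y' := by simp only [hY]; ring
    rwa [e]
  set φ : ℝ → ℝ := fun θ => u - S.res (Y θ) - θ * (J - S.res y') with hφ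
  have hφc : ContinuousOn φ (Icc 0 1) :=
    (continuousOn_const.sub (h.res_cont.comp (by fun_prop) hYmem)).sub (by fun_prop)
  have e0 : φ 0 = u - S.res y := by simp [hφ, hY]
  have e1 : φ 1 = u - J := by simp [hφ, hY]
  obtain ⟨θ, hθ, hθ0⟩ : ∃ θ ∈ Icc (0 : ℝ) 1, φ θ = 0 := by
    rcases le_total (S.res y) J with hle | hle
    · rw [uIcc_of_le hle] at hu
      exact intermediate_value_Icc' zero_le_one hφc ⟨by rw [e1]; linarith [hu.2],
        by rw [e0]; linarith [hu.1]⟩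
    · rw [uIcc_of_ge hle] at hu
      exact intermediate_value_Icc zero_le_one hφc ⟨by rw [e0]; linarith [hu.2],
        by rw [e1]; linarith [hu.1]⟩
  refine mem_thickening_arc.2 ⟨Y θ, hYmem θ hθ, ?_⟩
  have e : ((u, y) : ℝ × ℝ) - (S.res (Y θ), Y θ) = θ • ((J, y) - (S.res y', y')) := by
    ext
    · simp only [Prod.fst_sub, Prod.smul_fst, smul_eq_mul]
      linarith
    · simp only [Prod.snd_sub, Prod.smul_snd, smul_eq_mul, hY]
      ring
  rw [e, map_smul, norm_smul, Real.norm_eq_abs, abs_of_nonneg hθ.1]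
  exact (mul_le_of_le_one_left (norm_nonneg _) hθ.2).trans_lt hlt

omit sc in
theorem ordConnected_fiber (hy : y ∈ Icc S.bm S.bp) :
    {J | (J, y) ∈ S.slowZone c ρ}.OrdConnected := by
  refine ⟨fun J hJ J' hJ' u hu => ?_⟩
  rcases le_total u (S.res y) with hle | hle
  · exact h.uIcc_subset_fiber hy hJ (by rw [uIcc_of_ge (hu.1.trans hle)]; exact ⟨hu.1, hle⟩)
  · exact h.uIcc_subset_fiber hy hJ' (by rw [uIcc_of_le (hle.trans hu.2)]; exact ⟨hle, hu.2⟩)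

/-! ### The truncated Hamiltonian is a convex family -/

omit sc in
theorem slowHam_periodic (s : ℝ) (x : ℝ × ℝ) : S.slowHam (s + 1, x) = S.slowHam (s, x) := by
  simp only [slowHam, trunc, h.periodic_Z]

/-- On the arc the derivative of the integrable part in `Jˢ` vanishes, and that of `Z` is small. -/
theorem size_force (hy : y ∈ Icc S.bm S.bp) (s : ℝ) :
    SizeLE ρ 1171 (fderiv ℝ S.slowHam (s, S.res y, y) (0, 1, 0)) := by
  have hz : (S.res y, y) ∈ S.slowZone c ρ :=
    arc_mem ((zpow_pos sc.pos _).trans_le (le_width sc)) hy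
  have hz' : S.resL (s, S.res y, y) ∈ (univ : Set ℝ) ×ˢ S.zone c ρ := ⟨mem_univ _, hz⟩
  have h1 : (1 : WithTop ℕ∞) ≤ r := le_trans (by norm_num) (h.three_le sc.r_le)
  have hr0 : (r : WithTop ℕ∞) ≠ 0 := fun h0 => by rw [h0] at h1; simp at h1
  have d1 : HasFDerivAt S.sfH₀ (fderiv ℝ S.sfH₀ (S.res y, y)) (S.res y, y) := by
    refine DifferentiableAt.hasFDerivAt ?_
    have hH : DifferentiableAt ℝ S.H₀ (S.A.actionL (S.res y, y)) :=
      (h.smooth_H₀.contDiffAt ((isOpen_zone S c ρ).mem_nhds hz)).differentiableAt hr0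
    have : DifferentiableAt ℝ (fun J : ℝ × ℝ => S.H₀ (S.A.actionL J) + S.A.k 2 * J.1) (S.res y, y) :=
      (DifferentiableAt.comp (S.res y, y) hH S.A.actionL.differentiableAt).add (by fun_prop)
    exact this
  have d2 : HasFDerivAt S.Z (fderiv ℝ S.Z (S.resL (s, S.res y, y))) (S.resL (s, S.res y, y)) :=
    ((h.smooth_Z.contDiffAt ((isOpen_resZone S c ρ).mem_nhds hz')).differentiableAt
      hr0).hasFDerivAt
  have d3 : HasFDerivAt S.slowHam ((fderiv ℝ S.sfH₀ (S.res y, y)).comp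
      (ContinuousLinearMap.snd ℝ ℝ (ℝ × ℝ))
      + (fderiv ℝ S.Z (S.resL (s, S.res y, y))).comp S.resL) (s, S.res y, y) :=
    (HasFDerivAt.comp (s, S.res y, y) (g := S.sfH₀) (f := fun z : ℝ × ℝ × ℝ => z.2) d1
      hasFDerivAt_snd).add (d2.comp (s, S.res y, y) S.resL.hasFDerivAt)
  have h0 := h.res_eq y hy
  have e : fderiv ℝ S.slowHam (s, S.res y, y) (0, 1, 0)
      = fderiv ℝ S.Z (S.resL (s, S.res y, y)) (S.resL (0, 1, 0)) := by
    rw [d3.fderiv, add_apply, ContinuousLinearMap.comp_apply, ContinuousLinearMap.comp_apply]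
    change fderiv ℝ S.sfH₀ (S.res y, y) (1, 0) + _ = _
    rw [h0, zero_add]
  rw [e]
  have s1 : SizeLE ρ 1173 (fderiv ℝ S.Z (S.resL (s, S.res y, y))) := by
    rw [SizeLE, ← norm_iteratedFDeriv_one]
    exact (h.bound_Z 1 (by norm_num) _ hz').trans (bound_Z_le sc)
  refine s1.apply sc.pos sc.half (m := -2) ((h.size_resL sc).apply sc.pos sc.half (m := 0) ?_
    (by norm_num)) (by norm_num)
  rw [SizeLE, zpow_zero]
  simp [Prod.norm_def]

/-- On each fiber the truncated Hamiltonian has its minimum very close to the resonant arc. -/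
theorem exists_zero (hy : y ∈ Icc S.bm S.bp) (s : ℝ) :
    ∃ J, SizeLE ρ 1168 (J - S.res y) ∧ (J, y) ∈ S.slowZone c ρ ∧
      fderiv ℝ S.slowHam (s, J, y) (0, 1, 0) = 0 := by
  have ht : 0 < ρ ^ (1168 : ℤ) := zpow_pos sc.pos _
  set t := ρ ^ (1168 : ℤ) with htdef
  have hw : 0 < width c ρ / 2 := (zpow_pos sc.pos _).trans (lt_half_width sc)
  have hmem : ∀ J ∈ Icc (S.res y - t) (S.res y + t), (J, y) ∈ S.slowZone c ρ := fun J hJ =>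
    near_mem_zone sc (n := 1168) (by norm_num) (s := S.res y)
      (abs_le.2 ⟨by linarith [hJ.1], by linarith [hJ.2]⟩) h (arc_mem hw hy)
  have hder : ∀ J ∈ Icc (S.res y - t) (S.res y + t),
      HasDerivAt (fun J => fderiv ℝ S.slowHam (s, J, y) (0, 1, 0))
        (fderiv ℝ (fderiv ℝ S.slowHam) (s, J, y) (0, 1, 0) (0, 1, 0)) J := fun J hJ =>
    hasDerivAt_fderiv_snd ((h.contDiffOn_slowHam sc).contDiffAt
      (((isOpen_slowZone S c ρ).preimage continuous_snd).mem_nhds (hmem J hJ)))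
  set F : ℝ → ℝ := fun J => fderiv ℝ S.slowHam (s, J, y) (0, 1, 0) with hF
  have hc : ContinuousOn F (Icc (S.res y - t) (S.res y + t)) := fun J hJ =>
    (hder J hJ).continuousAt.continuousWithinAt
  have hgrow : ∀ a ∈ Icc (S.res y - t) (S.res y + t), ∀ b ∈ Icc (S.res y - t) (S.res y + t), a < b →
      ρ ^ (2 : ℤ) * (b - a) ≤ F b - F a := by
    intro a ha b hb hab
    have hsub : Icc a b ⊆ Icc (S.res y - t) (S.res y + t) := Icc_subset_Icc ha.1 hb.2
    obtain ⟨x, hx, e⟩ := exists_hasDerivAt_eq_slope F _ hab (hc.mono hsub)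
      fun x hx => hder x (hsub ⟨hx.1.le, hx.2.le⟩)
    rw [eq_div_iff (by linarith)] at e
    rw [← e]
    exact mul_le_mul_of_nonneg_right
      (h.convex_slowHam sc (hmem x (hsub ⟨hx.1.le, hx.2.le⟩))) (by linarith)
  have hforce := h.size_force sc hy s
  have hforce' : |F (S.res y)| ≤ ρ ^ (1171 : ℤ) := hforce
  have h4 : ρ ^ (1171 : ℤ) ≤ ρ ^ (2 : ℤ) * t := by
    rw [htdef, ← zpow_add₀ sc.pos.ne']
    exact sc.zpow_le (by norm_num)
  have g1 := hgrow (S.res y) ⟨by linarith, by linarith⟩ (S.res y + t) ⟨by linarith, le_rfl⟩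
    (by linarith)
  have g2 := hgrow (S.res y - t) ⟨le_rfl, by linarith⟩ (S.res y) ⟨by linarith, by linarith⟩
    (by linarith)
  rw [add_sub_cancel_left] at g1
  rw [sub_sub_cancel] at g2
  obtain ⟨l1, l2⟩ := abs_le.1 hforce'
  obtain ⟨J, hJ, hJ0⟩ := intermediate_value_Icc (by linarith) hc
    (show (0 : ℝ) ∈ Icc (F (S.res y - t)) (F (S.res y + t)) from ⟨by linarith, by linarith⟩)
  exact ⟨J, abs_le.2 ⟨by linarith [hJ.1], by linarith [hJ.2]⟩, hmem J hJ, hJ0⟩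

theorem convexFamily : ConvexFamily S.slowHam (S.slowZone c ρ) (Icc S.bm S.bp) where
  isOpen := isOpen_slowZone S c ρ
  smooth := h.contDiffOn_slowHam sc
  periodic := h.slowHam_periodic
  convex z hz := (zpow_pos sc.pos 2).trans_le (h.convex_slowHam sc hz)
  ordConnected _ hy := h.ordConnected_fiber hy
  exists_zero _ hy s := by
    obtain ⟨J, -, h1, h2⟩ := h.exists_zero sc hy s
    exact ⟨J, h1, h2⟩

/-- Minimal critical points are very close to the resonant arc. -/
theorem minimal_near (hy : y ∈ Icc S.bm S.bp) {x : ℝ × ℝ}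
    (hx : Minimal S.slowHam (S.slowZone c ρ) y x) :
    S.A.action (x.2, y) ∈ Metric.thickening (width c ρ / 2) S.arc := by
  have hcf := h.convexFamily sc
  obtain ⟨J, h1, h2, h3⟩ := h.exists_zero sc hy x.1
  have e : x.2 = J := by
    rw [hcf.eq_argmin hy hx.mem (Minimal.critical hcf hx).2, hcf.eq_argmin hy h2 h3]
  have hr : ρ ^ (1166 : ℤ) < width c ρ / 2 :=
    (sc.zpow_le (by norm_num)).trans_lt (lt_half_width sc)
  have h4 := h.mem_thickening_of_near sc (w := width c ρ / 2 - ρ ^ (1166 : ℤ))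
    (arc_mem (by linarith) hy) h1
  rw [e]
  refine Metric.thickening_mono ?_ _ h4
  rw [show (1168 : ℤ) - 2 = 1166 by norm_num]
  linarith

end Estimates

end NormalForm

namespace NormalForm

variable {S : NormalForm} {r : ℕ} {D C₀ c κ K ρ : ℝ}

namespace Estimates

variable (h : S.Estimates r D C₀ c K ρ) (sc : Scale r D C₀ c κ K ρ) {p : Phase} {I : Set ℝ}
  {γ : ℝ → ℝ × ℝ}

/-! ### The remainder in slow-fast variables -/

theorem phaseL_mem (hp : (slow p).2 ∈ S.slowZone c ρ) :
    S.A.phaseL p ∈ (univ : Set (ℝ × ℝ)) ×ˢ S.zone c ρ ×ˢ (univ : Set ℝ) := by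
  rw [S.A.phaseL_apply]
  exact ⟨mem_univ _, hp, mem_univ _⟩

include h

/-- A lattice vector `l` with `k · l = 0` leaves `ψˢ` unchanged, and shifts `ψᶠ` by `f · (l₁, l₂)`. -/
theorem slowRem_add {l : Fin 3 → ℤ} (hl : (∑ j, S.A.k j * l j) = 0) (p : Phase) :
    S.slowRem ((p.1.1, p.1.2 + (S.A.f 0 * l 0 + S.A.f 1 * l 1)), p.2.1, p.2.2 + l 2)
      = S.slowRem p := by
  have hdet := h.det_ne
  have hk : (S.A.k 0 : ℝ) * l 0 + S.A.k 1 * l 1 + S.A.k 2 * l 2 = 0 := by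
    rw [Fin.sum_univ_three] at hl
    exact_mod_cast hl
  rw [slowRem, slowRem, S.A.phaseL_apply, S.A.phaseL_apply,
    ← h.periodic_R (S.A.angle p.1 p.2.2) (S.A.action p.2.1) p.2.2 l]
  have e : S.A.angle (p.1.1, p.1.2 + (S.A.f 0 * l 0 + S.A.f 1 * l 1)) (p.2.2 + l 2)
      = ((S.A.angle p.1 p.2.2).1 + l 0, (S.A.angle p.1 p.2.2).2 + l 1) := by
    unfold SlowFast.angle
    refine Prod.ext ?_ ?_
    · simp only
      rw [div_add' _ _ _ hdet]
      congr 1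
      unfold SlowFast.det
      linear_combination (-(S.A.f 1 : ℝ)) * hk
    · simp only
      rw [div_add' _ _ _ hdet]
      congr 1
      unfold SlowFast.det
      linear_combination (S.A.f 0 : ℝ) * hk
  rw [e]

include sc

theorem contDiffOn_slowRem :
    ContDiffOn ℝ 2 S.slowRem (slow ⁻¹' {z | z.2 ∈ S.slowZone c ρ}) :=
  (h.smooth_R.of_le (le_trans (by norm_num) (h.three_le sc.r_le))).comp
    S.A.phaseL.contDiff.contDiffOn fun _ hp => phaseL_mem hp

theorem size_slowRem (hp : (slow p).2 ∈ S.slowZone c ρ) {i : ℕ} (hi : i ≤ 2) :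
    ‖iteratedFDeriv ℝ i S.slowRem p‖ ≤ unit r ρ ^ (1790 : ℤ) := by
  have hi' : (i : WithTop ℕ∞) ≤ r := by
    refine le_trans ?_ (h.three_le sc.r_le)
    exact_mod_cast (by omega : i ≤ 3)
  have hm := phaseL_mem hp
  have h1 : (1 : ℝ) ≤ ρ ^ (-3 : ℤ) := by
    have := sc.zpow_le (a := 0) (b := -3) (by norm_num)
    rwa [zpow_zero] at this
  have hX := Real.rpow_nonneg sc.pos.le (qExp * ((r : ℝ) + 1) - 2 * mExp)
  refine (norm_iteratedFDeriv_comp_clm_le (isOpen_phaseZone S c ρ) h.smooth_R S.A.phaseL hm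
    hi').trans ?_
  calc ‖iteratedFDeriv ℝ i S.R (S.A.phaseL p)‖ * ‖S.A.phaseL‖ ^ i
      ≤ (ρ ^ (-1 : ℤ) * ρ ^ (qExp * ((r : ℝ) + 1) - 2 * mExp)) * (ρ ^ (-3 : ℤ)) ^ 2 := by
        refine mul_le_mul ((h.bound_R i hi _ hm).trans (mul_le_mul_of_nonneg_right ?_ hX))
          ((pow_le_pow_left₀ (norm_nonneg _) (h.size_phaseL sc) i).trans (pow_le_pow_right₀ h1 hi))
          (by positivity) (mul_nonneg (zpow_nonneg sc.pos.le _) hX)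
        rw [← Scale.inv_eq]
        exact sc.C_le
    _ = ρ ^ (-1 + (qExp * ((r : ℝ) + 1) - 2 * mExp) + -6) := by
        rw [Real.rpow_add sc.pos, Real.rpow_add sc.pos, ← zpow_natCast, ← zpow_mul,
          ← Real.rpow_intCast, ← Real.rpow_intCast]
        norm_num
    _ ≤ unit r ρ ^ (1790 : ℤ) := sc.le_unit_zpow (by
        rw [qExp, mExp]
        push_cast
        linarith [sc.r_real])

/-! ### Branches of saddles of the truncated Hamiltonian -/

/-- In the unit `η = unit r ρ` the bound `ρ ^ (252 (r + 1) - 1516)` on the remainder is below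
`η ^ 1790 = ρ ^ (250.6 r)`, and the neighbourhood of size `η ^ 5` lies in the zone. -/
theorem saddleFamily (hI : IsOpen I) (hγ : Branch S.slowHam (S.slowZone c ρ) I γ)
    (hhalf : ∀ y ∈ I, S.A.action ((γ y).2, y) ∈ Metric.thickening (width c ρ / 2) S.arc)
    (hstrong : ∀ y ∈ I, ρ ^ (14 * (r : ℝ) + 4) ≤ negHess S.slowHam (lift γ y)) :
    SaddleFamily (unit r ρ) S.slowHam S.slowRem {z | z.2 ∈ S.slowZone c ρ} I
      (fun y => (γ y).1) (fun y => (γ y).2) := by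
  have hr := sc.r_real
  have hsoft : ρ ^ (-9 : ℤ) ≤ unit r ρ ^ (-1 : ℤ) := by
    have := sc.le_unit_zpow (n := -1) (b := -9) (by push_cast; linarith)
    rwa [show (-9 : ℝ) = ((-9 : ℤ) : ℝ) by norm_num, Real.rpow_intCast] at this
  refine ⟨sc.unit_pos, sc.unit_le, (isOpen_slowZone S c ρ).preimage continuous_snd, hI,
    h.contDiffOn_slowHam sc, h.contDiffOn_slowRem sc, fun z hz => ?_, fun z hz => ?_,
    fun z hz => ?_, fun p hp => ?_, fun p hp => ?_, fun y hy s J hJ => ?_, fun y hy => ?_,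
    fun y hy => ?_, fun y hy => (hγ.critical y hy).1, fun y hy => (hγ.critical y hy).2,
    fun y hy => ?_, fun y hy => ?_⟩
  · rw [SizeLE, ← norm_iteratedFDeriv_one]
    exact (h.size_slowHam sc hz (i := 1) (by norm_num) (by norm_num)).trans hsoft
  · rw [SizeLE, norm_fderiv₂]
    exact (h.size_slowHam sc hz (i := 2) (by norm_num) (by norm_num)).trans hsoft
  · rw [SizeLE, norm_fderiv₃]
    exact (h.size_slowHam sc hz (i := 3) (by norm_num) (by norm_num)).trans hsoft
  · rw [SizeLE, ← norm_iteratedFDeriv_one]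
    exact h.size_slowRem sc hp (by norm_num)
  · rw [SizeLE, norm_fderiv₂]
    exact h.size_slowRem sc hp le_rfl
  · refine near_mem_zone sc (n := 1017) le_rfl (hJ.trans ?_) h (hhalf y hy)
    have := sc.unit_zpow_le (n := 5) (b := 1017) (by push_cast; linarith)
    rw [show (1017 : ℝ) = ((1017 : ℤ) : ℝ) by norm_num, Real.rpow_intCast] at this
    exact_mod_cast this
  · exact (hγ.smooth y hy).fst.contDiffWithinAt
  · exact (hγ.smooth y hy).snd.contDiffWithinAt
  · refine le_trans ?_ (h.convex_slowHam sc (hγ.mem y hy))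
    have := sc.unit_zpow_le (n := 1) (b := 2) (by push_cast; linarith)
    rw [zpow_one, show (2 : ℝ) = ((2 : ℤ) : ℝ) by norm_num, Real.rpow_intCast] at this
    exact this
  · refine le_trans ?_ (hstrong y hy)
    have := sc.unit_zpow_le (n := 102) (b := 14 * (r : ℝ) + 4) (by push_cast; linarith)
    exact_mod_cast this

end Estimates

namespace IsBifurcationSequence

variable {N : ℕ} {a : Fin (N + 2) → ℝ}

theorem Icc_subset (hb : S.IsBifurcationSequence r κ c ρ N a) (i : Fin (N + 1)) :
    Icc (a i.castSucc) (a i.succ) ⊆ Icc S.bm S.bp := by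
  rw [← hb.first, ← hb.last]
  exact Icc_subset_Icc (hb.strictMono.monotone (Fin.zero_le _))
    (hb.strictMono.monotone (Fin.le_last _))

/-- Between two consecutive values the minimal critical point is unique, and at the end points there
are at most two. -/
theorem minimalInterval (hb : S.IsBifurcationSequence r κ c ρ N a) (h : S.Estimates r D C₀ c K ρ)
    (sc : Scale r D C₀ c κ K ρ) (i : Fin (N + 1)) :
    MinimalInterval S.slowHam (S.slowZone c ρ) (Icc S.bm S.bp) (a i.castSucc) (a i.succ) := by
  have hcf := h.convexFamily sc
  have hreg : ∀ y ∈ Icc S.bm S.bp,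
      (∀ j : Fin (N + 2), j ≠ 0 → j ≠ Fin.last (N + 1) → y ≠ a j) →
      ∃ x, Minimal S.slowHam (S.slowZone c ρ) y x ∧
        ∀ x', Minimal S.slowHam (S.slowZone c ρ) y x' → SamePoint x x' := hb.regular
  have htwo : ∀ y ∈ Icc S.bm S.bp, ∃ x₁ x₂, Minimal S.slowHam (S.slowZone c ρ) y x₁ ∧
      Minimal S.slowHam (S.slowZone c ρ) y x₂ ∧
      ∀ x, Minimal S.slowHam (S.slowZone c ρ) y x → SamePoint x₁ x ∨ SamePoint x₂ x := by
    intro y hy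
    by_cases hj : ∀ j : Fin (N + 2), j ≠ 0 → j ≠ Fin.last (N + 1) → y ≠ a j
    · obtain ⟨x, hx, hx'⟩ := hreg y hy hj
      exact ⟨x, x, hx, hx, fun x' h' => Or.inl (hx' x' h')⟩
    · push Not at hj
      obtain ⟨j, j0, j1, rfl⟩ := hj
      obtain ⟨x, x₁, hx, hx₁, -, hall⟩ := hb.bifurcation j j0 j1
      exact ⟨x, x₁, hx, hx₁, hall⟩
  refine ⟨hb.strictMono Fin.castSucc_lt_succ, hb.Icc_subset i, fun y hy => ?_, fun y hy x hx => ?_,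
    fun y hy x x' hx hx' => ?_, htwo⟩
  · obtain ⟨x, -, hx, -⟩ := htwo y hy
    exact ⟨x, hx⟩
  · exact (hcf.negHess_of_isSaddle hx.mem
      (mul_nonneg (sc.pos.le.trans sc.κ_le) (Real.rpow_nonneg sc.pos.le _))
      (hb.saddle y hy x hx)).1
  · have hyB := hb.Icc_subset i (Ioo_subset_Icc_self hy)
    obtain ⟨x₀, -, hall⟩ := hreg y hyB fun j _ _ hyj => by
      rw [hyj] at hy
      have h1 := hb.strictMono.lt_iff_lt.1 hy.1
      have h2 := hb.strictMono.lt_iff_lt.1 hy.2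
      rw [Fin.lt_def, Fin.val_castSucc] at h1
      rw [Fin.lt_def, Fin.val_succ] at h2
      omega
    exact (hall x hx).symm.trans (hall x' hx')

theorem le_negHess (hb : S.IsBifurcationSequence r κ c ρ N a) (h : S.Estimates r D C₀ c K ρ)
    (sc : Scale r D C₀ c κ K ρ) {y : ℝ} (hy : y ∈ Icc S.bm S.bp) {x : ℝ × ℝ}
    (hx : Minimal S.slowHam (S.slowZone c ρ) y x) :
    ρ ^ (14 * (r : ℝ) + 4) < negHess S.slowHam (x.1, x.2, y) := by
  have hX := Real.rpow_nonneg sc.pos.le ((dExp * r + 1) / 2)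
  have h1 := ((h.convexFamily sc).negHess_of_isSaddle hx.mem
    (mul_nonneg (sc.pos.le.trans sc.κ_le) hX) (hb.saddle y hy x hx)).2
  refine lt_of_lt_of_le ?_ h1
  calc ρ ^ (14 * (r : ℝ) + 4) < ρ ^ (14 * (r : ℝ) + 3) :=
        Real.rpow_lt_rpow_of_exponent_gt sc.pos (by linarith [sc.le]) (by linarith)
    _ = (ρ * ρ ^ ((dExp * r + 1) / 2)) ^ 2 := by
        rw [mul_pow, ← Real.rpow_natCast (ρ ^ _), ← Real.rpow_mul sc.pos.le, ← Real.rpow_natCast ρ,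
          ← Real.rpow_add sc.pos, dExp]
        congr 1
        push_cast
        ring
    _ ≤ (κ * ρ ^ ((dExp * r + 1) / 2)) ^ 2 :=
        pow_le_pow_left₀ (mul_nonneg sc.pos.le hX) (mul_le_mul_of_nonneg_right sc.κ_le hX) 2

end IsBifurcationSequence

end NormalForm

/-! ### The scales -/

theorem le_radius {τ R₀ : ℝ} (hτ : 0 < τ) (hR : 1 ≤ R₀) (n : ℕ) : R₀ ≤ radius τ R₀ n := by
  induction n with
  | zero => exact le_rfl
  | succ n ih =>
    refine ih.trans ?_
    have := Real.rpow_le_rpow_of_exponent_le (hR.trans ih) (show (1 : ℝ) ≤ 1 + 2 * τ by linarith)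
    rwa [Real.rpow_one] at this

/-- A lower bound for the initial radius, from which on every constant is at most `ρ⁻¹`. -/
noncomputable def minRadius (D C₀ c κ : ℝ) : ℝ := 100 + D + C₀ + c⁻¹ + κ⁻¹

theorem scale_rho {r : ℕ} {τ D C₀ c κ R₀ : ℝ} (hr : 2018 ≤ r) (hτ : 0 < τ) (hτ' : τ < 1 / 50)
    (hD : 1 ≤ D) (hC₀ : 1 ≤ C₀) (hc : 0 < c) (hκ : 0 < κ) (hR : minRadius D C₀ c κ ≤ R₀) (n : ℕ) :
    Scale r D C₀ c κ (radius τ R₀ n) (rho τ R₀ n) := by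
  have hc' := inv_pos.2 hc
  have hκ' := inv_pos.2 hκ
  rw [minRadius] at hR
  have hK := le_radius hτ (by linarith : (1 : ℝ) ≤ R₀) n
  have hρ : radius τ R₀ n ≤ (rho τ R₀ n)⁻¹ := by
    rw [rho, Real.rpow_neg (by linarith), inv_inv]
    have := Real.rpow_le_rpow_of_exponent_le (show (1 : ℝ) ≤ radius τ R₀ n by linarith)
      (show (1 : ℝ) ≤ 3 - 5 * τ by linarith)
    rwa [Real.rpow_one] at this
  have hpos : 0 < rho τ R₀ n := Real.rpow_pos_of_pos (by linarith) _
  have key : ∀ x : ℝ, 0 < x → x⁻¹ ≤ radius τ R₀ n → rho τ R₀ n ≤ x := fun x hx h =>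
    (inv_le_inv₀ hx hpos).1 (h.trans hρ)
  refine ⟨hpos, key _ (by norm_num) (by norm_num; linarith), hr, by linarith,
    key _ (by positivity) (by rw [inv_inv]; linarith), by linarith,
    key _ hc (by linarith), key _ hκ (by linarith), by linarith, hρ⟩

/-! ### Intervals between bifurcation values -/

section Enlarged

variable {N : ℕ} {a : Fin (N + 2) → ℝ} {i : Fin (N + 1)} {s t : ℝ}

theorem enlarged_subset_Icc (hs : 0 ≤ s) :
    enlarged a i s ⊆ Icc (a i.castSucc - s) (a i.succ + s) := by
  refine Icc_subset_Icc ?_ ?_ <;> split_ifs <;> linarith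

theorem enlarged_mono (hst : s ≤ t) : enlarged a i s ⊆ enlarged a i t := by
  refine Icc_subset_Icc ?_ ?_ <;> split_ifs <;> linarith

theorem Icc_subset_enlarged (hs : 0 ≤ s) :
    Icc (a i.castSucc) (a i.succ) ⊆ enlarged a i s := by
  refine Icc_subset_Icc ?_ ?_ <;> split_ifs <;> linarith

end Enlarged

theorem exists_Icc_subset_of_isOpen {a b : ℝ} (hab : a ≤ b) {I : Set ℝ} (hI : IsOpen I)
    (h : Icc a b ⊆ I) : ∃ δ > 0, Icc (a - δ) (b + δ) ⊆ I := by
  obtain ⟨ε, hε, hεI⟩ := isCompact_Icc.exists_thickening_subset_open hI h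
  refine ⟨ε / 2, by positivity, fun y hy => hεI ?_⟩
  rw [Metric.mem_thickening_iff]
  rcases le_total y a with h2 | h2
  · exact ⟨a, ⟨le_rfl, hab⟩, by rw [Real.dist_eq, abs_lt]; constructor <;> linarith [hy.1]⟩
  rcases le_total y b with h3 | h3
  · exact ⟨y, ⟨h2, h3⟩, by simpa using hε⟩
  · exact ⟨b, ⟨hab, le_rfl⟩, by rw [Real.dist_eq, abs_lt]; constructor <;> linarith [hy.2]⟩

namespace NormalForm

variable {S : NormalForm} {r : ℕ} {D C₀ c κ K ρ : ℝ}

/-- A branch of saddles over a neighbourhood of an interval between bifurcation values which is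
minimal over the interval, uniformly hyperbolic, and well inside the zone. -/
theorem Estimates.exists_strong_branch (h : S.Estimates r D C₀ c K ρ) (sc : Scale r D C₀ c κ K ρ)
    {N : ℕ} {a : Fin (N + 2) → ℝ} (hb : S.IsBifurcationSequence r κ c ρ N a) (i : Fin (N + 1)) :
    ∃ (I : Set ℝ) (γ : ℝ → ℝ × ℝ), IsOpen I ∧ Icc (a i.castSucc) (a i.succ) ⊆ I ∧
      Branch S.slowHam (S.slowZone c ρ) I γ ∧
      (∀ y ∈ Icc (a i.castSucc) (a i.succ), Minimal S.slowHam (S.slowZone c ρ) y (γ y)) ∧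
      (∀ y ∈ I, S.A.action ((γ y).2, y) ∈ Metric.thickening (width c ρ / 2) S.arc) ∧
      ∀ y ∈ I, ρ ^ (14 * (r : ℝ) + 4) ≤ negHess S.slowHam (lift γ y) := by
  have hcf := h.convexFamily sc
  obtain ⟨ε, hε, γ, hγ, hγm⟩ := hcf.exists_minimal_branch (hb.minimalInterval h sc i)
  set U := Ioo (a i.castSucc - ε) (a i.succ + ε)
  have hc1 : ContinuousOn (fun y => S.A.action ((γ y).2, y)) U := fun y hy => by
    have h1 := (hγ.smooth y hy).continuousAt.snd
    unfold SlowFast.action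
    exact (((continuousAt_const.mul h1).add (continuousAt_const.mul continuousAt_id)).prodMk
      ((continuousAt_const.mul h1).add
        (continuousAt_const.mul continuousAt_id))).continuousWithinAt
  have hc2 : ContinuousOn (fun y => negHess S.slowHam (lift γ y)) U := fun y hy =>
    ContinuousAt.comp_continuousWithinAt (g := negHess S.slowHam)
      (hcf.continuousAt_negHess (z := lift γ y) (hγ.mem y hy)) (hγ.continuousOn_lift y hy)
  have ho := (hc1.prodMk hc2).isOpen_inter_preimage isOpen_Ioo
    ((Metric.isOpen_thickening (δ := width c ρ / 2) (E := S.arc)).prod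
      (isOpen_Ioi (a := ρ ^ (14 * (r : ℝ) + 4))))
  refine ⟨_, γ, ho, fun y hy => ?_, hγ.mono inter_subset_left, hγm, fun y hy => hy.2.1,
    fun y hy => (show _ < _ from hy.2.2).le⟩
  have hyB := hb.Icc_subset i hy
  exact ⟨⟨by linarith [hy.1], by linarith [hy.2]⟩, h.minimal_near sc hyB (hγm y hy),
    hb.le_negHess h sc hyB (hγm y hy)⟩

theorem Estimates.isSaddleCurve (h : S.Estimates r D C₀ c K ρ) (sc : Scale r D C₀ c κ K ρ)
    {I Y₀ Y : Set ℝ} {γ : ℝ → ℝ × ℝ} (hγ : Branch S.slowHam (S.slowZone c ρ) I γ)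
    (hm : ∀ y ∈ Y₀, Minimal S.slowHam (S.slowZone c ρ) y (γ y)) (hY : Y ⊆ I) :
    S.IsSaddleCurve c ρ Y₀ Y (fun y => (γ y).1) (fun y => (γ y).2) :=
  ⟨fun y hy => (hγ.smooth y (hY hy)).fst.contDiffWithinAt,
    fun y hy => (hγ.smooth y (hY hy)).snd.contDiffWithinAt,
    fun y hy => ⟨hγ.mem y (hY hy), (h.convexFamily sc).isSaddle_of_negHess (hγ.mem y (hY hy))
      (hγ.critical y (hY hy)) (hγ.pos y (hY hy))⟩, hm⟩

/-- A curve of saddles that is minimal over the interval is a lift of the branch. -/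
theorem IsSaddleCurve.eq_add_int {N : ℕ} {a : Fin (N + 2) → ℝ} {i : Fin (N + 1)} {I Y : Set ℝ}
    {γ : ℝ → ℝ × ℝ} {ψs Js : ℝ → ℝ}
    (hs : S.IsSaddleCurve c ρ (Icc (a i.castSucc) (a i.succ)) Y ψs Js)
    (h : S.Estimates r D C₀ c K ρ) (sc : Scale r D C₀ c κ K ρ)
    (hb : S.IsBifurcationSequence r κ c ρ N a)
    (hγ : Branch S.slowHam (S.slowZone c ρ) I γ)
    (hγm : ∀ y ∈ Icc (a i.castSucc) (a i.succ), Minimal S.slowHam (S.slowZone c ρ) y (γ y))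
    (hYI : Y ⊆ I) (hYc : IsPreconnected Y) (hY : Icc (a i.castSucc) (a i.succ) ⊆ Y) :
    ∃ n : ℤ, ∀ y ∈ Y, (ψs y, Js y) = γ y + ((n : ℝ), 0) :=
  Branch.eq_add_int (h.convexFamily sc) (hb.minimalInterval h sc i) hγ hγm hYI hYc hY
    (hs.1.continuousOn.prodMk hs.2.1.continuousOn)
    (fun y hy => ((h.convexFamily sc).critical_iff (x := (ψs y, Js y)) (hs.2.2.1 y hy).1).1
      (hs.2.2.1 y hy).2.1) hs.2.2.2

end NormalForm

end SingleResonance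

open SingleResonance LyapunovPerron ConvexFamily NormalForm in
theorem mainTheorem5 (r : ℕ) (hr : 2018 ≤ r) (τ : ℝ) (hτ : 0 < τ) (hτ' : τ < 1 / 50)
    (D C₀ c κ : ℝ) (hD : 1 ≤ D) (hC₀ : 1 ≤ C₀) (hc : 0 < c) (hκ : 0 < κ) :
    ∃ C Rmin : ℝ, 0 < C ∧ 1 < Rmin ∧ ∀ R₀ : ℝ, Rmin ≤ R₀ → ∀ (n : ℕ) (ρ : ℝ),
      ρ = SingleResonance.rho τ R₀ n →
      ∀ S : SingleResonance.NormalForm,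
      S.Estimates r D C₀ c (SingleResonance.radius τ R₀ n) ρ →
      ∀ (N : ℕ) (a : Fin (N + 2) → ℝ), S.IsBifurcationSequence r κ c ρ N a →
      ∀ i : Fin (N + 1), ∃ δ : ℝ, 0 < δ ∧
        -- the curve of minimal saddles extends to the enlarged interval
        (∃ ψs Js : ℝ → ℝ, S.IsSaddleCurve c ρ (Set.Icc (a i.castSucc) (a i.succ))
          (SingleResonance.enlarged a i δ) ψs Js) ∧
        ∀ ψs Js : ℝ → ℝ, S.IsSaddleCurve c ρ (Set.Icc (a i.castSucc) (a i.succ))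
          (SingleResonance.enlarged a i δ) ψs Js →
        ∀ Y : Set ℝ, Y = SingleResonance.enlarged a i (δ / 2) →
        ∀ V : Set SingleResonance.Phase, V = SingleResonance.tube Y ψs Js
          (C * ρ ^ (SingleResonance.mExp - 1 + 2 * SingleResonance.dExp * r))
          (C * ρ ^ (2 * SingleResonance.mExp - 1 + 2 * SingleResonance.dExp * r)) →
        ∃ Ψ 𝒥 : ℝ × ℝ × ℝ → ℝ,
          ContDiffOn ℝ 1 Ψ (SingleResonance.params Y) ∧
          ContDiffOn ℝ 1 𝒥 (SingleResonance.params Y) ∧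
          -- periodicity in the fast angle and time
          (∀ l : Fin 3 → ℤ, (∑ j, S.A.k j * l j) = 0 →
            ∀ x t : ℝ, ∀ y ∈ Y,
              Ψ (x + (S.A.f 0 * l 0 + S.A.f 1 * l 1), y, t + l 2) = Ψ (x, y, t) ∧
              𝒥 (x + (S.A.f 0 * l 0 + S.A.f 1 * l 1), y, t + l 2) = 𝒥 (x, y, t)) ∧
          -- weak invariance
          (∀ p ∈ SingleResonance.cylinder Y Ψ 𝒥,
            SingleResonance.hamField S.sfHam p ∈ SingleResonance.cylTangent Y Ψ 𝒥 p) ∧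
          -- normal hyperbolicity
          SingleResonance.NormallyHyperbolic (SingleResonance.hamField S.sfHam)
            (SingleResonance.cylinder Y Ψ 𝒥) (SingleResonance.cylTangent Y Ψ 𝒥) ∧
          -- position relative to `V`, which lies in the domain of the normal form
          (∀ p ∈ V, S.A.action p.2.1 ∈ S.zone c ρ) ∧
          SingleResonance.cylinder Y Ψ 𝒥 ⊆ V ∧
          (∀ γ : ℝ → SingleResonance.Phase,
            (∀ s, HasDerivAt γ (SingleResonance.hamField S.sfHam (γ s)) s) →
            (∀ s, γ s ∈ V) → ∀ s, γ s ∈ SingleResonance.cylinder Y Ψ 𝒥) ∧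
          -- localization and derivatives
          ∀ x t : ℝ, ∀ y ∈ Y,
            |Ψ (x, y, t) - ψs y|
              ≤ C * ρ ^ (SingleResonance.mExp - 1 + 5 * SingleResonance.dExp * r) ∧
            |𝒥 (x, y, t) - Js y|
              ≤ C * ρ ^ (2 * SingleResonance.mExp - 1 + 5 * SingleResonance.dExp * r) ∧
            |derivWithin (fun y' => Ψ (x, y', t) - ψs y') Y y|
              ≤ C * ρ ^ (3 / 2 * SingleResonance.dExp * r - (3 * SingleResonance.mExp + 1) / 2) ∧
            |deriv (fun x' => Ψ (x', y, t)) x|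
              ≤ C * ρ ^ (3 / 2 * SingleResonance.dExp * r - (SingleResonance.mExp + 1) / 2) := by
  have hc' := inv_pos.2 hc
  have hκ' := inv_pos.2 hκ
  refine ⟨1, minRadius D C₀ c κ, one_pos, by rw [minRadius]; linarith, ?_⟩
  intro R₀ hR n ρ hρ S h N a hb i
  have sc : Scale r D C₀ c κ (radius τ R₀ n) ρ := hρ ▸ scale_rho hr hτ hτ' hD hC₀ hc hκ hR n
  have hr' := sc.r_real
  have hcf := h.convexFamily sc
  obtain ⟨I, γ, hIo, habI, hγ, hγm, hhalf, hstrong⟩ := h.exists_strong_branch sc hb i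
  have hab : a i.castSucc < a i.succ := hb.strictMono Fin.castSucc_lt_succ
  obtain ⟨δ, hδ, hδI⟩ := exists_Icc_subset_of_isOpen hab.le hIo habI
  have hYI : enlarged a i δ ⊆ I := (enlarged_subset_Icc hδ.le).trans hδI
  refine ⟨δ, hδ, ⟨_, _, h.isSaddleCurve sc hγ hγm hYI⟩, ?_⟩
  intro ψs Js hs Y hY V hV
  obtain ⟨m, hm⟩ := hs.eq_add_int h sc hb hγ hγm hYI isPreconnected_Icc
    (Icc_subset_enlarged hδ.le)
  -- the given lift of the curve is a translate of the branch found above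
  have hfam := h.saddleFamily sc hIo (hγ.add_intCast hcf m) (by simpa using hhalf)
    (fun y hy => by rw [lift_add, hcf.negHess_add_intCast]; exact hstrong y hy)
  have hYδ : Y ⊆ enlarged a i δ := hY ▸ enlarged_mono (by linarith)
  have hψ : ∀ y ∈ Y, (γ y + ((m : ℝ), 0)).1 = ψs y := fun y hy => by rw [← hm y (hYδ hy)]
  have hJ : ∀ y ∈ Y, (γ y + ((m : ℝ), 0)).2 = Js y := fun y hy => by rw [← hm y (hYδ hy)]
  obtain ⟨α, β, hαβ, hYαβ⟩ : ∃ α β : ℝ, α < β ∧ Y = Icc α β :=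
    ⟨_, _, by split_ifs <;> linarith, hY⟩
  obtain ⟨Ψ, 𝒥, h1, h2, h3, h4, h5, h6, h7⟩ := hfam.exists_cylinder hαβ
    (hYαβ ▸ hYδ.trans hYI) (sfHam_eq_slow h.det_ne)
  simp only [← hYαβ] at h1 h2 h4 h5 h6 h7
  have hpow : ∀ (n : ℤ) (b : ℝ), b ≤ 14 / 100 * (r : ℝ) * n → unit r ρ ^ n ≤ 1 * ρ ^ b :=
    fun n b hb => by rw [one_mul]; exact sc.unit_zpow_le hb
  have hpow' : ∀ (n : ℤ) (b : ℝ), 14 / 100 * (r : ℝ) * n ≤ b → 1 * ρ ^ b ≤ unit r ρ ^ n :=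
    fun n b hb => by rw [one_mul]; exact sc.le_unit_zpow hb
  refine ⟨Ψ, 𝒥, h1, h2, fun l hl x t y _ => h3 _ _ (fun p => h.slowRem_add hl p) x y t, h4, h5,
    ?_, ?_, fun γ' hγ' hV' => h6 γ' hγ' fun s => ?_, fun x t y hy => ⟨?_, ?_, ?_, ?_⟩⟩
  · intro p hp
    rw [hV] at hp
    refine Estimates.near_mem_zone sc (n := 1017) (s := (γ p.2.1.2).2) le_rfl ?_ h
      (hhalf _ (hYI (hYδ hp.1)))
    have e : (γ p.2.1.2).2 = Js p.2.1.2 := by rw [← hJ _ hp.1]; simp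
    rw [e, SizeLE]
    refine hp.2.2.trans ?_
    rw [one_mul, ← Real.rpow_intCast]
    exact sc.rpow_le (by rw [mExp, dExp]; push_cast; linarith)
  · rintro _ ⟨⟨x, y, t⟩, hy, rfl⟩
    rw [hV]
    have hy' : y ∈ Y := hy
    have := h7 x t y hy'
    rw [hψ y hy', hJ y hy'] at this
    exact ⟨hy', this.1.trans (hpow _ _ (by rw [mExp, dExp]; push_cast; linarith)),
      this.2.1.trans (hpow _ _ (by rw [mExp, dExp]; push_cast; linarith))⟩
  · have := hV' s
    rw [hV] at this
    refine ⟨this.1, ?_, ?_⟩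
    · simp only [hψ _ this.1]
      exact this.2.1.trans (hpow' _ _ (by rw [mExp, dExp]; push_cast; linarith))
    · simp only [hJ _ this.1]
      exact this.2.2.trans (hpow' _ _ (by rw [mExp, dExp]; push_cast; linarith))
  · rw [← hψ y hy]
    exact (h7 x t y hy).1.trans (hpow _ _ (by rw [mExp, dExp]; push_cast; linarith))
  · rw [← hJ y hy]
    exact (h7 x t y hy).2.1.trans (hpow _ _ (by rw [mExp, dExp]; push_cast; linarith))
  · rw [derivWithin_congr (f₁ := fun y' => Ψ (x, y', t) - ψs y')
      (f := fun y' => Ψ (x, y', t) - (γ y' + ((m : ℝ), 0)).1)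
      (fun y' hy' => by simp only [hψ y' hy']) (by simp only [hψ y hy])]
    exact (h7 x t y hy).2.2.1.trans (hpow _ _ (by rw [mExp, dExp]; push_cast; linarith))
  · exact (h7 x t y hy).2.2.2.trans (hpow _ _ (by rw [mExp, dExp]; push_cast; linarith))
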